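/- **Setting.** Let $n\ge 1$, $1<p,q<\infty$, $1/p+1/p'=1$, $1/q+1/q'=1$. Write $\mathbf x=(t,x)$, $\mathbf y=(s,y)$ for points of $\mathbf R^{1+n}_+=\{(t,x): t>0,\ x\in\mathbf R^n\}$. Functions are real- or complex-valued and measurable; cubes have sides parallel to the axes, $\ell(Q)$ is the side length of $Q$, and $cQ$ is the concentric cube of side length $c\,\ell(Q)$. For a cube $Q\subset\mathbf R^n$ put $Q^{ca}=(0,\ell(Q))\times Q$, $Q^w=(\ell(Q)/2,\ell(Q))\times Q$ and $\widetilde Q^w=(\ell(Q)/2,3\ell(Q)/2)\times 2Q$. For fixed $\alpha>0$ let $$Nf(x)=\operatorname*{ess\,sup}_{|y-x|<\alpha t}|f(t,y)|,\qquad Cf(x)=\sup_{Q\ni x}\frac1{|Q|}\int_{Q^{ca}}|f|,\qquad W_qf(t,x)=|Q^w|^{-1/q}\|f\|_{L_q(Q^w)},$$ where the supremum is over all cubes $Q\subset\mathbf R^n$ containing $x$, and where in the definition of $W_q$ the cube $Q$ has centre $x$ and side length $t$. **Operators.** A Calderón–Zygmund kernel with constants $A$ and $0<\gamma\le1$ is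 a function $k$ on $\mathbf R^{1+n}_+\times\mathbf R^{1+n}_+$ with $|k(\mathbf x,\mathbf y)|\le A|\mathbf x-\mathbf y|^{-(n+1)}$ for $\mathbf x\neq\mathbf y$, and $|k(\mathbf x,\mathbf y+\mathbf h)-k(\mathbf x,\mathbf y)|$ and $|k(\mathbf x+\mathbf h,\mathbf y)-k(\mathbf x,\mathbf y)|$ at most $A|\mathbf h|^\gamma/|\mathbf x-\mathbf y|^{n+1+\gamma}$ whenever $|\mathbf h|\le|\mathbf x-\mathbf y|/2$ (all points in $\mathbf R^{1+n}_+$). An upward (downward) causal Calderón–Zygmund operator $S^+$ ($S^-$) is a bounded linear operator on $L_2(\mathbf R^{1+n}_+)$ such that, for some such $k$, for every compactly supported $f\in L_2(\mathbf R^{1+n}_+)$ and a.e. $\mathbf x\notin\operatorname{supp}f$ one has $S^\pm f(\mathbf x)=\int k^\pm(\mathbf x,\mathbf y)f(\mathbf y)\,d\mathbf y$, where $k^+=k$ for $t>s$ and $k^+=0$ for $t<s$, respectively $k^-=k$ for $t<s$ and $k^-=0$ for $t>s$. **Dyadic objects.** Let $\mathcal D=\bigcup_{j\in\mathbf Z}\mathcal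 D_j$ be a system of dyadic cubes in $\mathbf R^n$: each $\mathcal D_j$ is a partition of $\mathbf R^n$ into half-open cubes of side length $2^{-j}$, every cube of $\mathcal D_{j+1}$ lies in a cube of $\mathcal D_j$, and any two cubes of $\mathcal D$ lie in a common cube of $\mathcal D$. Let $\boldsymbol{\mathcal D}$ consist of the cubes $\mathbf Q=(a,a+\ell)\times Q$ with $Q\in\mathcal D$, $\ell=\ell(Q)$ and $a\in\{0,\ell,2\ell,\dots\}$. For $\mathbf x=(t,x)\in\mathbf Q$ put $\mathbf Q^\Box_{\mathbf x}=(\min(a+\ell/2,t),a+2\ell)\times 3Q$. A collection $\widehat{\boldsymbol{\mathcal D}}\subset\boldsymbol{\mathcal D}$ is $\eta$-sparse if there are pairwise disjoint measurable sets $E_{\mathbf Q}\subset\mathbf Q$, $\mathbf Q\in\widehat{\boldsymbol{\mathcal D}}$, with $|E_{\mathbf Q}|\ge\eta|\mathbf Q|$. For a family $(f_Q)_{Q\in\mathcal D}$ of numbers in $[0,\infty]$ let $$C_{\mathcal D}(f_Q)(x)=\sup_{Q\in\mathcal D,\,Q\ni x}\frac1{|Q|}\sum_{R\in\mathcal D,\,R\subset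 Q}|R^w|f_R ,$$ and put $(W_{\mathcal D,q}f)_Q=|Q^w|^{-1/q}\|f\|_{L_q(Q^w)}$, $(\widetilde W_{\mathcal D,q}f)_Q=|\widetilde Q^w|^{-1/q}\|f\|_{L_q(\widetilde Q^w)}$. **Theorem.** (1) Let $S^-$ be a downward causal Calderón–Zygmund operator. There is an operator, still denoted $S^-$, that agrees with the given one on $L_2(\mathbf R^{1+n}_+)$, is linear and bounded on $L_q(\mathbf R^{1+n}_+)$, and is linear on the space of all $f$ with $\|C(W_qf)\|_{L_p(\mathbf R^n)}<\infty$, with $$\|C(W_q(S^-f))\|_{L_p(\mathbf R^n)}\le c\,\|C(W_qf)\|_{L_p(\mathbf R^n)}$$ for all such $f$. Here $c$ depends only on $n,p,q,\gamma,A$ and an upper bound for $\|S^-\|_{L_2\to L_2}$. (2) Let $S^+$ be an upward causal Calderón–Zygmund operator. There is an operator, still denoted $S^+$, that agrees with the given one on $L_2(\mathbf R^{1+n}_+)$, is linear and bounded on $L_{q'}(\mathbf R^{1+n}_+)$, and is linear on the space of all $f$ with $\|N(W_{q'}f)\|_{L_{p'}(\mathbf R^n)}<\infty$, with $$\|N(W_{q'}(S^+f))\|_{L_{p'}(\mathbf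 R^n)}\le c\,\|N(W_{q'}f)\|_{L_{p'}(\mathbf R^n)}$$ for all such $f$. Here $c$ depends only on $n,p,q,\alpha,\gamma,A$ and an upper bound for $\|S^+\|_{L_2\to L_2}$. (3) Let $0<\eta<1$. There is a constant $c$, depending only on $n$, $q$ and $\eta$, such that for every $\mathcal D$ as above, every $\eta$-sparse collection $\widehat{\boldsymbol{\mathcal D}}\subset\boldsymbol{\mathcal D}$, every measurable $f$ on $\mathbf R^{1+n}_+$, every $A\ge 0$, and every $\widehat Sf$ satisfying $$|\widehat Sf(\mathbf x)|\le A\sum_{\mathbf Q\in\widehat{\boldsymbol{\mathcal D}},\,\mathbf Q\ni\mathbf x}\frac1{|\mathbf Q^\Box_{\mathbf x}|}\int_{\mathbf Q^\Box_{\mathbf x}}|f(\mathbf y)|\,d\mathbf y\qquad\text{for a.e. }\mathbf x\in\mathbf R^{1+n}_+$$ (in particular for $\widehat Sf$ equal to this sum, with $A=1$), one has at every point of $\mathbf R^n$ $$C_{\mathcal D}W_{\mathcal D,q}(\widehat Sf)\le c\,A\,\bigl(C_{\mathcal D}\widetilde W_{\mathcal D,q}f+Cf\bigr).$$ -/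

import Mathlib

open MeasureTheory Set
open scoped ENNReal NNReal

noncomputable section

namespace CausalCZO

/-- The boundary `ℝⁿ` with its Euclidean norm. -/
abbrev Bd (n : ℕ) : Type := EuclideanSpace ℝ (Fin n)

/-- Points `(t, x)` of `ℝ^{1+n}`. -/
abbrev Pt (n : ℕ) : Type := ℝ × Bd n

/-- The open upper half space `t > 0`. -/
def halfSpace (n : ℕ) : Set (Pt n) := {x | 0 < x.1}

/-- Lebesgue measure on the half space. -/
def hmeas (n : ℕ) : Measure (Pt n) := volume.restrict (halfSpace n)

/-- Euclidean length of a vector of `ℝ^{1+n}` (the product type carries the sup norm). -/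
def euclLen {n : ℕ} (v : Pt n) : ℝ := Real.sqrt (v.1 ^ 2 + ‖v.2‖ ^ 2)

/-! ### Cubes and the regions built on them -/

/-- An axis-parallel cube of `ℝⁿ`, given by centre and side length. -/
@[ext] structure Cube (n : ℕ) where
  center : Bd n
  side : ℝ

/-- The cube as a (half-open) set. -/
def Cube.set {n : ℕ} (Q : Cube n) : Set (Bd n) :=
  {y | ∀ i, Q.center i - Q.side / 2 ≤ y i ∧ y i < Q.center i + Q.side / 2}

/-- The concentric cube `cQ`. -/
def Cube.dilate {n : ℕ} (c : ℝ) (Q : Cube n) : Cube n := ⟨Q.center, c * Q.side⟩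

/-- The Carleson box `(0, ℓ(Q)) × Q`. -/
def Cube.carleson {n : ℕ} (Q : Cube n) : Set (Pt n) := Ioo 0 Q.side ×ˢ Q.set

/-- The Whitney region `(ℓ(Q)/2, ℓ(Q)) × Q`. -/
def Cube.whitney {n : ℕ} (Q : Cube n) : Set (Pt n) := Ioo (Q.side / 2) Q.side ×ˢ Q.set

/-- The enlarged Whitney region `(ℓ(Q)/2, 3ℓ(Q)/2) × 2Q`. -/
def Cube.whitneyTilde {n : ℕ} (Q : Cube n) : Set (Pt n) :=
  Ioo (Q.side / 2) (3 * Q.side / 2) ×ˢ (Q.dilate 2).set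

/-! ### The continuous functionals -/

section Functionals

variable {n : ℕ} {ε : Type*} [ENorm ε]

/-- The average `|E|^{-1/q} ‖f‖_{L_q(E)}`. -/
def lqAvg (q : ℝ) (E : Set (Pt n)) (f : Pt n → ε) : ℝ≥0∞ :=
  (volume E) ^ (-(1 / q)) * eLpNorm f (ENNReal.ofReal q) (volume.restrict E)

/-- `W_q f (t, x)`: the `L_q` average over the Whitney region of the cube with centre `x` and
side length `t`. -/
def whitneyAvg (q : ℝ) (f : Pt n → ε) (x : Pt n) : ℝ≥0∞ :=
  lqAvg q (Cube.whitney ⟨x.2, x.1⟩) f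

/-- The Carleson functional, a supremum over all cubes containing `x`. -/
def carlesonFn (f : Pt n → ε) (x : Bd n) : ℝ≥0∞ :=
  ⨆ (Q : Cube n) (_ : 0 < Q.side) (_ : x ∈ Q.set),
    (volume Q.set)⁻¹ * ∫⁻ y in Q.carleson, ‖f y‖ₑ

/-- The non-tangential maximal functional of aperture `α`. -/
def nontanFn (α : ℝ) (f : Pt n → ε) (x : Bd n) : ℝ≥0∞ :=
  essSup (fun y => ‖f y‖ₑ) (volume.restrict {y : Pt n | 0 < y.1 ∧ ‖y.2 - x‖ < α * y.1})

/-- `‖C (W_q f)‖_p`. -/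
def normCW (p q : ℝ) (f : Pt n → ε) : ℝ≥0∞ :=
  eLpNorm (carlesonFn (whitneyAvg q f)) (ENNReal.ofReal p) volume

/-- `‖N (W_q f)‖_p`. -/
def normNW (α p q : ℝ) (f : Pt n → ε) : ℝ≥0∞ :=
  eLpNorm (nontanFn α (whitneyAvg q f)) (ENNReal.ofReal p) volume

end Functionals

/-! ### Dyadic systems and dyadic functionals -/

/-- A system of dyadic cubes of `ℝⁿ` that is connected under inclusion; `cubes j` are the
cubes of side length `2^{-j}`. -/
structure DyadicSystem (n : ℕ) where
  cubes : ℤ → Set (Cube n)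
  side_eq : ∀ j, ∀ Q ∈ cubes j, Q.side = (2 : ℝ) ^ (-j)
  tiling : ∀ j x, ∃! Q, Q ∈ cubes j ∧ x ∈ Q.set
  nested : ∀ j, ∀ Q ∈ cubes (j + 1), ∃ R ∈ cubes j, Q.set ⊆ R.set
  connected : ∀ i j, ∀ Q ∈ cubes i, ∀ R ∈ cubes j,
    ∃ m, ∃ P ∈ cubes m, Q.set ⊆ P.set ∧ R.set ⊆ P.set

/-- All cubes of the system. -/
def DyadicSystem.all {n : ℕ} (D : DyadicSystem n) : Set (Cube n) := ⋃ j, D.cubes j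

/-- The dyadic Carleson functional of a family `(F_Q)`, at the point `x`. -/
def DyadicSystem.carlesonFn {n : ℕ} (D : DyadicSystem n) (F : Cube n → ℝ≥0∞) (x : Bd n) :
    ℝ≥0∞ :=
  ⨆ (Q : Cube n) (_ : Q ∈ D.all) (_ : x ∈ Q.set),
    (volume Q.set)⁻¹ * ∑' R : {R : Cube n // R ∈ D.all ∧ R.set ⊆ Q.set},
      volume R.1.whitney * F R.1

/-- A cube `(kℓ, (k+1)ℓ) × Q` of `ℝ^{1+n}_+`, where `ℓ = ℓ(Q)`. -/
structure Box (n : ℕ) where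
  k : ℕ
  base : Cube n

/-- The coordinate `a` of the bottom of the box `(a, a + ℓ) × Q`. -/
def Box.bot {n : ℕ} (R : Box n) : ℝ := R.k * R.base.side

/-- The box as a set. -/
def Box.set {n : ℕ} (R : Box n) : Set (Pt n) :=
  Ioo R.bot (R.bot + R.base.side) ×ˢ R.base.set

/-- The region `(min (a + ℓ/2) t, a + 2ℓ) × 3Q` attached to a point `(t, x)` of the box. -/
def Box.region {n : ℕ} (R : Box n) (x : Pt n) : Set (Pt n) :=
  Ioo (min (R.bot + R.base.side / 2) x.1) (R.bot + 2 * R.base.side) ×ˢ (R.base.dilate 3).set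

/-- The dyadic system of the half space associated with a dyadic system of `ℝⁿ`. -/
def DyadicSystem.boxes {n : ℕ} (D : DyadicSystem n) : Set (Box n) := {R | R.base ∈ D.all}

/-- `η`-sparse collections of boxes. -/
def IsSparse {n : ℕ} (η : ℝ) (𝒮 : Set (Box n)) : Prop :=
  ∃ E : Box n → Set (Pt n),
    (∀ R ∈ 𝒮, MeasurableSet (E R) ∧ E R ⊆ R.set ∧
      ENNReal.ofReal η * volume R.set ≤ volume (E R)) ∧
    𝒮.PairwiseDisjoint E

/-- The causal sparse sum: the sum over the boxes `R ∈ 𝒮` containing `x` of the average of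
`|f|` over the region attached to `R` and `x`. -/
def sparseSum {n : ℕ} {ε : Type*} [ENorm ε] (𝒮 : Set (Box n)) (f : Pt n → ε) (x : Pt n) :
    ℝ≥0∞ :=
  ∑' R : {R : Box n // R ∈ 𝒮 ∧ x ∈ R.set}, (volume (R.1.region x))⁻¹ * ∫⁻ y in R.1.region x, ‖f y‖ₑ

/-! ### Causal Calderón–Zygmund operators -/

section Operators

variable {𝕜 : Type*} [RCLike 𝕜] {n : ℕ}

/-- A Calderón–Zygmund kernel on the half space with constant `A` and regularity `γ`. -/
structure IsCZKernel (γ A : ℝ) (k : Pt n → Pt n → 𝕜) : Prop where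
  size : ∀ x ∈ halfSpace n, ∀ y ∈ halfSpace n, x ≠ y →
    ‖k x y‖ ≤ A / euclLen (x - y) ^ (n + 1)
  reg_right : ∀ x ∈ halfSpace n, ∀ y ∈ halfSpace n, x ≠ y → ∀ h : Pt n,
    y + h ∈ halfSpace n → euclLen h ≤ euclLen (x - y) / 2 →
    ‖k x (y + h) - k x y‖ ≤ A * euclLen h ^ γ / euclLen (x - y) ^ ((n : ℝ) + 1 + γ)
  reg_left : ∀ x ∈ halfSpace n, ∀ y ∈ halfSpace n, x ≠ y → ∀ h : Pt n,
    x + h ∈ halfSpace n → euclLen h ≤ euclLen (x - y) / 2 →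
    ‖k (x + h) y - k x y‖ ≤ A * euclLen h ^ γ / euclLen (x - y) ^ ((n : ℝ) + 1 + γ)

/-- The upward part of a kernel: zero unless `t > s`. -/
def upKernel (k : Pt n → Pt n → 𝕜) (x y : Pt n) : 𝕜 := if y.1 < x.1 then k x y else 0

/-- The downward part of a kernel: zero unless `t < s`. -/
def downKernel (k : Pt n → Pt n → 𝕜) (x y : Pt n) : 𝕜 := if x.1 < y.1 then k x y else 0

/-- `S` is given by the kernel `K` off the support, for compactly supported `L_2` functions. -/
def HasKernel (S : Lp 𝕜 2 (hmeas n) →L[𝕜] Lp 𝕜 2 (hmeas n)) (K : Pt n → Pt n → 𝕜) : Prop :=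
  ∀ F : Set (Pt n), IsCompact F → F ⊆ halfSpace n → ∀ f : Lp 𝕜 2 (hmeas n),
    (∀ᵐ y ∂(hmeas n), y ∉ F → f y = 0) →
    ∀ᵐ x ∂(hmeas n), x ∉ F → S f x = ∫ y, K x y * f y ∂(hmeas n)

/-- Upward mapping causal Calderón–Zygmund operators, with quantitative constants. -/
def IsUpwardCZO (γ A B : ℝ) (S : Lp 𝕜 2 (hmeas n) →L[𝕜] Lp 𝕜 2 (hmeas n)) : Prop :=
  ‖S‖ ≤ B ∧ ∃ k : Pt n → Pt n → 𝕜, IsCZKernel γ A k ∧ HasKernel S (upKernel k)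

/-- Downward mapping causal Calderón–Zygmund operators, with quantitative constants. -/
def IsDownwardCZO (γ A B : ℝ) (S : Lp 𝕜 2 (hmeas n) →L[𝕜] Lp 𝕜 2 (hmeas n)) : Prop :=
  ‖S‖ ≤ B ∧ ∃ k : Pt n → Pt n → 𝕜, IsCZKernel γ A k ∧ HasKernel S (downKernel k)

/-- `T` is linear on the space of those `f` with `N f < ∞`, and bounded there by `C`. -/
structure BoundedLinearOn (N : (Pt n →ₘ[hmeas n] 𝕜) → ℝ≥0∞) (C : ℝ≥0)
    (T : (Pt n →ₘ[hmeas n] 𝕜) → (Pt n →ₘ[hmeas n] 𝕜)) : Prop where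
  map_add : ∀ f g, N f < ∞ → N g < ∞ → T (f + g) = T f + T g
  map_smul : ∀ (c : 𝕜) f, N f < ∞ → T (c • f) = c • T f
  bound : ∀ f, N f < ∞ → N (T f) ≤ C * N f

/-- `T` extends `S`, is linear and bounded on `L_r` of the half space, and is linear and
bounded, with constant `C`, on the space of those `f` with `N f < ∞`. -/
def ExtendsBoundedly (S : Lp 𝕜 2 (hmeas n) →L[𝕜] Lp 𝕜 2 (hmeas n)) (r : ℝ)
    (N : (Pt n →ₘ[hmeas n] 𝕜) → ℝ≥0∞) (C : ℝ≥0)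
    (T : (Pt n →ₘ[hmeas n] 𝕜) → (Pt n →ₘ[hmeas n] 𝕜)) : Prop :=
  (∀ f : Lp 𝕜 2 (hmeas n), T (f : Pt n →ₘ[hmeas n] 𝕜) = (S f : Pt n →ₘ[hmeas n] 𝕜)) ∧
  (∃ M : ℝ≥0, BoundedLinearOn (fun f => eLpNorm f (ENNReal.ofReal r) (hmeas n)) M T) ∧
  BoundedLinearOn N C T

end Operators

end CausalCZO

end

namespace CausalCZO

open Filter Topology Metric

/-! ### Real interpolation of restricted weak-type estimates -/

section Interpolation

variable {α : Type*} [MeasurableSpace α] {μ : Measure α}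

/-! Up to the jump at equal heights, a causal operator is a classical Calderón–Zygmund operator.
Cutting the kernel off there destroys regularity in the second variable only where |t - s| is at
most the displacement δ. On that strip the size bound suffices: the strip has mass of order δ Rⁿ in
balls of radius R, so the critical kernel |x - y|^{-(n+1)} integrates to O(δ/ρ) beyond distance ρ
(`lintegral_strip_le`). Hörmander's condition therefore survives (`RoughKernel.hormander`). The
Calderón–Zygmund decomposition gives weak type (1,1) (`RoughKernel.weak_type`), interpolation gives
exponents below two, and duality gives those above two, the adjoint being causal in the opposite
direction (`strong_type`).

The operator is extended as an almost everywhere limit of its values on truncations of f to a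
compact exhaustion of the half space. With E a compact neighbourhood of a point, the limit splits
into the operator applied to the restriction of f to E, controlled in L_q, and an absolutely
convergent kernel integral over the complement (`tendsto_apply_truncation`). Linearity and agreement
with S on L_2 are inherited by the limit (`exists_isCausalExtension`). Taking E to be a box around a
Whitney region bounds W_q(Tf)(t,x) by finitely many Whitney averages of f at sheared points plus a
tail, the integral of |f(s,y)| (t + s + |x - y|)^{-(n+1)} over the heights s that causality allows
(`IsCausalExtension.whitneyAvg_le`).

The two functionals fit these two tails. For a downward operator only s > t/2 matters. For fixed
(s,y) the kernel integrated over t < 2s and all x is bounded, so Tonelli controls the near part of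
the Carleson functional of the tail, while the far part is summed over annuli. The result is a
pointwise bound, valid at every boundary point (`exists_carlesonFn_upperTail_le`). For an upward
operator only s < t matters. The mass of |f| below height t in a ball of radius R is at most t Rⁿ
times an iterated maximal function of N(W_q f), and the sum over annuli cancels the factor t
(`exists_lowerTail_le`). The maximal theorem then concludes.

For sparse sums, fix a dyadic cube R and a point of its Whitney region. Boxes of side at least ℓ(R)
through the point stand on the boundary, one per generation, and their averages add up to the same
upper tail (`exists_tsum_large_boxes_le`). The enlargement of a smaller box stays inside the
enlarged Whitney region (`Box.star_subset_whitneyTilde`), so these boxes form a local sparse sum,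
bounded on L_q by duality and the maximal theorem (`exists_lintegral_tsum_starAvg_le`). Summing over
the disjoint Whitney regions below a cube gives the two terms of the estimate. -/

lemma lintegral_rpow_lt_ofReal {s : ℝ} (hs : 0 < s) {b : ℝ} (hb : 0 ≤ b) :
    ∫⁻ l in Ioi (0 : ℝ), {l : ℝ | ENNReal.ofReal l < ENNReal.ofReal b}.indicator
      (fun l => ENNReal.ofReal (l ^ (s - 1))) l = ENNReal.ofReal b ^ s / ENNReal.ofReal s := by
  have h1 : ∫⁻ l in Ioi (0 : ℝ), {l : ℝ | ENNReal.ofReal l < ENNReal.ofReal b}.indicator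
      (fun l => ENNReal.ofReal (l ^ (s - 1))) l
      = ∫⁻ l in Ioc (0 : ℝ) b, ENNReal.ofReal (l ^ (s - 1)) := by
    rw [← restrict_Ioo_eq_restrict_Ioc, ← lintegral_indicator measurableSet_Ioo,
      ← lintegral_indicator measurableSet_Ioi]
    congr 1
    ext l
    by_cases h0 : 0 < l
    · by_cases hl : l < b
      · have : ENNReal.ofReal l < ENNReal.ofReal b :=
          (ENNReal.ofReal_lt_ofReal_iff (h0.trans hl)).2 hl
        simp [indicator, h0, hl, this]
      · have : ¬ ENNReal.ofReal l < ENNReal.ofReal b := by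
          rw [not_lt] at hl ⊢; exact ENNReal.ofReal_le_ofReal hl
        simp [indicator, h0, hl, this]
    · simp [indicator, h0]
  have hint := intervalIntegral.intervalIntegrable_rpow' (a := 0) (b := b)
    (show -1 < s - 1 by linarith)
  rw [h1, ← ofReal_integral_eq_lintegral_ofReal
    ((intervalIntegrable_iff_integrableOn_Ioc_of_le hb).1 hint)
    ((ae_restrict_iff' measurableSet_Ioc).2 (.of_forall fun l hl => Real.rpow_nonneg hl.1.le _)),
    ← intervalIntegral.integral_of_le hb, integral_rpow (Or.inl (by linarith)),
    ENNReal.ofReal_rpow_of_nonneg hb hs.le, ← ENNReal.ofReal_div_of_pos hs]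
  congr 1
  rw [sub_add_cancel, Real.zero_rpow hs.ne', sub_zero]

lemma lintegral_rpow_lt {s : ℝ} (hs : 0 < s) (a : ℝ≥0∞) :
    ∫⁻ l in Ioi (0 : ℝ), {l : ℝ | ENNReal.ofReal l < a}.indicator
      (fun l => ENNReal.ofReal (l ^ (s - 1))) l = a ^ s / ENNReal.ofReal s := by
  rcases eq_or_ne a ∞ with rfl | ha
  · rw [ENNReal.top_rpow_of_pos hs, ENNReal.top_div_of_ne_top ENNReal.ofReal_ne_top]
    -- By monotonicity in the height, the finite height (r s)^{1/s}, for which the integral is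
    -- exactly r, gives a lower bound.
    refine ENNReal.eq_top_of_forall_nnreal_le fun r => ?_
    have hr : (0 : ℝ) ≤ (r * s) ^ (1 / s) := by positivity
    calc (r : ℝ≥0∞) = ENNReal.ofReal ((r * s) ^ (1 / s)) ^ s / ENNReal.ofReal s := by
          rw [ENNReal.ofReal_rpow_of_nonneg hr hs.le, ← Real.rpow_mul (by positivity),
            one_div_mul_cancel hs.ne', Real.rpow_one, ← ENNReal.ofReal_div_of_pos hs,
            mul_div_cancel_right₀ _ hs.ne', ENNReal.ofReal_coe_nnreal]
      _ ≤ _ := by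
          rw [← lintegral_rpow_lt_ofReal hs hr]
          gcongr with l
          exact le_top
  · rw [← ENNReal.ofReal_toReal ha]
    exact lintegral_rpow_lt_ofReal hs ENNReal.toReal_nonneg

lemma lintegral_rpow_ge {s : ℝ} (hs : s < 0) {a : ℝ≥0∞} (h0 : a ≠ 0) (ht : a ≠ ∞) :
    ∫⁻ l in Ioi (0 : ℝ), {l : ℝ | a ≤ ENNReal.ofReal l}.indicator
      (fun l => ENNReal.ofReal (l ^ (s - 1))) l = a ^ s / ENNReal.ofReal (-s) := by
  have hb : 0 < a.toReal := ENNReal.toReal_pos h0 ht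
  have h1 : ∫⁻ l in Ioi (0 : ℝ), {l : ℝ | a ≤ ENNReal.ofReal l}.indicator
      (fun l => ENNReal.ofReal (l ^ (s - 1))) l
      = ∫⁻ l in Ioi a.toReal, ENNReal.ofReal (l ^ (s - 1)) := by
    rw [restrict_Ioi_eq_restrict_Ici (a := a.toReal), ← lintegral_indicator measurableSet_Ici,
      ← lintegral_indicator measurableSet_Ioi]
    congr 1
    ext l
    have key : 0 < l → (a ≤ ENNReal.ofReal l ↔ a.toReal ≤ l) := fun h =>
      ENNReal.le_ofReal_iff_toReal_le ht h.le
    by_cases hl : a.toReal ≤ l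
    · have h0l : 0 < l := hb.trans_le hl
      simp [indicator, h0l, hl, key]
    · by_cases h0l : 0 < l
      · simp [indicator, h0l, hl, key]
      · simp [indicator, h0l, hl]
  rw [h1, ← ofReal_integral_eq_lintegral_ofReal
    (integrableOn_Ioi_rpow_of_lt (by linarith) hb)
    ((ae_restrict_iff' measurableSet_Ioi).2
      (.of_forall fun l hl => Real.rpow_nonneg (hb.trans hl).le _)),
    integral_Ioi_rpow_of_lt (by linarith) hb]
  conv_rhs => rw [← ENNReal.ofReal_toReal ht]
  rw [ENNReal.ofReal_rpow_of_pos hb, ← ENNReal.ofReal_div_of_pos (by linarith), sub_add_cancel,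
    neg_div, div_neg]

/-- Layer cake by Tonelli. Points where v is infinite are included, since the one-dimensional
formula holds there too. -/
lemma lintegral_rpow_eq_layer [SFinite μ] {s : ℝ} (hs : 0 < s) {v : α → ℝ≥0∞}
    (hv : Measurable v) :
    ∫⁻ x, v x ^ s ∂μ = ENNReal.ofReal s *
      ∫⁻ l in Ioi (0 : ℝ), ENNReal.ofReal (l ^ (s - 1)) * μ {x | ENNReal.ofReal l < v x} := by
  have hm : Measurable (Function.uncurry fun (l : ℝ) (x : α) =>
      {l : ℝ | ENNReal.ofReal l < v x}.indicator (fun l => ENNReal.ofReal (l ^ (s - 1))) l) := by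
    have : MeasurableSet {z : ℝ × α | ENNReal.ofReal z.1 < v z.2} :=
      measurableSet_lt (by fun_prop) (by fun_prop)
    have h2 : Measurable fun z : ℝ × α => ENNReal.ofReal (z.1 ^ (s - 1)) := by fun_prop
    exact h2.indicator this
  have h1 : ∀ l : ℝ, ENNReal.ofReal (l ^ (s - 1)) * μ {x | ENNReal.ofReal l < v x}
      = ∫⁻ x, {l : ℝ | ENNReal.ofReal l < v x}.indicator
        (fun l => ENNReal.ofReal (l ^ (s - 1))) l ∂μ := by
    intro l
    rw [← lintegral_indicator_const (measurableSet_lt measurable_const hv)]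
    rfl
  simp_rw [h1]
  rw [lintegral_lintegral_swap hm.aemeasurable, ← lintegral_const_mul' _ _ ENNReal.ofReal_ne_top]
  congr 1
  ext x
  rw [lintegral_rpow_lt hs, ENNReal.mul_div_cancel (by simpa using hs) ENNReal.ofReal_ne_top]

/-- After Tonelli the inner integral is that of l^{s-2} over 0 < l < u(x). It converges at 0
precisely because s > 1. -/
lemma lintegral_tail_le [SFinite μ] {s : ℝ} (hs : 1 < s) {u : α → ℝ≥0∞} (hu : Measurable u) :
    ∫⁻ l in Ioi (0 : ℝ), ENNReal.ofReal (l ^ (s - 1)) *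
      ((ENNReal.ofReal l)⁻¹ * ∫⁻ x in {x | ENNReal.ofReal l < u x}, u x ∂μ)
      = (∫⁻ x, u x ^ s ∂μ) / ENNReal.ofReal (s - 1) := by
  have hm : Measurable (Function.uncurry fun (l : ℝ) (x : α) =>
      u x * {l : ℝ | ENNReal.ofReal l < u x}.indicator
        (fun l => ENNReal.ofReal (l ^ (s - 1 - 1))) l) := by
    have : MeasurableSet {z : ℝ × α | ENNReal.ofReal z.1 < u z.2} :=
      measurableSet_lt (by fun_prop) (by fun_prop)
    have h2 : Measurable fun z : ℝ × α => ENNReal.ofReal (z.1 ^ (s - 1 - 1)) := by fun_prop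
    exact (hu.comp measurable_snd).mul (h2.indicator this)
  have h1 : ∀ l ∈ Ioi (0 : ℝ), ENNReal.ofReal (l ^ (s - 1)) *
      ((ENNReal.ofReal l)⁻¹ * ∫⁻ x in {x | ENNReal.ofReal l < u x}, u x ∂μ)
      = ∫⁻ x, u x * {l : ℝ | ENNReal.ofReal l < u x}.indicator
        (fun l => ENNReal.ofReal (l ^ (s - 1 - 1))) l ∂μ := by
    intro l hl
    rw [← mul_assoc, ← lintegral_indicator (measurableSet_lt measurable_const hu),
      ← ENNReal.ofReal_inv_of_pos hl, ← ENNReal.ofReal_mul (Real.rpow_nonneg (le_of_lt hl) _),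
      ← lintegral_const_mul' _ _ ENNReal.ofReal_ne_top]
    congr 1
    ext x
    by_cases hx : ENNReal.ofReal l < u x
    · simp only [indicator, mem_ofPred_eq, hx, if_true]
      rw [mul_comm, Real.rpow_sub_one (ne_of_gt hl) (s - 1), div_eq_mul_inv]
    · simp [indicator, hx]
  rw [setLIntegral_congr_fun measurableSet_Ioi h1, lintegral_lintegral_swap hm.aemeasurable,
    div_eq_mul_inv, ← lintegral_mul_const' _ _ (by simp [hs])]
  congr 1
  ext x
  have hm1 : Measurable ({l : ℝ | ENNReal.ofReal l < u x}.indicator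
      (fun l => ENNReal.ofReal (l ^ (s - 1 - 1)))) :=
    Measurable.indicator (by fun_prop) (measurableSet_lt (by fun_prop) measurable_const)
  rw [lintegral_const_mul _ hm1, lintegral_rpow_lt (by linarith), div_eq_mul_inv, ← mul_assoc]
  congr 1
  conv_lhs => rw [← ENNReal.rpow_one (u x), ← ENNReal.rpow_mul, one_mul]
  rw [← ENNReal.rpow_add_of_nonneg _ _ zero_le_one (by linarith)]
  congr 1; ring

/-- After Tonelli the inner integral is that of l^{s-3} over l ≥ u(x), convergent at infinity
because s < 2. The values u = 0 and u = ∞ are treated apart, and there only an inequality is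
claimed. -/
lemma lintegral_head_le [SFinite μ] {s : ℝ} (h0 : 0 < s) (hs : s < 2) {u : α → ℝ≥0∞}
    (hu : Measurable u) :
    ∫⁻ l in Ioi (0 : ℝ), ENNReal.ofReal (l ^ (s - 1)) *
      ((ENNReal.ofReal l)⁻¹ ^ 2 * ∫⁻ x in {x | u x ≤ ENNReal.ofReal l}, u x ^ 2 ∂μ)
      ≤ (∫⁻ x, u x ^ s ∂μ) / ENNReal.ofReal (2 - s) := by
  have hm : Measurable (Function.uncurry fun (l : ℝ) (x : α) =>
      u x ^ 2 * {l : ℝ | u x ≤ ENNReal.ofReal l}.indicator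
        (fun l => ENNReal.ofReal (l ^ (s - 2 - 1))) l) := by
    have : MeasurableSet {z : ℝ × α | u z.2 ≤ ENNReal.ofReal z.1} :=
      measurableSet_le (by fun_prop) (by fun_prop)
    have h2 : Measurable fun z : ℝ × α => ENNReal.ofReal (z.1 ^ (s - 2 - 1)) := by fun_prop
    exact ((hu.comp measurable_snd).pow_const 2).mul (h2.indicator this)
  have h1 : ∀ l ∈ Ioi (0 : ℝ), ENNReal.ofReal (l ^ (s - 1)) *
      ((ENNReal.ofReal l)⁻¹ ^ 2 * ∫⁻ x in {x | u x ≤ ENNReal.ofReal l}, u x ^ 2 ∂μ)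
      = ∫⁻ x, u x ^ 2 * {l : ℝ | u x ≤ ENNReal.ofReal l}.indicator
        (fun l => ENNReal.ofReal (l ^ (s - 2 - 1))) l ∂μ := by
    intro l hl
    have hl0 : 0 < l := hl
    rw [← mul_assoc, ← lintegral_indicator (measurableSet_le hu measurable_const),
      ← ENNReal.ofReal_inv_of_pos hl, ← ENNReal.ofReal_pow (by positivity),
      ← ENNReal.ofReal_mul (Real.rpow_nonneg (le_of_lt hl) _),
      ← lintegral_const_mul' _ _ ENNReal.ofReal_ne_top]
    congr 1
    ext x
    by_cases hx : u x ≤ ENNReal.ofReal l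
    · simp only [indicator, mem_ofPred_eq, hx, if_true]
      rw [mul_comm]
      congr 2
      rw [show s - 2 - 1 = (s - 1) - (2 : ℕ) by push_cast; ring, Real.rpow_sub_natCast hl0.ne']
      field_simp
    · simp [indicator, hx]
  rw [setLIntegral_congr_fun measurableSet_Ioi h1, lintegral_lintegral_swap hm.aemeasurable,
    div_eq_mul_inv, ← lintegral_mul_const' _ _ (by simp [hs])]
  refine lintegral_mono fun x => ?_
  have hm1 : Measurable ({l : ℝ | u x ≤ ENNReal.ofReal l}.indicator
      (fun l => ENNReal.ofReal (l ^ (s - 2 - 1)))) :=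
    Measurable.indicator (by fun_prop) (measurableSet_le measurable_const (by fun_prop))
  rw [lintegral_const_mul _ hm1]
  rcases eq_or_ne (u x) 0 with hx | hx
  · simp [hx]
  rcases eq_or_ne (u x) ∞ with ht | ht
  · simp [ht, h0]
  rw [lintegral_rpow_ge (by linarith) hx ht, div_eq_mul_inv, ← mul_assoc, neg_sub,
    ← ENNReal.rpow_natCast, ← ENNReal.rpow_add _ _ hx ht]
  simp

/-- Strong type from a restricted weak-type estimate of order one. -/
lemma lintegral_rpow_le_of_weak_tail [SFinite μ] {s : ℝ} (hs : 1 < s) {u v : α → ℝ≥0∞}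
    (hu : Measurable u) (hv : Measurable v) {C : ℝ≥0∞} (hC : C ≠ ∞)
    (h : ∀ l : ℝ, 0 < l → μ {x | ENNReal.ofReal l < v x} ≤
      C * ((ENNReal.ofReal l)⁻¹ * ∫⁻ x in {x | ENNReal.ofReal l < u x}, u x ∂μ)) :
    ∫⁻ x, v x ^ s ∂μ ≤ ENNReal.ofReal s * (C / ENNReal.ofReal (s - 1)) * ∫⁻ x, u x ^ s ∂μ := by
  rw [lintegral_rpow_eq_layer (by linarith) hv, mul_assoc]
  gcongr
  calc _ ≤ ∫⁻ l in Ioi (0 : ℝ), C * (ENNReal.ofReal (l ^ (s - 1)) *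
        ((ENNReal.ofReal l)⁻¹ * ∫⁻ x in {x | ENNReal.ofReal l < u x}, u x ∂μ)) := by
        refine setLIntegral_mono' measurableSet_Ioi fun l hl => ?_
        rw [mul_left_comm]
        gcongr
        exact h l hl
    _ = _ := by
        rw [lintegral_const_mul' _ _ hC, lintegral_tail_le hs hu, div_eq_mul_inv, div_eq_mul_inv]
        ring

/-- Strong type for `1 < s < 2` by interpolation between weak type one and strong type two. -/
lemma lintegral_rpow_le_of_weak [SFinite μ] {s : ℝ} (hs : 1 < s) (hs2 : s < 2)
    {u v : α → ℝ≥0∞}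
    (hu : Measurable u) (hv : Measurable v) {C D : ℝ≥0∞} (hC : C ≠ ∞) (hD : D ≠ ∞)
    (h : ∀ l : ℝ, 0 < l → μ {x | ENNReal.ofReal l < v x} ≤
      C * ((ENNReal.ofReal l)⁻¹ * ∫⁻ x in {x | ENNReal.ofReal l < u x}, u x ∂μ) +
      D * ((ENNReal.ofReal l)⁻¹ ^ 2 * ∫⁻ x in {x | u x ≤ ENNReal.ofReal l}, u x ^ 2 ∂μ)) :
    ∫⁻ x, v x ^ s ∂μ ≤ ENNReal.ofReal s * (C / ENNReal.ofReal (s - 1) +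
      D / ENNReal.ofReal (2 - s)) * ∫⁻ x, u x ^ s ∂μ := by
  rw [lintegral_rpow_eq_layer (by linarith) hv, mul_assoc]
  gcongr
  calc _ ≤ ∫⁻ l in Ioi (0 : ℝ), (C * (ENNReal.ofReal (l ^ (s - 1)) *
        ((ENNReal.ofReal l)⁻¹ * ∫⁻ x in {x | ENNReal.ofReal l < u x}, u x ∂μ)) +
        D * (ENNReal.ofReal (l ^ (s - 1)) * ((ENNReal.ofReal l)⁻¹ ^ 2 *
          ∫⁻ x in {x | u x ≤ ENNReal.ofReal l}, u x ^ 2 ∂μ))) := by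
        refine setLIntegral_mono' measurableSet_Ioi fun l hl => ?_
        rw [mul_left_comm C, mul_left_comm D, ← mul_add]
        gcongr
        exact h l hl
    _ ≤ _ := by
        rw [lintegral_add_left', lintegral_const_mul' _ _ hC, lintegral_const_mul' _ _ hD,
          lintegral_tail_le hs hu, add_mul]
        · refine add_le_add (le_of_eq ?_) ((mul_le_mul_right
            (lintegral_head_le (by linarith) hs2 hu) D).trans (le_of_eq ?_)) <;>
          · rw [div_eq_mul_inv, div_eq_mul_inv]
            ring
        · refine Measurable.aemeasurable ?_
          refine Measurable.const_mul (Measurable.mul (by fun_prop) (Measurable.mul (by fun_prop)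
            ?_)) _
          have : Measurable (Function.uncurry fun (l : ℝ) (x : α) =>
              {x | ENNReal.ofReal l < u x}.indicator u x) :=
            (hu.comp measurable_snd).indicator (s := {z : ℝ × α | ENNReal.ofReal z.1 < u z.2})
              (measurableSet_lt (by fun_prop) (by fun_prop))
          have h3 := this.lintegral_prod_right' (ν := μ)
          simp_rw [← lintegral_indicator (measurableSet_lt measurable_const hu)]
          exact h3

end Interpolation

/-! ### The centred maximal function on a finite-dimensional normed space -/

section Maximal

variable {E : Type*} [NormedAddCommGroup E] [NormedSpace ℝ E] [FiniteDimensional ℝ E]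
  [MeasurableSpace E] [BorelSpace E]

/-- The centred Hardy–Littlewood maximal function over balls of dyadic radii. -/
noncomputable def maxFn (μ : Measure E) (u : E → ℝ≥0∞) (x : E) : ℝ≥0∞ :=
  ⨆ k : ℤ, (μ (closedBall x ((2 : ℝ) ^ k)))⁻¹ * ∫⁻ y in closedBall x ((2 : ℝ) ^ k), u y ∂μ

variable (μ : Measure E) [μ.IsAddHaarMeasure]

lemma measurable_lintegral_closedBall {u : E → ℝ≥0∞} (hu : Measurable u) (r : ℝ) :
    Measurable fun x => ∫⁻ y in closedBall x r, u y ∂μ := by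
  have : Measurable (Function.uncurry fun (x y : E) => (closedBall x r).indicator u y) :=
    (hu.comp measurable_snd).indicator (s := {z : E × E | dist z.2 z.1 ≤ r})
      (measurableSet_le (by fun_prop) (by fun_prop))
  have h3 := this.lintegral_prod_right' (ν := μ)
  convert h3 using 2 with x
  rw [← lintegral_indicator measurableSet_closedBall]
  rfl

/-- Dyadic radii make the supremum countable, and the volume of a ball does not depend on its
centre. -/
lemma measurable_maxFn {u : E → ℝ≥0∞} (hu : Measurable u) : Measurable (maxFn μ u) := by
  refine Measurable.iSup fun k => ?_
  simp_rw [Measure.addHaar_closedBall_center μ]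
  exact (measurable_lintegral_closedBall μ hu _).const_mul _

/-- Rounding a radius up to a power of two at most doubles it, so the dyadic maximal function
controls averages over all balls. -/
lemma lintegral_closedBall_le_maxFn (u : E → ℝ≥0∞) (x : E) {r : ℝ} (hr : 0 < r) :
    ∫⁻ y in closedBall x r, u y ∂μ ≤ μ (closedBall 0 (2 * r)) * maxFn μ u x := by
  obtain ⟨k, hk1, hk2⟩ := exists_mem_Ioc_zpow (y := (2 : ℝ)) hr (by norm_num)
  have h2 : (2 : ℝ) ^ (k + 1) ≤ 2 * r := by
    rw [zpow_add_one₀ (by norm_num)]; linarith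
  have hpos : μ (closedBall x ((2 : ℝ) ^ (k + 1))) ≠ 0 :=
    (measure_closedBall_pos μ x (by positivity)).ne'
  have hfin : μ (closedBall x ((2 : ℝ) ^ (k + 1))) ≠ ∞ := measure_closedBall_lt_top.ne
  calc ∫⁻ y in closedBall x r, u y ∂μ
      ≤ ∫⁻ y in closedBall x ((2 : ℝ) ^ (k + 1)), u y ∂μ :=
        lintegral_mono_set (closedBall_subset_closedBall hk2)
    _ = μ (closedBall x ((2 : ℝ) ^ (k + 1))) * ((μ (closedBall x ((2 : ℝ) ^ (k + 1))))⁻¹ *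
        ∫⁻ y in closedBall x ((2 : ℝ) ^ (k + 1)), u y ∂μ) := by
        rw [← mul_assoc, ENNReal.mul_inv_cancel hpos hfin, one_mul]
    _ ≤ _ := by
        refine mul_le_mul' ?_ ?_
        · rw [Measure.addHaar_closedBall_center μ x]
          exact measure_mono (closedBall_subset_closedBall h2)
        · exact le_iSup (fun k : ℤ => (μ (closedBall x ((2 : ℝ) ^ k)))⁻¹ *
            ∫⁻ y in closedBall x ((2 : ℝ) ^ k), u y ∂μ) (k + 1)

/-- Vitali's covering lemma with enlargement factor five. The selection needs bounded radii, so the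
superlevel set is exhausted by the sets `A N` that use only radii up to 2^N, and continuity of the
measure from below removes the restriction. -/
lemma maxFn_weak {u : E → ℝ≥0∞} (l : ℝ≥0∞) (hl : l ≠ 0) (hlt : l ≠ ∞) :
    μ {x | l < maxFn μ u x} ≤ ENNReal.ofReal (5 ^ Module.finrank ℝ E) * (l⁻¹ * ∫⁻ x, u x ∂μ) := by
  set C := ENNReal.ofReal (5 ^ Module.finrank ℝ E) with hC
  let A : ℕ → Set E := fun N => {x | ∃ k : ℤ, k ≤ N ∧
    l * μ (closedBall x ((2 : ℝ) ^ k)) < ∫⁻ y in closedBall x ((2 : ℝ) ^ k), u y ∂μ}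
  have hA : {x | l < maxFn μ u x} ⊆ ⋃ N, A N := by
    intro x hx
    obtain ⟨k, hk⟩ := lt_iSup_iff.1 (show l < maxFn μ u x from hx)
    refine mem_iUnion.2 ⟨k.toNat, k, Int.self_le_toNat k, ?_⟩
    rw [mul_comm _⁻¹, ← div_eq_mul_inv] at hk
    exact ENNReal.mul_lt_of_lt_div hk
  have hmono : Monotone A := by
    intro N M hNM x ⟨k, hk, h⟩
    exact ⟨k, hk.trans (by exact_mod_cast hNM), h⟩
  refine (measure_mono hA).trans ?_
  rw [hmono.measure_iUnion]
  refine iSup_le fun N => ?_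
  choose! k hkN hk using fun x (hx : x ∈ A N) => hx
  obtain ⟨w, hwA, hdis, hcov⟩ := Vitali.exists_disjoint_subfamily_covering_enlargement_closedBall
    (A N) (fun x => x) (fun x => (2 : ℝ) ^ k x) ((2 : ℝ) ^ (N : ℤ))
    (fun x hx => zpow_le_zpow_right₀ (by norm_num) (hkN x hx)) 5 (by norm_num)
  have hcount : w.Countable := by
    refine hdis.countable_of_nonempty_interior fun x hx => ?_
    exact ⟨x, ball_subset_interior_closedBall (mem_ball_self (by positivity))⟩
  have hsub : A N ⊆ ⋃ x ∈ w, closedBall x (5 * (2 : ℝ) ^ k x) := by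
    intro x hx
    obtain ⟨b, hb, hb2⟩ := hcov x hx
    exact mem_biUnion hb (hb2 (mem_closedBall_self (by positivity)))
  have := hcount.to_subtype
  calc μ (A N) ≤ ∑' x : w, μ (closedBall x.1 (5 * (2 : ℝ) ^ k x)) :=
        (measure_mono hsub).trans (measure_biUnion_le μ hcount _)
    _ = C * ∑' x : w, μ (closedBall x.1 ((2 : ℝ) ^ k x)) := by
        rw [← ENNReal.tsum_mul_left]
        congr 1
        ext x
        rw [Measure.addHaar_closedBall_mul μ _ (by norm_num) (by positivity),
          Measure.addHaar_closedBall_center μ x.1]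
    _ ≤ C * ∑' x : w, l⁻¹ * ∫⁻ y in closedBall x.1 ((2 : ℝ) ^ k x), u y ∂μ := by
        gcongr with x
        rw [mul_comm l⁻¹, ← div_eq_mul_inv, ENNReal.le_div_iff_mul_le (Or.inl hl) (Or.inl hlt),
          mul_comm]
        exact (hk x.1 (hwA x.2)).le
    _ = C * (l⁻¹ * ∫⁻ y in ⋃ x : w, closedBall x.1 ((2 : ℝ) ^ k x), u y ∂μ) := by
        rw [ENNReal.tsum_mul_left, lintegral_iUnion (fun x => measurableSet_closedBall)]
        intro x y hxy
        exact hdis x.2 y.2 (fun h => hxy (Subtype.ext h))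
    _ ≤ _ := by
        gcongr
        exact Measure.restrict_le_self

/-- The part of u not exceeding l has averages at most l. This sharpens the weak-type bound to one
that sees only the set where u > l. -/
lemma maxFn_le_add {u : E → ℝ≥0∞} (hu : Measurable u) (l : ℝ≥0∞) (x : E) :
    maxFn μ u x ≤ maxFn μ ({x | l < u x}.indicator u) x + l := by
  refine iSup_le fun k => ?_
  have hpos : μ (closedBall x ((2 : ℝ) ^ k)) ≠ 0 :=
    (measure_closedBall_pos μ x (by positivity)).ne'
  have hfin : μ (closedBall x ((2 : ℝ) ^ k)) ≠ ∞ := measure_closedBall_lt_top.ne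
  calc _ ≤ (μ (closedBall x ((2 : ℝ) ^ k)))⁻¹ * ∫⁻ y in closedBall x ((2 : ℝ) ^ k),
        ({x | l < u x}.indicator u y + l) ∂μ := by
        gcongr with y
        by_cases h : l < u y
        · simp [indicator, h]
        · simp only [indicator, mem_ofPred_eq, h, if_false, zero_add]
          exact not_lt.1 h
    _ = (μ (closedBall x ((2 : ℝ) ^ k)))⁻¹ * (∫⁻ y in closedBall x ((2 : ℝ) ^ k),
        ({x | l < u x}.indicator u y) ∂μ) + l := by
        rw [lintegral_add_left (hu.indicator (measurableSet_lt measurable_const hu)), mul_add,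
          setLIntegral_const, mul_left_comm, ENNReal.inv_mul_cancel hpos hfin, mul_one]
    _ ≤ _ := by
        gcongr
        exact le_iSup (fun k : ℤ => (μ (closedBall x ((2 : ℝ) ^ k)))⁻¹ *
            ∫⁻ y in closedBall x ((2 : ℝ) ^ k), ({x | l < u x}.indicator u y) ∂μ) k

/-- The maximal theorem. -/
theorem lintegral_maxFn_rpow_le {s : ℝ} (hs : 1 < s) : ∃ C : ℝ≥0, ∀ u : E → ℝ≥0∞, Measurable u →
    ∫⁻ x, maxFn μ u x ^ s ∂μ ≤ C * ∫⁻ x, u x ^ s ∂μ := by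
  set c := ENNReal.ofReal (5 ^ Module.finrank ℝ E) with hc
  refine ⟨(2 ^ s * (ENNReal.ofReal s * (c / ENNReal.ofReal (s - 1)))).toNNReal, fun u hu => ?_⟩
  have h0 : ENNReal.ofReal (s - 1) ≠ 0 := by simpa using hs
  rw [ENNReal.coe_toNNReal (by finiteness)]
  -- The factor 1/2 absorbs the additive l: if half the maximal function exceeds l, then the maximal
  -- function of the large part of u exceeds l.
  have h1 := lintegral_rpow_le_of_weak_tail (μ := μ) hs (u := u) (v := fun x => 2⁻¹ * maxFn μ u x)
    hu ((measurable_maxFn μ hu).const_mul _) (C := c) ENNReal.ofReal_ne_top fun l hl => by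
      have hl' : ENNReal.ofReal l ≠ 0 := by simpa using hl
      calc μ {x | ENNReal.ofReal l < 2⁻¹ * maxFn μ u x}
          ≤ μ {x | ENNReal.ofReal l < maxFn μ ({x | ENNReal.ofReal l < u x}.indicator u) x} := by
            refine measure_mono fun x hx => ?_
            have hx : ENNReal.ofReal l < 2⁻¹ * maxFn μ u x := hx
            show ENNReal.ofReal l < _
            by_contra! hcon
            refine absurd hx (not_lt.2 ?_)
            calc 2⁻¹ * maxFn μ u x ≤ 2⁻¹ * (ENNReal.ofReal l + ENNReal.ofReal l) := by
                  gcongr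
                  exact (maxFn_le_add μ hu (ENNReal.ofReal l) x).trans (by gcongr)
              _ = ENNReal.ofReal l := by
                  rw [← two_mul, ← mul_assoc, ENNReal.inv_mul_cancel (by simp) (by simp), one_mul]
        _ ≤ _ := by
            refine (maxFn_weak μ _ hl' ENNReal.ofReal_ne_top).trans ?_
            rw [lintegral_indicator (measurableSet_lt measurable_const hu)]
  have h2 : ∀ x, maxFn μ u x ^ s = 2 ^ s * (2⁻¹ * maxFn μ u x) ^ s := by
    intro x
    rw [← ENNReal.mul_rpow_of_nonneg _ _ (by linarith), ← mul_assoc,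
      ENNReal.mul_inv_cancel (by simp) (by simp), one_mul]
  simp_rw [h2]
  rw [lintegral_const_mul' _ _ (by finiteness), mul_assoc]
  gcongr

/-- Integration of a power of the distance against a measure of given growth. -/
lemma lintegral_annuli_le {X : Type*} [PseudoMetricSpace X] [MeasurableSpace X]
    [OpensMeasurableSpace X] (ν : Measure X) {a b : ℝ} (hab : a < b) (hb : 0 < b)
    {m : ℝ≥0∞} {x : X} {ρ : ℝ}
    (hρ : 0 < ρ) (h : ∀ R, ρ ≤ R → ν (closedBall x R) ≤ m * ENNReal.ofReal (R ^ a)) :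
    ∫⁻ y in {y | ρ ≤ dist y x}, ENNReal.ofReal (dist y x ^ (-b)) ∂ν ≤
      ENNReal.ofReal (2 ^ a * (1 - 2 ^ (a - b))⁻¹) * (m * ENNReal.ofReal (ρ ^ (a - b))) := by
  have hsub : {y | ρ ≤ dist y x} ⊆ ⋃ k : ℕ, {y | 2 ^ k * ρ ≤ dist y x ∧
      dist y x ≤ 2 ^ (k + 1) * ρ} := by
    intro y hy
    have hy : ρ ≤ dist y x := hy
    obtain ⟨k, hk1, hk2⟩ := exists_nat_pow_near (x := dist y x / ρ) (y := (2 : ℝ))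
      ((one_le_div hρ).2 hy) (by norm_num)
    exact mem_iUnion.2 ⟨k, (le_div_iff₀ hρ).1 hk1, ((div_lt_iff₀ hρ).1 hk2).le⟩
  have h2 : (2 : ℝ) ^ (a - b) < 1 := Real.rpow_lt_one_of_one_lt_of_neg (by norm_num) (by linarith)
  have h2p : 0 < (2 : ℝ) ^ (a - b) := by positivity
  calc _ ≤ ∑' k : ℕ, ∫⁻ y in {y | 2 ^ k * ρ ≤ dist y x ∧ dist y x ≤ 2 ^ (k + 1) * ρ},
        ENNReal.ofReal (dist y x ^ (-b)) ∂ν :=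
        (lintegral_mono_set hsub).trans (lintegral_iUnion_le _ _)
    -- On the k-th annulus the integrand is at most (2^k ρ)^{-b} and the mass at most m (2^{k+1}
    -- ρ)^a, so the terms form a geometric series of ratio 2^{a-b} < 1.
    _ ≤ ∑' k : ℕ, ENNReal.ofReal (((2 : ℝ) ^ (a - b)) ^ k) *
          (ENNReal.ofReal (2 ^ a) * (m * ENNReal.ofReal (ρ ^ (a - b)))) := by
        refine ENNReal.tsum_le_tsum fun k => ?_
        have hk : 0 < 2 ^ k * ρ := by positivity
        have hms : MeasurableSet {y | 2 ^ k * ρ ≤ dist y x ∧ dist y x ≤ 2 ^ (k + 1) * ρ} := by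
          have hd : Measurable fun y => dist y x := (continuous_id.dist continuous_const).measurable
          exact (measurableSet_le measurable_const hd).inter (measurableSet_le hd measurable_const)
        calc _ ≤ ∫⁻ y in {y | 2 ^ k * ρ ≤ dist y x ∧ dist y x ≤ 2 ^ (k + 1) * ρ},
                ENNReal.ofReal ((2 ^ k * ρ) ^ (-b)) ∂ν := by
              refine setLIntegral_mono' hms fun y hy => ENNReal.ofReal_le_ofReal ?_
              exact Real.rpow_le_rpow_of_nonpos hk hy.1 (by linarith)
          _ ≤ ENNReal.ofReal ((2 ^ k * ρ) ^ (-b)) *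
                (m * ENNReal.ofReal ((2 ^ (k + 1) * ρ) ^ a)) := by
              rw [setLIntegral_const]
              gcongr
              refine (measure_mono fun y hy => hy.2).trans (h _ ?_)
              have : (1 : ℝ) ≤ 2 ^ (k + 1) := one_le_pow₀ (by norm_num)
              nlinarith
          _ = _ := by
              rw [mul_left_comm, ← ENNReal.ofReal_mul (by positivity), mul_left_comm _ m,
                mul_left_comm _ m, ← ENNReal.ofReal_mul (by positivity),
                ← ENNReal.ofReal_mul (by positivity)]
              congr 2
              rw [← Real.rpow_natCast, ← Real.rpow_natCast, ← Real.rpow_natCast,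
                Real.mul_rpow (by positivity) hρ.le, Real.mul_rpow (by positivity) hρ.le,
                ← Real.rpow_mul (by norm_num), ← Real.rpow_mul (by norm_num),
                ← Real.rpow_mul (by norm_num), Real.rpow_sub hρ, Real.rpow_neg hρ.le]
              have e1 : (2 : ℝ) ^ (((k + 1 : ℕ) : ℝ) * a) = 2 ^ ((k : ℝ) * a) * 2 ^ a := by
                rw [← Real.rpow_add (by norm_num)]; congr 1; push_cast; ring
              have e2 : (2 : ℝ) ^ ((a - b) * (k : ℝ)) = 2 ^ ((k : ℝ) * a) * 2 ^ ((k : ℝ) * (-b)) := by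
                rw [← Real.rpow_add (by norm_num)]; congr 1; ring
              rw [e1, e2]
              field_simp
    _ = _ := by
        rw [ENNReal.tsum_mul_right, ← ENNReal.ofReal_tsum_of_nonneg (fun k => by positivity)
          (summable_geometric_of_lt_one h2p.le h2), tsum_geometric_of_lt_one h2p.le h2,
          ← mul_assoc, ← ENNReal.ofReal_mul (inv_nonneg.2 (by linarith)), mul_comm (_⁻¹)]

end Maximal

end CausalCZO

namespace CausalCZO

open Filter Topology Metric

/-! ### Cubes and dyadic cubes -/

section Cubes

variable {n : ℕ}

/-- The crude factor n + 1 in place of √n keeps all later constants rational, and positive in every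
dimension. -/
lemma norm_le_of_abs_le {y : Bd n} {b : ℝ} (hb : 0 ≤ b) (h : ∀ i, |y i| ≤ b) :
    ‖y‖ ≤ (n + 1) * b := by
  rw [EuclideanSpace.norm_eq, Real.sqrt_le_left (by positivity)]
  calc ∑ i, ‖y i‖ ^ 2 ≤ ∑ _i : Fin n, b ^ 2 := by
        gcongr with i
        exact h i
    _ = n * b ^ 2 := by simp
    _ ≤ ((n + 1) * b) ^ 2 := by
        rw [mul_pow]
        gcongr
        nlinarith [(Nat.cast_nonneg n : (0 : ℝ) ≤ n)]

lemma abs_apply_le_norm (y : Bd n) (i : Fin n) : |y i| ≤ ‖y‖ := PiLp.norm_apply_le y i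

lemma Cube.set_eq_preimage (Q : Cube n) : Q.set = (WithLp.ofLp : Bd n → (Fin n → ℝ)) ⁻¹'
    (Set.pi univ fun i => Ico (Q.center i - Q.side / 2) (Q.center i + Q.side / 2)) := by
  ext y
  simp [Cube.set]

lemma Cube.measurableSet_set (Q : Cube n) : MeasurableSet Q.set := by
  rw [Q.set_eq_preimage]
  exact (PiLp.volume_preserving_ofLp (Fin n)).measurable
    (MeasurableSet.univ_pi fun i => measurableSet_Ico)

lemma Cube.volume_set (Q : Cube n) (hQ : 0 ≤ Q.side) :
    volume Q.set = ENNReal.ofReal (Q.side ^ n) := by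
  rw [Q.set_eq_preimage, (PiLp.volume_preserving_ofLp (Fin n)).measure_preimage
    (MeasurableSet.univ_pi fun i => measurableSet_Ico).nullMeasurableSet, Real.volume_pi_Ico]
  simp [ENNReal.ofReal_pow hQ]

lemma Cube.convex_set (Q : Cube n) : Convex ℝ Q.set := by
  rw [Q.set_eq_preimage]
  exact (convex_pi fun i _ => convex_Ico _ _).is_linear_preimage
    ⟨fun _ _ => rfl, fun _ _ => rfl⟩

lemma Cube.set_subset_closedBall (Q : Cube n) (hQ : 0 ≤ Q.side) :
    Q.set ⊆ closedBall Q.center ((n + 1) * (Q.side / 2)) := by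
  intro y hy
  rw [mem_closedBall, dist_eq_norm]
  refine norm_le_of_abs_le (by positivity) fun i => ?_
  rw [PiLp.sub_apply, abs_le]
  constructor <;> linarith [(hy i).1, (hy i).2]

lemma Cube.ball_subset_set (Q : Cube n) : ball Q.center (Q.side / 2) ⊆ Q.set := by
  intro y hy i
  have h := (abs_apply_le_norm (y - Q.center) i).trans_lt (mem_ball_iff_norm.1 hy)
  rw [PiLp.sub_apply, abs_lt] at h
  constructor <;> linarith [h.1, h.2]

/-- Indices of dyadic cubes of `ℝ^{1+n}`: generation and integer position. -/
abbrev DyIdx (n : ℕ) : Type := ℤ × ℤ × (Fin n → ℤ)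

/-- The half-open dyadic cube with a given index. -/
def dyCube (i : DyIdx n) : Set (Pt n) :=
  {y | ⌊(2 : ℝ) ^ i.1 * y.1⌋ = i.2.1 ∧ ∀ m, ⌊(2 : ℝ) ^ i.1 * y.2 m⌋ = i.2.2 m}

/-- The index of the dyadic cube of generation `j` containing a point. -/
noncomputable def dyIdx (j : ℤ) (y : Pt n) : DyIdx n :=
  (j, ⌊(2 : ℝ) ^ j * y.1⌋, fun m => ⌊(2 : ℝ) ^ j * y.2 m⌋)

/-- Side length of a dyadic cube. -/
noncomputable def dySide (i : DyIdx n) : ℝ := (2 : ℝ) ^ (-i.1)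

/-- Centre of a dyadic cube. -/
noncomputable def dyCenter (i : DyIdx n) : Pt n :=
  (dySide i * (i.2.1 + 1 / 2), WithLp.toLp 2 fun m => dySide i * (i.2.2 m + 1 / 2))

lemma dySide_pos (i : DyIdx n) : 0 < dySide i := by unfold dySide; positivity

lemma mem_dyCube_iff {i : DyIdx n} {y : Pt n} : y ∈ dyCube i ↔ dyIdx i.1 y = i := by
  obtain ⟨j, v, w⟩ := i
  simp [dyCube, dyIdx, funext_iff]

lemma mem_dyCube_dyIdx (j : ℤ) (y : Pt n) : y ∈ dyCube (dyIdx j y) := ⟨rfl, fun _ => rfl⟩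

lemma floor_zpow_mul_eq_iff {j : ℤ} {t : ℝ} {z : ℤ} :
    ⌊(2 : ℝ) ^ j * t⌋ = z ↔ (2 : ℝ) ^ (-j) * z ≤ t ∧ t < (2 : ℝ) ^ (-j) * (z + 1) := by
  have : 0 < (2 : ℝ) ^ j := by positivity
  rw [Int.floor_eq_iff, zpow_neg, inv_mul_le_iff₀ this, lt_inv_mul_iff₀ this]

lemma dyCube_eq (i : DyIdx n) : dyCube i =
    Ico (dySide i * i.2.1) (dySide i * (i.2.1 + 1)) ×ˢ
      (⟨(dyCenter i).2, dySide i⟩ : Cube n).set := by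
  ext y
  simp only [dyCube, floor_zpow_mul_eq_iff, mem_prod, mem_Ico, Cube.set, mem_ofPred_eq, dyCenter]
  change (dySide i * _ ≤ y.1 ∧ y.1 < dySide i * _) ∧ (∀ m, dySide i * _ ≤ y.2 m ∧
    y.2 m < dySide i * _) ↔ _
  refine and_congr Iff.rfl (forall_congr' fun m => ?_)
  rw [show dySide i * ((i.2.2 m : ℝ) + 1 / 2) - dySide i / 2 = dySide i * i.2.2 m by ring,
    show dySide i * ((i.2.2 m : ℝ) + 1 / 2) + dySide i / 2 = dySide i * (i.2.2 m + 1) by ring]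

lemma measurableSet_dyCube (i : DyIdx n) : MeasurableSet (dyCube i) := by
  rw [dyCube_eq]
  exact measurableSet_Ico.prod (Cube.measurableSet_set _)

lemma volume_dyCube (i : DyIdx n) : volume (dyCube i) = ENNReal.ofReal (dySide i ^ (n + 1)) := by
  have h := (dySide_pos i).le
  rw [dyCube_eq, Measure.volume_eq_prod, Measure.prod_prod, Real.volume_Ico,
    Cube.volume_set _ h, ← ENNReal.ofReal_mul (by nlinarith)]
  congr 1
  simp only
  ring

lemma volume_dyCube_ne_zero (i : DyIdx n) : volume (dyCube i) ≠ 0 := by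
  have := dySide_pos i
  rw [volume_dyCube]
  simp only [ne_eq, ENNReal.ofReal_eq_zero, not_le]
  positivity

lemma volume_dyCube_ne_top (i : DyIdx n) : volume (dyCube i) ≠ ∞ := by
  rw [volume_dyCube]; exact ENNReal.ofReal_ne_top

lemma convex_dyCube (i : DyIdx n) : Convex ℝ (dyCube i) := by
  rw [dyCube_eq]
  exact (convex_Ico _ _).prod (Cube.convex_set _)

lemma dyCube_subset_closedBall (i : DyIdx n) :
    dyCube i ⊆ closedBall (dyCenter i) ((n + 1) * dySide i) := by
  have h := dySide_pos i
  intro y hy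
  rw [dyCube_eq] at hy
  have h1 : dySide i * i.2.1 ≤ y.1 ∧ y.1 < dySide i * (i.2.1 + 1) := hy.1
  have h2 : dist y.2 (dyCenter i).2 ≤ (n + 1) * (dySide i / 2) :=
    Cube.set_subset_closedBall (⟨(dyCenter i).2, dySide i⟩ : Cube n) h.le hy.2
  have hn : (0 : ℝ) ≤ n := Nat.cast_nonneg n
  have h3 : (dyCenter i).1 = dySide i * (i.2.1 + 1 / 2) := rfl
  rw [mem_closedBall, Prod.dist_eq, max_le_iff, Real.dist_eq, abs_le, h3]
  refine ⟨⟨?_, ?_⟩, h2.trans ?_⟩ <;> nlinarith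

lemma ball_subset_dyCube (i : DyIdx n) : ball (dyCenter i) (dySide i / 2) ⊆ dyCube i := by
  rw [dyCube_eq, ← ball_prod_same (dyCenter i).1 (dyCenter i).2]
  refine prod_mono ?_ (Cube.ball_subset_set (⟨(dyCenter i).2, dySide i⟩ : Cube n))
  rw [Real.ball_eq_Ioo]
  simp only [dyCenter]
  intro t ht
  constructor <;> linarith [ht.1, ht.2]

/-- Nestedness of the grid: the floor of half a number depends only on its floor, so the index of a
parent is determined by that of its child. -/
lemma dyIdx_pred {j : ℤ} {y z : Pt n} (h : dyIdx j y = dyIdx j z) :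
    dyIdx (j - 1) y = dyIdx (j - 1) z := by
  have key : ∀ s t : ℝ, ⌊(2 : ℝ) ^ j * s⌋ = ⌊(2 : ℝ) ^ j * t⌋ →
      ⌊(2 : ℝ) ^ (j - 1) * s⌋ = ⌊(2 : ℝ) ^ (j - 1) * t⌋ := by
    intro s t h
    have e : ∀ r : ℝ, (2 : ℝ) ^ (j - 1) * r = (2 : ℝ) ^ j * r / (2 : ℕ) := by
      intro r
      rw [zpow_sub_one₀ (by norm_num)]
      push_cast
      ring
    rw [e, e, Int.floor_div_natCast, Int.floor_div_natCast, h]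
  simp only [dyIdx, Prod.mk.injEq, true_and, funext_iff] at h ⊢
  exact ⟨key _ _ h.1, fun m => key _ _ (h.2 m)⟩

lemma dyIdx_of_le {j k : ℤ} (hk : k ≤ j) {y z : Pt n} (h : dyIdx j y = dyIdx j z) :
    dyIdx k y = dyIdx k z := by
  obtain ⟨m, rfl⟩ := Int.le.dest hk
  induction m with
  | zero => simpa using h
  | succ m ih =>
    refine ih (by omega) ?_
    have := dyIdx_pred h
    rwa [show k + ((m + 1 : ℕ) : ℤ) - 1 = k + m by push_cast; ring] at this

lemma dyCube_subset_dyCube_pred (j : ℤ) (y : Pt n) :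
    dyCube (dyIdx j y) ⊆ dyCube (dyIdx (j - 1) y) := by
  intro z hz
  rw [mem_dyCube_iff] at hz ⊢
  exact dyIdx_pred hz

instance : (volume : Measure (Pt n)).IsAddHaarMeasure :=
  inferInstanceAs ((volume : Measure ℝ).prod (volume : Measure (Bd n))).IsAddHaarMeasure

/-- Dyadic Lebesgue differentiation. -/
lemma ae_tendsto_dyadic_average {w : Pt n → ℝ≥0∞} (hw : Measurable w) (hfin : ∫⁻ y, w y ≠ ∞) :
    ∀ᵐ x : Pt n, Tendsto (fun k : ℕ => (∫⁻ y in dyCube (dyIdx k x), w y) /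
      volume (dyCube (dyIdx k x))) atTop (𝓝 (w x)) := by
  set d := Module.finrank ℝ (Pt n)
  set ω := volume (closedBall (0 : Pt n) 1)
  have hd : d = n + 1 := by simp [d, add_comm]
  have hω : ω ≠ ∞ := measure_closedBall_lt_top.ne
  -- A cube lies in a ball of radius 2(n+1) times its side about any of its points. The Vitali
  -- family asks for the tripled ball, hence the factor 6(n+1).
  set C : ℝ≥0 := (ENNReal.ofReal ((6 * (n + 1)) ^ d) * ω).toNNReal
  have hC : (C : ℝ≥0∞) = ENNReal.ofReal ((6 * (n + 1)) ^ d) * ω :=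
    ENNReal.coe_toNNReal (by finiteness)
  -- A Vitali family consists of closed sets. Half-open cubes may be replaced by their closures
  -- because the frontier of a convex set is null.
  have hcl : ∀ i : DyIdx n, (closure (dyCube i) : Set (Pt n)) =ᵐ[volume] dyCube i := fun i =>
    closure_ae_eq_of_null_frontier ((convex_dyCube i).addHaar_frontier _)
  have hdist : ∀ (k : ℕ) (x : Pt n), closure (dyCube (dyIdx k x)) ⊆
      closedBall x (2 * (n + 1) * (2 : ℝ) ^ (-(k : ℤ))) := by
    intro k x
    refine closure_minimal (fun y hy => ?_) isClosed_closedBall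
    have h1 := dyCube_subset_closedBall _ hy
    have h2 := dyCube_subset_closedBall _ (mem_dyCube_dyIdx k x)
    rw [mem_closedBall] at h1 h2 ⊢
    have h3 := dist_triangle_right y x (dyCenter (dyIdx k x))
    have : dySide (dyIdx k x) = (2 : ℝ) ^ (-(k : ℤ)) := rfl
    rw [this] at h1 h2
    linarith
  have hfreq : ∀ x : Pt n, ∃ᶠ r in 𝓝[>] (0 : ℝ),
      volume (closedBall x (3 * r)) ≤ (2 * 3 : ℝ≥0) ^ d * volume (closedBall x r) := by
    intro x
    refine Eventually.frequently (eventually_nhdsWithin_of_forall fun r hr => ?_)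
    have hr : 0 < r := hr
    rw [Measure.addHaar_closedBall_mul volume x (by norm_num) hr.le,
      Measure.addHaar_closedBall_center volume x]
    refine mul_le_mul_left ?_ _
    rw [ENNReal.ofReal_pow (by norm_num)]
    refine pow_le_pow_left' ?_ _
    rw [← ENNReal.ofReal_coe_nnreal]
    apply ENNReal.ofReal_le_ofReal
    norm_num
  set C' : ℝ≥0 := max C ((2 * 3 : ℝ≥0) ^ d)
  let V := Vitali.vitaliFamily (volume : Measure (Pt n)) C' fun x => (hfreq x).mono fun r hr =>
    hr.trans (mul_le_mul_left (by
      rw [← ENNReal.coe_pow]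
      exact ENNReal.coe_le_coe.2 (le_max_right C ((2 * 3 : ℝ≥0) ^ d))) _)
  have hV := V.ae_tendsto_lintegral_div hw.aemeasurable hfin
  filter_upwards [hV] with x hx
  have hten : Tendsto (fun k : ℕ => closure (dyCube (dyIdx k x))) atTop (V.filterAt x) := by
    rw [V.tendsto_filterAt_iff]
    constructor
    · refine .of_forall fun k => ⟨isClosed_closure, ?_, _, hdist k x, ?_⟩
      · refine ⟨dyCenter (dyIdx k x), interior_mono subset_closure ?_⟩
        exact interior_maximal (ball_subset_dyCube _) isOpen_ball
          (mem_ball_self (half_pos (dySide_pos _)))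
      · have hp : (0 : ℝ) < 2 ^ (-(k : ℤ)) := by positivity
        rw [measure_congr (hcl _), volume_dyCube,
          show 3 * (2 * ((n : ℝ) + 1) * 2 ^ (-(k : ℤ))) = (6 * (n + 1)) * 2 ^ (-(k : ℤ)) by ring,
          Measure.addHaar_closedBall_mul volume _ (by positivity) hp.le,
          Measure.addHaar_closedBall' volume _ hp.le]
        calc _ = (C : ℝ≥0∞) * ENNReal.ofReal (dySide (dyIdx k x) ^ (n + 1)) := by
              rw [hC, ← hd, mul_right_comm, mul_assoc]
              rfl
          _ ≤ _ := by
              gcongr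
              exact le_max_left _ _
    · intro ε hε
      have h0 : Tendsto (fun k : ℕ => 2 * ((n : ℝ) + 1) * (2 : ℝ) ^ (-(k : ℤ))) atTop (𝓝 0) := by
        have : Tendsto (fun k : ℕ => ((1 : ℝ) / 2) ^ k) atTop (𝓝 0) :=
          tendsto_pow_atTop_nhds_zero_of_lt_one (by norm_num) (by norm_num)
        simpa [zpow_neg] using this.const_mul (2 * ((n : ℝ) + 1))
      filter_upwards [h0.eventually_lt_const hε] with k hk
      exact (hdist k x).trans (closedBall_subset_closedBall hk.le)
  refine (hx.comp hten).congr fun k => ?_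
  simp only [Function.comp]
  rw [setLIntegral_congr (hcl _), measure_congr (hcl _)]

/-- The Calderón–Zygmund stopping cubes at a given height. -/
theorem exists_stopping_cubes {w : Pt n → ℝ≥0∞} (hw : Measurable w) (hfin : ∫⁻ y, w y ≠ ∞)
    {l : ℝ≥0∞} (hl : l ≠ 0) (hl' : l ≠ ∞) :
    ∃ I : Set (DyIdx n), I.PairwiseDisjoint dyCube ∧
      (∀ i ∈ I, l * volume (dyCube i) < ∫⁻ y in dyCube i, w y ∧
        ∫⁻ y in dyCube i, w y ≤ 2 ^ (n + 1) * l * volume (dyCube i)) ∧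
      ∀ᵐ x, (x ∉ ⋃ i ∈ I, dyCube i) → w x ≤ l := by
  let big : DyIdx n → Prop := fun i => l * volume (dyCube i) < ∫⁻ y in dyCube i, w y
  -- No very large cube is big: the total mass is finite, while a cube of side at least 2^N has
  -- volume at least N.
  obtain ⟨N, hN⟩ : ∃ N : ℕ, ∀ i : DyIdx n, i.1 ≤ -(N : ℤ) → ¬ big i := by
    obtain ⟨N, hN⟩ : ∃ N : ℕ, (∫⁻ y, w y) / l < N := ENNReal.exists_nat_gt
      (ENNReal.div_lt_top hfin hl).ne
    refine ⟨N, fun i hi => not_lt.2 ?_⟩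
    calc ∫⁻ y in dyCube i, w y ≤ ∫⁻ y, w y := setLIntegral_le_lintegral _ _
      _ ≤ l * N := by
        rw [mul_comm]
        exact (ENNReal.div_le_iff_le_mul (Or.inl hl) (Or.inl hl')).1 hN.le
      _ ≤ l * volume (dyCube i) := by
        gcongr
        rw [volume_dyCube, ← ENNReal.ofReal_natCast]
        apply ENNReal.ofReal_le_ofReal
        have h1 : (2 : ℝ) ^ N ≤ dySide i := by
          rw [dySide, ← zpow_natCast]
          exact zpow_le_zpow_right₀ (by norm_num) (by omega)
        have h2 : (N : ℝ) ≤ 2 ^ N := by exact_mod_cast Nat.lt_two_pow_self.le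
        have h3 : (1 : ℝ) ≤ 2 ^ N := one_le_pow₀ (by norm_num)
        exact h2.trans (h1.trans (le_self_pow₀ (h3.trans h1) (by simp)))
  -- The stopping cubes are the maximal big ones, those with no big ancestor.
  let I : Set (DyIdx n) := {i | big i ∧ ∀ y ∈ dyCube i, ∀ k < i.1, ¬ big (dyIdx k y)}
  refine ⟨I, ?_, ?_, ?_⟩
  · have key : ∀ a ∈ I, ∀ b ∈ I, a.1 ≤ b.1 → ∀ y ∈ dyCube a, y ∈ dyCube b → a = b := by
      intro a ha b hb hab y hya hyb
      rcases hab.lt_or_eq with h | h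
      · have := hb.2 y hyb _ h
        rw [mem_dyCube_iff.1 hya] at this
        exact absurd ha.1 this
      · rw [← mem_dyCube_iff.1 hya, ← mem_dyCube_iff.1 hyb, h]
    intro a ha b hb hab
    refine Set.disjoint_left.2 fun y hya hyb => hab ?_
    rcases le_total a.1 b.1 with h | h
    · exact key a ha b hb h y hya hyb
    · exact (key b hb a ha h y hyb hya).symm
  · intro i hi
    refine ⟨hi.1, ?_⟩
    have hy : dyCenter i ∈ dyCube i := ball_subset_dyCube i (mem_ball_self (half_pos (dySide_pos i)))
    -- The parent is not big and has 2^{n+1} times the volume, which gives the upper bound for the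
    -- average.
    have h1 := hi.2 _ hy (i.1 - 1) (by omega)
    have h2 : dyCube i ⊆ dyCube (dyIdx (i.1 - 1) (dyCenter i)) := by
      conv_lhs => rw [← mem_dyCube_iff.1 hy]
      exact dyCube_subset_dyCube_pred _ _
    calc ∫⁻ y in dyCube i, w y ≤ ∫⁻ y in dyCube (dyIdx (i.1 - 1) (dyCenter i)), w y :=
          lintegral_mono_set h2
      _ ≤ l * volume (dyCube (dyIdx (i.1 - 1) (dyCenter i))) := not_lt.1 h1
      _ = _ := by
        have : dySide (dyIdx (i.1 - 1) (dyCenter i)) = 2 * dySide i := by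
          change (2 : ℝ) ^ (-(i.1 - 1)) = 2 * (2 : ℝ) ^ (-i.1)
          rw [neg_sub, sub_eq_add_neg, zpow_add₀ (by norm_num), zpow_one]
        rw [volume_dyCube, volume_dyCube, this, mul_pow, ENNReal.ofReal_mul (by positivity),
          ENNReal.ofReal_pow (by norm_num), ENNReal.ofReal_ofNat]
        ring
  · filter_upwards [ae_tendsto_dyadic_average hw hfin] with x hx hxI
    refine le_of_tendsto hx (.of_forall fun k => ?_)
    rw [ENNReal.div_le_iff_le_mul (Or.inl (volume_dyCube_ne_zero _))
      (Or.inl (volume_dyCube_ne_top _))]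
    by_contra! hcon
    -- If some cube around x were big, there would be a largest such cube, of least generation. It
    -- would be a stopping cube containing x.
    obtain ⟨j, hj, hmin⟩ := Int.exists_least_of_bdd (P := fun j => big (dyIdx j x))
      ⟨-N, fun z hz => by
        by_contra! h
        exact hN (dyIdx z x) h.le hz⟩ ⟨k, hcon⟩
    refine hxI (mem_biUnion (x := dyIdx j x) ⟨hj, fun y hy m hm hb => ?_⟩ (mem_dyCube_dyIdx j x))
    have h1 : dyIdx m y = dyIdx m x := dyIdx_of_le (le_of_lt hm) (mem_dyCube_iff.1 hy)
    rw [h1] at hb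
    exact absurd (hmin m hb) (not_le.2 hm)

end Cubes

end CausalCZO

namespace CausalCZO

open Filter Topology Metric

/-! ### Causal Calderón–Zygmund kernels in the sup metric -/

section Kernels

variable {𝕜 : Type*} [RCLike 𝕜] {n : ℕ}

lemma norm_le_euclLen (v : Pt n) : ‖v‖ ≤ euclLen v := by
  rw [Prod.norm_def, max_le_iff, euclLen, Real.norm_eq_abs]
  exact ⟨Real.abs_le_sqrt (by nlinarith [sq_nonneg ‖v.2‖]),
    Real.le_sqrt_of_sq_le (by nlinarith [sq_nonneg v.1])⟩

lemma euclLen_le (v : Pt n) : euclLen v ≤ 2 * ‖v‖ := by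
  have h1 : |v.1| ≤ ‖v‖ := le_max_left _ _
  have h2 : ‖v.2‖ ≤ ‖v‖ := le_max_right _ _
  rw [euclLen, Real.sqrt_le_left (by positivity), ← sq_abs]
  nlinarith [abs_nonneg v.1, norm_nonneg v.2, norm_nonneg v]

lemma isOpen_halfSpace : IsOpen (halfSpace n) := isOpen_lt continuous_const continuous_fst

lemma measurableSet_halfSpace : MeasurableSet (halfSpace n) := isOpen_halfSpace.measurableSet

lemma ae_mem_halfSpace : ∀ᵐ x ∂(hmeas n), x ∈ halfSpace n :=
  ae_restrict_mem measurableSet_halfSpace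

lemma hmeas_le : hmeas n ≤ volume := Measure.restrict_le_self

instance : SigmaFinite (hmeas n) := inferInstanceAs (SigmaFinite (volume.restrict _))

instance : IsFiniteMeasureOnCompacts (hmeas n) :=
  inferInstanceAs (IsFiniteMeasureOnCompacts (volume.restrict _))

/-- A causal kernel, as seen in the sup metric: size and regularity in the second variable, up
to the jump at equal heights. -/
structure RoughKernel (γ A : ℝ) (K : Pt n → Pt n → 𝕜) : Prop where
  nonneg : 0 ≤ A
  measurable : Measurable (Function.uncurry K)
  size : ∀ x y, ‖K x y‖ ≤ A * dist x y ^ (-((n : ℝ) + 1))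
  reg : ∀ x ∈ halfSpace n, ∀ y ∈ halfSpace n, ∀ y' ∈ halfSpace n, 4 * dist y' y ≤ dist x y →
    ‖K x y' - K x y‖ ≤ A * dist y' y ^ γ * dist x y ^ (-((n : ℝ) + 1 + γ)) +
      if |x.1 - y.1| ≤ dist y' y then A * dist x y ^ (-((n : ℝ) + 1)) else 0

/-- The part of a kernel on the half space where `0 < σ (t - s)`. -/
noncomputable def causalKernel (σ : ℝ) (k : Pt n → Pt n → 𝕜) (x y : Pt n) : 𝕜 :=
  open Classical in if x ∈ halfSpace n ∧ y ∈ halfSpace n ∧ 0 < σ * (x.1 - y.1) then k x y else 0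

lemma IsCZKernel.nonneg {γ A : ℝ} {k : Pt n → Pt n → 𝕜} (hk : IsCZKernel γ A k) : 0 ≤ A := by
  have h1 : ((1, 0) : Pt n) ∈ halfSpace n := by simp [halfSpace]
  have h2 : ((2, 0) : Pt n) ∈ halfSpace n := by simp [halfSpace]
  have hne : ((1, 0) : Pt n) ≠ (2, 0) := by simp
  have h := (norm_nonneg _).trans (hk.size _ h1 _ h2 hne)
  have hpos : 0 < euclLen (((1, 0) : Pt n) - (2, 0)) :=
    (norm_pos_iff.2 (sub_ne_zero.2 hne)).trans_le (norm_le_euclLen _)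
  by_contra! hA
  have := div_neg_of_neg_of_pos hA (pow_pos hpos (n + 1))
  linarith

/-- The hypotheses are symmetric in the two variables, so the kernel of the adjoint satisfies them
with the same constants. -/
lemma IsCZKernel.conj {γ A : ℝ} {k : Pt n → Pt n → 𝕜} (hk : IsCZKernel γ A k) :
    IsCZKernel γ A (fun x y => (starRingEnd 𝕜) (k y x)) := by
  have hs : ∀ x y : Pt n, euclLen (x - y) = euclLen (y - x) := by
    intro x y
    have h1 : (x - y).1 ^ 2 = (y - x).1 ^ 2 := by simp only [Prod.fst_sub]; ring
    simp only [euclLen, h1, Prod.snd_sub, norm_sub_rev x.2]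
  refine ⟨fun x hx y hy hxy => ?_, fun x hx y hy hxy h hh h2 => ?_, fun x hx y hy hxy h hh h2 => ?_⟩
  · rw [RCLike.norm_conj, hs]
    exact hk.size y hy x hx hxy.symm
  · rw [← map_sub, RCLike.norm_conj, hs]
    exact hk.reg_left y hy x hx hxy.symm h hh (by rwa [hs])
  · rw [← map_sub, RCLike.norm_conj, hs]
    exact hk.reg_right y hy x hx hxy.symm h hh (by rwa [hs])

lemma IsCZKernel.size_dist {γ A : ℝ} {k : Pt n → Pt n → 𝕜} (hk : IsCZKernel γ A k) {x y : Pt n}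
    (hx : x ∈ halfSpace n) (hy : y ∈ halfSpace n) (hxy : x ≠ y) :
    ‖k x y‖ ≤ A * dist x y ^ (-((n : ℝ) + 1)) := by
  have hpos := dist_pos.2 hxy
  refine (hk.size x hx y hy hxy).trans ?_
  rw [Real.rpow_neg hpos.le, ← div_eq_mul_inv, show ((n : ℝ) + 1) = ((n + 1 : ℕ) : ℝ) by push_cast; rfl,
    Real.rpow_natCast]
  have := hk.nonneg
  gcongr
  rw [dist_eq_norm]
  exact norm_le_euclLen _

/-- The Euclidean length lies between one and two times the sup norm, so a separation factor 4 in
the sup metric gives the required factor 2. The extra constant is 2^γ ≤ 2. -/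
lemma IsCZKernel.reg_dist {γ A : ℝ} {k : Pt n → Pt n → 𝕜} (hk : IsCZKernel γ A k) (h0 : 0 < γ)
    (h1 : γ ≤ 1) {x y y' : Pt n}
    (hx : x ∈ halfSpace n) (hy : y ∈ halfSpace n) (hy' : y' ∈ halfSpace n) (hxy : x ≠ y)
    (h : 4 * dist y' y ≤ dist x y) :
    ‖k x y' - k x y‖ ≤ 2 * A * dist y' y ^ γ * dist x y ^ (-((n : ℝ) + 1 + γ)) := by
  have hpos := dist_pos.2 hxy
  have hA := hk.nonneg
  have e : y + (y' - y) = y' := by abel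
  have h2 := hk.reg_right x hx y hy hxy (y' - y) (by rwa [e]) (by
    have := euclLen_le (y' - y)
    have := norm_le_euclLen (x - y)
    rw [← dist_eq_norm] at *
    linarith)
  rw [e] at h2
  refine h2.trans ?_
  rw [Real.rpow_neg hpos.le, ← div_eq_mul_inv]
  have h3 : euclLen (y' - y) ^ γ ≤ 2 * dist y' y ^ γ := by
    calc euclLen (y' - y) ^ γ ≤ (2 * dist y' y) ^ γ := by
          refine Real.rpow_le_rpow (Real.sqrt_nonneg _) ?_ h0.le
          rw [dist_eq_norm]; exact euclLen_le _
      _ = 2 ^ γ * dist y' y ^ γ := Real.mul_rpow (by norm_num) dist_nonneg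
      _ ≤ 2 ^ (1 : ℝ) * dist y' y ^ γ := by gcongr; norm_num
      _ = _ := by rw [Real.rpow_one]
  have h4 : dist x y ≤ euclLen (x - y) := by rw [dist_eq_norm]; exact norm_le_euclLen _
  calc _ ≤ A * (2 * dist y' y ^ γ) / dist x y ^ ((n : ℝ) + 1 + γ) := by gcongr
    _ = _ := by ring

lemma isOpen_offDiag : IsOpen {z : Pt n × Pt n | z.1 ∈ halfSpace n ∧ z.2 ∈ halfSpace n ∧
    z.1 ≠ z.2} :=
  (isOpen_halfSpace.preimage continuous_fst).inter
    ((isOpen_halfSpace.preimage continuous_snd).inter (isOpen_ne_fun continuous_fst continuous_snd))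

/-- Moving one variable at a time, the two regularity conditions give joint continuity off the
diagonal. This supplies the joint measurability of kernels, which is not part of their definition.
-/
lemma IsCZKernel.continuousOn {γ A : ℝ} {k : Pt n → Pt n → 𝕜} (hk : IsCZKernel γ A k) (h0 : 0 < γ)
    (h1 : γ ≤ 1) : ContinuousOn (Function.uncurry k)
      {z : Pt n × Pt n | z.1 ∈ halfSpace n ∧ z.2 ∈ halfSpace n ∧ z.1 ≠ z.2} := by
  have hA := hk.nonneg
  rintro ⟨x, y⟩ ⟨hx, hy, hxy⟩
  refine ContinuousAt.continuousWithinAt ?_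
  have hpos : 0 < dist x y := dist_pos.2 hxy
  set D := dist x y
  set B := (D / 2) ^ (-((n : ℝ) + 1 + γ)) with hB
  have hBD : D ^ (-((n : ℝ) + 1 + γ)) ≤ B :=
    Real.rpow_le_rpow_of_nonpos (by positivity) (by linarith) (by
      have : (0 : ℝ) ≤ n := Nat.cast_nonneg n
      linarith)
  rw [ContinuousAt, tendsto_iff_norm_sub_tendsto_zero]
  have hlim : Tendsto (fun z : Pt n × Pt n => 2 * A * dist z.1 x ^ γ * B +
      2 * A * dist z.2 y ^ γ * B) (𝓝 (x, y)) (𝓝 0) := by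
    have hc : Continuous fun z : Pt n × Pt n => 2 * A * dist z.1 x ^ γ * B +
        2 * A * dist z.2 y ^ γ * B := by
      have := h0.le
      fun_prop (disch := assumption)
    have := hc.tendsto (x, y)
    simpa [Real.zero_rpow h0.ne'] using this
  refine squeeze_zero' (.of_forall fun z => norm_nonneg _) ?_ hlim
  have e1 : ∀ᶠ z : Pt n × Pt n in 𝓝 (x, y), dist z.1 x < D / 8 :=
    (continuous_fst.tendsto (x, y)).eventually (Metric.ball_mem_nhds x (by positivity : 0 < D / 8))
  have e2 : ∀ᶠ z : Pt n × Pt n in 𝓝 (x, y), dist z.2 y < D / 8 :=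
    (continuous_snd.tendsto (x, y)).eventually (Metric.ball_mem_nhds y (by positivity : 0 < D / 8))
  filter_upwards [e1, e2, isOpen_offDiag.mem_nhds (show (x, y) ∈ _ from ⟨hx, hy, hxy⟩)]
    with z hz1 hz2 ⟨hzx, hzy, _⟩
  have hd : D / 2 ≤ dist x z.2 := by
    have := dist_triangle x z.2 y
    change D ≤ _ at this
    linarith
  have hne : x ≠ z.2 := dist_pos.1 (by linarith)
  have s1 : ‖k z.1 z.2 - k x z.2‖ ≤ 2 * A * dist z.1 x ^ γ * B := by
    have := (hk.conj).reg_dist h0 h1 hzy hx hzx hne.symm (by rw [dist_comm z.2 x]; linarith)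
    rw [← map_sub, RCLike.norm_conj] at this
    refine this.trans ?_
    gcongr
    rw [dist_comm z.2 x]
    exact Real.rpow_le_rpow_of_nonpos (by positivity) hd (by
      have : (0 : ℝ) ≤ n := Nat.cast_nonneg n
      linarith)
  have s2 : ‖k x z.2 - k x y‖ ≤ 2 * A * dist z.2 y ^ γ * B := by
    refine (hk.reg_dist h0 h1 hx hy hzy hxy (by change _ ≤ D; linarith)).trans ?_
    gcongr
  calc ‖Function.uncurry k z - Function.uncurry k (x, y)‖
      = ‖(k z.1 z.2 - k x z.2) + (k x z.2 - k x y)‖ := by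
        rw [sub_add_sub_cancel]; rfl
    _ ≤ _ := (norm_add_le _ _).trans (add_le_add s1 s2)

lemma mul_pos_iff_neg_of_neg {a b : ℝ} (hb : b < 0) : 0 < a * b ↔ a < 0 := by
  rw [mul_pos_iff]
  constructor
  · rintro (h | h)
    · linarith [h.2]
    · exact h.1
  · exact fun h => Or.inr ⟨h, hb⟩

/-- The difference can fail to be an ordinary kernel increment only if y and y' lie on different
sides of the height of x, or one of them on it, which forces |t - s| ≤ |y' - y|. The difference is
then at most a single kernel value. As x is at least half as far from y' as from y, the size bound
loses a factor 2^{n+1}. -/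
lemma IsCZKernel.roughKernel {γ A : ℝ} {k : Pt n → Pt n → 𝕜} (hk : IsCZKernel γ A k) (h0 : 0 < γ)
    (h1 : γ ≤ 1) (σ : ℝ) : RoughKernel γ (2 ^ (n + 1) * A) (causalKernel σ k) := by
  have hA := hk.nonneg
  have hn : (0 : ℝ) ≤ n := Nat.cast_nonneg n
  have h2 : (2 : ℝ) ≤ 2 ^ (n + 1) := le_self_pow₀ (by norm_num) (by simp)
  have hle : 2 * A ≤ 2 ^ (n + 1) * A := by gcongr
  have hsz : ∀ x y, ‖causalKernel σ k x y‖ ≤ A * dist x y ^ (-((n : ℝ) + 1)) := by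
    intro x y
    unfold causalKernel
    split_ifs with h
    · refine hk.size_dist h.1 h.2.1 fun hxy => ?_
      simp [hxy] at h
    · rw [norm_zero]; positivity
  refine ⟨by positivity, ?_, fun x y => (hsz x y).trans ?_, ?_⟩
  · classical
    have hm := ContinuousOn.measurable_piecewise (hk.continuousOn h0 h1)
      (continuousOn_const (c := (0 : 𝕜))) isOpen_offDiag.measurableSet
    have hP : MeasurableSet {z : Pt n × Pt n | 0 < σ * (z.1.1 - z.2.1)} :=
      measurableSet_lt measurable_const (by fun_prop)
    convert hm.indicator hP using 1
    ext ⟨x, y⟩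
    simp only [Function.uncurry, causalKernel, indicator, piecewise, mem_ofPred_eq]
    by_cases hp : 0 < σ * (x.1 - y.1)
    · have hxy : x ≠ y := fun h => by simp [h] at hp
      simp [hp, hxy]
    · simp [hp]
  · gcongr; linarith
  · intro x hx y hy y' hy' h
    rcases eq_or_ne x y with rfl | hxy
    · have : y' = x := by
        rw [dist_self] at h
        exact dist_le_zero.1 (by linarith)
      subst this
      rw [sub_self, norm_zero]
      positivity
    have hpos := dist_pos.2 hxy
    by_cases hj : |x.1 - y.1| ≤ dist y' y
    · rw [if_pos hj]
      by_cases hs : (0 < σ * (x.1 - y.1) ∧ 0 < σ * (x.1 - y'.1))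
      · have := hk.reg_dist h0 h1 hx hy hy' hxy h
        simp only [causalKernel, hx, hy, hy', hs.1, hs.2, true_and, if_true]
        refine this.trans (le_add_of_le_of_nonneg ?_ (by positivity))
        gcongr
      · have hmax : ‖causalKernel σ k x y' - causalKernel σ k x y‖ ≤
            2 ^ (n + 1) * A * dist x y ^ (-((n : ℝ) + 1)) := by
          have hd : dist x y / 2 ≤ dist x y' := by
            have := dist_triangle x y' y
            linarith
          have b1 := hsz x y
          have b2 : ‖causalKernel σ k x y'‖ ≤ 2 ^ (n + 1) * A * dist x y ^ (-((n : ℝ) + 1)) := by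
            refine (hsz x y').trans ?_
            calc A * dist x y' ^ (-((n : ℝ) + 1)) ≤ A * (dist x y / 2) ^ (-((n : ℝ) + 1)) := by
                  refine mul_le_mul_of_nonneg_left ?_ hA
                  exact Real.rpow_le_rpow_of_nonpos (by positivity) hd (by linarith)
              _ = _ := by
                  rw [Real.div_rpow hpos.le (by norm_num), Real.rpow_neg (by norm_num : (0 : ℝ) ≤ 2),
                    show ((n : ℝ) + 1) = ((n + 1 : ℕ) : ℝ) by push_cast; rfl, Real.rpow_natCast]
                  field_simp
          have b3 : A * dist x y ^ (-((n : ℝ) + 1)) ≤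
              2 ^ (n + 1) * A * dist x y ^ (-((n : ℝ) + 1)) := by
            gcongr; linarith
          rw [not_and_or] at hs
          rcases hs with hs | hs
          · have : causalKernel σ k x y = 0 := by simp [causalKernel, hs]
            rw [this, sub_zero]; exact b2
          · have : causalKernel σ k x y' = 0 := by simp [causalKernel, hs]
            rw [this, zero_sub, norm_neg]; exact b1.trans b3
        refine hmax.trans (le_add_of_nonneg_left ?_)
        positivity
    · rw [if_neg hj, add_zero]
      have hyy : |y'.1 - y.1| ≤ dist y' y := by
        rw [Prod.dist_eq, ← Real.dist_eq]; exact le_max_left _ _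
      -- The displacement is smaller than the height gap, so it cannot carry y across the height of
      -- x.
      have hsgn : 0 < σ * (x.1 - y.1) ↔ 0 < σ * (x.1 - y'.1) := by
        rw [not_le] at hj
        have h3 := hyy.trans_lt hj
        have hy1 := abs_lt.1 h3
        rcases lt_trichotomy (x.1 - y.1) 0 with hn | hn | hn
        · rw [abs_of_neg hn] at hy1
          rw [mul_pos_iff_neg_of_neg hn, mul_pos_iff_neg_of_neg (by linarith)]
        · rw [hn, abs_zero] at h3
          exact absurd h3 (not_lt.2 (abs_nonneg _))
        · rw [abs_of_pos hn] at hy1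
          rw [mul_pos_iff_of_pos_right hn, mul_pos_iff_of_pos_right (by linarith)]
      have hreg := hk.reg_dist h0 h1 hx hy hy' hxy h
      by_cases hs : 0 < σ * (x.1 - y.1)
      · simp only [causalKernel, hx, hy, hy', hs, hsgn.1 hs, true_and, if_true]
        refine hreg.trans ?_
        gcongr
      · have hs' := hs
        rw [hsgn] at hs'
        simp only [causalKernel, hx, hy, hy', hs, hs', true_and, if_false, sub_self, norm_zero]
        positivity

lemma HasKernel.congr {S : Lp 𝕜 2 (hmeas n) →L[𝕜] Lp 𝕜 2 (hmeas n)} {K K' : Pt n → Pt n → 𝕜}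
    (h : HasKernel S K) (hK : ∀ x ∈ halfSpace n, ∀ y ∈ halfSpace n, K x y = K' x y) :
    HasKernel S K' := by
  intro F hF hFH f hf
  filter_upwards [h F hF hFH f hf, ae_mem_halfSpace] with x hx hxH hxF
  rw [hx hxF]
  refine integral_congr_ae ?_
  filter_upwards [ae_mem_halfSpace] with y hy
  rw [hK x hxH y hy]

lemma IsUpwardCZO.exists_kernel {γ A B : ℝ} {S : Lp 𝕜 2 (hmeas n) →L[𝕜] Lp 𝕜 2 (hmeas n)}
    (h : IsUpwardCZO γ A B S) : ∃ k, IsCZKernel γ A k ∧ HasKernel S (causalKernel 1 k) := by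
  obtain ⟨-, k, hk, hS⟩ := h
  refine ⟨k, hk, hS.congr fun x hx y hy => ?_⟩
  simp [upKernel, causalKernel, hx, hy]

lemma IsDownwardCZO.exists_kernel {γ A B : ℝ} {S : Lp 𝕜 2 (hmeas n) →L[𝕜] Lp 𝕜 2 (hmeas n)}
    (h : IsDownwardCZO γ A B S) : ∃ k, IsCZKernel γ A k ∧ HasKernel S (causalKernel (-1) k) := by
  obtain ⟨-, k, hk, hS⟩ := h
  refine ⟨k, hk, hS.congr fun x hx y hy => ?_⟩
  simp [downKernel, causalKernel, hx, hy]

/-- Passing to the adjoint reverses the causal direction, so the duality argument stays within the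
class of causal kernels. -/
lemma causalKernel_conj (σ : ℝ) (k : Pt n → Pt n → 𝕜) (x y : Pt n) :
    causalKernel (-σ) (fun x y => (starRingEnd 𝕜) (k y x)) x y =
      (starRingEnd 𝕜) (causalKernel σ k y x) := by
  have : -σ * (x.1 - y.1) = σ * (y.1 - x.1) := by ring
  unfold causalKernel
  rw [this]
  by_cases h : x ∈ halfSpace n ∧ y ∈ halfSpace n ∧ 0 < σ * (y.1 - x.1)
  · rw [if_pos h, if_pos ⟨h.2.1, h.1, h.2.2⟩]
  · rw [if_neg h, if_neg fun h' => h ⟨h'.2.1, h'.1, h'.2.2⟩, map_zero]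

/-! ### Integral estimates for kernels -/

lemma volume_closedBall_pt (c : Pt n) {R : ℝ} (hR : 0 ≤ R) :
    volume (closedBall c R) = volume (closedBall (0 : Pt n) 1) * ENNReal.ofReal (R ^ ((n : ℝ) + 1)) := by
  rw [Measure.addHaar_closedBall' volume c hR, mul_comm]
  congr 2
  rw [show ((n : ℝ) + 1) = ((n + 1 : ℕ) : ℝ) by push_cast; rfl, Real.rpow_natCast]
  simp [add_comm]

lemma volume_closedBall_bd (c : Bd n) {R : ℝ} (hR : 0 ≤ R) :
    volume (closedBall c R) = volume (closedBall (0 : Bd n) 1) * ENNReal.ofReal (R ^ (n : ℝ)) := by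
  rw [Measure.addHaar_closedBall' volume c hR, mul_comm]
  congr 2
  rw [Real.rpow_natCast]
  simp

lemma lintegral_dist_rpow_le {b : ℝ} (hb : (n : ℝ) + 1 < b) : ∃ C : ℝ≥0, ∀ (c : Pt n) (ρ : ℝ),
    0 < ρ → ∫⁻ x in {x | ρ ≤ dist x c}, ENNReal.ofReal (dist x c ^ (-b)) ≤
      C * ENNReal.ofReal (ρ ^ ((n : ℝ) + 1 - b)) := by
  have hn : (0 : ℝ) ≤ n := Nat.cast_nonneg n
  have hf : volume (closedBall (0 : Pt n) 1) ≠ ∞ := measure_closedBall_lt_top.ne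
  refine ⟨(ENNReal.ofReal (2 ^ ((n : ℝ) + 1) * (1 - 2 ^ ((n : ℝ) + 1 - b))⁻¹) *
    volume (closedBall (0 : Pt n) 1)).toNNReal, fun c ρ hρ => ?_⟩
  rw [ENNReal.coe_toNNReal (by finiteness), mul_assoc]
  exact lintegral_annuli_le volume hb (by linarith) hρ fun R hR =>
    (volume_closedBall_pt c (hρ.le.trans hR)).le

/-- In a ball of radius R the strip has mass of order δ Rⁿ, one power of R less than the full space.
The kernel of critical size is therefore summable over dyadic annuli, and the gain is δ/ρ. -/
lemma lintegral_strip_le (n : ℕ) : ∃ C : ℝ≥0, ∀ (c : Pt n) (ρ δ : ℝ), 0 < ρ → 0 ≤ δ →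
    ∫⁻ x in {x | ρ ≤ dist x c ∧ |x.1 - c.1| ≤ δ}, ENNReal.ofReal (dist x c ^ (-((n : ℝ) + 1))) ≤
      C * ENNReal.ofReal (δ / ρ) := by
  have hn : (0 : ℝ) ≤ n := Nat.cast_nonneg n
  have hf : volume (closedBall (0 : Bd n) 1) ≠ ∞ := measure_closedBall_lt_top.ne
  set C0 := ENNReal.ofReal (2 ^ (n : ℝ) * (1 - 2 ^ ((n : ℝ) - (n + 1)))⁻¹)
  refine ⟨(C0 * (2 * volume (closedBall (0 : Bd n) 1))).toNNReal, fun c ρ δ hρ hδ => ?_⟩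
  rw [ENNReal.coe_toNNReal (by finiteness)]
  have hms : MeasurableSet {x : Pt n | ρ ≤ dist x c} :=
    measurableSet_le measurable_const (continuous_id.dist continuous_const).measurable
  have hset : {x : Pt n | ρ ≤ dist x c ∧ |x.1 - c.1| ≤ δ} =
    {x | ρ ≤ dist x c} ∩ {x | |x.1 - c.1| ≤ δ} := rfl
  rw [hset, ← Measure.restrict_restrict hms]
  refine (lintegral_annuli_le (volume.restrict {x : Pt n | |x.1 - c.1| ≤ δ}) (a := n) (b := n + 1)
    (m := 2 * ENNReal.ofReal δ * volume (closedBall (0 : Bd n) 1)) (by linarith) (by linarith) hρ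
    fun R hR => ?_).trans (le_of_eq ?_)
  · rw [Measure.restrict_apply measurableSet_closedBall]
    calc _ ≤ volume ((closedBall c.1 δ) ×ˢ (closedBall c.2 R)) := by
          refine measure_mono fun x hx => ⟨?_, ?_⟩
          · rw [mem_closedBall, Real.dist_eq]; exact hx.2
          · exact (le_max_right _ _).trans (mem_closedBall.1 hx.1)
      _ = _ := by
          rw [Measure.volume_eq_prod, Measure.prod_prod, Real.volume_closedBall,
            volume_closedBall_bd _ (hρ.le.trans hR), ENNReal.ofReal_mul (by norm_num),
            ENNReal.ofReal_ofNat, mul_assoc]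
          ring
  · have e : ρ ^ ((n : ℝ) - (n + 1)) = ρ⁻¹ := by
      rw [show (n : ℝ) - (n + 1) = -1 by ring, Real.rpow_neg_one]
    rw [e, div_eq_mul_inv, ENNReal.ofReal_mul hδ]
    ring

/-- The Hölder part contributes δ^γ (4δ)^{-γ}, and the jump part lives in the strip of half-width δ
and contributes δ/(4δ). Both are at most one, so the constant does not depend on scale. -/
lemma RoughKernel.hormander {γ : ℝ} (hγ : 0 < γ) (A : ℝ) : ∃ C : ℝ≥0, ∀ K : Pt n → Pt n → 𝕜,
    RoughKernel γ A K → ∀ c ∈ halfSpace n, ∀ y ∈ halfSpace n, ∀ δ : ℝ, 0 < δ → dist y c ≤ δ →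
      ∫⁻ x in {x | 4 * δ ≤ dist x c}, ‖K x y - K x c‖ₑ ∂(hmeas n) ≤ C := by
  obtain ⟨C1, h1⟩ := lintegral_dist_rpow_le (n := n) (b := n + 1 + γ) (by linarith)
  obtain ⟨C2, h2⟩ := lintegral_strip_le n
  refine ⟨A.toNNReal * C1 + A.toNNReal * C2, fun K hK c hc y hy δ hδ hyc => ?_⟩
  have hA := hK.nonneg
  have hms : MeasurableSet {x : Pt n | 4 * δ ≤ dist x c} :=
    measurableSet_le measurable_const (continuous_id.dist continuous_const).measurable
  have hms2 : MeasurableSet {x : Pt n | |x.1 - c.1| ≤ δ} :=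
    measurableSet_le (by fun_prop) measurable_const
  calc ∫⁻ x in {x | 4 * δ ≤ dist x c}, ‖K x y - K x c‖ₑ ∂(hmeas n)
      ≤ ∫⁻ x in {x | 4 * δ ≤ dist x c}, (ENNReal.ofReal (A * δ ^ γ) *
          ENNReal.ofReal (dist x c ^ (-((n : ℝ) + 1 + γ))) + ENNReal.ofReal A *
          {x : Pt n | |x.1 - c.1| ≤ δ}.indicator
            (fun x => ENNReal.ofReal (dist x c ^ (-((n : ℝ) + 1)))) x) ∂(hmeas n) := by
        refine setLIntegral_mono_ae' hms ?_
        filter_upwards [ae_mem_halfSpace] with x hxH hx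
        have hx : 4 * δ ≤ dist x c := hx
        have := hK.reg x hxH c hc y hy (by linarith)
        rw [← ofReal_norm]
        refine (ENNReal.ofReal_le_ofReal (this.trans (add_le_add (b := A * δ ^ γ *
          dist x c ^ (-((n : ℝ) + 1 + γ))) (d := A * {x : Pt n | |x.1 - c.1| ≤ δ}.indicator
            (fun x => dist x c ^ (-((n : ℝ) + 1))) x) ?_ ?_))).trans ?_
        · gcongr
        · split_ifs with hj
          · have : |x.1 - c.1| ≤ δ := hj.trans hyc
            simp [indicator, this]
          · refine mul_nonneg hA (indicator_nonneg (fun _ _ => by positivity) _)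
        · rw [ENNReal.ofReal_add (by positivity)
            (mul_nonneg hA (indicator_nonneg (fun _ _ => by positivity) _)),
            ENNReal.ofReal_mul (by positivity), ENNReal.ofReal_mul hA]
          gcongr
          by_cases hj : |x.1 - c.1| ≤ δ
          · simp only [indicator, mem_ofPred_eq, hj, if_true]
            rw [ENNReal.ofReal_mul hA]
          · simp [indicator, hj]
    _ ≤ ∫⁻ x in {x | 4 * δ ≤ dist x c}, (ENNReal.ofReal (A * δ ^ γ) *
          ENNReal.ofReal (dist x c ^ (-((n : ℝ) + 1 + γ))) + ENNReal.ofReal A *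
          {x : Pt n | |x.1 - c.1| ≤ δ}.indicator
            (fun x => ENNReal.ofReal (dist x c ^ (-((n : ℝ) + 1)))) x) := by
        gcongr
        exact hmeas_le
    _ = ENNReal.ofReal (A * δ ^ γ) * (∫⁻ x in {x | 4 * δ ≤ dist x c},
          ENNReal.ofReal (dist x c ^ (-((n : ℝ) + 1 + γ)))) + ENNReal.ofReal A *
          ∫⁻ x in {x | 4 * δ ≤ dist x c ∧ |x.1 - c.1| ≤ δ},
            ENNReal.ofReal (dist x c ^ (-((n : ℝ) + 1))) := by
        rw [lintegral_add_left (by fun_prop), lintegral_const_mul' _ _ ENNReal.ofReal_ne_top,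
          lintegral_const_mul' _ _ ENNReal.ofReal_ne_top, setLIntegral_indicator hms2, inter_comm]
        rfl
    _ ≤ ENNReal.ofReal (A * δ ^ γ) * (C1 * ENNReal.ofReal ((4 * δ) ^ ((n : ℝ) + 1 - (n + 1 + γ)))) +
          ENNReal.ofReal A * (C2 * ENNReal.ofReal (δ / (4 * δ))) := by
        gcongr
        · exact h1 c _ (by linarith)
        · exact h2 c _ _ (by linarith) hδ.le
    _ ≤ _ := by
        push_cast
        have e1 : δ ^ γ * (4 * δ) ^ ((n : ℝ) + 1 - (n + 1 + γ)) ≤ 1 := by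
          rw [show (n : ℝ) + 1 - (n + 1 + γ) = -γ by ring, Real.rpow_neg (by positivity),
            ← div_eq_mul_inv]
          refine div_le_one_of_le₀ ?_ (by positivity)
          exact Real.rpow_le_rpow hδ.le (by linarith) hγ.le
        have e2 : δ / (4 * δ) ≤ 1 := div_le_one_of_le₀ (by linarith) (by positivity)
        refine add_le_add ?_ (mul_le_mul' le_rfl ?_)
        · rw [mul_left_comm, ← ENNReal.ofReal_mul (by positivity), mul_comm, mul_assoc A]
          refine mul_le_mul' ?_ le_rfl
          exact ENNReal.ofReal_le_ofReal (mul_le_of_le_one_right hA e1)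
        · refine mul_le_of_le_one_right' ?_
          rw [← ENNReal.ofReal_one]
          exact ENNReal.ofReal_le_ofReal e2

end Kernels

end CausalCZO

namespace CausalCZO

open Filter Topology Metric

/-! ### Convergence in `L_p` -/

section LpTools

variable {𝕜 : Type*} [RCLike 𝕜] {α : Type*} [MeasurableSpace α] {μ : Measure α}

lemma eLpNorm_rpow_eq_lintegral {E : Type*} [NormedAddCommGroup E] {q : ℝ} (hq : 0 < q)
    (f : α → E) : eLpNorm f (ENNReal.ofReal q) μ ^ q = ∫⁻ x, ‖f x‖ₑ ^ q ∂μ := by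
  rw [eLpNorm_eq_eLpNorm' (by simpa using hq) ENNReal.ofReal_ne_top, eLpNorm',
    ENNReal.toReal_ofReal hq.le, ← ENNReal.rpow_mul, one_div_mul_cancel hq.ne', ENNReal.rpow_one]

lemma eLpNorm_two_sq_eq_lintegral {E : Type*} [NormedAddCommGroup E] (f : α → E) :
    eLpNorm f 2 μ ^ 2 = ∫⁻ x, ‖f x‖ₑ ^ 2 ∂μ := by
  have := eLpNorm_rpow_eq_lintegral (μ := μ) (q := 2) (by norm_num) f
  simpa using this

/-- Cutting off an `L_p` function along sets that exhaust its support. -/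
lemma tendsto_toLp_indicator {p : ℝ≥0∞} [Fact (1 ≤ p)] (hp : p ≠ ∞) {f : α → 𝕜}
    (hf : MemLp f p μ) {s : ℕ → Set α} (hs : ∀ m, MeasurableSet (s m))
    (h : ∀ᵐ x ∂μ, ∀ᶠ m in atTop, x ∈ s m ∨ f x = 0) :
    Tendsto (fun m => (hf.indicator (hs m)).toLp _) atTop (𝓝 (hf.toLp f)) := by
  have hp0 : p ≠ 0 := (zero_lt_one.trans_le Fact.out).ne'
  have hpr : 0 < p.toReal := ENNReal.toReal_pos hp0 hp
  rw [Lp.tendsto_Lp_iff_tendsto_eLpNorm'']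
  have h1 : Tendsto (fun m => ∫⁻ x, ‖((s m).indicator f - f) x‖ₑ ^ p.toReal ∂μ) atTop (𝓝 0) := by
    have h0 : ∫⁻ _x, (0 : ℝ≥0∞) ∂μ = 0 := by simp
    rw [← h0]
    refine tendsto_lintegral_of_dominated_convergence' (fun x => ‖f x‖ₑ ^ p.toReal) (fun m => ?_)
      (fun m => .of_forall fun x => ?_) ?_ ?_
    · exact ((hf.1.indicator (hs m)).sub hf.1).enorm.pow_const _
    · refine ENNReal.rpow_le_rpow ?_ hpr.le
      by_cases hx : x ∈ s m <;> simp [hx]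
    · exact (lintegral_rpow_enorm_lt_top_of_eLpNorm_lt_top hp0 hp hf.2).ne
    · filter_upwards [h] with x hx
      refine tendsto_const_nhds.congr' ?_
      filter_upwards [hx] with m hm
      rcases hm with hm | hm
      · simp [hm, hpr]
      · by_cases hx : x ∈ s m <;> simp [hx, hm, hpr]
  have h2 := h1.ennrpow_const (1 / p.toReal)
  rw [ENNReal.zero_rpow_of_pos (by positivity)] at h2
  refine h2.congr fun m => ?_
  rw [eLpNorm_eq_eLpNorm' hp0 hp, eLpNorm']

lemma exists_subseq_ae_tendsto {p : ℝ≥0∞} [Fact (1 ≤ p)] {u : ℕ → Lp 𝕜 p μ} {v : Lp 𝕜 p μ}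
    (h : Tendsto u atTop (𝓝 v)) : ∃ φ : ℕ → ℕ, StrictMono φ ∧
      ∀ᵐ x ∂μ, Tendsto (fun m => u (φ m) x) atTop (𝓝 (v x)) :=
  (tendstoInMeasure_of_tendsto_Lp h).exists_seq_tendsto_ae

end LpTools

/-! ### The weak-type estimate -/

section WeakType

variable {𝕜 : Type*} [RCLike 𝕜] {n : ℕ}

lemma RoughKernel.norm_le {γ A : ℝ} {K : Pt n → Pt n → 𝕜} (hK : RoughKernel γ A K) {x y : Pt n}
    {δ : ℝ} (hδ : 0 < δ) (h : δ ≤ dist x y) : ‖K x y‖ ≤ A * δ ^ (-((n : ℝ) + 1)) := by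
  refine (hK.size x y).trans (mul_le_mul_of_nonneg_left ?_ hK.nonneg)
  exact Real.rpow_le_rpow_of_nonpos hδ h (by
    have : (0 : ℝ) ≤ n := Nat.cast_nonneg n
    linarith)

lemma RoughKernel.measurable_right {γ A : ℝ} {K : Pt n → Pt n → 𝕜} (hK : RoughKernel γ A K)
    (x : Pt n) : Measurable (K x) := hK.measurable.comp measurable_prodMk_left

lemma RoughKernel.measurable_left {γ A : ℝ} {K : Pt n → Pt n → 𝕜} (hK : RoughKernel γ A K)
    (y : Pt n) : Measurable (fun x => K x y) := hK.measurable.comp measurable_prodMk_right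

lemma exists_dist_ge_of_notMem {E : Set (Pt n)} (hE : IsClosed E) {x : Pt n} (hx : x ∉ E) :
    ∃ δ > 0, ∀ y ∈ E, δ ≤ dist x y := by
  obtain ⟨δ, hδ, h⟩ := Metric.isOpen_iff.1 hE.isOpen_compl x hx
  refine ⟨δ, hδ, fun y hy => ?_⟩
  by_contra! hcon
  exact h (by rwa [mem_ball, dist_comm]) hy

/-- The pieces `{1/(m+1) ≤ t}` of the half space. -/
def aboveHeight (n m : ℕ) : Set (Pt n) := {y | 1 / ((m : ℝ) + 1) ≤ y.1}

lemma isClosed_aboveHeight (m : ℕ) : IsClosed (aboveHeight n m) :=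
  isClosed_le continuous_const continuous_fst

lemma aboveHeight_subset (m : ℕ) : aboveHeight n m ⊆ halfSpace n := fun _ hy =>
  lt_of_lt_of_le (by positivity : 0 < 1 / ((m : ℝ) + 1)) hy

lemma eventually_mem_aboveHeight {y : Pt n} (hy : y ∈ halfSpace n) :
    ∀ᶠ m in atTop, y ∈ aboveHeight n m := by
  have hy : 0 < y.1 := hy
  filter_upwards [(tendsto_one_div_add_atTop_nhds_zero_nat (𝕜 := ℝ)).eventually_lt_const hy]
    with m hm using hm.le

/-- The kernel representation for functions supported in a bounded closed set that may touch the
boundary of the half space. -/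
lemma HasKernel.apply_of_isBounded {γ A : ℝ} {K : Pt n → Pt n → 𝕜} (hK : RoughKernel γ A K)
    {S : Lp 𝕜 2 (hmeas n) →L[𝕜] Lp 𝕜 2 (hmeas n)} (hS : HasKernel S K) {E : Set (Pt n)}
    (hE : IsClosed E) (hb : Bornology.IsBounded E) (f : Lp 𝕜 2 (hmeas n))
    (hf : ∀ᵐ y ∂(hmeas n), y ∉ E → f y = 0) :
    ∀ᵐ x ∂(hmeas n), x ∉ E → S f x = ∫ y, K x y * f y ∂(hmeas n) := by
  have hcl : ∀ m, IsClosed (E ∩ aboveHeight n m) := fun m => hE.inter (isClosed_aboveHeight m)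
  have hcpt : ∀ m, IsCompact (E ∩ aboveHeight n m) := fun m =>
    Metric.isCompact_of_isClosed_isBounded (hcl m) (hb.subset inter_subset_left)
  -- The kernel formula is assumed only for supports compact in the open half space. Cutting away
  -- the layer below height 1/(m+1) makes it available, and the limit is taken along an almost
  -- everywhere convergent subsequence.
  set F : ℕ → Lp 𝕜 2 (hmeas n) := fun m =>
    ((Lp.memLp f).indicator (hcl m).measurableSet).toLp _ with hF
  have hFae : ∀ᵐ y ∂(hmeas n), ∀ m, F m y = (E ∩ aboveHeight n m).indicator f y :=
    ae_all_iff.2 fun m => MemLp.coeFn_toLp _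
  have hlim : Tendsto F atTop (𝓝 f) := by
    have := tendsto_toLp_indicator (by simp) (Lp.memLp f) (fun m => (hcl m).measurableSet) (by
      filter_upwards [hf, ae_mem_halfSpace] with y hy hyH
      filter_upwards [eventually_mem_aboveHeight hyH] with m hm
      by_cases hyE : y ∈ E
      · exact Or.inl ⟨hyE, hm⟩
      · exact Or.inr (hy hyE))
    rwa [Lp.toLp_coeFn] at this
  obtain ⟨φ, hφ, hconv⟩ := exists_subseq_ae_tendsto ((S.continuous.tendsto f).comp hlim)
  have hker : ∀ᵐ x ∂(hmeas n), ∀ m, x ∉ E ∩ aboveHeight n m →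
      S (F m) x = ∫ y, K x y * F m y ∂(hmeas n) := by
    refine ae_all_iff.2 fun m => hS _ (hcpt m)
      (inter_subset_right.trans (aboveHeight_subset m)) (F m) ?_
    filter_upwards [hFae] with y hy hyE
    rw [hy m, indicator_of_notMem hyE]
  have hint : Integrable f (hmeas n) := by
    have h1 : IntegrableOn f E (hmeas n) := by
      have : IsFiniteMeasure ((hmeas n).restrict E) :=
        ⟨by rw [Measure.restrict_apply_univ]; exact hb.measure_lt_top⟩
      exact ((Lp.memLp f).restrict E).integrable one_le_two
    rw [← integrable_indicator_iff hE.measurableSet] at h1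
    refine h1.congr ?_
    filter_upwards [hf] with y hy
    by_cases hyE : y ∈ E
    · rw [indicator_of_mem hyE]
    · rw [indicator_of_notMem hyE, hy hyE]
  filter_upwards [hconv, hker] with x hx1 hx2 hxE
  obtain ⟨δ, hδ, hdist⟩ := exists_dist_ge_of_notMem hE hxE
  refine tendsto_nhds_unique hx1 ?_
  -- Dominated convergence: at the fixed point x, at distance δ from E, the kernel is bounded on E,
  -- and f is integrable.
  have hlimit : Tendsto (fun m => ∫ y, K x y * F (φ m) y ∂(hmeas n)) atTop
      (𝓝 (∫ y, K x y * f y ∂(hmeas n))) := by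
    refine tendsto_integral_of_dominated_convergence
      (fun y => A * δ ^ (-((n : ℝ) + 1)) * ‖f y‖) (fun m => ?_) (hint.norm.const_mul _)
      (fun m => ?_) ?_
    · exact (hK.measurable_right x).aestronglyMeasurable.mul (Lp.aestronglyMeasurable _)
    · filter_upwards [hFae] with y hy
      rw [hy, norm_mul]
      by_cases hyE : y ∈ E ∩ aboveHeight n (φ m)
      · rw [indicator_of_mem hyE]
        gcongr
        exact hK.norm_le hδ (hdist y hyE.1)
      · rw [indicator_of_notMem hyE, norm_zero, mul_zero]
        have := hK.nonneg
        positivity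
    · filter_upwards [hFae, hf, ae_mem_halfSpace] with y hy hy2 hyH
      refine tendsto_const_nhds.congr' ?_
      filter_upwards [hφ.tendsto_atTop.eventually (eventually_mem_aboveHeight hyH)] with m hm
      rw [hy]
      by_cases hyE : y ∈ E
      · rw [indicator_of_mem (show y ∈ E ∩ aboveHeight n (φ m) from ⟨hyE, hm⟩)]
      · rw [indicator_of_notMem (fun h => hyE h.1), hy2 hyE]
  refine hlimit.congr fun m => ?_
  exact (hx2 (φ m) fun h => hxE h.1).symm

/-- The basic cancellation estimate. -/
lemma HasKernel.lintegral_apply_le {γ A : ℝ} {K : Pt n → Pt n → 𝕜} (hK : RoughKernel γ A K)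
    {S : Lp 𝕜 2 (hmeas n) →L[𝕜] Lp 𝕜 2 (hmeas n)} (hS : HasKernel S K) {C : ℝ≥0∞}
    {c : Pt n} {δ : ℝ} (hδ : 0 < δ)
    (hC : ∀ y ∈ halfSpace n, dist y c ≤ δ →
      ∫⁻ x in {x | 4 * δ ≤ dist x c}, ‖K x y - K x c‖ₑ ∂(hmeas n) ≤ C)
    (b : Lp 𝕜 2 (hmeas n)) (hb : ∀ᵐ y ∂(hmeas n), y ∉ closedBall c δ → b y = 0)
    (h0 : ∫ y, b y ∂(hmeas n) = 0) :
    ∫⁻ x in {x | 4 * δ ≤ dist x c}, ‖S b x‖ₑ ∂(hmeas n) ≤ C * ∫⁻ y, ‖b y‖ₑ ∂(hmeas n) := by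
  have hms : MeasurableSet {x : Pt n | 4 * δ ≤ dist x c} :=
    measurableSet_le measurable_const (continuous_id.dist continuous_const).measurable
  have hint : Integrable b (hmeas n) := by
    have h1 : IntegrableOn b (closedBall c δ) (hmeas n) := by
      have : IsFiniteMeasure ((hmeas n).restrict (closedBall c δ)) :=
        ⟨by rw [Measure.restrict_apply_univ]; exact measure_closedBall_lt_top⟩
      exact ((Lp.memLp b).restrict _).integrable one_le_two
    rw [← integrable_indicator_iff measurableSet_closedBall] at h1
    refine h1.congr ?_
    filter_upwards [hb] with y hy
    by_cases hyE : y ∈ closedBall c δ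
    · rw [indicator_of_mem hyE]
    · rw [indicator_of_notMem hyE, hy hyE]
  have hmeas1 : Measurable (Function.uncurry fun x y => ‖K x y - K x c‖ₑ * ‖b y‖ₑ) :=
    ((hK.measurable.sub ((hK.measurable_left c).comp measurable_fst)).enorm).mul
      ((Lp.stronglyMeasurable b).measurable.comp measurable_snd).enorm
  calc ∫⁻ x in {x | 4 * δ ≤ dist x c}, ‖S b x‖ₑ ∂(hmeas n)
      ≤ ∫⁻ x in {x | 4 * δ ≤ dist x c}, ∫⁻ y, ‖K x y - K x c‖ₑ * ‖b y‖ₑ ∂(hmeas n) ∂(hmeas n) := by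
        refine setLIntegral_mono_ae' hms ?_
        filter_upwards [hS.apply_of_isBounded hK isClosed_closedBall isBounded_closedBall b hb]
          with x hx hxc
        have hxc : 4 * δ ≤ dist x c := hxc
        have hx' : x ∉ closedBall c δ := by rw [mem_closedBall]; linarith
        have hi1 : Integrable (fun y => K x y * b y) (hmeas n) := by
          refine Integrable.mono' (hint.norm.const_mul (A * (3 * δ) ^ (-((n : ℝ) + 1))))
            ((hK.measurable_right x).aestronglyMeasurable.mul hint.1) ?_
          filter_upwards [hb] with y hy
          by_cases hyE : y ∈ closedBall c δ
          · rw [norm_mul]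
            gcongr
            refine hK.norm_le (by positivity) ?_
            have := dist_triangle x y c
            rw [mem_closedBall] at hyE
            linarith
          · rw [hy hyE, mul_zero, norm_zero, mul_zero]
        have hi2 : Integrable (fun y => K x c * b y) (hmeas n) := hint.const_mul _
        -- The mean value zero of b allows the value of the kernel at the centre to be subtracted.
        have : S b x = ∫ y, (K x y - K x c) * b y ∂(hmeas n) := by
          simp_rw [sub_mul]
          rw [integral_sub hi1 hi2, integral_const_mul, h0, mul_zero, sub_zero, hx hx']
        rw [this]
        refine (enorm_integral_le_lintegral_enorm _).trans (le_of_eq ?_)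
        simp_rw [enorm_mul]
    _ = ∫⁻ y, ∫⁻ x in {x | 4 * δ ≤ dist x c}, ‖K x y - K x c‖ₑ * ‖b y‖ₑ ∂(hmeas n) ∂(hmeas n) :=
        lintegral_lintegral_swap hmeas1.aemeasurable
    _ ≤ ∫⁻ y, C * ‖b y‖ₑ ∂(hmeas n) := by
        refine lintegral_mono_ae ?_
        filter_upwards [hb, ae_mem_halfSpace] with y hy hyH
        rw [lintegral_mul_const' _ _ enorm_ne_top]
        by_cases hyE : y ∈ closedBall c δ
        · gcongr
          exact hC y hyH hyE
        · simp [hy hyE]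
    _ = C * ∫⁻ y, ‖b y‖ₑ ∂(hmeas n) :=
        lintegral_const_mul _ (Lp.stronglyMeasurable b).measurable.enorm

lemma volume_boundary : volume {y : Pt n | y.1 = 0} = 0 := by
  have : {y : Pt n | y.1 = 0} = ({0} : Set ℝ) ×ˢ (univ : Set (Bd n)) := by
    ext y; simp
  rw [this, Measure.volume_eq_prod, Measure.prod_prod, Real.volume_singleton, zero_mul]

/-- Dyadic cubes may touch the boundary plane, which is a null set. -/
lemma restrict_hmeas_of_subset {Q : Set (Pt n)} (hQ : MeasurableSet Q)
    (h : ∀ y ∈ Q, 0 ≤ y.1) : (hmeas n).restrict Q = volume.restrict Q := by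
  rw [hmeas, Measure.restrict_restrict hQ]
  refine Measure.restrict_congr_set ?_
  have : ∀ᵐ y : Pt n, ¬ y.1 = 0 := measure_eq_zero_iff_ae_notMem.1 volume_boundary
  filter_upwards [this] with y hy
  refine propext ⟨fun h' => h'.1, fun h' => ⟨h', lt_of_le_of_ne (h y h') (Ne.symm hy)⟩⟩

/-- The bad part of a function on a stopping cube. -/
noncomputable def badPart (f : Pt n → 𝕜) (i : DyIdx n) : Pt n → 𝕜 :=
  (dyCube i).indicator fun y => f y - ⨍ z in dyCube i, f z

lemma enorm_average_le (f : Pt n → 𝕜) (i : DyIdx n) :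
    ‖⨍ z in dyCube i, f z‖ₑ ≤ (volume (dyCube i))⁻¹ * ∫⁻ z in dyCube i, ‖f z‖ₑ := by
  rw [average]
  refine (enorm_integral_le_lintegral_enorm _).trans (le_of_eq ?_)
  rw [lintegral_smul_measure, Measure.restrict_apply_univ, smul_eq_mul]

lemma lintegral_badPart_le {f : Pt n → 𝕜} (hf : Measurable f) (i : DyIdx n) :
    ∫⁻ y, ‖badPart f i y‖ₑ ∂(hmeas n) ≤ 2 * ∫⁻ y in dyCube i, ‖f y‖ₑ := by
  have hv := volume_dyCube_ne_zero i
  have hv' := volume_dyCube_ne_top i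
  have e : ∀ y, ‖badPart f i y‖ₑ =
      (dyCube i).indicator (fun y => ‖f y - ⨍ z in dyCube i, f z‖ₑ) y := by
    intro y; rw [badPart, enorm_indicator_eq_indicator_enorm]
  calc ∫⁻ y, ‖badPart f i y‖ₑ ∂(hmeas n) ≤ ∫⁻ y, ‖badPart f i y‖ₑ :=
        lintegral_mono' hmeas_le le_rfl
    _ = ∫⁻ y in dyCube i, ‖f y - ⨍ z in dyCube i, f z‖ₑ := by
        simp_rw [e]
        rw [lintegral_indicator (measurableSet_dyCube i)]
    _ ≤ ∫⁻ y in dyCube i, (‖f y‖ₑ + ‖⨍ z in dyCube i, f z‖ₑ) :=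
        lintegral_mono fun y => enorm_sub_le
    _ = (∫⁻ y in dyCube i, ‖f y‖ₑ) + ‖⨍ z in dyCube i, f z‖ₑ * volume (dyCube i) := by
        rw [lintegral_add_left hf.enorm, setLIntegral_const]
    _ ≤ (∫⁻ y in dyCube i, ‖f y‖ₑ) + (volume (dyCube i))⁻¹ * (∫⁻ z in dyCube i, ‖f z‖ₑ) *
          volume (dyCube i) := by
        gcongr
        exact enorm_average_le f i
    _ = _ := by
        rw [mul_right_comm, ENNReal.inv_mul_cancel hv hv', one_mul, two_mul]

lemma integral_badPart {f : Pt n → 𝕜} {i : DyIdx n} (hi : ∀ y ∈ dyCube i, 0 ≤ y.1) :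
    ∫ y, badPart f i y ∂(hmeas n) = 0 := by
  have : IsFiniteMeasure (volume.restrict (dyCube i)) :=
    ⟨by rw [Measure.restrict_apply_univ]; exact (volume_dyCube_ne_top i).lt_top⟩
  rw [badPart, integral_indicator (measurableSet_dyCube i),
    restrict_hmeas_of_subset (measurableSet_dyCube i) hi]
  exact integral_sub_average _ _

set_option maxHeartbeats 1600000 in
/-- The weak-type `(1,1)` estimate. -/
theorem RoughKernel.weak_type {γ : ℝ} (hγ : 0 < γ) (A : ℝ) (B : ℝ≥0) : ∃ C : ℝ≥0,
    ∀ (K : Pt n → Pt n → 𝕜) (S : Lp 𝕜 2 (hmeas n) →L[𝕜] Lp 𝕜 2 (hmeas n)),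
      RoughKernel γ A K → HasKernel S K → (∀ f, eLpNorm (S f) 2 (hmeas n) ≤
        B * eLpNorm f 2 (hmeas n)) → ∀ (f : Lp 𝕜 2 (hmeas n)) (l : ℝ), 0 < l →
      hmeas n {x | 2 * ENNReal.ofReal l < ‖S f x‖ₑ} ≤
        C * ((ENNReal.ofReal l)⁻¹ * ∫⁻ y, ‖f y‖ₑ ∂(hmeas n)) := by
  obtain ⟨H, hH⟩ := RoughKernel.hormander (𝕜 := 𝕜) (n := n) hγ A
  set ω := volume (closedBall (0 : Pt n) 1)
  have hω : ω ≠ ∞ := measure_closedBall_lt_top.ne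
  set C0 : ℝ≥0∞ := ω * ENNReal.ofReal ((4 * (n + 1)) ^ ((n : ℝ) + 1))
  set C1 : ℝ≥0∞ := B ^ 2 * ((2 ^ (n + 1)) ^ 2 + 1 + 1)
  -- The summands account for the good part, the exceptional set and the bad part. The final 1 keeps
  -- the constant nonzero, which settles the case of infinite mass.
  set C2 : ℝ≥0∞ := C1 + (C0 + H * 2) + 1 with hC2
  have hC2t : C2 ≠ ∞ := by finiteness
  refine ⟨C2.toNNReal, fun K S hK hS hB f l hl => ?_⟩
  rw [ENNReal.coe_toNNReal hC2t]
  set L := ENNReal.ofReal l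
  have hL0 : L ≠ 0 := by simpa [L] using hl
  have hLt : L ≠ ∞ := ENNReal.ofReal_ne_top
  set F := ∫⁻ y, ‖f y‖ₑ ∂(hmeas n) with hF
  rcases eq_or_ne F ∞ with hFt | hFt
  · rw [hFt, ENNReal.mul_top (by simpa using hLt), ENNReal.mul_top (by simp [hC2])]
    exact le_top
  rcases eq_or_ne F 0 with hF0 | hF0
  · have : f = 0 := by
      rw [hF, lintegral_eq_zero_iff (Lp.stronglyMeasurable f).measurable.enorm] at hF0
      rw [Lp.eq_zero_iff_ae_eq_zero]
      filter_upwards [hF0] with y hy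
      simpa using hy
    have h0 : ∀ᵐ x ∂(hmeas n), ¬ (2 * L < ‖S f x‖ₑ) := by
      rw [this, map_zero]
      filter_upwards [Lp.coeFn_zero 𝕜 2 (hmeas n)] with x hx
      rw [not_lt, hx, Pi.zero_apply, enorm_zero]
      exact bot_le
    rw [hF0, mul_zero, mul_zero]
    exact (measure_eq_zero_iff_ae_notMem.2 h0).le
  set f0 : Pt n → 𝕜 := (halfSpace n).indicator f with hf0
  have hf0m : Measurable f0 :=
    (Lp.stronglyMeasurable f).measurable.indicator measurableSet_halfSpace
  have hff0 : f0 =ᵐ[hmeas n] f := by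
    filter_upwards [ae_mem_halfSpace] with y hy
    rw [hf0, indicator_of_mem hy]
  set w : Pt n → ℝ≥0∞ := fun y => ‖f0 y‖ₑ with hw
  have hwm : Measurable w := hf0m.enorm
  have hwF : ∫⁻ y, w y = F := by
    simp only [hw, hf0, enorm_indicator_eq_indicator_enorm]
    rw [lintegral_indicator measurableSet_halfSpace]
    rfl
  have hf0i : Integrable f0 := ⟨hf0m.aestronglyMeasurable, by
    rw [HasFiniteIntegral]; exact (hwF ▸ hFt.lt_top)⟩
  have hf0L2 : MemLp f0 2 (hmeas n) := (memLp_congr_ae hff0).2 (Lp.memLp f)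
  obtain ⟨I, hdis, hI, hgood⟩ := exists_stopping_cubes hwm (by rwa [hwF]) hL0 hLt
  -- A cube below the boundary carries no mass, so it cannot be big.
  have hpos : ∀ i ∈ I, 0 ≤ i.2.1 := by
    intro i hi
    by_contra! hneg
    have h1 : ∫⁻ y in dyCube i, w y = 0 := by
      rw [setLIntegral_congr_fun (g := fun _ => 0) (measurableSet_dyCube i), lintegral_zero]
      intro y hy
      have hy1 : y.1 < dySide i * (i.2.1 + 1) := by
        rw [dyCube_eq] at hy; exact hy.1.2
      have : (i.2.1 : ℝ) + 1 ≤ 0 := by exact_mod_cast hneg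
      have : y ∉ halfSpace n := by
        simp only [halfSpace, mem_ofPred_eq, not_lt]
        nlinarith [dySide_pos i]
      simp only [hw, hf0, indicator_of_notMem this, enorm_zero]
    have := (hI i hi).1
    rw [h1] at this
    exact not_lt_bot this
  have hsub0 : ∀ i ∈ I, ∀ y ∈ dyCube i, 0 ≤ y.1 := by
    intro i hi y hy
    rw [dyCube_eq] at hy
    have : (0 : ℝ) ≤ i.2.1 := by exact_mod_cast hpos i hi
    exact (mul_nonneg (dySide_pos i).le this).trans hy.1.1
  have hcen : ∀ i ∈ I, dyCenter i ∈ halfSpace n := by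
    intro i hi
    have : (0 : ℝ) ≤ i.2.1 := by exact_mod_cast hpos i hi
    have h2 := dySide_pos i
    change 0 < dySide i * (i.2.1 + 1 / 2)
    positivity
  have hdis' : Pairwise (Function.onFun Disjoint fun i : I => dyCube i.1) := fun (i j : I) hij =>
    hdis i.2 j.2 fun h => hij (Subtype.ext h)
  have hsumw : ∑' i : I, ∫⁻ y in dyCube i.1, w y ≤ F := by
    rw [← lintegral_iUnion (fun i : I => measurableSet_dyCube i.1) hdis', ← hwF]
    exact setLIntegral_le_lintegral _ _
  have hsumv : ∑' i : I, volume (dyCube i.1) ≤ L⁻¹ * F := by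
    rw [mul_comm, ← div_eq_mul_inv, ENNReal.le_div_iff_mul_le (Or.inl hL0) (Or.inl hLt), mul_comm,
      ← ENNReal.tsum_mul_left]
    exact (ENNReal.tsum_le_tsum fun i : I => (hI i.1 i.2).1.le).trans hsumw
  have hsum2 : ∑' i : I, ∫⁻ y in dyCube i.1, w y ^ 2 ∂(hmeas n) ≠ ∞ := by
    rw [← lintegral_iUnion (fun i : I => measurableSet_dyCube i.1) hdis']
    refine ne_top_of_le_ne_top ?_ (setLIntegral_le_lintegral _ _)
    rw [← eLpNorm_two_sq_eq_lintegral]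
    exact ENNReal.pow_ne_top hf0L2.2.ne
  -- Only finitely many bad parts are removed, so that linearity of S on L_2 suffices. The set s is
  -- chosen so large that the L_2 mass of f on the remaining cubes is at most l ‖f‖₁, a quantity the
  -- good part can absorb.
  obtain ⟨s, hs⟩ : ∃ s : Finset I,
      ∑' i : {i : I // i ∉ s}, ∫⁻ y in dyCube i.1.1, w y ^ 2 ∂(hmeas n) ≤ L * F := by
    have := (ENNReal.tendsto_tsum_compl_atTop_zero hsum2).eventually_lt_const
      (pos_iff_ne_zero.2 (mul_ne_zero hL0 hF0))
    obtain ⟨s, hs⟩ := this.exists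
    exact ⟨s, hs.le⟩
  have hbL2 : ∀ i : DyIdx n, MemLp (badPart f0 i) 2 (hmeas n) := by
    intro i
    have : badPart f0 i = (dyCube i).indicator f0 -
        (dyCube i).indicator fun _ => ⨍ z in dyCube i, f0 z := by
      ext y; by_cases hy : y ∈ dyCube i <;> simp [badPart, hy]
    rw [this]
    refine (hf0L2.indicator (measurableSet_dyCube i)).sub ?_
    exact memLp_indicator_const 2 (measurableSet_dyCube i) _
      (Or.inr ((hmeas_le _).trans_lt (volume_dyCube_ne_top i).lt_top).ne)
  set b : I → Lp 𝕜 2 (hmeas n) := fun i => (hbL2 i.1).toLp _ with hb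
  have hbae : ∀ᵐ y ∂(hmeas n), ∀ i : I, b i y = badPart f0 i.1 y :=
    ae_all_iff.2 fun i => MemLp.coeFn_toLp _
  set g : Lp 𝕜 2 (hmeas n) := f - ∑ i ∈ s, b i with hg
  have hsumae : ∀ t : I → Lp 𝕜 2 (hmeas n), ∀ᵐ y ∂(hmeas n), (∑ i ∈ s, t i : Lp 𝕜 2 (hmeas n)) y =
      ∑ i ∈ s, t i y := by
    intro t
    exact Lp.coeFn_fun_finsetSum s t
  -- the good part
  have hg2 : ∫⁻ y, ‖g y‖ₑ ^ 2 ∂(hmeas n) ≤ ((2 ^ (n + 1)) ^ 2 + 1 + 1) * (L * F) := by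
    -- On a selected cube g is an average of f, at most 2^{n+1} l. Off all cubes |f| ≤ l. On an
    -- unselected cube g is f itself. The three summands correspond to these cases.
    have hpt : ∀ᵐ y ∂(hmeas n), ‖g y‖ₑ ^ 2 ≤
        (∑' i : I, (dyCube i.1).indicator (fun _ => (2 ^ (n + 1) * L) ^ 2) y) + L * w y +
        ∑' i : {i : I // i ∉ s}, (dyCube i.1.1).indicator (fun y => w y ^ 2) y := by
      filter_upwards [Lp.coeFn_sub f (∑ i ∈ s, b i), hsumae b, hbae, hff0,
        ae_restrict_of_ae hgood] with y h1 h2 h3 h4 h5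
      have hgy : g y = f0 y - ∑ i ∈ s, badPart f0 i.1 y := by
        rw [h1, Pi.sub_apply, h2, ← h4]
        simp_rw [h3]
      have hz : ∀ i j : I, y ∈ dyCube i.1 → j ≠ i → badPart f0 j.1 y = 0 := by
        intro i j hi hij
        exact indicator_of_notMem (fun hj => disjoint_left.1 (hdis' hij) hj hi) _
      by_cases hy : y ∈ ⋃ i ∈ I, dyCube i
      · obtain ⟨i, hiI, hyi⟩ := mem_iUnion₂.1 hy
        by_cases his : (⟨i, hiI⟩ : I) ∈ s
        · rw [Finset.sum_eq_single_of_mem _ his fun j _ hj => hz ⟨i, hiI⟩ j hyi hj] at hgy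
          rw [badPart, indicator_of_mem hyi, sub_sub_cancel] at hgy
          have hle : ‖g y‖ₑ ≤ 2 ^ (n + 1) * L := by
            rw [hgy]
            refine (enorm_average_le f0 i).trans ?_
            rw [mul_comm, ← div_eq_mul_inv, ENNReal.div_le_iff_le_mul
              (Or.inl (volume_dyCube_ne_zero i)) (Or.inl (volume_dyCube_ne_top i))]
            exact (hI i hiI).2
          calc ‖g y‖ₑ ^ 2 ≤ (2 ^ (n + 1) * L) ^ 2 := by gcongr
            _ = (dyCube i).indicator (fun _ => (2 ^ (n + 1) * L) ^ 2) y := by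
                rw [indicator_of_mem hyi]
            _ ≤ ∑' i : I, (dyCube i.1).indicator (fun _ => (2 ^ (n + 1) * L) ^ 2) y :=
                ENNReal.le_tsum (f := fun i : I => (dyCube i.1).indicator
                  (fun _ => (2 ^ (n + 1) * L) ^ 2) y) ⟨i, hiI⟩
            _ ≤ _ := by rw [add_assoc]; exact le_self_add
        · rw [Finset.sum_eq_zero fun j hj => hz ⟨i, hiI⟩ j hyi fun h => his (h ▸ hj),
            sub_zero] at hgy
          calc ‖g y‖ₑ ^ 2 = (dyCube i).indicator (fun y => w y ^ 2) y := by
                rw [indicator_of_mem hyi, hgy]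
            _ ≤ ∑' i : {i : I // i ∉ s}, (dyCube i.1.1).indicator (fun y => w y ^ 2) y :=
                ENNReal.le_tsum (f := fun i : {i : I // i ∉ s} => (dyCube i.1.1).indicator
                  (fun y => w y ^ 2) y) ⟨⟨i, hiI⟩, his⟩
            _ ≤ _ := le_add_self
      · have hz' : ∀ j ∈ s, badPart f0 j.1 y = 0 := fun j _ =>
          indicator_of_notMem (fun hj => hy (mem_biUnion j.2 hj)) _
        rw [Finset.sum_eq_zero hz', sub_zero] at hgy
        calc ‖g y‖ₑ ^ 2 = w y * w y := by rw [hgy, sq]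
          _ ≤ L * w y := by gcongr; exact h5 hy
          _ ≤ _ := le_add_right le_add_self
    refine (lintegral_mono_ae hpt).trans ?_
    have hm1 : ∀ i : I, Measurable ((dyCube i.1).indicator
        (fun _ : Pt n => ((2 : ℝ≥0∞) ^ (n + 1) * L) ^ 2)) :=
      fun i => measurable_const.indicator (measurableSet_dyCube _)
    have hm2 : ∀ i : {i : I // i ∉ s}, Measurable ((dyCube i.1.1).indicator
        (fun y => w y ^ 2)) :=
      fun i => (hwm.pow_const 2).indicator (measurableSet_dyCube _)
    rw [lintegral_add_right _ (Measurable.tsum hm2),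
      lintegral_add_right _ (hwm.const_mul L), lintegral_tsum fun i => (hm1 i).aemeasurable,
      lintegral_tsum fun i => (hm2 i).aemeasurable, lintegral_const_mul _ hwm, add_mul, add_mul,
      one_mul]
    refine add_le_add (add_le_add ?_ ?_) ?_
    · simp_rw [lintegral_indicator_const (measurableSet_dyCube _)]
      rw [ENNReal.tsum_mul_left]
      calc _ ≤ (2 ^ (n + 1) * L) ^ 2 * (L⁻¹ * F) := by
            gcongr
            exact (ENNReal.tsum_le_tsum fun i => hmeas_le _).trans hsumv
        _ = (2 ^ (n + 1)) ^ 2 * (L * F) * (L * L⁻¹) := by ring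
        _ = _ := by rw [ENNReal.mul_inv_cancel hL0 hLt, mul_one]
    · gcongr
      exact (lintegral_mono' hmeas_le le_rfl).trans hwF.le
    · simp_rw [lintegral_indicator (measurableSet_dyCube _)]
      exact hs
  have hSg : hmeas n {x | L < ‖S g x‖ₑ} ≤ C1 * (L⁻¹ * F) := by
    have hcheb := meas_ge_le_lintegral_div (μ := hmeas n)
      ((Lp.stronglyMeasurable (S g)).measurable.enorm.pow_const 2).aemeasurable
      (pow_ne_zero 2 hL0) (ENNReal.pow_ne_top hLt)
    calc hmeas n {x | L < ‖S g x‖ₑ} ≤ hmeas n {x | L ^ 2 ≤ ‖S g x‖ₑ ^ 2} := by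
          refine measure_mono fun x hx => ?_
          exact pow_le_pow_left' (le_of_lt (show L < ‖S g x‖ₑ from hx)) 2
      _ ≤ (∫⁻ x, ‖S g x‖ₑ ^ 2 ∂(hmeas n)) / L ^ 2 := hcheb
      _ ≤ (B ^ 2 * (((2 ^ (n + 1)) ^ 2 + 1 + 1) * (L * F))) / L ^ 2 := by
          gcongr
          rw [← eLpNorm_two_sq_eq_lintegral] at hg2 ⊢
          calc eLpNorm (S g) 2 (hmeas n) ^ 2 ≤ (B * eLpNorm g 2 (hmeas n)) ^ 2 := by
                gcongr; exact hB g
            _ ≤ _ := by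
                rw [mul_pow]; gcongr
      _ = C1 * (L⁻¹ * F) * (L * L⁻¹) := by
          rw [div_eq_mul_inv, ENNReal.inv_pow]; ring
      _ = _ := by rw [ENNReal.mul_inv_cancel hL0 hLt, mul_one]
  -- the bad part
  set Ω : Set (Pt n) := ⋃ i : I, ball (dyCenter i.1) (4 * ((n + 1) * dySide i.1)) with hΩ
  have hΩm : hmeas n Ω ≤ C0 * (L⁻¹ * F) := by
    calc hmeas n Ω ≤ ∑' i : I, hmeas n (ball (dyCenter i.1) (4 * ((n + 1) * dySide i.1))) :=
          measure_iUnion_le _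
      _ ≤ ∑' i : I, C0 * volume (dyCube i.1) := by
          refine ENNReal.tsum_le_tsum fun i => ?_
          have hp := dySide_pos i.1
          refine (hmeas_le _).trans ((measure_mono ball_subset_closedBall).trans (le_of_eq ?_))
          rw [volume_closedBall_pt _ (by positivity), ← mul_assoc,
            Real.mul_rpow (by positivity) hp.le, ENNReal.ofReal_mul (by positivity), ← mul_assoc,
            volume_dyCube]
          congr 2
          rw [show ((n : ℝ) + 1) = ((n + 1 : ℕ) : ℝ) by push_cast; rfl, Real.rpow_natCast]
      _ ≤ _ := by rw [ENNReal.tsum_mul_left]; gcongr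
  -- Outside the enlarged balls the cancellation estimate applies to each bad part separately, and
  -- the L_1 masses add up.
  have hbad : ∫⁻ x in Ωᶜ, ‖S (∑ i ∈ s, b i) x‖ₑ ∂(hmeas n) ≤ H * 2 * F := by
    have hterm : ∀ i : I, ∫⁻ x in {x | 4 * ((n + 1) * dySide i.1) ≤ dist x (dyCenter i.1)},
        ‖S (b i) x‖ₑ ∂(hmeas n) ≤ H * (2 * ∫⁻ y in dyCube i.1, w y) := by
      intro i
      have hp := dySide_pos i.1
      have hδ : 0 < ((n : ℝ) + 1) * dySide i.1 := by positivity
      have hbi : ⇑(b i) =ᵐ[hmeas n] badPart f0 i.1 := MemLp.coeFn_toLp _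
      refine (hS.lintegral_apply_le hK hδ
        (fun y hy hyc => hH K hK _ (hcen i.1 i.2) y hy _ hδ hyc) (b i) ?_ ?_).trans ?_
      · filter_upwards [hbi] with y hy hyc
        rw [hy]
        exact indicator_of_notMem (fun h => hyc (dyCube_subset_closedBall _ h)) _
      · rw [integral_congr_ae hbi]
        exact integral_badPart (hsub0 i.1 i.2)
      · gcongr
        refine (lintegral_mono_ae (hbi.mono fun y hy => ?_)).trans (lintegral_badPart_le hf0m i.1)
        rw [hy]
    calc ∫⁻ x in Ωᶜ, ‖S (∑ i ∈ s, b i) x‖ₑ ∂(hmeas n)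
        ≤ ∫⁻ x in Ωᶜ, ∑ i ∈ s, ‖S (b i) x‖ₑ ∂(hmeas n) := by
          refine lintegral_mono_ae (ae_restrict_of_ae ?_)
          filter_upwards [hsumae fun i => S (b i)] with x hx
          rw [map_sum, hx]
          exact enorm_sum_le _ _
      _ = ∑ i ∈ s, ∫⁻ x in Ωᶜ, ‖S (b i) x‖ₑ ∂(hmeas n) :=
          lintegral_finsetSum _ fun i _ => (Lp.stronglyMeasurable (S (b i))).measurable.enorm
      _ ≤ ∑ i ∈ s, H * (2 * ∫⁻ y in dyCube i.1, w y) := by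
          refine Finset.sum_le_sum fun i _ => le_trans (lintegral_mono_set ?_) (hterm i)
          intro x hx
          have : x ∉ ball (dyCenter i.1) (4 * ((n + 1) * dySide i.1)) :=
            fun h => hx (mem_iUnion.2 ⟨i, h⟩)
          rwa [mem_ball, not_lt] at this
      _ = H * 2 * ∑ i ∈ s, ∫⁻ y in dyCube i.1, w y := by
          rw [Finset.mul_sum]
          exact Finset.sum_congr rfl fun _ _ => by ring
      _ ≤ _ := by
          gcongr
          exact (ENNReal.sum_le_tsum s).trans hsumw
  have hΩo : MeasurableSet Ω := (isOpen_iUnion fun i => isOpen_ball).measurableSet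
  have hSb : hmeas n {x | L < ‖S (∑ i ∈ s, b i) x‖ₑ} ≤ (C0 + H * 2) * (L⁻¹ * F) := by
    have hcheb := meas_ge_le_lintegral_div (μ := (hmeas n).restrict Ωᶜ)
      (Lp.stronglyMeasurable (S (∑ i ∈ s, b i))).measurable.enorm.aemeasurable hL0 hLt
    calc hmeas n {x | L < ‖S (∑ i ∈ s, b i) x‖ₑ}
        ≤ hmeas n Ω + (hmeas n).restrict Ωᶜ {x | L ≤ ‖S (∑ i ∈ s, b i) x‖ₑ} := by
          rw [Measure.restrict_apply' hΩo.compl]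
          refine (measure_mono fun x hx => ?_).trans (measure_union_le _ _)
          by_cases hxΩ : x ∈ Ω
          · exact Or.inl hxΩ
          · exact Or.inr ⟨le_of_lt (show L < ‖S (∑ i ∈ s, b i) x‖ₑ from hx), hxΩ⟩
      _ ≤ C0 * (L⁻¹ * F) + H * 2 * F / L :=
          add_le_add hΩm (hcheb.trans (ENNReal.div_le_div_right hbad _))
      _ = _ := by rw [div_eq_mul_inv]; ring
  calc hmeas n {x | 2 * L < ‖S f x‖ₑ}
      ≤ hmeas n ({x | L < ‖S g x‖ₑ} ∪ {x | L < ‖S (∑ i ∈ s, b i) x‖ₑ}) := by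
        refine measure_mono_ae ?_
        have hsplit : S f = S g + S (∑ i ∈ s, b i) := by rw [← map_add, hg, sub_add_cancel]
        filter_upwards [Lp.coeFn_add (S g) (S (∑ i ∈ s, b i))] with x hx hx2
        have hx2 : 2 * L < ‖S f x‖ₑ := hx2
        by_contra hcon
        have hcon : ¬ (L < ‖S g x‖ₑ ∨ L < ‖S (∑ i ∈ s, b i) x‖ₑ) := hcon
        rw [not_or, not_lt, not_lt] at hcon
        rw [hsplit, hx] at hx2
        refine absurd hx2 (not_lt.2 ((enorm_add_le _ _).trans ?_))
        rw [two_mul]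
        exact add_le_add hcon.1 hcon.2
    _ ≤ C1 * (L⁻¹ * F) + (C0 + H * 2) * (L⁻¹ * F) :=
        (measure_union_le _ _).trans (add_le_add hSg hSb)
    _ ≤ C2 * (L⁻¹ * F) := by
        rw [← add_mul, hC2]
        exact mul_le_mul' le_self_add le_rfl

end WeakType

end CausalCZO

namespace CausalCZO

open Filter Topology Metric

/-! ### Strong-type estimates -/

section StrongType

variable {𝕜 : Type*} [RCLike 𝕜] {n : ℕ}

lemma eLpNorm_apply_le {S : Lp 𝕜 2 (hmeas n) →L[𝕜] Lp 𝕜 2 (hmeas n)} {B : ℝ} (hB : ‖S‖ ≤ B)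
    (f : Lp 𝕜 2 (hmeas n)) :
    eLpNorm (S f) 2 (hmeas n) ≤ B.toNNReal * eLpNorm f 2 (hmeas n) := by
  have h := S.le_of_opNorm_le hB f
  rw [← Lp.enorm_def, ← Lp.enorm_def, ← ofReal_norm, ← ofReal_norm]
  have hB0 : 0 ≤ B := (norm_nonneg _).trans hB
  change _ ≤ ENNReal.ofReal B * _
  rw [← ENNReal.ofReal_mul hB0]
  exact ENNReal.ofReal_le_ofReal h

lemma exists_Lp_ae_eq_indicator {p : ℝ≥0∞} {μ : Measure (Pt n)} (f : Lp 𝕜 p μ) {s : Set (Pt n)}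
    (hs : MeasurableSet s) : ∃ g : Lp 𝕜 p μ, (g : Pt n → 𝕜) =ᵐ[μ] s.indicator (f : Pt n → 𝕜) :=
  ⟨((Lp.memLp f).indicator hs).toLp _, MemLp.coeFn_toLp _⟩

/-- The distribution of `S f`, after splitting `f` at height `l`. -/
lemma HasKernel.measure_lt_enorm_le {S : Lp 𝕜 2 (hmeas n) →L[𝕜] Lp 𝕜 2 (hmeas n)} {C B : ℝ≥0}
    {l : ℝ} (hl : 0 < l)
    (hw : ∀ f : Lp 𝕜 2 (hmeas n), hmeas n {x | 2 * ENNReal.ofReal l < ‖S f x‖ₑ} ≤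
      C * ((ENNReal.ofReal l)⁻¹ * ∫⁻ y, ‖f y‖ₑ ∂(hmeas n)))
    (hB : ∀ f, eLpNorm (S f) 2 (hmeas n) ≤ B * eLpNorm f 2 (hmeas n)) (f : Lp 𝕜 2 (hmeas n)) :
    hmeas n {x | ENNReal.ofReal l < 4⁻¹ * ‖S f x‖ₑ} ≤
      C * ((ENNReal.ofReal l)⁻¹ * ∫⁻ x in {x | ENNReal.ofReal l < ‖f x‖ₑ}, ‖f x‖ₑ ∂(hmeas n)) +
      B ^ 2 * ((ENNReal.ofReal l)⁻¹ ^ 2 *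
        ∫⁻ x in {x | ‖f x‖ₑ ≤ ENNReal.ofReal l}, ‖f x‖ₑ ^ 2 ∂(hmeas n)) := by
  set u : Pt n → ℝ≥0∞ := fun x => ‖f x‖ₑ with hu
  have hum : Measurable u := (Lp.stronglyMeasurable f).measurable.enorm
  set L := ENNReal.ofReal l
  have hL0 : L ≠ 0 := by simpa [L] using hl
  have hLt : L ≠ ∞ := ENNReal.ofReal_ne_top
  have hm1 : MeasurableSet {x | L < u x} := measurableSet_lt measurable_const hum
  have hm2 : MeasurableSet {x | u x ≤ L} := measurableSet_le hum measurable_const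
  obtain ⟨f1, e1⟩ := exists_Lp_ae_eq_indicator f hm1
  obtain ⟨f2, e2⟩ := exists_Lp_ae_eq_indicator f hm2
  have hsum : f = f1 + f2 := by
    apply Lp.ext
    filter_upwards [Lp.coeFn_add f1 f2, e1, e2] with x h h1 h2
    rw [h, Pi.add_apply, h1, h2]
    by_cases hx : L < u x
    · simp [indicator, hx]
    · simp [indicator, hx, not_lt.1 hx]
  have w1 := hw f1
  have i1 : ∫⁻ y, ‖f1 y‖ₑ ∂(hmeas n) = ∫⁻ x in {x | L < u x}, u x ∂(hmeas n) := by
    rw [← lintegral_indicator hm1]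
    refine lintegral_congr_ae (e1.mono fun y hy => ?_)
    simp only [hy, enorm_indicator_eq_indicator_enorm]
    rfl
  have i2 : ∫⁻ y, ‖f2 y‖ₑ ^ 2 ∂(hmeas n) = ∫⁻ x in {x | u x ≤ L}, u x ^ 2 ∂(hmeas n) := by
    rw [← lintegral_indicator hm2]
    refine lintegral_congr_ae (e2.mono fun y hy => ?_)
    simp only [hy, enorm_indicator_eq_indicator_enorm]
    simp [indicator, hu]
  have w2 : hmeas n {x | L ≤ ‖S f2 x‖ₑ} ≤
      B ^ 2 * (L⁻¹ ^ 2 * ∫⁻ x in {x | u x ≤ L}, u x ^ 2 ∂(hmeas n)) := by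
    have hcheb := meas_ge_le_lintegral_div (μ := hmeas n)
      ((Lp.stronglyMeasurable (S f2)).measurable.enorm.pow_const 2).aemeasurable
      (pow_ne_zero 2 hL0) (ENNReal.pow_ne_top hLt)
    calc hmeas n {x | L ≤ ‖S f2 x‖ₑ} ≤ hmeas n {x | L ^ 2 ≤ ‖S f2 x‖ₑ ^ 2} :=
          measure_mono fun x hx =>
            show L ^ 2 ≤ ‖S f2 x‖ₑ ^ 2 from pow_le_pow_left' (show L ≤ ‖S f2 x‖ₑ from hx) 2
      _ ≤ (∫⁻ x, ‖S f2 x‖ₑ ^ 2 ∂(hmeas n)) / L ^ 2 := hcheb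
      _ ≤ (B ^ 2 * ∫⁻ x in {x | u x ≤ L}, u x ^ 2 ∂(hmeas n)) / L ^ 2 := by
          gcongr
          rw [← i2, ← eLpNorm_two_sq_eq_lintegral, ← eLpNorm_two_sq_eq_lintegral, ← mul_pow]
          gcongr
          exact hB f2
      _ = _ := by rw [div_eq_mul_inv, ENNReal.inv_pow]; ring
  rw [i1] at w1
  -- If |S f1| ≤ 2l and |S f2| < l at a point, then |S f| ≤ 4l there. This is the source of the
  -- factor 1/4.
  refine le_trans ?_ (add_le_add w1 w2)
  refine le_trans (measure_mono_ae ?_) (measure_union_le _ _)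
  filter_upwards [Lp.coeFn_add (S f1) (S f2)] with x hx hx2
  have hx2 : L < 4⁻¹ * ‖S f x‖ₑ := hx2
  by_contra hcon
  have hcon : ¬ (2 * L < ‖S f1 x‖ₑ ∨ L ≤ ‖S f2 x‖ₑ) := hcon
  rw [not_or, not_lt, not_le] at hcon
  refine absurd hx2 (not_lt.2 ?_)
  rw [hsum, map_add, hx, Pi.add_apply]
  calc 4⁻¹ * ‖S f1 x + S f2 x‖ₑ ≤ 4⁻¹ * (2 * L + 2 * L) := by
        gcongr
        refine (enorm_add_le _ _).trans (add_le_add hcon.1 (hcon.2.le.trans ?_))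
        rw [two_mul]; exact le_self_add
    _ = L := by
        rw [← add_mul, ← mul_assoc, show (2 : ℝ≥0∞) + 2 = 4 by norm_num,
          ENNReal.inv_mul_cancel (by simp) (by simp), one_mul]

/-- Strong type below two, by interpolation. -/
theorem RoughKernel.strong_type_lt_two {γ : ℝ} (hγ : 0 < γ) (A : ℝ) (B : ℝ≥0) {r : ℝ} (hr : 1 < r)
    (hr2 : r < 2) : ∃ C : ℝ≥0,
    ∀ (K : Pt n → Pt n → 𝕜) (S : Lp 𝕜 2 (hmeas n) →L[𝕜] Lp 𝕜 2 (hmeas n)),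
      RoughKernel γ A K → HasKernel S K → (∀ f, eLpNorm (S f) 2 (hmeas n) ≤
        B * eLpNorm f 2 (hmeas n)) → ∀ (f : Lp 𝕜 2 (hmeas n)),
      ∫⁻ x, ‖S f x‖ₑ ^ r ∂(hmeas n) ≤ C * ∫⁻ x, ‖f x‖ₑ ^ r ∂(hmeas n) := by
  obtain ⟨C, hC⟩ := RoughKernel.weak_type (𝕜 := 𝕜) (n := n) hγ A B
  have h1 : ENNReal.ofReal (r - 1) ≠ 0 := by simpa using hr
  have h2 : ENNReal.ofReal (2 - r) ≠ 0 := by simpa using hr2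
  set c : ℝ≥0∞ := 4 ^ r * (ENNReal.ofReal r * (C / ENNReal.ofReal (r - 1) +
    B ^ 2 / ENNReal.ofReal (2 - r))) with hc
  have hct : c ≠ ∞ := by finiteness
  refine ⟨c.toNNReal, fun K S hK hS hB f => ?_⟩
  rw [ENNReal.coe_toNNReal hct]
  have hum : Measurable fun x => ‖f x‖ₑ := (Lp.stronglyMeasurable f).measurable.enorm
  have hvm : Measurable fun x => ‖S f x‖ₑ := (Lp.stronglyMeasurable (S f)).measurable.enorm
  have key := lintegral_rpow_le_of_weak (μ := hmeas n) hr hr2 (u := fun x => ‖f x‖ₑ)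
    (v := fun x => 4⁻¹ * ‖S f x‖ₑ) hum (hvm.const_mul _) (C := C) (D := B ^ 2)
    (by finiteness) (by finiteness) fun l hl =>
      HasKernel.measure_lt_enorm_le hl (fun f => hC K S hK hS hB f l hl) hB f
  calc ∫⁻ x, ‖S f x‖ₑ ^ r ∂(hmeas n)
      = ∫⁻ x, 4 ^ r * (4⁻¹ * ‖S f x‖ₑ) ^ r ∂(hmeas n) := lintegral_congr fun x => by
        rw [← ENNReal.mul_rpow_of_nonneg _ _ (by linarith), ← mul_assoc,
          ENNReal.mul_inv_cancel (by simp) (by simp), one_mul]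
    _ = 4 ^ r * ∫⁻ x, (4⁻¹ * ‖S f x‖ₑ) ^ r ∂(hmeas n) :=
        lintegral_const_mul' _ _ (by finiteness)
    _ ≤ 4 ^ r * (ENNReal.ofReal r * (C / ENNReal.ofReal (r - 1) +
          B ^ 2 / ENNReal.ofReal (2 - r)) * ∫⁻ x, ‖f x‖ₑ ^ r ∂(hmeas n)) := by
        gcongr
    _ = _ := by rw [hc]; ring

lemma integrable_of_isCompact {f : Lp 𝕜 2 (hmeas n)} {F : Set (Pt n)} (hF : IsCompact F)
    (hf : ∀ᵐ y ∂(hmeas n), y ∉ F → f y = 0) : Integrable f (hmeas n) := by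
  have h1 : IntegrableOn f F (hmeas n) := by
    have : IsFiniteMeasure ((hmeas n).restrict F) :=
      ⟨by rw [Measure.restrict_apply_univ]; exact hF.measure_lt_top⟩
    exact ((Lp.memLp f).restrict F).integrable one_le_two
  rw [← integrable_indicator_iff hF.measurableSet] at h1
  refine h1.congr ?_
  filter_upwards [hf] with y hy
  by_cases hyE : y ∈ F
  · rw [indicator_of_mem hyE]
  · rw [indicator_of_notMem hyE, hy hyE]

/-- The kernel of the adjoint operator. -/
lemma HasKernel.adjoint {γ A : ℝ} {K : Pt n → Pt n → 𝕜} (hK : RoughKernel γ A K)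
    {S : Lp 𝕜 2 (hmeas n) →L[𝕜] Lp 𝕜 2 (hmeas n)} (hS : HasKernel S K) :
    HasKernel (ContinuousLinearMap.adjoint S) (fun x y => (starRingEnd 𝕜) (K y x)) := by
  intro F hF hFH f hf
  set u := ContinuousLinearMap.adjoint S f with hu
  set U : Pt n → 𝕜 := fun x => ∫ y, (starRingEnd 𝕜) (K y x) * f y ∂(hmeas n) with hU
  have hfi := integrable_of_isCompact hF hf
  -- These compact sets exhaust the half space minus F while keeping a positive distance from F, so
  -- the kernel is bounded on each product of `G m` with F.
  let G : ℕ → Set (Pt n) := fun m => closedBall 0 m ∩ (aboveHeight n m ∩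
    {x | ∀ y ∈ F, 1 / ((m : ℝ) + 1) ≤ dist x y})
  have hG : ∀ m, IsCompact (G m) := by
    intro m
    refine (isCompact_closedBall _ _).inter_right ((isClosed_aboveHeight m).inter ?_)
    have : {x | ∀ y ∈ F, 1 / ((m : ℝ) + 1) ≤ dist x y} =
        ⋂ y ∈ F, {x : Pt n | 1 / ((m : ℝ) + 1) ≤ dist x y} := by
      ext x; simp
    rw [this]
    exact isClosed_biInter fun y _ => isClosed_le continuous_const (continuous_id.dist continuous_const)
  have hUm : StronglyMeasurable U := by
    have : Measurable (Function.uncurry fun x y => (starRingEnd 𝕜) (K y x) * f y) := by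
      have h1 : Measurable fun z : Pt n × Pt n => K z.2 z.1 := hK.measurable.comp measurable_swap
      exact (RCLike.continuous_conj.measurable.comp h1).mul
        ((Lp.stronglyMeasurable f).measurable.comp measurable_snd)
    exact this.stronglyMeasurable.integral_prod_right
  have hmain : ∀ m, ∀ᵐ x ∂(hmeas n), x ∈ G m → u x = U x := by
    intro m
    set c := A * (1 / ((m : ℝ) + 1)) ^ (-((n : ℝ) + 1)) with hc
    have hA := hK.nonneg
    have hc0 : 0 ≤ c := by positivity
    have hGd : ∀ x ∈ G m, ∀ y ∈ F, ‖K y x‖ ≤ c := fun x hx y hy =>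
      hK.norm_le (by positivity) (by rw [dist_comm]; exact hx.2.2 y hy)
    have hVL : MemLp ((G m).indicator U) 2 (hmeas n) := by
      have hb : ∀ x, ‖(G m).indicator U x‖ ≤ c * ∫ y, ‖f y‖ ∂(hmeas n) := by
        intro x
        have h0 : 0 ≤ ∫ y, ‖f y‖ ∂(hmeas n) := integral_nonneg fun _ => norm_nonneg _
        by_cases hx : x ∈ G m
        · rw [indicator_of_mem hx, hU, ← integral_const_mul]
          refine norm_integral_le_of_norm_le (hfi.norm.const_mul c) ?_
          filter_upwards [hf] with y hy
          by_cases hyF : y ∈ F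
          · rw [norm_mul, RCLike.norm_conj]
            gcongr
            exact hGd x hx y hyF
          · simp [hy hyF]
        · rw [indicator_of_notMem hx, norm_zero]
          positivity
      have : IsFiniteMeasure ((hmeas n).restrict (G m)) :=
        ⟨by rw [Measure.restrict_apply_univ]; exact (hG m).measure_lt_top⟩
      rw [memLp_indicator_iff_restrict (hG m).measurableSet]
      refine MemLp.of_bound hUm.aestronglyMeasurable (c * ∫ y, ‖f y‖ ∂(hmeas n)) ?_
      filter_upwards [ae_restrict_mem (hG m).measurableSet] with x hx
      have := hb x
      rwa [indicator_of_mem hx] at this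
    set V := hVL.toLp _ with hV
    have hVe : ⇑V =ᵐ[hmeas n] (G m).indicator U := MemLp.coeFn_toLp _
    set W := ((Lp.memLp u).indicator (hG m).measurableSet).toLp _ with hW
    have hWe : ⇑W =ᵐ[hmeas n] (G m).indicator u := MemLp.coeFn_toLp _
    -- The error between the adjoint and its candidate formula, cut off to `G m`, serves as its own
    -- test function.
    set g := W - V with hg
    have hge : ∀ᵐ x ∂(hmeas n), g x = (G m).indicator (fun x => u x - U x) x := by
      filter_upwards [Lp.coeFn_sub W V, hVe, hWe] with x h1 h2 h3
      rw [h1, Pi.sub_apply, h2, h3]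
      by_cases hx : x ∈ G m <;> simp [hx]
    have hg0 : ∀ᵐ x ∂(hmeas n), x ∉ G m → g x = 0 := by
      filter_upwards [hge] with x hx hxG
      rw [hx, indicator_of_notMem hxG]
    have hgi := integrable_of_isCompact (hG m) hg0
    -- the pairing
    have hpair : inner 𝕜 u g = inner 𝕜 V g := by
      have h1 : inner 𝕜 u g = inner 𝕜 f (S g) := by
        rw [hu, ContinuousLinearMap.adjoint_inner_left]
      have h2 : inner 𝕜 f (S g) = ∫ x, ∫ y, K x y * g y * (starRingEnd 𝕜) (f x)
          ∂(hmeas n) ∂(hmeas n) := by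
        rw [L2.inner_def]
        refine integral_congr_ae ?_
        filter_upwards [hf, hS (G m) (hG m) (fun x hx => aboveHeight_subset m hx.2.1) g hg0]
          with x h1 h2
        by_cases hxF : x ∈ F
        · have hxG : x ∉ G m := fun h => by
            have := h.2.2 x hxF
            rw [dist_self] at this
            exact absurd this (not_le.2 (by positivity))
          rw [RCLike.inner_apply, h2 hxG, integral_mul_const]
        · simp [h1 hxF]
      have h3 : inner 𝕜 V g = ∫ y, ∫ x, K x y * g y * (starRingEnd 𝕜) (f x)
          ∂(hmeas n) ∂(hmeas n) := by
        rw [L2.inner_def]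
        refine integral_congr_ae ?_
        filter_upwards [hVe, hg0] with y h1 h2
        by_cases hy : y ∈ G m
        · rw [RCLike.inner_apply, h1, indicator_of_mem hy, hU, ← integral_conj,
            ← integral_const_mul]
          congr 1
          ext x
          rw [map_mul, RCLike.conj_conj]
          ring
        · simp [h2 hy]
      rw [h1, h2, h3]
      refine integral_integral_swap ?_
      have hprod : Integrable (fun z : Pt n × Pt n => ‖f z.1‖ * ‖g z.2‖)
          ((hmeas n).prod (hmeas n)) := hfi.norm.mul_prod hgi.norm
      refine Integrable.mono' (hprod.const_mul c) ?_ ?_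
      · refine Measurable.aestronglyMeasurable ?_
        exact (hK.measurable.mul ((Lp.stronglyMeasurable g).measurable.comp measurable_snd)).mul
          (RCLike.continuous_conj.measurable.comp
            ((Lp.stronglyMeasurable f).measurable.comp measurable_fst))
      · have a1 : ∀ᵐ z ∂((hmeas n).prod (hmeas n)), z.1 ∉ F → f z.1 = 0 :=
          Measure.quasiMeasurePreserving_fst.ae hf
        have a2 : ∀ᵐ z ∂((hmeas n).prod (hmeas n)), z.2 ∉ G m → g z.2 = 0 :=
          Measure.quasiMeasurePreserving_snd.ae hg0
        filter_upwards [a1, a2] with z h1 h2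
        by_cases hz1 : z.1 ∈ F
        · by_cases hz2 : z.2 ∈ G m
          · simp only [Function.uncurry, norm_mul, RCLike.norm_conj]
            rw [mul_assoc, mul_comm ‖g z.2‖]
            gcongr
            exact hGd _ hz2 _ hz1
          · simp [h2 hz2, Function.uncurry]
        · simp [h1 hz1, Function.uncurry]
    -- As g vanishes off `G m`, its square norm is the pairing of u - V with g, and the pairing
    -- identity makes that vanish.
    have hzero : inner 𝕜 g g = 0 := by
      have : inner 𝕜 g g = inner 𝕜 (u - V) g := by
        rw [L2.inner_def, L2.inner_def]
        refine integral_congr_ae ?_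
        filter_upwards [hge, Lp.coeFn_sub u V, hVe] with x h1 h2 h3
        by_cases hx : x ∈ G m
        · rw [h2, Pi.sub_apply, h3, h1, indicator_of_mem hx, indicator_of_mem hx]
        · simp [h1, hx]
      rw [this, inner_sub_left, hpair, sub_self]
    rw [inner_self_eq_zero] at hzero
    rw [hzero] at hge
    filter_upwards [hge, Lp.coeFn_zero 𝕜 2 (hmeas n)] with x h1 h2 hx
    rw [h2, indicator_of_mem hx] at h1
    exact (sub_eq_zero.1 h1.symm)
  filter_upwards [ae_all_iff.2 hmain, ae_mem_halfSpace] with x hx hxH hxF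
  obtain ⟨δ, hδ, hd⟩ := exists_dist_ge_of_notMem hF.isClosed hxF
  have e1 : ∀ᶠ m : ℕ in atTop, x ∈ closedBall (0 : Pt n) m := by
    filter_upwards [eventually_ge_atTop ⌈dist x 0⌉₊] with m hm
    rw [mem_closedBall]
    exact (Nat.le_ceil (dist x 0)).trans (Nat.cast_le.2 hm)
  have e2 : ∀ᶠ m : ℕ in atTop, 1 / ((m : ℝ) + 1) < δ :=
    (tendsto_one_div_add_atTop_nhds_zero_nat (𝕜 := ℝ)).eventually_lt_const hδ
  obtain ⟨m, h1, h2, h3⟩ := (e1.and (e2.and (eventually_mem_aboveHeight hxH))).exists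
  exact hx m ⟨h1, h3, fun y hy => h2.le.trans (hd y hy)⟩

/-- With u = S f, pair u with u |u|^{q-2} and move S to the other side. The test function is cut off
to the sets where 1/(m+1) ≤ |u| ≤ m. They have finite measure, so the test function is in L_2 and
the quantity J to be divided by is finite. Monotone convergence removes the cutoff. -/
lemma lintegral_rpow_le_of_adjoint {q q' : ℝ} (hqq : q.HolderConjugate q') (hq : 2 < q)
    {C : ℝ≥0∞} (S : Lp 𝕜 2 (hmeas n) →L[𝕜] Lp 𝕜 2 (hmeas n))
    (h : ∀ f : Lp 𝕜 2 (hmeas n), ∫⁻ x, ‖ContinuousLinearMap.adjoint S f x‖ₑ ^ q' ∂(hmeas n) ≤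
      C * ∫⁻ x, ‖f x‖ₑ ^ q' ∂(hmeas n)) (f : Lp 𝕜 2 (hmeas n)) :
    ∫⁻ x, ‖S f x‖ₑ ^ q ∂(hmeas n) ≤ C ^ (q / q') * ∫⁻ x, ‖f x‖ₑ ^ q ∂(hmeas n) := by
  have hq0 : 0 < q := hqq.pos
  have hq0' : 0 < q' := hqq.symm.pos
  set u : Pt n → 𝕜 := ⇑(S f) with hu
  have hum : StronglyMeasurable u := Lp.stronglyMeasurable (S f)
  let E : ℕ → Set (Pt n) := fun m => {x | 1 / ((m : ℝ) + 1) ≤ ‖u x‖ ∧ ‖u x‖ ≤ m}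
  have hE : ∀ m, MeasurableSet (E m) := fun m =>
    (measurableSet_le measurable_const hum.measurable.norm).inter
      (measurableSet_le hum.measurable.norm measurable_const)
  have hEfin : ∀ m, hmeas n (E m) < ∞ := by
    intro m
    have := (Lp.memLp (S f)).meas_ge_lt_top (by simp) (by simp)
      (ε := (1 / ((m : ℝ) + 1)).toNNReal) (by simp; positivity)
    refine (measure_mono fun x hx => ?_).trans_lt this
    simp only [mem_ofPred_eq]
    rw [← NNReal.coe_le_coe, coe_nnnorm, Real.coe_toNNReal _ (by positivity)]
    exact hx.1
  have hmain : ∀ m, ∫⁻ x in E m, ‖u x‖ₑ ^ q ∂(hmeas n) ≤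
      C ^ (q / q') * ∫⁻ x, ‖f x‖ₑ ^ q ∂(hmeas n) := by
    intro m
    set J := ∫⁻ x in E m, ‖u x‖ₑ ^ q ∂(hmeas n) with hJ
    set h0 : Pt n → 𝕜 := fun x => u x * ((‖u x‖ ^ (q - 2) : ℝ) : 𝕜) with hh0
    have hh0m : StronglyMeasurable h0 :=
      hum.mul (RCLike.continuous_ofReal.comp_stronglyMeasurable
        (hum.norm.measurable.pow_const _).stronglyMeasurable)
    have hnorm : ∀ x, ‖h0 x‖ = ‖u x‖ ^ (q - 1) := by
      intro x
      rw [hh0, norm_mul, RCLike.norm_ofReal, abs_of_nonneg (by positivity)]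
      rcases eq_or_ne ‖u x‖ 0 with h | h
      · rw [h, zero_mul, Real.zero_rpow (by linarith)]
      · rw [← Real.rpow_one_add' (norm_nonneg _) (by linarith)]
        congr 1; ring
    have hL : MemLp ((E m).indicator h0) 2 (hmeas n) := by
      have : IsFiniteMeasure ((hmeas n).restrict (E m)) :=
        ⟨by rw [Measure.restrict_apply_univ]; exact hEfin m⟩
      rw [memLp_indicator_iff_restrict (hE m)]
      refine MemLp.of_bound hh0m.aestronglyMeasurable ((m : ℝ) ^ (q - 1)) ?_
      filter_upwards [ae_restrict_mem (hE m)] with x hx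
      rw [hnorm]
      exact Real.rpow_le_rpow (norm_nonneg _) hx.2 (by linarith)
    set g := hL.toLp _ with hg
    have hge : ⇑g =ᵐ[hmeas n] (E m).indicator h0 := MemLp.coeFn_toLp _
    have hgq : ∫⁻ x, ‖g x‖ₑ ^ q' ∂(hmeas n) = J := by
      rw [hJ, ← lintegral_indicator (hE m)]
      refine lintegral_congr_ae (hge.mono fun x hx => ?_)
      simp only [hx]
      by_cases hxE : x ∈ E m
      · rw [indicator_of_mem hxE, indicator_of_mem hxE, ← ofReal_norm, hnorm, ← ofReal_norm,
          ENNReal.ofReal_rpow_of_nonneg (by positivity) hq0'.le,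
          ENNReal.ofReal_rpow_of_nonneg (by positivity) hq0.le, ← Real.rpow_mul (norm_nonneg _),
          hqq.sub_one_mul_conj]
      · rw [indicator_of_notMem hxE, indicator_of_notMem hxE, enorm_zero,
          ENNReal.zero_rpow_of_pos hq0']
    have hJfin : J ≠ ∞ := by
      have : J ≤ ∫⁻ _x in E m, ENNReal.ofReal ((m : ℝ) ^ q) ∂(hmeas n) := by
        refine setLIntegral_mono' (hE m) fun x hx => ?_
        rw [← ofReal_norm, ENNReal.ofReal_rpow_of_nonneg (norm_nonneg _) hq0.le]
        exact ENNReal.ofReal_le_ofReal (Real.rpow_le_rpow (norm_nonneg _) hx.2 hq0.le)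
      rw [setLIntegral_const] at this
      exact ne_top_of_le_ne_top (ENNReal.mul_ne_top ENNReal.ofReal_ne_top (hEfin m).ne) this
    have hpair : J = ‖(inner 𝕜 g (S f) : 𝕜)‖ₑ := by
      have e : (inner 𝕜 g (S f) : 𝕜) = ((∫ x in E m, ‖u x‖ ^ q ∂(hmeas n) : ℝ) : 𝕜) := by
        rw [L2.inner_def, ← integral_ofReal, ← integral_indicator (hE m)]
        refine integral_congr_ae (hge.mono fun x hx => ?_)
        simp only [hx]
        by_cases hxE : x ∈ E m
        · have hpos : 0 < ‖u x‖ := lt_of_lt_of_le (by positivity) hxE.1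
          rw [indicator_of_mem hxE, indicator_of_mem hxE, RCLike.inner_apply, hh0]
          simp only [map_mul, RCLike.conj_ofReal]
          rw [← mul_assoc, ← hu, RCLike.mul_conj, ← RCLike.ofReal_pow, ← RCLike.ofReal_mul]
          congr 1
          rw [← Real.rpow_natCast, ← Real.rpow_add hpos]
          congr 1; push_cast; ring
        · simp [indicator_of_notMem hxE]
      have hnn : 0 ≤ ∫ x in E m, ‖u x‖ ^ q ∂(hmeas n) := integral_nonneg fun _ => by positivity
      rw [e, ← ofReal_norm, RCLike.norm_ofReal, abs_of_nonneg hnn,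
        integral_eq_lintegral_of_nonneg_ae (.of_forall fun _ => by positivity)
        (hum.norm.measurable.pow_const _).aestronglyMeasurable]
      have e2 : ∀ x, ENNReal.ofReal (‖u x‖ ^ q) = ‖u x‖ₑ ^ q := fun x => by
        rw [← ofReal_norm, ENNReal.ofReal_rpow_of_nonneg (norm_nonneg _) hq0.le]
      simp_rw [e2]
      rw [ENNReal.ofReal_toReal hJfin]
    have hle : J ≤ (C * J) ^ (1 / q') * (∫⁻ x, ‖f x‖ₑ ^ q ∂(hmeas n)) ^ (1 / q) := by
      calc J = ‖(inner 𝕜 (ContinuousLinearMap.adjoint S g) f : 𝕜)‖ₑ := by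
            rw [hpair, ContinuousLinearMap.adjoint_inner_left]
        _ ≤ ∫⁻ x, ‖ContinuousLinearMap.adjoint S g x‖ₑ * ‖f x‖ₑ ∂(hmeas n) := by
            rw [L2.inner_def]
            refine (enorm_integral_le_lintegral_enorm _).trans (lintegral_mono fun x => ?_)
            rw [RCLike.inner_apply, enorm_mul, RCLike.enorm_conj, mul_comm]
        _ ≤ (∫⁻ x, ‖ContinuousLinearMap.adjoint S g x‖ₑ ^ q' ∂(hmeas n)) ^ (1 / q') *
              (∫⁻ x, ‖f x‖ₑ ^ q ∂(hmeas n)) ^ (1 / q) :=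
            ENNReal.lintegral_mul_le_Lp_mul_Lq _ hqq.symm
              (Lp.stronglyMeasurable _).measurable.enorm.aemeasurable
              (Lp.stronglyMeasurable _).measurable.enorm.aemeasurable
        _ ≤ _ := by
            gcongr
            rw [← hgq]
            exact h g
    rcases eq_or_ne J 0 with hJ0 | hJ0
    · rw [hJ0]; exact bot_le
    -- J is now finite and nonzero, so its power 1/q' can be cancelled from both sides of the Hölder
    -- bound.
    have hsplit : J = J ^ (1 / q') * J ^ (1 / q) := by
      rw [← ENNReal.rpow_add _ _ hJ0 hJfin, one_div, one_div, hqq.symm.inv_add_inv_eq_one,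
        ENNReal.rpow_one]
    have h5 : J ^ (1 / q) ≤ C ^ (1 / q') * (∫⁻ x, ‖f x‖ₑ ^ q ∂(hmeas n)) ^ (1 / q) := by
      have hJ1 : J ^ (1 / q') ≠ 0 := by
        simp [ENNReal.rpow_eq_zero_iff, hJ0, hJfin]
      have hJ2 : J ^ (1 / q') ≠ ∞ := ENNReal.rpow_ne_top_of_nonneg (by positivity) hJfin
      rw [← ENNReal.mul_le_mul_iff_right hJ1 hJ2, ← hsplit]
      refine hle.trans (le_of_eq ?_)
      rw [ENNReal.mul_rpow_of_nonneg _ _ (by positivity)]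
      ring
    have h6 := ENNReal.rpow_le_rpow h5 hq0.le
    rw [ENNReal.mul_rpow_of_nonneg _ _ hq0.le, ← ENNReal.rpow_mul, ← ENNReal.rpow_mul,
      ← ENNReal.rpow_mul, one_div_mul_cancel hq0.ne', ENNReal.rpow_one, ENNReal.rpow_one] at h6
    rwa [show 1 / q' * q = q / q' by ring] at h6
  have hmono : Monotone E := by
    intro a b hab x hx
    have : (a : ℝ) ≤ b := by exact_mod_cast hab
    refine ⟨le_trans ?_ hx.1, hx.2.trans this⟩
    gcongr
  have hU : ∀ x, u x ≠ 0 → x ∈ ⋃ m, E m := by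
    intro x hx
    have e1 : ∀ᶠ m : ℕ in atTop, 1 / ((m : ℝ) + 1) < ‖u x‖ :=
      (tendsto_one_div_add_atTop_nhds_zero_nat (𝕜 := ℝ)).eventually_lt_const (norm_pos_iff.2 hx)
    obtain ⟨m, h1, h2⟩ := (e1.and (eventually_ge_atTop ⌈‖u x‖⌉₊)).exists
    exact mem_iUnion.2 ⟨m, h1.le, (Nat.le_ceil _).trans (Nat.cast_le.2 h2)⟩
  calc ∫⁻ x, ‖u x‖ₑ ^ q ∂(hmeas n) = ∫⁻ x in ⋃ m, E m, ‖u x‖ₑ ^ q ∂(hmeas n) := by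
        rw [← lintegral_indicator (MeasurableSet.iUnion hE)]
        refine lintegral_congr fun x => ?_
        by_cases hx : u x = 0
        · simp [indicator, hx, hq0]
        · rw [indicator_of_mem (hU x hx)]
    _ = ⨆ m, ∫⁻ x in E m, ‖u x‖ₑ ^ q ∂(hmeas n) := by
        rw [setLIntegral_iUnion_of_directed _ hmono.directed_le]
    _ ≤ _ := iSup_le hmain

/-- Causal Calderón–Zygmund operators are bounded on `L_q`, for all `1 < q < ∞`. -/
theorem strong_type (n : ℕ) (γ A B : ℝ) (h0 : 0 < γ) (h1 : γ ≤ 1) {q : ℝ} (hq : 1 < q) :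
    ∃ C : ℝ≥0, ∀ (σ : ℝ) (k : Pt n → Pt n → 𝕜) (S : Lp 𝕜 2 (hmeas n) →L[𝕜] Lp 𝕜 2 (hmeas n)),
      IsCZKernel γ A k → HasKernel S (causalKernel σ k) → ‖S‖ ≤ B → ∀ f : Lp 𝕜 2 (hmeas n),
        ∫⁻ x, ‖S f x‖ₑ ^ q ∂(hmeas n) ≤ C * ∫⁻ x, ‖f x‖ₑ ^ q ∂(hmeas n) := by
  rcases lt_trichotomy q 2 with h2 | rfl | h2
  · obtain ⟨C, hC⟩ := RoughKernel.strong_type_lt_two (𝕜 := 𝕜) (n := n) h0 (2 ^ (n + 1) * A)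
      B.toNNReal hq h2
    exact ⟨C, fun σ k S hk hS hB f =>
      hC _ S (hk.roughKernel h0 h1 σ) hS (eLpNorm_apply_le hB) f⟩
  · refine ⟨B.toNNReal ^ 2, fun σ k S hk hS hB f => ?_⟩
    have h := eLpNorm_apply_le hB f
    have h3 := pow_le_pow_left' h 2
    rw [mul_pow, eLpNorm_two_sq_eq_lintegral, eLpNorm_two_sq_eq_lintegral] at h3
    simpa using h3
  -- For q > 2 the conjugate exponent lies in (1, 2), where the bound is applied to the adjoint,
  -- causal with reversed direction and with the same constants.
  · have hqq := Real.HolderConjugate.conjExponent hq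
    have hq'1 : 1 < q.conjExponent := hqq.symm.lt
    have hq'2 : q.conjExponent < 2 := by
      rw [Real.conjExponent, div_lt_iff₀ (by linarith)]
      linarith
    obtain ⟨C, hC⟩ := RoughKernel.strong_type_lt_two (𝕜 := 𝕜) (n := n) h0 (2 ^ (n + 1) * A)
      B.toNNReal hq'1 hq'2
    refine ⟨(C + 1) ^ (q / q.conjExponent), fun σ k S hk hS hB f => ?_⟩
    rw [ENNReal.coe_rpow_of_nonneg _ (by have := hqq.symm.pos; positivity)]
    refine lintegral_rpow_le_of_adjoint hqq h2 S (fun g => ?_) f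
    have hadj := hS.adjoint (hk.roughKernel h0 h1 σ)
    have hker : (fun x y => (starRingEnd 𝕜) (causalKernel σ k y x)) =
        causalKernel (-σ) (fun x y => (starRingEnd 𝕜) (k y x)) := by
      ext x y
      rw [causalKernel_conj]
    rw [hker] at hadj
    refine (hC _ _ (hk.conj.roughKernel h0 h1 (-σ)) hadj (eLpNorm_apply_le ?_) g).trans ?_
    · rwa [LinearIsometryEquiv.norm_map]
    · gcongr
      simp

end StrongType

end CausalCZO

namespace CausalCZO

open Filter Topology Metric

/-! ### Extension by density -/

section Extend

variable {𝕜 : Type*} [RCLike 𝕜] {α : Type*} [MeasurableSpace α] {μ : Measure α}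

/-- The functions in `L_2 ∩ L_r`. -/
noncomputable def interSubmodule (𝕜 : Type*) [RCLike 𝕜] (μ : Measure α) (r : ℝ≥0∞) :
    Submodule 𝕜 (Lp 𝕜 2 μ) where
  carrier := {f | MemLp f r μ}
  add_mem' {f g} hf hg := (MemLp.add hf hg).ae_eq (Lp.coeFn_add f g).symm
  zero_mem' := (MemLp.zero (ε := 𝕜)).ae_eq (Lp.coeFn_zero 𝕜 2 μ).symm
  smul_mem' c f hf := (MemLp.const_smul hf c).ae_eq (Lp.coeFn_smul c f).symm

/-- The part in `L_r` of a linear operator on `L_2` that preserves `L_2 ∩ L_r`. -/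
noncomputable def interMap {r : ℝ≥0∞} (L : interSubmodule 𝕜 μ r →ₗ[𝕜] Lp 𝕜 2 μ)
    (h : ∀ f, MemLp (L f) r μ) : interSubmodule 𝕜 μ r →ₗ[𝕜] Lp 𝕜 r μ where
  toFun f := (h f).toLp _
  map_add' f g := by
    rw [← MemLp.toLp_add]
    exact MemLp.toLp_congr _ _ (by rw [map_add]; exact Lp.coeFn_add _ _)
  map_smul' c f := by
    rw [RingHom.id_apply, ← MemLp.toLp_const_smul]
    exact MemLp.toLp_congr _ _ (by rw [map_smul]; exact Lp.coeFn_smul _ _)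

lemma memLp_two_of_norm_le {r : ℝ≥0∞} (hr0 : 1 ≤ r) (hr : r ≤ 2) {f : α → 𝕜} (hf : MemLp f r μ)
    {m : ℝ} (hm : ∀ᵐ x ∂μ, ‖f x‖ ≤ m) : MemLp f 2 μ := by
  have hrt : r ≠ ∞ := ne_top_of_le_ne_top (by simp) hr
  have hr' : r ≠ 0 := (zero_lt_one.trans_le hr0).ne'
  have h2 : r.toReal ≤ 2 := by simpa using ENNReal.toReal_mono (by simp) hr
  have h0 : 0 ≤ r.toReal := ENNReal.toReal_nonneg
  refine ⟨hf.1, ?_⟩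
  have h1 := lintegral_rpow_enorm_lt_top_of_eLpNorm_lt_top hr' hrt hf.2
  rw [eLpNorm_lt_top_iff_lintegral_rpow_enorm_lt_top (by simp) (by simp)]
  calc ∫⁻ x, ‖f x‖ₑ ^ (2 : ℝ≥0∞).toReal ∂μ
      ≤ ∫⁻ x, ENNReal.ofReal m ^ (2 - r.toReal) * ‖f x‖ₑ ^ r.toReal ∂μ := by
        refine lintegral_mono_ae (hm.mono fun x hx => ?_)
        have e : (2 : ℝ≥0∞).toReal = (2 - r.toReal) + r.toReal := by simp
        rw [e, ENNReal.rpow_add_of_nonneg _ _ (by linarith) h0]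
        refine mul_le_mul' (ENNReal.rpow_le_rpow ?_ (by linarith)) le_rfl
        rw [← ofReal_norm]
        exact ENNReal.ofReal_le_ofReal hx
    _ = ENNReal.ofReal m ^ (2 - r.toReal) * ∫⁻ x, ‖f x‖ₑ ^ r.toReal ∂μ :=
        lintegral_const_mul' _ _ (by have : 0 ≤ 2 - r.toReal := by linarith
                                     finiteness)
    _ < ∞ := ENNReal.mul_lt_top (by have : 0 ≤ 2 - r.toReal := by linarith
                                    finiteness) h1

/-- Cutting g to the set where |g| ≤ j lands in L_2 because r ≤ 2. The truncations are dominated by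
|g|, so a single sequence serves every other norm as well. -/
lemma exists_truncation {r : ℝ≥0∞} [Fact (1 ≤ r)] (hr : r ≤ 2) (g : Lp 𝕜 r μ) :
    ∃ (u : ℕ → Lp 𝕜 2 μ) (hu : ∀ j, MemLp (u j) r μ),
      (∀ j, ∀ᵐ x ∂μ, ‖u j x‖ ≤ ‖g x‖) ∧ (∀ᵐ x ∂μ, Tendsto (fun j => u j x) atTop (𝓝 (g x))) ∧
      Tendsto (fun j => (hu j).toLp _) atTop (𝓝 g) := by
  have hrt : r ≠ ∞ := ne_top_of_le_ne_top (by simp) hr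
  have hm : ∀ j : ℕ, MeasurableSet {x | ‖g x‖ ≤ j} := fun j =>
    measurableSet_le (Lp.stronglyMeasurable g).measurable.norm measurable_const
  have hi : ∀ j : ℕ, MemLp ({x | ‖g x‖ ≤ j}.indicator g) r μ := fun j =>
    (Lp.memLp g).indicator (hm j)
  have h2 : ∀ j : ℕ, MemLp ({x | ‖g x‖ ≤ j}.indicator g) 2 μ := fun j =>
    memLp_two_of_norm_le Fact.out hr (hi j) (m := j) (.of_forall fun x => by
      by_cases hx : ‖g x‖ ≤ j <;> simp [indicator, hx])
  have he : ∀ j, ⇑((h2 j).toLp _) =ᵐ[μ] {x | ‖g x‖ ≤ j}.indicator g := fun j =>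
    MemLp.coeFn_toLp _
  have hev : ∀ x, ∀ᶠ j : ℕ in atTop, ‖g x‖ ≤ j := fun x => by
    filter_upwards [eventually_ge_atTop ⌈‖g x‖⌉₊] with j hj
    exact (Nat.le_ceil _).trans (Nat.cast_le.2 hj)
  refine ⟨fun j => (h2 j).toLp _, fun j => (hi j).ae_eq (he j).symm, fun j => ?_, ?_, ?_⟩
  · filter_upwards [he j] with x hx
    rw [hx]
    by_cases hx : ‖g x‖ ≤ j <;> simp [indicator, hx]
  · filter_upwards [ae_all_iff.2 he] with x hx
    refine tendsto_const_nhds.congr' ?_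
    filter_upwards [hev x] with j hj
    rw [hx, indicator_of_mem (show x ∈ {x | ‖g x‖ ≤ j} from hj)]
  · have := tendsto_toLp_indicator hrt (Lp.memLp g) hm (.of_forall fun x =>
      (hev x).mono fun j hj => Or.inl hj)
    rw [Lp.toLp_coeFn] at this
    refine this.congr fun j => ?_
    exact MemLp.toLp_congr _ _ (he j).symm

/-- An operator on `L_2` that is bounded in `L_r` norm extends to `L_r`. -/
lemma exists_Lp_extension {r : ℝ≥0∞} [Fact (1 ≤ r)] (hr : r ≤ 2) (C : ℝ≥0)
    (S : Lp 𝕜 2 μ →L[𝕜] Lp 𝕜 2 μ)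
    (h : ∀ f : Lp 𝕜 2 μ, eLpNorm (S f) r μ ≤ C * eLpNorm f r μ) :
    ∃ R : Lp 𝕜 r μ →L[𝕜] Lp 𝕜 r μ, ∀ (f : Lp 𝕜 2 μ) (hf : MemLp f r μ),
      R (hf.toLp f) =ᵐ[μ] S f := by
  set V := interSubmodule 𝕜 μ r
  have hS : ∀ f : V, MemLp ((S.toLinearMap ∘ₗ V.subtype) f) r μ := fun f =>
    ⟨Lp.aestronglyMeasurable _, (h f.1).trans_lt (ENNReal.mul_lt_top ENNReal.coe_lt_top f.2.2)⟩
  set F := interMap (S.toLinearMap ∘ₗ V.subtype) hS with hF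
  set e := interMap (r := r) V.subtype (fun f => f.2) with he
  have hd : DenseRange e := by
    intro g
    obtain ⟨u, hu, -, -, h3⟩ := exists_truncation hr g
    exact mem_closure_of_tendsto h3 (.of_forall fun j => ⟨⟨u j, hu j⟩, rfl⟩)
  have hb : ∀ f, ‖F f‖ ≤ C * ‖e f‖ := by
    intro f
    have hf : MemLp f.1 r μ := f.2
    change ‖(hS f).toLp _‖ ≤ C * ‖hf.toLp _‖
    rw [Lp.norm_toLp, Lp.norm_toLp, ← ENNReal.coe_toReal, ← ENNReal.toReal_mul]
    exact ENNReal.toReal_mono (ENNReal.mul_ne_top ENNReal.coe_ne_top f.2.2.ne) (h f.1)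
  refine ⟨F.extendOfNorm e, fun f hf => ?_⟩
  have := LinearMap.extendOfNorm_eq hd ⟨C, hb⟩ ⟨f, hf⟩
  change F.extendOfNorm e (hf.toLp f) = (hS ⟨f, hf⟩).toLp _ at this
  rw [this]
  exact MemLp.coeFn_toLp _

/-- A subsequence of the truncations along which the images also converge almost everywhere. Bounds
and kernel formulas for S pass to the extension through it. -/
lemma exists_seq_tendsto_extension {r : ℝ≥0∞} [Fact (1 ≤ r)] (hr : r ≤ 2)
    {S : Lp 𝕜 2 μ →L[𝕜] Lp 𝕜 2 μ} {R : Lp 𝕜 r μ →L[𝕜] Lp 𝕜 r μ}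
    (hR : ∀ (f : Lp 𝕜 2 μ) (hf : MemLp f r μ), R (hf.toLp f) =ᵐ[μ] S f) (g : Lp 𝕜 r μ) :
    ∃ u : ℕ → Lp 𝕜 2 μ, (∀ j, ∀ᵐ x ∂μ, ‖u j x‖ ≤ ‖g x‖) ∧
      (∀ᵐ x ∂μ, Tendsto (fun j => u j x) atTop (𝓝 (g x))) ∧
      ∀ᵐ x ∂μ, Tendsto (fun j => S (u j) x) atTop (𝓝 (R g x)) := by
  obtain ⟨u, hu, h1, h2, h3⟩ := exists_truncation hr g
  obtain ⟨φ, hφ, h4⟩ := exists_subseq_ae_tendsto ((R.continuous.tendsto g).comp h3)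
  refine ⟨fun j => u (φ j), fun j => h1 _, ?_, ?_⟩
  · filter_upwards [h2] with x hx using hx.comp hφ.tendsto_atTop
  · filter_upwards [h4, ae_all_iff.2 fun j => hR (u j) (hu j)] with x hx hx2
    refine hx.congr fun j => ?_
    exact hx2 _

/-- Fatou's lemma along dominated truncations: an L_q bound for S on L_2 carries over to the
extension on L_r, whether or not g lies in L_2. -/
lemma eLpNorm_extension_le {r : ℝ≥0∞} [Fact (1 ≤ r)] (hr : r ≤ 2)
    {S : Lp 𝕜 2 μ →L[𝕜] Lp 𝕜 2 μ} {R : Lp 𝕜 r μ →L[𝕜] Lp 𝕜 r μ}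
    (hR : ∀ (f : Lp 𝕜 2 μ) (hf : MemLp f r μ), R (hf.toLp f) =ᵐ[μ] S f) {q C : ℝ≥0∞}
    (h : ∀ f : Lp 𝕜 2 μ, eLpNorm (S f) q μ ≤ C * eLpNorm f q μ) (g : Lp 𝕜 r μ) :
    eLpNorm (R g) q μ ≤ C * eLpNorm g q μ := by
  obtain ⟨u, h1, -, h3⟩ := exists_seq_tendsto_extension hr hR g
  refine Lp.eLpNorm_le_of_ae_tendsto (.of_forall fun j => (h (u j)).trans ?_)
    (fun j => Lp.aestronglyMeasurable _) h3
  exact mul_le_mul' le_rfl (eLpNorm_mono_ae (h1 j))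

end Extend

/-! ### Kernel representation of the extension -/

section Represent

variable {𝕜 : Type*} [RCLike 𝕜] {n : ℕ}

lemma integrable_of_isBounded {p : ℝ≥0∞} (hp : 1 ≤ p) {g : Pt n → 𝕜} (hg : MemLp g p (hmeas n))
    {E : Set (Pt n)} (hE : IsClosed E) (hb : Bornology.IsBounded E)
    (hf : ∀ᵐ y ∂(hmeas n), y ∉ E → g y = 0) : Integrable g (hmeas n) := by
  have h1 : IntegrableOn g E (hmeas n) := by
    have : IsFiniteMeasure ((hmeas n).restrict E) :=
      ⟨by rw [Measure.restrict_apply_univ]; exact hb.measure_lt_top⟩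
    exact (hg.restrict E).integrable hp
  rw [← integrable_indicator_iff hE.measurableSet] at h1
  refine h1.congr ?_
  filter_upwards [hf] with y hy
  by_cases hyE : y ∈ E
  · rw [indicator_of_mem hyE]
  · rw [indicator_of_notMem hyE, hy hyE]

/-- Dominated convergence along the truncations: away from E the kernel is bounded on E, and |g| is
an integrable majorant. -/
lemma HasKernel.extension_apply {γ A : ℝ} {K : Pt n → Pt n → 𝕜} (hK : RoughKernel γ A K)
    {S : Lp 𝕜 2 (hmeas n) →L[𝕜] Lp 𝕜 2 (hmeas n)} (hS : HasKernel S K)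
    {r : ℝ≥0∞} [Fact (1 ≤ r)] (hr : r ≤ 2) {R : Lp 𝕜 r (hmeas n) →L[𝕜] Lp 𝕜 r (hmeas n)}
    (hR : ∀ (f : Lp 𝕜 2 (hmeas n)) (hf : MemLp f r (hmeas n)), R (hf.toLp f) =ᵐ[hmeas n] S f)
    {E : Set (Pt n)} (hE : IsClosed E) (hb : Bornology.IsBounded E) (g : Lp 𝕜 r (hmeas n))
    (hg : ∀ᵐ y ∂(hmeas n), y ∉ E → g y = 0) :
    ∀ᵐ x ∂(hmeas n), x ∉ E → R g x = ∫ y, K x y * g y ∂(hmeas n) := by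
  obtain ⟨u, h1, h2, h3⟩ := exists_seq_tendsto_extension hr hR g
  have hgi := integrable_of_isBounded Fact.out (Lp.memLp g) hE hb hg
  have hu0 : ∀ j, ∀ᵐ y ∂(hmeas n), y ∉ E → u j y = 0 := fun j => by
    filter_upwards [h1 j, hg] with y hy hy2 hyE
    rw [hy2 hyE, norm_zero] at hy
    exact norm_le_zero_iff.1 hy
  filter_upwards [h3, ae_all_iff.2 fun j => hS.apply_of_isBounded hK hE hb (u j) (hu0 j)]
    with x hx1 hx2 hxE
  obtain ⟨δ, hδ, hd⟩ := exists_dist_ge_of_notMem hE hxE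
  refine tendsto_nhds_unique hx1 ?_
  simp_rw [fun j => hx2 j hxE]
  refine tendsto_integral_of_dominated_convergence (fun y => A * δ ^ (-((n : ℝ) + 1)) * ‖g y‖)
    (fun j => ((hK.measurable_right x).mul (Lp.stronglyMeasurable _).measurable).aestronglyMeasurable)
    (hgi.norm.const_mul _) (fun j => ?_) ?_
  · filter_upwards [h1 j, hg] with y hy hy2
    rw [norm_mul]
    by_cases hyE : y ∈ E
    · have hA := hK.nonneg
      exact mul_le_mul (hK.norm_le hδ (hd y hyE)) hy (norm_nonneg _) (by positivity)
    · rw [hy2 hyE, norm_zero] at hy ⊢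
      rw [norm_le_zero_iff.1 hy]
      simp
  · filter_upwards [h2] with y hy using hy.const_mul _

end Represent

end CausalCZO

namespace CausalCZO

open Filter Topology Metric

/-! ### Extension to locally integrable functions with finite tails -/

section Exhaustion

variable {n : ℕ}

/-- An exhaustion of the half space by compact sets. -/
def exhaustion (n m : ℕ) : Set (Pt n) := closedBall 0 m ∩ aboveHeight n m

lemma isCompact_exhaustion (m : ℕ) : IsCompact (exhaustion n m) :=
  (isCompact_closedBall _ _).inter_right (isClosed_aboveHeight m)

lemma measurableSet_exhaustion (m : ℕ) : MeasurableSet (exhaustion n m) :=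
  (isCompact_exhaustion m).measurableSet

lemma exhaustion_subset (m : ℕ) : exhaustion n m ⊆ halfSpace n :=
  inter_subset_right.trans (aboveHeight_subset m)

lemma exhaustion_mono : Monotone (exhaustion n) := by
  intro a b hab x hx
  have h : (a : ℝ) ≤ b := by exact_mod_cast hab
  refine ⟨closedBall_subset_closedBall h hx.1, ?_⟩
  have h1 : 1 / ((a : ℝ) + 1) ≤ x.1 := hx.2
  have h2 : 1 / ((b : ℝ) + 1) ≤ 1 / ((a : ℝ) + 1) := by gcongr
  exact h2.trans h1

/-- A bounded set at positive height is contained in a member of the exhaustion. -/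
lemma exists_subset_exhaustion {E : Set (Pt n)} (hb : Bornology.IsBounded E) {δ : ℝ} (hδ : 0 < δ)
    (h : ∀ y ∈ E, δ ≤ y.1) : ∃ m, E ⊆ exhaustion n m := by
  obtain ⟨ρ, hρ⟩ := hb.subset_closedBall 0
  have e1 := (tendsto_one_div_add_atTop_nhds_zero_nat (𝕜 := ℝ)).eventually_lt_const hδ
  obtain ⟨m, h1, h2⟩ := (e1.and (eventually_ge_atTop ⌈ρ⌉₊)).exists
  refine ⟨m, fun y hy => ⟨closedBall_subset_closedBall ?_ (hρ hy), ?_⟩⟩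
  · exact (Nat.le_ceil _).trans (Nat.cast_le.2 h2)
  · exact h1.le.trans (h y hy)

lemma exists_mem_interior_exhaustion {x : Pt n} (hx : x ∈ halfSpace n) :
    ∃ m, x ∈ interior (exhaustion n m) := by
  have hx : 0 < x.1 := hx
  obtain ⟨m, hm⟩ := exists_subset_exhaustion (E := ball x (x.1 / 2)) isBounded_ball
    (δ := x.1 / 2) (by positivity) (fun y hy => by
      have h1 : |y.1 - x.1| ≤ dist y x := by
        rw [← Real.dist_eq]; exact le_max_left _ _
      have h2 := mem_ball.1 hy
      have := (abs_lt.1 (h1.trans_lt h2)).1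
      linarith)
  exact ⟨m, interior_maximal hm isOpen_ball (mem_ball_self (by positivity))⟩

lemma eventually_mem_exhaustion {x : Pt n} (hx : x ∈ halfSpace n) :
    ∀ᶠ m in atTop, x ∈ exhaustion n m := by
  obtain ⟨m, hm⟩ := exists_mem_interior_exhaustion hx
  filter_upwards [eventually_ge_atTop m] with k hk using exhaustion_mono hk (interior_subset hm)

end Exhaustion

/-! ### Limits along compact truncations -/

section TruncLimit

variable {𝕜 : Type*} [RCLike 𝕜] {n : ℕ} {r : ℝ≥0∞} [Fact (1 ≤ r)]

/-- `g` is the almost everywhere limit of the images under `R` of the truncations of `f`. -/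
def IsTruncLimit (R : Lp 𝕜 r (hmeas n) →L[𝕜] Lp 𝕜 r (hmeas n)) (f g : Pt n →ₘ[hmeas n] 𝕜) :
    Prop :=
  ∃ hm : ∀ m, MemLp ((exhaustion n m).indicator f) r (hmeas n),
    ∀ᵐ x ∂(hmeas n), Tendsto (fun m => R ((hm m).toLp _) x) atTop (𝓝 (g x))

variable {R : Lp 𝕜 r (hmeas n) →L[𝕜] Lp 𝕜 r (hmeas n)} {f f' g g' : Pt n →ₘ[hmeas n] 𝕜}

lemma IsTruncLimit.unique (h : IsTruncLimit R f g) (h' : IsTruncLimit R f g') : g = g' := by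
  obtain ⟨hm, h⟩ := h
  obtain ⟨hm', h'⟩ := h'
  apply AEEqFun.ext
  filter_upwards [h, h'] with x hx hx'
  exact tendsto_nhds_unique hx hx'

lemma IsTruncLimit.add (h : IsTruncLimit R f g) (h' : IsTruncLimit R f' g') :
    IsTruncLimit R (f + f') (g + g') := by
  obtain ⟨hm, h⟩ := h
  obtain ⟨hm', h'⟩ := h'
  have e : ∀ m, (exhaustion n m).indicator f + (exhaustion n m).indicator f' =ᵐ[hmeas n]
      (exhaustion n m).indicator ⇑(f + f') := fun m => by
    filter_upwards [AEEqFun.coeFn_add f f'] with x hx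
    by_cases hxE : x ∈ exhaustion n m <;> simp [hxE, hx]
  refine ⟨fun m => ((hm m).add (hm' m)).ae_eq (e m), ?_⟩
  have e2 : ∀ m, R ((((hm m).add (hm' m)).ae_eq (e m)).toLp _) =ᵐ[hmeas n]
      R ((hm m).toLp _) + R ((hm' m).toLp _) := fun m => by
    have : (((hm m).add (hm' m)).ae_eq (e m)).toLp _ = (hm m).toLp _ + (hm' m).toLp _ := by
      rw [← MemLp.toLp_add]
      exact MemLp.toLp_congr _ _ (e m).symm
    rw [this, map_add]
    exact Lp.coeFn_add _ _
  filter_upwards [h, h', ae_all_iff.2 e2, AEEqFun.coeFn_add g g'] with x h1 h2 h3 h4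
  rw [h4]
  exact (h1.add h2).congr fun m => (h3 m).symm

lemma IsTruncLimit.smul (c : 𝕜) (h : IsTruncLimit R f g) : IsTruncLimit R (c • f) (c • g) := by
  obtain ⟨hm, h⟩ := h
  have e : ∀ m, c • (exhaustion n m).indicator f =ᵐ[hmeas n]
      (exhaustion n m).indicator ⇑(c • f) := fun m => by
    filter_upwards [AEEqFun.coeFn_smul c f] with x hx
    by_cases hxE : x ∈ exhaustion n m <;> simp [hxE, hx]
  refine ⟨fun m => ((hm m).const_smul c).ae_eq (e m), ?_⟩
  have e2 : ∀ m, R ((((hm m).const_smul c).ae_eq (e m)).toLp _) =ᵐ[hmeas n]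
      c • R ((hm m).toLp _) := fun m => by
    have : (((hm m).const_smul c).ae_eq (e m)).toLp _ = c • (hm m).toLp _ := by
      rw [← MemLp.toLp_const_smul]
      exact MemLp.toLp_congr _ _ (e m).symm
    rw [this, map_smul]
    exact Lp.coeFn_smul _ _
  filter_upwards [h, ae_all_iff.2 e2, AEEqFun.coeFn_smul c g] with x h1 h3 h4
  rw [h4]
  exact (h1.const_smul c).congr fun m => (h3 m).symm

open Classical in
/-- The extension of `R`: the limit along truncations, where it exists. -/
noncomputable def truncExtension (R : Lp 𝕜 r (hmeas n) →L[𝕜] Lp 𝕜 r (hmeas n))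
    (f : Pt n →ₘ[hmeas n] 𝕜) : Pt n →ₘ[hmeas n] 𝕜 :=
  if h : ∃ g, IsTruncLimit R f g then h.choose else 0

lemma IsTruncLimit.truncExtension_eq (h : IsTruncLimit R f g) : truncExtension R f = g := by
  have h' : ∃ g, IsTruncLimit R f g := ⟨g, h⟩
  rw [truncExtension, dif_pos h']
  exact h'.choose_spec.unique h

lemma memLp_indicator_of_subset_exhaustion {p q : ℝ≥0∞} (hpq : p ≤ q) {f : Pt n → 𝕜}
    (hf : ∀ m, MemLp ((exhaustion n m).indicator f) q (hmeas n)) {E : Set (Pt n)}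
    (hE : MeasurableSet E) {M : ℕ} (hEM : E ⊆ exhaustion n M) :
    MemLp (E.indicator f) p (hmeas n) := by
  have h : MemLp (E.indicator f) q (hmeas n) := by
    have := (hf M).indicator hE
    rwa [indicator_indicator, inter_eq_left.2 hEM] at this
  have : IsFiniteMeasure ((hmeas n).restrict E) :=
    ⟨by rw [Measure.restrict_apply_univ]
        exact (measure_mono hEM).trans_lt (isCompact_exhaustion M).measure_lt_top⟩
  rw [memLp_indicator_iff_restrict hE] at h ⊢
  exact h.mono_exponent hpq

/-- For large m the truncation splits into its parts on E and off E. The first is constant in m. At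
interior points of E the image of the second is the kernel integral, which converges by dominated
convergence as soon as the tail is absolutely finite. This gives both existence and local structure
of the limit. -/
lemma tendsto_apply_truncation {γ A : ℝ} {K : Pt n → Pt n → 𝕜} (hK : RoughKernel γ A K)
    {S : Lp 𝕜 2 (hmeas n) →L[𝕜] Lp 𝕜 2 (hmeas n)} (hS : HasKernel S K) (hr : r ≤ 2)
    (hR : ∀ (f : Lp 𝕜 2 (hmeas n)) (hf : MemLp f r (hmeas n)), R (hf.toLp f) =ᵐ[hmeas n] S f)
    (hf : ∀ m, MemLp ((exhaustion n m).indicator f) r (hmeas n)) {E : Set (Pt n)}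
    (hE : MeasurableSet E) {M : ℕ} (hEM : E ⊆ exhaustion n M) :
    ∀ᵐ z ∂(hmeas n), z ∈ interior E → ∫⁻ y in Eᶜ, ‖K z y‖ₑ * ‖f y‖ₑ ∂(hmeas n) < ∞ →
      Tendsto (fun m => R ((hf m).toLp _) z) atTop
        (𝓝 (R ((memLp_indicator_of_subset_exhaustion le_rfl hf hE hEM).toLp _) z +
          ∫ y in Eᶜ, K z y * f y ∂(hmeas n))) := by
  set hfE := memLp_indicator_of_subset_exhaustion le_rfl hf hE hEM
  have hEm : ∀ m, MeasurableSet (exhaustion n m \ E) := fun m =>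
    (measurableSet_exhaustion m).diff hE
  have hfm : ∀ m, MemLp ((exhaustion n m \ E).indicator f) r (hmeas n) := fun m =>
    memLp_indicator_of_subset_exhaustion le_rfl hf (hEm m) sdiff_subset
  have hdec : ∀ m, M ≤ m → R ((hf m).toLp _) =ᵐ[hmeas n]
      R (hfE.toLp _) + R ((hfm m).toLp _) := fun m hm => by
    have : (hf m).toLp _ = hfE.toLp _ + (hfm m).toLp _ := by
      rw [← MemLp.toLp_add]
      refine MemLp.toLp_congr _ _ (.of_forall fun x => ?_)
      have hsub := hEM.trans (exhaustion_mono (n := n) hm)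
      by_cases hx : x ∈ E
      · simp [hx, hsub hx]
      · by_cases hx2 : x ∈ exhaustion n m <;> simp [hx, hx2, indicator]
    rw [this, map_add]
    exact Lp.coeFn_add _ _
  have hrep : ∀ m, ∀ᵐ z ∂(hmeas n), z ∉ closure (exhaustion n m \ E) →
      R ((hfm m).toLp _) z = ∫ y in exhaustion n m \ E, K z y * f y ∂(hmeas n) := fun m => by
    have e := MemLp.coeFn_toLp (hfm m)
    have := hS.extension_apply hK hr hR isClosed_closure
      ((isCompact_exhaustion m).isBounded.subset sdiff_subset).closure ((hfm m).toLp _) (by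
        filter_upwards [e] with y hy hyE
        rw [hy, indicator_of_notMem fun h => hyE (subset_closure h)])
    filter_upwards [this] with z hz hzE
    rw [hz hzE, ← integral_indicator (hEm m)]
    refine integral_congr_ae (e.mono fun y hy => ?_)
    simp only [hy, indicator]
    split_ifs <;> simp
  filter_upwards [ae_all_iff.2 hrep, ae_all_iff.2 fun m =>
    eventually_imp_distrib_left.2 (hdec m)]
    with z h1 h2 hzE hfin
  have hlim : Tendsto (fun m => ∫ y in exhaustion n m \ E, K z y * f y ∂(hmeas n)) atTop
      (𝓝 (∫ y in Eᶜ, K z y * f y ∂(hmeas n))) := by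
    have hKf : AEStronglyMeasurable (fun y => K z y * f y) (hmeas n) :=
      (hK.measurable_right z).aestronglyMeasurable.mul f.aestronglyMeasurable
    have hint : IntegrableOn (fun y => K z y * f y) Eᶜ (hmeas n) := by
      refine ⟨hKf.restrict, ?_⟩
      rw [HasFiniteIntegral]
      simpa [enorm_mul] using hfin
    simp_rw [← integral_indicator (hEm _)]
    rw [← integral_indicator hE.compl]
    refine tendsto_integral_of_dominated_convergence
      (fun y => ‖Eᶜ.indicator (fun y => K z y * f y) y‖) (fun m => hKf.indicator (hEm m))
      ((integrable_indicator_iff hE.compl).2 hint).norm (fun m => .of_forall fun y => ?_) ?_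
    · by_cases hy : y ∈ E <;> by_cases hy2 : y ∈ exhaustion n m <;> simp [hy, hy2] <;>
        positivity
    · filter_upwards [ae_mem_halfSpace] with y hy
      refine tendsto_const_nhds.congr' ?_
      filter_upwards [eventually_mem_exhaustion hy] with m hm
      by_cases hy : y ∈ E <;> simp [hy, hm]
  refine (hlim.const_add _).congr' ?_
  filter_upwards [eventually_ge_atTop M] with m hm
  rw [h2 m hm, Pi.add_apply, h1 m]
  intro hcl
  have : closure (exhaustion n m \ E) ⊆ (interior E)ᶜ := by
    rw [← closure_compl]
    exact closure_mono fun y hy => hy.2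
  exact this hcl hzE

/-- `f` has a finite tail against `K` at the point `z`. -/
def FiniteTail (K : Pt n → Pt n → 𝕜) (f : Pt n → 𝕜) (z : Pt n) : Prop :=
  ∃ M, z ∈ interior (exhaustion n M) ∧
    ∫⁻ y in (exhaustion n M)ᶜ, ‖K z y‖ₑ * ‖f y‖ₑ ∂(hmeas n) < ∞

/-- A finite tail relative to a single member of the exhaustion forces convergence at the point, and
almost everywhere limits of measurable functions are measurable. -/
lemma exists_isTruncLimit {γ A : ℝ} {K : Pt n → Pt n → 𝕜} (hK : RoughKernel γ A K)
    {S : Lp 𝕜 2 (hmeas n) →L[𝕜] Lp 𝕜 2 (hmeas n)} (hS : HasKernel S K) (hr : r ≤ 2)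
    (hR : ∀ (f : Lp 𝕜 2 (hmeas n)) (hf : MemLp f r (hmeas n)), R (hf.toLp f) =ᵐ[hmeas n] S f)
    (hf : ∀ m, MemLp ((exhaustion n m).indicator f) r (hmeas n))
    (ht : ∀ᵐ z ∂(hmeas n), FiniteTail K f z) : ∃ g, IsTruncLimit R f g := by
  have h : ∀ᵐ z ∂(hmeas n), ∃ l, Tendsto (fun m => R ((hf m).toLp _) z) atTop (𝓝 l) := by
    filter_upwards [ht, ae_all_iff.2 fun M => tendsto_apply_truncation hK hS hr hR hf
      (measurableSet_exhaustion M) (M := M) subset_rfl] with z hz hz2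
    obtain ⟨M, h1, h2⟩ := hz
    exact ⟨_, hz2 M h1 h2⟩
  obtain ⟨G, hG, hlim⟩ := exists_stronglyMeasurable_limit_of_tendsto_ae
    (fun m => Lp.aestronglyMeasurable (R ((hf m).toLp _))) h
  refine ⟨AEEqFun.mk G hG.aestronglyMeasurable, hf, ?_⟩
  filter_upwards [hlim, AEEqFun.coeFn_mk G hG.aestronglyMeasurable] with z h1 h2
  rwa [h2]

/-- Hölder's inequality: away from z the kernel lies in L_{q'}, because (n+1)q' > n+1. -/
lemma finiteTail_of_memLp {γ A : ℝ} {K : Pt n → Pt n → 𝕜} (hK : RoughKernel γ A K) {q : ℝ}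
    (hq : 1 < q) {f : Pt n → 𝕜} (hf : MemLp f (ENNReal.ofReal q) (hmeas n)) {z : Pt n}
    (hz : z ∈ halfSpace n) : FiniteTail K f z := by
  obtain ⟨M, hM⟩ := exists_mem_interior_exhaustion hz
  refine ⟨M, hM, ?_⟩
  obtain ⟨δ, hδ, hd⟩ := Metric.isOpen_iff.1 isOpen_interior z hM
  have hqq := Real.HolderConjugate.conjExponent hq
  set q' := q.conjExponent
  have hq0 := hqq.pos
  have hq0' := hqq.symm.pos
  have hn : 0 < (n : ℝ) + 1 := by positivity
  have hb : (n : ℝ) + 1 < ((n : ℝ) + 1) * q' := lt_mul_of_one_lt_right hn hqq.symm.lt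
  obtain ⟨C, hC⟩ := lintegral_dist_rpow_le (n := n) hb
  have hA := hK.nonneg
  have h1 : ∫⁻ y in (exhaustion n M)ᶜ, ‖K z y‖ₑ ^ q' ∂(hmeas n) < ∞ := by
    calc ∫⁻ y in (exhaustion n M)ᶜ, ‖K z y‖ₑ ^ q' ∂(hmeas n)
        ≤ ∫⁻ y in {y | δ ≤ dist y z}, ENNReal.ofReal (A ^ q') *
            ENNReal.ofReal (dist y z ^ (-(((n : ℝ) + 1) * q'))) := by
          refine (lintegral_mono_set (t := {y | δ ≤ dist y z}) fun y hy => ?_).trans ?_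
          · by_contra hcon
            exact hy (interior_subset (hd (mem_ball.2 (not_le.1 hcon))))
          refine (lintegral_mono' (Measure.restrict_mono_measure hmeas_le _) le_rfl).trans ?_
          refine lintegral_mono fun y => ?_
          rw [← ENNReal.ofReal_mul (by positivity), ← ofReal_norm,
            ENNReal.ofReal_rpow_of_nonneg (norm_nonneg _) hq0'.le]
          refine ENNReal.ofReal_le_ofReal ?_
          rw [← neg_mul, Real.rpow_mul dist_nonneg, ← Real.mul_rpow hA (by positivity),
            dist_comm y z]
          exact Real.rpow_le_rpow (norm_nonneg _) (hK.size z y) hq0'.le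
      _ = ENNReal.ofReal (A ^ q') * ∫⁻ y in {y | δ ≤ dist y z},
            ENNReal.ofReal (dist y z ^ (-(((n : ℝ) + 1) * q'))) :=
          lintegral_const_mul' _ _ ENNReal.ofReal_ne_top
      _ < ∞ := ENNReal.mul_lt_top ENNReal.ofReal_lt_top
          ((hC z δ hδ).trans_lt (by finiteness))
  have h2 : ∫⁻ y in (exhaustion n M)ᶜ, ‖f y‖ₑ ^ q ∂(hmeas n) < ∞ := by
    refine (setLIntegral_le_lintegral _ _).trans_lt ?_
    rw [← eLpNorm_rpow_eq_lintegral hq0]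
    exact ENNReal.rpow_lt_top_of_nonneg hq0.le hf.2.ne
  refine (ENNReal.lintegral_mul_le_Lp_mul_Lq _ hqq.symm
    (hK.measurable_right z).enorm.aemeasurable hf.1.enorm.restrict).trans_lt ?_
  exact ENNReal.mul_lt_top (ENNReal.rpow_lt_top_of_nonneg (by positivity) h1.ne)
    (ENNReal.rpow_lt_top_of_nonneg (by positivity) h2.ne)

end TruncLimit

/-! ### The extended operator and its local control -/

section Main

variable {𝕜 : Type*} [RCLike 𝕜] {n : ℕ}

lemma exists_subseq_apply_truncation (S : Lp 𝕜 2 (hmeas n) →L[𝕜] Lp 𝕜 2 (hmeas n))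
    (f : Lp 𝕜 2 (hmeas n)) : ∃ (u : ℕ → Lp 𝕜 2 (hmeas n)) (φ : ℕ → ℕ), StrictMono φ ∧
      (∀ m, ⇑(u m) =ᵐ[hmeas n] (exhaustion n m).indicator (f : Pt n → 𝕜)) ∧
      ∀ᵐ x ∂(hmeas n), Tendsto (fun j => S (u (φ j)) x) atTop (𝓝 (S f x)) := by
  have h3 := tendsto_toLp_indicator (p := 2) (s := exhaustion n) (by simp) (Lp.memLp f)
    measurableSet_exhaustion
    (ae_mem_halfSpace.mono fun x hx => (eventually_mem_exhaustion hx).mono fun _ h => Or.inl h)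
  rw [Lp.toLp_coeFn] at h3
  obtain ⟨φ, hφ, h4⟩ := exists_subseq_ae_tendsto ((S.continuous.tendsto f).comp h3)
  exact ⟨fun m => ((Lp.memLp f).indicator (measurableSet_exhaustion m)).toLp _, φ, hφ,
    fun m => MemLp.coeFn_toLp _, h4⟩

/-- `T` extends the operator `S` with kernel `K` to the space `Y`, boundedly on `L_q`, with
control by the kernel away from the point of evaluation. -/
structure IsCausalExtension (K : Pt n → Pt n → 𝕜) (S : Lp 𝕜 2 (hmeas n) →L[𝕜] Lp 𝕜 2 (hmeas n))
    (q : ℝ) (C : ℝ≥0) (T : (Pt n →ₘ[hmeas n] 𝕜) → (Pt n →ₘ[hmeas n] 𝕜))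
    (Y : Set (Pt n →ₘ[hmeas n] 𝕜)) : Prop where
  map_add : ∀ f ∈ Y, ∀ g ∈ Y, T (f + g) = T f + T g
  map_smul : ∀ (c : 𝕜), ∀ f ∈ Y, T (c • f) = c • T f
  extends_two : ∀ f : Lp 𝕜 2 (hmeas n), T (f : Pt n →ₘ[hmeas n] 𝕜) = (S f : Pt n →ₘ[hmeas n] 𝕜)
  mem_of_memLp : ∀ f : Pt n →ₘ[hmeas n] 𝕜, eLpNorm f (ENNReal.ofReal q) (hmeas n) < ∞ → f ∈ Y
  bound : ∀ f : Pt n →ₘ[hmeas n] 𝕜, eLpNorm f (ENNReal.ofReal q) (hmeas n) < ∞ →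
    eLpNorm (T f) (ENNReal.ofReal q) (hmeas n) ≤ C * eLpNorm f (ENNReal.ofReal q) (hmeas n)
  mem_of_tail : ∀ f : Pt n →ₘ[hmeas n] 𝕜,
    (∀ m, eLpNorm f (ENNReal.ofReal q) ((hmeas n).restrict (exhaustion n m)) < ∞) →
    (∀ᵐ z ∂(hmeas n), FiniteTail K f z) → f ∈ Y
  local_bound : ∀ f ∈ Y,
    (∀ m, eLpNorm f (ENNReal.ofReal q) ((hmeas n).restrict (exhaustion n m)) < ∞) →
    ∀ E : Set (Pt n), MeasurableSet E → ∀ M, E ⊆ exhaustion n M →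
      ∃ h : Pt n → 𝕜, AEStronglyMeasurable h (hmeas n) ∧
        eLpNorm h (ENNReal.ofReal q) (hmeas n) ≤
          C * eLpNorm f (ENNReal.ofReal q) ((hmeas n).restrict E) ∧
        ∀ᵐ z ∂(hmeas n), z ∈ interior E →
          ‖T f z‖ₑ ≤ ‖h z‖ₑ + ∫⁻ y in Eᶜ, ‖K z y‖ₑ * ‖f y‖ₑ ∂(hmeas n)

lemma eLpNorm_le_of_lintegral_rpow_le {α : Type*} [MeasurableSpace α] {μ : Measure α} {q : ℝ}
    (hq : 0 < q) {C : ℝ≥0} {f g : α → 𝕜}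
    (h : ∫⁻ x, ‖f x‖ₑ ^ q ∂μ ≤ C * ∫⁻ x, ‖g x‖ₑ ^ q ∂μ) :
    eLpNorm f (ENNReal.ofReal q) μ ≤ (C ^ (1 / q) : ℝ≥0) * eLpNorm g (ENNReal.ofReal q) μ := by
  rw [← eLpNorm_rpow_eq_lintegral hq, ← eLpNorm_rpow_eq_lintegral hq] at h
  have := ENNReal.rpow_le_rpow h (show 0 ≤ 1 / q by positivity)
  rw [ENNReal.mul_rpow_of_nonneg _ _ (by positivity), ← ENNReal.rpow_mul, ← ENNReal.rpow_mul,
    mul_one_div_cancel hq.ne', ENNReal.rpow_one, ENNReal.rpow_one] at this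
  rwa [ENNReal.coe_rpow_of_nonneg _ (by positivity)]

/-- The truncation limit is built on L_r with r = min(q, 2). Functions locally in L_2 and functions
locally in L_q are both locally in L_r, so a single operator serves L_2, L_q and the larger spaces,
and its values agree on overlaps. The L_q bound for R on L_r comes from S through Fatou's lemma. -/
theorem exists_isCausalExtension (𝕜 : Type*) [RCLike 𝕜] (n : ℕ) (γ A B : ℝ) (h0 : 0 < γ)
    (h1 : γ ≤ 1) {q : ℝ} (hq : 1 < q) :
    ∃ C : ℝ≥0, ∀ (σ : ℝ) (k : Pt n → Pt n → 𝕜) (S : Lp 𝕜 2 (hmeas n) →L[𝕜] Lp 𝕜 2 (hmeas n)),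
      IsCZKernel γ A k → HasKernel S (causalKernel σ k) → ‖S‖ ≤ B →
      ∃ T Y, IsCausalExtension (causalKernel σ k) S q C T Y := by
  have hq0 : 0 < q := by linarith
  set r : ℝ := min q 2 with hrdef
  have hr1 : 1 < r := lt_min hq (by norm_num)
  have hr0 : 0 < r := by linarith
  obtain ⟨C1, hC1⟩ := strong_type (𝕜 := 𝕜) n γ A B h0 h1 hr1
  obtain ⟨C2, hC2⟩ := strong_type (𝕜 := 𝕜) n γ A B h0 h1 hq
  set ρ := ENNReal.ofReal r with hρ
  have hf1 : Fact (1 ≤ ρ) := ⟨by rw [hρ, ENNReal.one_le_ofReal]; exact hr1.le⟩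
  have hρ2 : ρ ≤ 2 := by
    rw [hρ, show (2 : ℝ≥0∞) = ENNReal.ofReal 2 by simp]
    exact ENNReal.ofReal_le_ofReal (min_le_right _ _)
  have hρq : ρ ≤ ENNReal.ofReal q := ENNReal.ofReal_le_ofReal (min_le_left _ _)
  refine ⟨C2 ^ (1 / q), fun σ k S hk hS hB => ?_⟩
  have hK := hk.roughKernel h0 h1 σ
  set K := causalKernel σ k
  obtain ⟨R, hR⟩ := exists_Lp_extension hρ2 (C1 ^ (1 / r)) S fun f =>
    eLpNorm_le_of_lintegral_rpow_le hr0 (hC1 σ k S hk hS hB f)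
  have hRq : ∀ g : Lp 𝕜 ρ (hmeas n), eLpNorm (R g) (ENNReal.ofReal q) (hmeas n) ≤
      (C2 ^ (1 / q) : ℝ≥0) * eLpNorm g (ENNReal.ofReal q) (hmeas n) :=
    eLpNorm_extension_le hρ2 hR fun f =>
      eLpNorm_le_of_lintegral_rpow_le hq0 (hC2 σ k S hk hS hB f)
  have hloc : ∀ {s : ℝ≥0∞} (f : Pt n →ₘ[hmeas n] 𝕜), ρ ≤ s →
      (∀ m, eLpNorm f s ((hmeas n).restrict (exhaustion n m)) < ∞) →
      ∀ m, MemLp ((exhaustion n m).indicator f) ρ (hmeas n) := by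
    intro s f hs hf m
    refine memLp_indicator_of_subset_exhaustion hs (fun m => ?_) (measurableSet_exhaustion m)
      subset_rfl
    rw [memLp_indicator_iff_restrict (measurableSet_exhaustion m)]
    exact ⟨f.aestronglyMeasurable.restrict, hf m⟩
  have hloc' : ∀ {s : ℝ≥0∞} (f : Pt n →ₘ[hmeas n] 𝕜), eLpNorm f s (hmeas n) < ∞ →
      ∀ m, eLpNorm f s ((hmeas n).restrict (exhaustion n m)) < ∞ := fun f hf m =>
    (eLpNorm_mono_measure _ Measure.restrict_le_self).trans_lt hf
  have hY : ∀ {s : ℝ}, 1 < s → ρ ≤ ENNReal.ofReal s → ∀ f : Pt n →ₘ[hmeas n] 𝕜,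
      eLpNorm f (ENNReal.ofReal s) (hmeas n) < ∞ → ∃ g, IsTruncLimit R f g := by
    intro s hs hs2 f hf
    refine exists_isTruncLimit hK hS hρ2 hR (hloc f hs2 (hloc' f hf)) ?_
    filter_upwards [ae_mem_halfSpace] with z hz
    exact finiteTail_of_memLp hK hs ⟨f.aestronglyMeasurable, hf⟩ hz
  refine ⟨truncExtension R, {f | ∃ g, IsTruncLimit R f g}, ?_, ?_, ?_, ?_, ?_, ?_, ?_⟩
  · rintro f ⟨g, hg⟩ f' ⟨g', hg'⟩
    rw [hg.truncExtension_eq, hg'.truncExtension_eq, (hg.add hg').truncExtension_eq]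
  · rintro c f ⟨g, hg⟩
    rw [hg.truncExtension_eq, (hg.smul c).truncExtension_eq]
  · intro f
    have hf2 : eLpNorm (f : Pt n →ₘ[hmeas n] 𝕜) (ENNReal.ofReal 2) (hmeas n) < ∞ := by
      simpa using Lp.eLpNorm_lt_top f
    obtain ⟨g, hg⟩ := hY one_lt_two (by simpa using hρ2) f hf2
    rw [hg.truncExtension_eq]
    obtain ⟨hm, hlim⟩ := hg
    -- The truncations converge in L_2, so their images tend to S f almost everywhere along a
    -- subsequence, and this identifies the full limit.
    obtain ⟨u, φ, hφ, hu, h4⟩ := exists_subseq_apply_truncation S f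
    have h5 : ∀ m, R ((hm m).toLp _) =ᵐ[hmeas n] S (u m) := fun m => by
      have := hR (u m) ((hm m).ae_eq (hu m).symm)
      rwa [MemLp.toLp_congr _ (hm m) (hu m)] at this
    apply AEEqFun.ext
    filter_upwards [hlim, h4, ae_all_iff.2 h5] with x a1 a2 a3
    refine tendsto_nhds_unique (a1.comp hφ.tendsto_atTop) (a2.congr fun m => ?_)
    exact (a3 _).symm
  · exact fun f hf => hY hq hρq f hf
  · intro f hf
    obtain ⟨g, hg⟩ := hY hq hρq f hf
    rw [hg.truncExtension_eq]
    obtain ⟨hm, hlim⟩ := hg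
    refine Lp.eLpNorm_le_of_ae_tendsto (.of_forall fun m => (hRq _).trans ?_)
      (fun m => Lp.aestronglyMeasurable _) hlim
    refine mul_le_mul' le_rfl ?_
    rw [eLpNorm_congr_ae (MemLp.coeFn_toLp (hm m))]
    exact eLpNorm_indicator_le _
  · exact fun f hf ht => exists_isTruncLimit hK hS hρ2 hR (hloc f hρq hf) ht
  · rintro f ⟨g, hg⟩ hf E hE M hEM
    rw [hg.truncExtension_eq]
    obtain ⟨hm, hlim⟩ := hg
    have hfE := memLp_indicator_of_subset_exhaustion le_rfl hm hE hEM
    refine ⟨R (hfE.toLp _), Lp.aestronglyMeasurable _, (hRq _).trans ?_, ?_⟩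
    · refine mul_le_mul' le_rfl ?_
      rw [eLpNorm_congr_ae (MemLp.coeFn_toLp hfE), eLpNorm_indicator_eq_eLpNorm_restrict hE]
    · filter_upwards [hlim, tendsto_apply_truncation hK hS hρ2 hR hm hE hEM] with z a1 a2 hzE
      -- Where the tail is infinite the bound is trivial; elsewhere the limit has the split form.
      rcases eq_top_or_lt_top (∫⁻ y in Eᶜ, ‖K z y‖ₑ * ‖f y‖ₑ ∂(hmeas n)) with ht | ht
      · rw [ht]; simp
      · rw [tendsto_nhds_unique a1 (a2 hzE ht)]
        refine (enorm_add_le _ _).trans (add_le_add le_rfl ?_)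
        refine (enorm_integral_le_lintegral_enorm _).trans (le_of_eq ?_)
        simp_rw [enorm_mul]

end Main

end CausalCZO

namespace CausalCZO

open Filter Topology Metric

/-! ### Whitney averages -/

section Whitney

variable {n : ℕ}

/-- The Whitney region of the point `X = (t, x)`. -/
abbrev whitneyAt (X : Pt n) : Set (Pt n) := Cube.whitney ⟨X.2, X.1⟩

lemma mem_whitneyAt {X y : Pt n} : y ∈ whitneyAt X ↔ (X.1 / 2 < y.1 ∧ y.1 < X.1) ∧
    ∀ i, X.2 i - X.1 / 2 ≤ y.2 i ∧ y.2 i < X.2 i + X.1 / 2 := Iff.rfl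

lemma measurableSet_whitneyAt_prod :
    MeasurableSet {P : Pt n × Pt n | P.2 ∈ whitneyAt P.1} := by
  have : {P : Pt n × Pt n | P.2 ∈ whitneyAt P.1} =
      {P | P.1.1 / 2 < P.2.1} ∩ {P | P.2.1 < P.1.1} ∩ ⋂ i : Fin n,
        ({P | P.1.2 i - P.1.1 / 2 ≤ P.2.2 i} ∩ {P | P.2.2 i < P.1.2 i + P.1.1 / 2}) := by
    ext P
    simp only [mem_ofPred_eq, mem_whitneyAt, mem_inter_iff, mem_iInter]
  rw [this]
  refine ((measurableSet_lt (by fun_prop) (by fun_prop)).inter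
    (measurableSet_lt (by fun_prop) (by fun_prop))).inter (MeasurableSet.iInter fun i =>
    (measurableSet_le (by fun_prop) (by fun_prop)).inter
      (measurableSet_lt (by fun_prop) (by fun_prop)))

lemma measurableSet_whitneyAt (X : Pt n) : MeasurableSet (whitneyAt X) :=
  measurableSet_Ioo.prod (Cube.measurableSet_set _)

lemma volume_whitneyAt {X : Pt n} (hX : 0 < X.1) :
    volume (whitneyAt X) = ENNReal.ofReal (X.1 ^ (n + 1) / 2) := by
  rw [whitneyAt, Cube.whitney, Measure.volume_eq_prod, Measure.prod_prod, Real.volume_Ioo,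
    Cube.volume_set _ hX.le, ← ENNReal.ofReal_mul (by simp only; linarith)]
  congr 1
  simp only
  ring

lemma volume_whitneyAt_ne_zero {X : Pt n} (hX : 0 < X.1) : volume (whitneyAt X) ≠ 0 := by
  rw [volume_whitneyAt hX]
  simp only [ne_eq, ENNReal.ofReal_eq_zero, not_le]
  positivity

lemma volume_whitneyAt_ne_top (X : Pt n) : volume (whitneyAt X) ≠ ∞ := by
  rcases le_or_gt X.1 0 with h | h
  · have : whitneyAt X = ∅ := by
      refine eq_empty_of_forall_notMem fun y hy => ?_
      have := hy.1.1
      have := hy.1.2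
      simp only at *
      linarith
    simp [this]
  · rw [volume_whitneyAt h]; exact ENNReal.ofReal_ne_top

lemma whitneyAt_subset (X : Pt n) : whitneyAt X ⊆ halfSpace n := by
  intro y hy
  obtain ⟨⟨h1, h2⟩, -⟩ := mem_whitneyAt.1 hy
  show 0 < y.1
  linarith

lemma whitneyAt_mem_nhds {X y : Pt n} (h1 : X.1 / 2 < y.1) (h2 : y.1 < X.1)
    (h3 : ∀ i, |y.2 i - X.2 i| < X.1 / 2) : whitneyAt X ∈ 𝓝 y := by
  have e1 : ∀ᶠ z : Pt n in 𝓝 y, X.1 / 2 < z.1 := continuous_fst.continuousAt.eventually_const_lt h1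
  have e2 : ∀ᶠ z : Pt n in 𝓝 y, z.1 < X.1 := continuous_fst.continuousAt.eventually_lt_const h2
  have e3 : ∀ᶠ z : Pt n in 𝓝 y, ∀ i, |z.2 i - X.2 i| < X.1 / 2 := by
    rw [eventually_all]
    intro i
    have : Continuous fun z : Pt n => |z.2 i - X.2 i| := by fun_prop
    exact this.continuousAt.eventually_lt_const (h3 i)
  filter_upwards [e1, e2, e3] with z z1 z2 z3
  refine mem_whitneyAt.2 ⟨⟨z1, z2⟩, fun i => ?_⟩
  have := abs_lt.1 (z3 i)
  constructor <;> linarith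

lemma lqAvg_eq {ε : Type*} [ENorm ε] {q : ℝ} (hq : 0 < q) (E : Set (Pt n)) (f : Pt n → ε) :
    lqAvg q E f = ((volume E)⁻¹ * ∫⁻ y in E, ‖f y‖ₑ ^ q) ^ (1 / q) := by
  rw [lqAvg, eLpNorm_eq_eLpNorm' (by simpa using hq) ENNReal.ofReal_ne_top, eLpNorm',
    ENNReal.toReal_ofReal hq.le, ENNReal.mul_rpow_of_nonneg _ _ (by positivity),
    ENNReal.rpow_neg, ENNReal.inv_rpow]

lemma whitneyAvg_eq {ε : Type*} [ENorm ε] {q : ℝ} (hq : 0 < q) (f : Pt n → ε) (X : Pt n) :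
    whitneyAvg q f X =
      ((volume (whitneyAt X))⁻¹ * ∫⁻ y in whitneyAt X, ‖f y‖ₑ ^ q) ^ (1 / q) := lqAvg_eq hq _ f

lemma whitneyAvg_enorm {ε : Type*} [ENorm ε] {q : ℝ} (hq : 0 < q) (f : Pt n → ε) :
    whitneyAvg q (fun y => ‖f y‖ₑ) = whitneyAvg q f := by
  ext X
  rw [whitneyAvg_eq hq, whitneyAvg_eq hq]
  rfl

lemma measurable_setLIntegral_prod {S : Set (Pt n × Pt n)} (hS : MeasurableSet S)
    {v : Pt n → ℝ≥0∞} (hv : Measurable v) :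
    Measurable fun X => ∫⁻ y in {y | (X, y) ∈ S}, v y := by
  have h : ∀ X, ∫⁻ y in {y | (X, y) ∈ S}, v y = ∫⁻ y, S.indicator (fun P => v P.2) (X, y) :=
    fun X => by
      have hm : MeasurableSet {y | (X, y) ∈ S} := measurable_prodMk_left hS
      rw [← lintegral_indicator hm]
      rfl
  simp_rw [h]
  exact ((hv.comp measurable_snd).indicator hS).lintegral_prod_right'

lemma measurable_whitneyAvg {q : ℝ} (hq : 0 < q) {u : Pt n → ℝ≥0∞} (hu : Measurable u) :
    Measurable (whitneyAvg q u) := by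
  have e : whitneyAvg q u = fun X => ((volume (whitneyAt X))⁻¹ *
      ∫⁻ y in whitneyAt X, u y ^ q) ^ (1 / q) := by
    ext X
    exact whitneyAvg_eq hq u X
  rw [e]
  refine ((Measurable.inv ?_).mul ?_).pow_const _
  · simpa using measurable_setLIntegral_prod (measurableSet_whitneyAt_prod (n := n))
      (v := fun _ => 1) measurable_const
  · exact measurable_setLIntegral_prod measurableSet_whitneyAt_prod (hu.pow_const q)

lemma measurable_volume_whitneyAt : Measurable fun X : Pt n => volume (whitneyAt X) := by
  simpa using measurable_setLIntegral_prod (measurableSet_whitneyAt_prod (n := n))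
    (v := fun _ => 1) measurable_const

lemma measurableSet_setOf_mem_whitneyAt (y : Pt n) : MeasurableSet {X | y ∈ whitneyAt X} :=
  measurable_prodMk_right measurableSet_whitneyAt_prod

lemma lintegral_pt_eq {g : Pt n → ℝ≥0∞} (hg : Measurable g) :
    ∫⁻ X, g X = ∫⁻ t : ℝ, ∫⁻ x : Bd n, g (t, x) :=
  lintegral_prod _ hg.aemeasurable

lemma lqAvg_one_le {q : ℝ} (hq : 1 ≤ q) {E : Set (Pt n)} (h0 : volume E ≠ 0) (h1 : volume E ≠ ∞)
    {u : Pt n → ℝ≥0∞} (hu : Measurable u) : lqAvg 1 E u ≤ lqAvg q E u := by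
  have h := eLpNorm_le_eLpNorm_mul_rpow_measure_univ (μ := volume.restrict E)
    (ENNReal.ofReal_le_ofReal hq) hu.aestronglyMeasurable
  rw [ENNReal.toReal_ofReal zero_le_one, ENNReal.toReal_ofReal (by linarith),
    Measure.restrict_apply_univ] at h
  unfold lqAvg
  calc _ ≤ volume E ^ (-(1 / 1) : ℝ) * (eLpNorm u (ENNReal.ofReal q) (volume.restrict E) *
        volume E ^ (1 / 1 - 1 / q : ℝ)) := mul_le_mul' le_rfl h
    _ = volume E ^ (-(1 / 1) : ℝ) * volume E ^ (1 / 1 - 1 / q : ℝ) *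
        eLpNorm u (ENNReal.ofReal q) (volume.restrict E) := by ring
    _ = _ := by
        rw [← ENNReal.rpow_add _ _ h0 h1]
        congr 2
        ring

lemma whitneyAvg_one_le {q : ℝ} (hq : 1 ≤ q) {u : Pt n → ℝ≥0∞} (hu : Measurable u) {X : Pt n}
    (hX : 0 < X.1) : whitneyAvg 1 u X ≤ whitneyAvg q u X :=
  lqAvg_one_le hq (volume_whitneyAt_ne_zero hX) (volume_whitneyAt_ne_top X) hu

lemma volume_reflected_cube (y : Bd n) {t : ℝ} (ht : 0 ≤ t) :
    volume {x : Bd n | y ∈ (⟨x, t⟩ : Cube n).set} = ENNReal.ofReal (t ^ n) := by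
  have : {x : Bd n | y ∈ (⟨x, t⟩ : Cube n).set} =
      (fun x => y - x) ⁻¹' (⟨0, t⟩ : Cube n).set := by
    ext x
    simp only [Cube.set, mem_ofPred_eq, mem_preimage, PiLp.sub_apply, PiLp.zero_apply]
    refine forall_congr' fun i => ?_
    constructor <;> rintro ⟨h1, h2⟩ <;> constructor <;> linarith
  rw [this, (Measure.measurePreserving_sub_left volume y).measure_preimage
    (Cube.measurableSet_set _).nullMeasurableSet, Cube.volume_set _ ht]

/-- For s < t < 2s, where s is the height of y, the admissible centres fill a cube of volume tⁿ, and
the weight is 2 t^{-(n+1)}. The slice contributes 2/t ≥ 1/s over an interval of length s. -/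
lemma one_le_lintegral_whitneyAt {y : Pt n} (hy : 0 < y.1) :
    1 ≤ ∫⁻ X in {X | y ∈ whitneyAt X}, (volume (whitneyAt X))⁻¹ := by
  have hm := measurableSet_setOf_mem_whitneyAt y
  have hv : Measurable fun X : Pt n => (volume (whitneyAt X))⁻¹ :=
    measurable_volume_whitneyAt.inv
  rw [← lintegral_indicator hm, lintegral_pt_eq (hv.indicator hm)]
  have key : ∀ t ∈ Ioo y.1 (2 * y.1), ENNReal.ofReal (1 / y.1) ≤
      ∫⁻ x : Bd n, {X : Pt n | y ∈ whitneyAt X}.indicator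
        (fun X => (volume (whitneyAt X))⁻¹) (t, x) := by
    intro t ht
    have ht0 : 0 < t := hy.trans ht.1
    have e : ∀ x : Bd n, {X : Pt n | y ∈ whitneyAt X}.indicator
        (fun X => (volume (whitneyAt X))⁻¹) (t, x) =
        {x : Bd n | y.2 ∈ (⟨x, t⟩ : Cube n).set}.indicator
          (fun _ => (ENNReal.ofReal (t ^ (n + 1) / 2))⁻¹) x := by
      intro x
      by_cases hx : y.2 ∈ (⟨x, t⟩ : Cube n).set
      · rw [indicator_of_mem (show x ∈ {x : Bd n | y.2 ∈ (⟨x, t⟩ : Cube n).set} from hx),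
          indicator_of_mem, volume_whitneyAt (X := (t, x)) ht0]
        exact mem_whitneyAt.2 ⟨⟨by simp only; linarith [ht.2], ht.1⟩, hx⟩
      · have h1 : x ∉ {x : Bd n | y.2 ∈ (⟨x, t⟩ : Cube n).set} := hx
        have h2 : ((t, x) : Pt n) ∉ {X : Pt n | y ∈ whitneyAt X} := fun h => hx h.2
        rw [indicator_of_notMem h1, indicator_of_notMem h2]
    simp_rw [e]
    have hm2 : MeasurableSet {x : Bd n | y.2 ∈ (⟨x, t⟩ : Cube n).set} := by
      have : {x : Bd n | y.2 ∈ (⟨x, t⟩ : Cube n).set} = ⋂ i : Fin n,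
          ({x | x i - t / 2 ≤ y.2 i} ∩ {x | y.2 i < x i + t / 2}) := by
        ext x; simp [Cube.set]
      rw [this]
      exact MeasurableSet.iInter fun i => (measurableSet_le (by fun_prop) (by fun_prop)).inter
        (measurableSet_lt (by fun_prop) (by fun_prop))
    rw [lintegral_indicator hm2, setLIntegral_const, volume_reflected_cube _ ht0.le,
      ← ENNReal.ofReal_inv_of_pos (by positivity), ← ENNReal.ofReal_mul (by positivity)]
    refine ENNReal.ofReal_le_ofReal ?_
    have : (t ^ (n + 1) / 2)⁻¹ * t ^ n = 2 / t := by rw [pow_succ]; field_simp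
    rw [this, div_le_div_iff₀ hy ht0]
    linarith [ht.2]
  calc (1 : ℝ≥0∞) = ∫⁻ _t in Ioo y.1 (2 * y.1), ENNReal.ofReal (1 / y.1) := by
        rw [setLIntegral_const, Real.volume_Ioo, ← ENNReal.ofReal_mul (by positivity)]
        rw [show 1 / y.1 * (2 * y.1 - y.1) = 1 by field_simp; ring]
        simp
    _ ≤ ∫⁻ t in Ioo y.1 (2 * y.1), _ := setLIntegral_mono' measurableSet_Ioo key
    _ ≤ _ := setLIntegral_le_lintegral _ _

/-- The integral of a function is controlled by that of its Whitney averages. -/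
lemma lintegral_le_lintegral_whitneyAvg {u : Pt n → ℝ≥0∞} (hu : Measurable u) {U U' : Set (Pt n)}
    (hU : MeasurableSet U) (hU' : MeasurableSet U') (hH : U ⊆ halfSpace n)
    (h : ∀ y ∈ U, ∀ X, y ∈ whitneyAt X → X ∈ U') :
    ∫⁻ y in U, u y ≤ ∫⁻ X in U', whitneyAvg 1 u X := by
  have hv : Measurable fun X : Pt n => (volume (whitneyAt X))⁻¹ :=
    measurable_volume_whitneyAt.inv
  set S : Set (Pt n × Pt n) := {P | P.2 ∈ whitneyAt P.1} ∩ {P | P.1 ∈ U'} with hS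
  have hSm : MeasurableSet S := measurableSet_whitneyAt_prod.inter (measurable_fst hU')
  set G : Pt n → Pt n → ℝ≥0∞ := fun X y =>
    S.indicator (fun P => (volume (whitneyAt P.1))⁻¹ * u P.2) (X, y) with hG
  have hGm : Measurable (Function.uncurry G) :=
    ((hv.comp measurable_fst).mul (hu.comp measurable_snd)).indicator hSm
  have e1 : ∫⁻ X in U', whitneyAvg 1 u X = ∫⁻ X, ∫⁻ y, G X y := by
    rw [← lintegral_indicator hU']
    refine lintegral_congr fun X => ?_
    by_cases hX : X ∈ U'
    · rw [indicator_of_mem hX, whitneyAvg_eq one_pos]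
      simp only [ENNReal.rpow_one, div_one, enorm_eq_self]
      rw [← lintegral_const_mul _ hu, ← lintegral_indicator (measurableSet_whitneyAt X)]
      refine lintegral_congr fun y => ?_
      by_cases hy : y ∈ whitneyAt X
      · rw [indicator_of_mem hy, hG]
        simp only
        rw [indicator_of_mem (show (X, y) ∈ S from ⟨hy, hX⟩)]
      · rw [indicator_of_notMem hy, hG]
        simp only
        rw [indicator_of_notMem (fun h => hy h.1)]
    · rw [indicator_of_notMem hX]
      have : ∀ y, G X y = 0 := fun y => indicator_of_notMem (fun h => hX h.2) _
      simp [this]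
  rw [e1, lintegral_lintegral_swap hGm.aemeasurable, ← lintegral_indicator hU]
  refine lintegral_mono fun y => ?_
  by_cases hy : y ∈ U
  · rw [indicator_of_mem hy]
    calc u y ≤ u y * ∫⁻ X in {X | y ∈ whitneyAt X}, (volume (whitneyAt X))⁻¹ :=
          le_mul_of_one_le_right' (one_le_lintegral_whitneyAt (hH hy))
      _ = ∫⁻ X in {X | y ∈ whitneyAt X}, u y * (volume (whitneyAt X))⁻¹ :=
          (lintegral_const_mul _ hv).symm
      _ = ∫⁻ X, G X y := by
          rw [← lintegral_indicator (measurableSet_setOf_mem_whitneyAt y)]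
          refine lintegral_congr fun X => ?_
          by_cases hX : y ∈ whitneyAt X
          · rw [indicator_of_mem (show X ∈ {X | y ∈ whitneyAt X} from hX), hG]
            simp only
            rw [indicator_of_mem (show (X, y) ∈ S from ⟨hX, h y hy X hX⟩), mul_comm]
          · have hX' : X ∉ {X : Pt n | y ∈ whitneyAt X} := hX
            rw [indicator_of_notMem hX', hG]
            simp only
            rw [indicator_of_notMem (fun h => hX h.1)]
      _ ≤ _ := le_rfl
  · rw [indicator_of_notMem hy]; exact bot_le

/-- The affine map `(t, x) ↦ (a t, x + t b)`, for `c = (a, b)`. -/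
def shear (c X : Pt n) : Pt n := (c.1 * X.1, X.2 + X.1 • c.2)

lemma measurable_shear (c : Pt n) : Measurable (shear c) := by
  unfold shear; fun_prop

/-- At a fixed height the map is a horizontal translation, so only the dilation of heights changes
volume. -/
lemma lintegral_comp_shear {c : Pt n} (hc : 0 < c.1) {g : Pt n → ℝ≥0∞} (hg : Measurable g) :
    ∫⁻ X, g (shear c X) = ENNReal.ofReal c.1⁻¹ * ∫⁻ X, g X := by
  have h1 : ∀ t : ℝ, ∫⁻ x : Bd n, g (shear c (t, x)) = ∫⁻ x : Bd n, g (c.1 * t, x) := fun t =>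
    lintegral_add_right_eq_self (fun x => g (c.1 * t, x)) (t • c.2)
  rw [lintegral_pt_eq (g := fun X => g (shear c X)) (hg.comp (measurable_shear c)),
    lintegral_pt_eq hg]
  simp_rw [h1]
  have hG : Measurable fun t : ℝ => ∫⁻ x : Bd n, g (t, x) := hg.lintegral_prod_right'
  rw [← lintegral_map hG (measurable_const_mul c.1), Real.map_volume_mul_left hc.ne',
    lintegral_smul_measure, abs_of_pos (inv_pos.2 hc), smul_eq_mul]

/-- A compact neighbourhood of the Whitney region of `X`. -/
def localBox (X : Pt n) : Set (Pt n) :=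
  Icc (X.1 / 4) (2 * X.1) ×ˢ {y | ∀ i, |y i - X.2 i| ≤ X.1}

lemma isClosed_localBox (X : Pt n) : IsClosed (localBox X) := by
  refine isClosed_Icc.prod ?_
  have : {y : Bd n | ∀ i, |y i - X.2 i| ≤ X.1} = ⋂ i, {y | |y i - X.2 i| ≤ X.1} := by
    ext; simp
  rw [this]
  exact isClosed_iInter fun i => isClosed_le (by fun_prop) continuous_const

lemma localBox_subset_closedBall {X : Pt n} (hX : 0 < X.1) :
    localBox X ⊆ closedBall X ((n + 1) * X.1) := by
  rintro y ⟨⟨h1, h2⟩, h3⟩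
  have h0 : X.1 ≤ (n + 1) * X.1 := le_mul_of_one_le_left hX.le (by simp)
  rw [mem_closedBall, Prod.dist_eq, max_le_iff]
  constructor
  · rw [Real.dist_eq, abs_le]
    constructor <;> linarith
  · rw [dist_eq_norm]
    exact norm_le_of_abs_le hX.le fun i => h3 i

lemma isBounded_localBox {X : Pt n} (hX : 0 < X.1) : Bornology.IsBounded (localBox X) :=
  isBounded_closedBall.subset (localBox_subset_closedBall hX)

lemma exists_localBox_subset_exhaustion {X : Pt n} (hX : 0 < X.1) :
    ∃ m, localBox X ⊆ exhaustion n m :=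
  exists_subset_exhaustion (isBounded_localBox hX) (δ := X.1 / 4) (by positivity) fun _ hy => hy.1.1

lemma whitneyAt_subset_interior_localBox (X : Pt n) :
    whitneyAt X ⊆ interior (localBox X) := by
  intro y hy
  obtain ⟨⟨h1, h2⟩, h3⟩ := mem_whitneyAt.1 hy
  have hX : 0 < X.1 := by linarith
  rw [mem_interior_iff_mem_nhds]
  have e1 : ∀ᶠ z : Pt n in 𝓝 y, X.1 / 4 < z.1 :=
    continuous_fst.continuousAt.eventually_const_lt (by linarith)
  have e2 : ∀ᶠ z : Pt n in 𝓝 y, z.1 < 2 * X.1 :=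
    continuous_fst.continuousAt.eventually_lt_const (by linarith)
  have e3 : ∀ᶠ z : Pt n in 𝓝 y, ∀ i, |z.2 i - X.2 i| < X.1 := by
    rw [eventually_all]
    intro i
    have : Continuous fun z : Pt n => |z.2 i - X.2 i| := by fun_prop
    refine this.continuousAt.eventually_lt_const ?_
    rw [abs_lt]
    constructor <;> linarith [(h3 i).1, (h3 i).2]
  filter_upwards [e1, e2, e3] with z z1 z2 z3
  exact ⟨⟨z1.le, z2.le⟩, fun i => (z3 i).le⟩

/-- Local boxes are covered by a fixed number of sheared Whitney regions. -/
lemma exists_finset_localBox_subset (n : ℕ) : ∃ s : Finset (Pt n), (∀ c ∈ s, 0 < c.1) ∧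
    ∀ X : Pt n, 0 < X.1 → localBox X ⊆ ⋃ c ∈ s, whitneyAt (shear c X) := by
  have hcomp : IsCompact (localBox ((1, 0) : Pt n)) :=
    Metric.isCompact_of_isClosed_isBounded (isClosed_localBox _) (isBounded_localBox one_pos)
  -- Compactness is needed for the one point (1, 0) only. The centre at 4/3 of the height of Y puts
  -- Y in the interior of its Whitney region, as 2/3 < 1 < 4/3.
  obtain ⟨s, hs, hcov⟩ := hcomp.elim_nhds_subcover (fun Y => whitneyAt (4 / 3 * Y.1, Y.2))
    fun Y hY => by
      have h1 : 1 / 4 ≤ Y.1 := hY.1.1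
      refine whitneyAt_mem_nhds ?_ ?_ fun i => ?_
      · simp only; linarith
      · simp only; linarith
      · simp only [sub_self, abs_zero]; linarith
  classical
  refine ⟨s.image fun Y => (4 / 3 * Y.1, Y.2), ?_, fun X hX y hy => ?_⟩
  · intro c hc
    obtain ⟨Y, hY, rfl⟩ := Finset.mem_image.1 hc
    have h1 : 1 / 4 ≤ Y.1 := (hs Y hY).1.1
    simp only
    linarith
  -- Dilation and translation carry the box of X to the box of (1, 0); in these coordinates the
  -- finitely many centres become shears of X.
  · have hy' : ((y.1 / X.1, X.1⁻¹ • (y.2 - X.2)) : Pt n) ∈ localBox ((1, 0) : Pt n) := by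
      obtain ⟨⟨h1, h2⟩, h3⟩ := hy
      refine ⟨⟨?_, ?_⟩, fun i => ?_⟩
      · simp only; rw [le_div_iff₀ hX]; linarith
      · simp only; rw [div_le_iff₀ hX]; linarith
      · have := h3 i
        simp only [PiLp.smul_apply, PiLp.sub_apply, smul_eq_mul, PiLp.zero_apply, sub_zero,
          abs_mul, abs_inv, abs_of_pos hX]
        rwa [inv_mul_le_iff₀ hX, mul_one]
    obtain ⟨Y, hY, hmem⟩ := mem_iUnion₂.1 (hcov hy')
    refine mem_iUnion₂.2 ⟨_, Finset.mem_image_of_mem _ hY, ?_⟩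
    obtain ⟨⟨h1, h2⟩, h3⟩ := mem_whitneyAt.1 hmem
    simp only at h1 h2
    rw [lt_div_iff₀ hX] at h1
    rw [div_lt_iff₀ hX] at h2
    refine mem_whitneyAt.2 ⟨⟨?_, ?_⟩, fun i => ?_⟩
    · simp only [shear]; linarith
    · simp only [shear]; linarith
    · have := h3 i
      simp only [PiLp.smul_apply, PiLp.sub_apply, smul_eq_mul] at this
      simp only [shear, PiLp.add_apply, PiLp.smul_apply, smul_eq_mul]
      rw [le_inv_mul_iff₀ hX, inv_mul_lt_iff₀ hX] at this
      constructor <;> nlinarith [this.1, this.2]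

/-- Almost everywhere finite Whitney averages make a function locally `q`-integrable. -/
lemma lintegral_exhaustion_lt_top {q : ℝ} (hq : 0 < q) {u : Pt n → ℝ≥0∞}
    (h : ∀ᵐ X ∂(hmeas n), whitneyAvg q u X < ∞) (m : ℕ) :
    ∫⁻ y in exhaustion n m, u y ^ q ∂(hmeas n) < ∞ := by
  -- Finiteness almost everywhere gives a dense set of good centres, and every point is interior to
  -- the Whitney region of one of them. A compact set then needs finitely many.
  have hd : Dense {X : Pt n | X ∈ halfSpace n → whitneyAvg q u X < ∞} :=
    Measure.dense_of_ae (μ := volume) ((ae_restrict_iff' measurableSet_halfSpace).1 h)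
  rw [← withDensity_apply _ (measurableSet_exhaustion m)]
  refine (isCompact_exhaustion m).measure_lt_top_of_nhdsWithin fun y hy => ?_
  have hy : 0 < y.1 := exhaustion_subset m hy
  set O : Set (Pt n) := {X | X.1 / 2 < y.1} ∩ {X | y.1 < X.1} ∩
    ⋂ i : Fin n, {X | |y.2 i - X.2 i| < X.1 / 2}
  have hO : IsOpen O := ((isOpen_lt (by fun_prop) (by fun_prop)).inter
    (isOpen_lt (by fun_prop) (by fun_prop))).inter
    (isOpen_iInter_of_finite fun i => isOpen_lt (by fun_prop) (by fun_prop))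
  obtain ⟨X, hXO, hX⟩ := hd.inter_open_nonempty O hO ⟨(4 / 3 * y.1, y.2), by
    refine ⟨⟨?_, ?_⟩, mem_iInter.2 fun i => ?_⟩
    · show 4 / 3 * y.1 / 2 < y.1; linarith
    · show y.1 < 4 / 3 * y.1; linarith
    · show |y.2 i - y.2 i| < 4 / 3 * y.1 / 2; simp only [sub_self, abs_zero]; linarith⟩
  have h1 : X.1 / 2 < y.1 := hXO.1.1
  have h2 : y.1 < X.1 := hXO.1.2
  have hX0 : 0 < X.1 := hy.trans h2
  have hfin : whitneyAvg q u X < ∞ := hX hX0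
  refine ⟨whitneyAt X, mem_nhdsWithin_of_mem_nhds (whitneyAt_mem_nhds h1 h2
    fun i => mem_iInter.1 hXO.2 i), ?_⟩
  rw [withDensity_apply _ (measurableSet_whitneyAt X)]
  refine (lintegral_mono' (Measure.restrict_mono_measure hmeas_le _) le_rfl).trans_lt ?_
  rw [whitneyAvg_eq hq, ENNReal.rpow_lt_top_iff_of_pos (by positivity)] at hfin
  by_contra hcon
  rw [not_lt, top_le_iff] at hcon
  simp only [enorm_eq_self, hcon] at hfin
  rw [ENNReal.mul_top (ENNReal.inv_ne_zero.2 (volume_whitneyAt_ne_top X))] at hfin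
  exact lt_irrefl _ hfin

lemma rpow_sum_le_sum_rpow {ι : Type*} (s : Finset ι) (a : ι → ℝ≥0∞) {p : ℝ} (hp : 0 < p)
    (hp1 : p ≤ 1) : (∑ i ∈ s, a i) ^ p ≤ ∑ i ∈ s, a i ^ p := by
  classical
  induction s using Finset.induction_on with
  | empty => simp [hp]
  | insert i s hi ih =>
    rw [Finset.sum_insert hi, Finset.sum_insert hi]
    exact (ENNReal.rpow_add_le_add_rpow _ _ hp.le hp1).trans (add_le_add le_rfl ih)

/-- The covering by sheared regions, combined with subadditivity of the power 1/q ≤ 1. The volume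
ratio between a sheared Whitney region and the original is c.1^{n+1}. -/
lemma exists_localBox_avg_le (n : ℕ) {q : ℝ} (hq : 1 < q) :
    ∃ (s : Finset (Pt n)) (Λ : ℝ≥0), (∀ c ∈ s, 0 < c.1) ∧
    ∀ (u : Pt n → ℝ≥0∞) (X : Pt n), 0 < X.1 →
      ((volume (whitneyAt X))⁻¹ * ∫⁻ y in localBox X, u y ^ q) ^ (1 / q) ≤
        Λ * ∑ c ∈ s, whitneyAvg q u (shear c X) := by
  obtain ⟨s, hs, hcov⟩ := exists_finset_localBox_subset n
  have hq0 : 0 < q := by linarith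
  set Λ : ℝ≥0 := (∑ c ∈ s, (c.1 ^ (n + 1)).toNNReal) ^ (1 / q) with hΛ
  refine ⟨s, Λ, hs, fun u X hX => ?_⟩
  rw [Finset.mul_sum]
  calc _ ≤ (∑ c ∈ s, (volume (whitneyAt X))⁻¹ *
          ∫⁻ y in whitneyAt (shear c X), u y ^ q) ^ (1 / q) := by
        rw [← Finset.mul_sum]
        refine ENNReal.rpow_le_rpow (mul_le_mul' le_rfl ?_) (by positivity)
        refine (lintegral_mono_set (hcov X hX)).trans ?_
        rw [show (⋃ c ∈ s, whitneyAt (shear c X)) = ⋃ c : s, whitneyAt (shear c.1 X) by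
          rw [iUnion_subtype]]
        refine (lintegral_iUnion_le _ _).trans ?_
        rw [tsum_fintype, Finset.sum_coe_sort s
          (fun c => ∫⁻ y in whitneyAt (shear c X), u y ^ q)]
    _ ≤ ∑ c ∈ s, ((volume (whitneyAt X))⁻¹ *
          ∫⁻ y in whitneyAt (shear c X), u y ^ q) ^ (1 / q) :=
        rpow_sum_le_sum_rpow _ _ (by positivity) (by rw [div_le_one hq0]; exact hq.le)
    _ ≤ _ := by
        refine Finset.sum_le_sum fun c hc => ?_
        have hc0 := hs c hc
        have hX' : 0 < (shear c X).1 := mul_pos hc0 hX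
        rw [whitneyAvg_eq hq0, hΛ, ENNReal.coe_rpow_of_nonneg _ (by positivity),
          ← ENNReal.mul_rpow_of_nonneg _ _ (by positivity)]
        refine ENNReal.rpow_le_rpow ?_ (by positivity)
        rw [← mul_assoc]
        refine mul_le_mul' ?_ le_rfl
        rw [volume_whitneyAt hX, volume_whitneyAt hX',
          ← ENNReal.ofReal_inv_of_pos (by positivity), ← ENNReal.ofReal_inv_of_pos (by positivity)]
        calc ENNReal.ofReal (X.1 ^ (n + 1) / 2)⁻¹
            = ENNReal.ofReal (c.1 ^ (n + 1)) *
              ENNReal.ofReal ((shear c X).1 ^ (n + 1) / 2)⁻¹ := by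
              rw [← ENNReal.ofReal_mul (by positivity)]
              congr 1
              simp only [shear]
              rw [mul_pow]
              field_simp
          _ ≤ _ := by
              refine mul_le_mul' ?_ le_rfl
              exact ENNReal.coe_le_coe.2 (Finset.single_le_sum
                (f := fun c : Pt n => (c.1 ^ (n + 1)).toNNReal) (fun _ _ => bot_le) hc)

end Whitney

end CausalCZO

namespace CausalCZO

open Filter Topology Metric

/-! ### Pointwise control of the extension by Whitney averages and tails -/

section Tail

variable {𝕜 : Type*} [RCLike 𝕜] {n : ℕ}

lemma eLpNorm_le_add_const {α : Type*} [MeasurableSpace α] {μ : Measure α} {q : ℝ} (hq : 1 ≤ q)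
    {f h : α → 𝕜} {τ : ℝ≥0∞} (hh : AEStronglyMeasurable h μ)
    (hf : ∀ᵐ x ∂μ, ‖f x‖ₑ ≤ ‖h x‖ₑ + τ) :
    eLpNorm f (ENNReal.ofReal q) μ ≤ eLpNorm h (ENNReal.ofReal q) μ + τ * μ univ ^ (1 / q) := by
  have hq0 : 0 < q := by linarith
  have hq1 : ENNReal.ofReal q ≠ 0 := by simpa using hq0
  rw [eLpNorm_eq_eLpNorm' hq1 ENNReal.ofReal_ne_top, eLpNorm_eq_eLpNorm' hq1 ENNReal.ofReal_ne_top,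
    eLpNorm', eLpNorm', ENNReal.toReal_ofReal hq0.le]
  calc (∫⁻ x, ‖f x‖ₑ ^ q ∂μ) ^ (1 / q)
      ≤ (∫⁻ x, ((fun x => ‖h x‖ₑ) + (fun _ => τ) : α → ℝ≥0∞) x ^ q ∂μ) ^ (1 / q) := by
        refine ENNReal.rpow_le_rpow (lintegral_mono_ae (hf.mono fun x hx => ?_)) (by positivity)
        exact ENNReal.rpow_le_rpow hx hq0.le
    _ ≤ (∫⁻ x, ‖h x‖ₑ ^ q ∂μ) ^ (1 / q) + (∫⁻ _x, τ ^ q ∂μ) ^ (1 / q) :=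
        ENNReal.lintegral_Lp_add_le hh.enorm aemeasurable_const hq
    _ = _ := by
        rw [lintegral_const, ENNReal.mul_rpow_of_nonneg _ _ (by positivity), ← ENNReal.rpow_mul,
          mul_one_div_cancel hq0.ne', ENNReal.rpow_one]

/-- Apply the local control with E the local box, whose interior contains the Whitney region. The
local part is an L_q average over the box, and the uniform tail bound is unchanged by averaging. -/
lemma IsCausalExtension.whitneyAvg_le {K : Pt n → Pt n → 𝕜}
    {S : Lp 𝕜 2 (hmeas n) →L[𝕜] Lp 𝕜 2 (hmeas n)} {q : ℝ} {C : ℝ≥0}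
    {T : (Pt n →ₘ[hmeas n] 𝕜) → (Pt n →ₘ[hmeas n] 𝕜)} {Y : Set (Pt n →ₘ[hmeas n] 𝕜)}
    (hT : IsCausalExtension K S q C T Y) (hq : 1 < q) {f : Pt n →ₘ[hmeas n] 𝕜} (hf : f ∈ Y)
    (hloc : ∀ m, eLpNorm f (ENNReal.ofReal q) ((hmeas n).restrict (exhaustion n m)) < ∞)
    {X : Pt n} (hX : 0 < X.1) {τ : ℝ≥0∞}
    (hτ : ∀ z ∈ whitneyAt X, ∫⁻ y in (localBox X)ᶜ, ‖K z y‖ₑ * ‖f y‖ₑ ∂(hmeas n) ≤ τ) :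
    whitneyAvg q (T f) X ≤ C * ((volume (whitneyAt X))⁻¹ *
      ∫⁻ y in localBox X, ‖f y‖ₑ ^ q) ^ (1 / q) + τ := by
  have hq0 : 0 < q := by linarith
  obtain ⟨M, hM⟩ := exists_localBox_subset_exhaustion hX
  obtain ⟨h, hm, hb, hp⟩ := hT.local_bound f hf hloc _ (isClosed_localBox X).measurableSet M hM
  set V := volume (whitneyAt X) with hV
  have hV0 := volume_whitneyAt_ne_zero hX
  have hVt := volume_whitneyAt_ne_top X
  have hres : (hmeas n).restrict (whitneyAt X) = volume.restrict (whitneyAt X) :=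
    restrict_hmeas_of_subset (measurableSet_whitneyAt X) fun y hy =>
      (show 0 < y.1 from whitneyAt_subset X hy).le
  have hpt : ∀ᵐ z ∂(volume.restrict (whitneyAt X)), ‖T f z‖ₑ ≤ ‖h z‖ₑ + τ := by
    rw [← hres]
    filter_upwards [ae_restrict_mem (measurableSet_whitneyAt X), ae_restrict_of_ae hp]
      with z hz hz2
    exact (hz2 (whitneyAt_subset_interior_localBox X hz)).trans (add_le_add le_rfl (hτ z hz))
  have hm' : AEStronglyMeasurable h (volume.restrict (whitneyAt X)) := by
    rw [← hres]
    exact hm.restrict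
  have e1 : eLpNorm (T f) (ENNReal.ofReal q) (volume.restrict (whitneyAt X)) ≤
      C * eLpNorm f (ENNReal.ofReal q) (volume.restrict (localBox X)) + τ * V ^ (1 / q) := by
    refine (eLpNorm_le_add_const hq.le hm' hpt).trans (add_le_add ?_ ?_)
    · rw [← hres]
      refine (eLpNorm_mono_measure _ Measure.restrict_le_self).trans (hb.trans ?_)
      exact mul_le_mul' le_rfl (eLpNorm_mono_measure _
        (Measure.restrict_mono_measure hmeas_le _))
    · rw [Measure.restrict_apply_univ]
  have e2 : V ^ (-(1 / q)) * V ^ (1 / q) = 1 := by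
    rw [← ENNReal.rpow_add _ _ hV0 hVt]; simp
  change V ^ (-(1 / q)) * eLpNorm (T f) (ENNReal.ofReal q) (volume.restrict (whitneyAt X)) ≤ _
  calc _ ≤ V ^ (-(1 / q)) * (C * eLpNorm f (ENNReal.ofReal q) (volume.restrict (localBox X)) +
        τ * V ^ (1 / q)) := mul_le_mul' le_rfl e1
    _ = C * (V ^ (-(1 / q)) * eLpNorm f (ENNReal.ofReal q) (volume.restrict (localBox X))) +
        (V ^ (-(1 / q)) * V ^ (1 / q)) * τ := by ring
    _ = _ := by
        rw [e2, one_mul, eLpNorm_eq_eLpNorm' (by simpa using hq0) ENNReal.ofReal_ne_top, eLpNorm',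
          ENNReal.toReal_ofReal hq0.le, ENNReal.mul_rpow_of_nonneg _ _ (by positivity),
          ENNReal.rpow_neg, ENNReal.inv_rpow]

/-- The kernel `(t + s + |x - y|)^{-(n+1)}`, which dominates Calderón–Zygmund kernels away from
Whitney regions. -/
noncomputable def tailKernel (X y : Pt n) : ℝ≥0∞ :=
  ENNReal.ofReal ((X.1 + y.1 + ‖y.2 - X.2‖) ^ (-((n : ℝ) + 1)))

lemma measurable_tailKernel : Measurable (Function.uncurry (tailKernel (n := n))) := by
  unfold tailKernel Function.uncurry
  fun_prop

/-- A point off the local box is at distance at least X.1/4 from every z in the Whitney region, so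
X.1 ≤ 4d for d = |z - y|. Then y.1 ≤ X.1 + d, and |y.2 - X.2| ≤ d + (n+1)X.1/2, which adds up to
(2n+12)d. -/
lemma add_add_norm_le_mul_dist {X z y : Pt n} (hz : z ∈ whitneyAt X)
    (hyX : y ∉ localBox X) : X.1 + y.1 + ‖y.2 - X.2‖ ≤ (2 * n + 12) * dist z y := by
  obtain ⟨⟨h1, h2⟩, h3⟩ := mem_whitneyAt.1 hz
  have hX : 0 < X.1 := by linarith
  have d1 : |z.1 - y.1| ≤ dist z y := by rw [← Real.dist_eq]; exact le_max_left _ _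
  have d2 : ‖z.2 - y.2‖ ≤ dist z y := by rw [← dist_eq_norm]; exact le_max_right _ _
  have d1' := abs_le.1 d1
  have hkey : X.1 ≤ 4 * dist z y := by
    by_contra! hcon
    refine hyX ⟨⟨?_, ?_⟩, fun i => ?_⟩
    · linarith
    · linarith
    · have d3 := abs_le.1 (((abs_apply_le_norm (z.2 - y.2) i).trans d2))
      rw [PiLp.sub_apply] at d3
      rw [abs_le]
      constructor <;> linarith [(h3 i).1, (h3 i).2]
  have d4 : ‖z.2 - X.2‖ ≤ (n + 1) * (X.1 / 2) := by
    refine norm_le_of_abs_le (by positivity) fun i => ?_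
    rw [PiLp.sub_apply, abs_le]
    constructor <;> linarith [(h3 i).1, (h3 i).2]
  have d5 : ‖y.2 - X.2‖ ≤ ‖z.2 - y.2‖ + ‖z.2 - X.2‖ := by
    rw [norm_sub_rev z.2 y.2]
    calc ‖y.2 - X.2‖ = ‖(y.2 - z.2) + (z.2 - X.2)‖ := by congr 1; abel
      _ ≤ _ := norm_add_le _ _
  have hn : (0 : ℝ) ≤ n := Nat.cast_nonneg n
  nlinarith

/-- The tail of a causal kernel off the local box of a point. -/
lemma IsCZKernel.lintegral_compl_localBox_le {γ A : ℝ} {k : Pt n → Pt n → 𝕜}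
    (hk : IsCZKernel γ A k) (σ : ℝ) {X z : Pt n} (hz : z ∈ whitneyAt X) {V : Set (Pt n)}
    (hV : MeasurableSet V) (hVc : ∀ y, 0 < y.1 → 0 < σ * (z.1 - y.1) → y ∈ V) (u : Pt n → ℝ≥0∞) :
    ∫⁻ y in (localBox X)ᶜ, ‖causalKernel σ k z y‖ₑ * u y ∂(hmeas n) ≤
      ENNReal.ofReal (A * (2 * n + 12) ^ ((n : ℝ) + 1)) * ∫⁻ y in V, tailKernel X y * u y := by
  have hB := (isClosed_localBox X).measurableSet.compl
  have hA := hk.nonneg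
  rw [← lintegral_const_mul' _ _ ENNReal.ofReal_ne_top, hmeas, Measure.restrict_restrict hB,
    ← lintegral_indicator (hB.inter measurableSet_halfSpace), ← lintegral_indicator hV]
  refine lintegral_mono fun y => ?_
  by_cases hy : y ∈ (localBox X)ᶜ ∩ halfSpace n
  swap
  · rw [indicator_of_notMem hy]; exact bot_le
  rw [indicator_of_mem hy]
  have hyH : 0 < y.1 := hy.2
  have hzH : z ∈ halfSpace n := whitneyAt_subset X hz
  have hX : 0 < X.1 := (show 0 < z.1 from hzH).trans hz.1.2
  by_cases hc : 0 < σ * (z.1 - y.1)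
  swap
  · rw [causalKernel, if_neg (fun h => hc h.2.2), enorm_zero, zero_mul]; exact bot_le
  rw [indicator_of_mem (hVc y hyH hc), causalKernel, if_pos ⟨hzH, hy.2, hc⟩, ← mul_assoc]
  refine mul_le_mul' ?_ le_rfl
  have hne : z ≠ y := by rintro rfl; simp at hc
  rw [← ofReal_norm, tailKernel, ← ENNReal.ofReal_mul (by positivity)]
  refine ENNReal.ofReal_le_ofReal ((hk.size_dist hzH hy.2 hne).trans ?_)
  rw [mul_assoc]
  refine mul_le_mul_of_nonneg_left ?_ hA
  have hg := add_add_norm_le_mul_dist hz hy.1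
  have hd : 0 < dist z y := dist_pos.2 hne
  have hs : 0 < X.1 + y.1 + ‖y.2 - X.2‖ := by positivity
  rw [← inv_mul_le_iff₀ (by positivity), ← Real.rpow_neg (by positivity),
    ← Real.mul_rpow (by positivity) (by positivity)]
  exact Real.rpow_le_rpow_of_nonpos hs hg (by linarith [show (0 : ℝ) ≤ n from Nat.cast_nonneg n])

/-- Each z lies in the Whitney region centred above it at 4/3 of its height, and some member of the
exhaustion contains the corresponding local box. -/
lemma finiteTail_of_forall {K : Pt n → Pt n → 𝕜} {f : Pt n → 𝕜}
    (h : ∀ X : Pt n, 0 < X.1 → ∀ z ∈ whitneyAt X,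
      ∫⁻ y in (localBox X)ᶜ, ‖K z y‖ₑ * ‖f y‖ₑ ∂(hmeas n) < ∞) :
    ∀ᵐ z ∂(hmeas n), FiniteTail K f z := by
  filter_upwards [ae_mem_halfSpace] with z hz
  have hz : 0 < z.1 := hz
  set X : Pt n := (4 / 3 * z.1, z.2) with hXdef
  have hX : 0 < X.1 := by simp only [hXdef]; positivity
  have hzX : z ∈ whitneyAt X := by
    refine mem_of_mem_nhds (whitneyAt_mem_nhds ?_ ?_ fun i => ?_)
    · simp only [hXdef]; linarith
    · simp only [hXdef]; linarith
    · simp only [hXdef, sub_self, abs_zero]; linarith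
  obtain ⟨M, hM⟩ := exists_localBox_subset_exhaustion hX
  refine ⟨M, interior_mono hM (whitneyAt_subset_interior_localBox X hzX), ?_⟩
  exact (lintegral_mono_set (compl_subset_compl.2 hM)).trans_lt (h X hX z hzX)

/-- Integrating the tail kernel over a horizontal slice. -/
lemma exists_lintegral_slice_le (n : ℕ) : ∃ C : ℝ≥0, ∀ (y : Bd n) (s : ℝ), 0 < s →
    ∫⁻ x : Bd n, ENNReal.ofReal ((s + ‖y - x‖) ^ (-((n : ℝ) + 1))) ≤
      C * ENNReal.ofReal s⁻¹ := by
  have hn : (0 : ℝ) ≤ n := Nat.cast_nonneg n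
  set ω := volume (closedBall (0 : Bd n) 1) with hω
  have hf : ω ≠ ∞ := measure_closedBall_lt_top.ne
  set C0 := ENNReal.ofReal (2 ^ (n : ℝ) * (1 - 2 ^ ((n : ℝ) - (n + 1)))⁻¹)
  refine ⟨(ω + C0 * ω).toNNReal, fun y s hs => ?_⟩
  rw [ENNReal.coe_toNNReal (by finiteness), add_mul]
  have hcov : (univ : Set (Bd n)) ⊆ closedBall y s ∪ {x | s ≤ dist x y} := fun x _ => by
    rcases le_total (dist x y) s with h | h
    · exact Or.inl h
    · exact Or.inr h
  rw [← setLIntegral_univ]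
  refine (lintegral_mono_set hcov).trans ((lintegral_union_le _ _ _).trans (add_le_add ?_ ?_))
  · calc _ ≤ ∫⁻ x in closedBall y s, ENNReal.ofReal (s ^ (-((n : ℝ) + 1))) := by
          refine lintegral_mono fun x => ENNReal.ofReal_le_ofReal ?_
          exact Real.rpow_le_rpow_of_nonpos hs (by simp) (by linarith)
      _ = _ := by
          rw [setLIntegral_const, volume_closedBall_bd y hs.le, mul_left_comm,
            ← ENNReal.ofReal_mul (by positivity), ← Real.rpow_add hs]
          rw [show -((n : ℝ) + 1) + n = -1 by ring, Real.rpow_neg_one]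
  · calc _ ≤ ∫⁻ x in {x | s ≤ dist x y}, ENNReal.ofReal (dist x y ^ (-((n : ℝ) + 1))) := by
          refine setLIntegral_mono' (measurableSet_le measurable_const
            (continuous_id.dist continuous_const).measurable) fun x hx => ?_
          refine ENNReal.ofReal_le_ofReal ?_
          have hx : s ≤ dist x y := hx
          refine Real.rpow_le_rpow_of_nonpos (hs.trans_le hx) ?_ (by linarith)
          rw [dist_eq_norm, norm_sub_rev]
          linarith
      _ ≤ C0 * (ω * ENNReal.ofReal (s ^ ((n : ℝ) - (n + 1)))) :=
          lintegral_annuli_le volume (by linarith) (by linarith) hs fun R hR =>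
            (volume_closedBall_bd y (hs.le.trans hR)).le
      _ = _ := by
          rw [show (n : ℝ) - (n + 1) = -1 by ring, Real.rpow_neg_one, mul_assoc]

/-- The tail kernel far away from a boundary point. -/
lemma tailKernel_le {X y : Pt n} {x₀ : Bd n} (hX : 0 < X.1) (hy : 0 < y.1)
    (h : 2 * ‖X.2 - x₀‖ ≤ dist y (0, x₀)) :
    tailKernel X y ≤ ENNReal.ofReal (2 ^ ((n : ℝ) + 1)) *
      ENNReal.ofReal (dist y (0, x₀) ^ (-((n : ℝ) + 1))) := by
  have hd : 0 < dist y (0, x₀) := by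
    refine dist_pos.2 fun h => ?_
    rw [h] at hy
    exact lt_irrefl _ hy
  -- If the horizontal distance to x₀ dominates, at most half of it comes from the displacement of
  -- X, and that half is absorbed on the left.
  have h2 : dist y (0, x₀) ≤ 2 * (X.1 + y.1 + ‖y.2 - X.2‖) := by
    rw [Prod.dist_eq] at h ⊢
    have h3 : dist y.2 x₀ ≤ ‖y.2 - X.2‖ + ‖X.2 - x₀‖ := by
      rw [← dist_eq_norm, ← dist_eq_norm]; exact dist_triangle _ _ _
    simp only [Real.dist_eq, sub_zero, abs_of_pos hy] at h ⊢
    have := norm_nonneg (y.2 - X.2)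
    rcases max_cases y.1 (dist y.2 x₀) with ⟨h4, -⟩ | ⟨h4, -⟩
    · rw [h4]; linarith
    · rw [h4] at h ⊢; linarith
  rw [tailKernel, ← ENNReal.ofReal_mul (by positivity)]
  refine ENNReal.ofReal_le_ofReal ?_
  have hn : (0 : ℝ) ≤ n := Nat.cast_nonneg n
  rw [← inv_mul_le_iff₀ (by positivity), ← Real.rpow_neg (by positivity),
    ← Real.mul_rpow (by positivity) (by positivity)]
  exact Real.rpow_le_rpow_of_nonpos hd h2 (by linarith)

end Tail

/-! ### The Carleson functional -/

section Carleson

variable {n : ℕ} {ε : Type*} [ENorm ε]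

lemma Cube.measurableSet_carleson (Q : Cube n) : MeasurableSet Q.carleson :=
  measurableSet_Ioo.prod Q.measurableSet_set

lemma Cube.volume_carleson (Q : Cube n) :
    volume Q.carleson = ENNReal.ofReal Q.side * volume Q.set := by
  rw [Cube.carleson, Measure.volume_eq_prod, Measure.prod_prod, Real.volume_Ioo, sub_zero]

lemma Cube.volume_set_ne_zero {Q : Cube n} (hQ : 0 < Q.side) : volume Q.set ≠ 0 := by
  rw [Q.volume_set hQ.le]
  simp only [ne_eq, ENNReal.ofReal_eq_zero, not_le]
  positivity

lemma Cube.volume_set_ne_top {Q : Cube n} (hQ : 0 < Q.side) : volume Q.set ≠ ∞ := by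
  rw [Q.volume_set hQ.le]; exact ENNReal.ofReal_ne_top

lemma lintegral_carleson_le {f : Pt n → ε} {Q : Cube n} (hQ : 0 < Q.side) {x : Bd n}
    (hx : x ∈ Q.set) : ∫⁻ y in Q.carleson, ‖f y‖ₑ ≤ volume Q.set * carlesonFn f x := by
  have h : (volume Q.set)⁻¹ * ∫⁻ y in Q.carleson, ‖f y‖ₑ ≤ carlesonFn f x :=
    le_iSup₂_of_le Q hQ (le_iSup_of_le hx le_rfl)
  calc ∫⁻ y in Q.carleson, ‖f y‖ₑ
      = volume Q.set * ((volume Q.set)⁻¹ * ∫⁻ y in Q.carleson, ‖f y‖ₑ) := by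
        rw [← mul_assoc, ENNReal.mul_inv_cancel (Cube.volume_set_ne_zero hQ)
          (Cube.volume_set_ne_top hQ), one_mul]
    _ ≤ _ := mul_le_mul' le_rfl h

lemma carlesonFn_le {f : Pt n → ε} {x : Bd n} {C : ℝ≥0∞}
    (h : ∀ Q : Cube n, 0 < Q.side → x ∈ Q.set →
      ∫⁻ y in Q.carleson, ‖f y‖ₑ ≤ volume Q.set * C) : carlesonFn f x ≤ C := by
  refine iSup₂_le fun Q hQ => iSup_le fun hx => ?_
  calc _ ≤ (volume Q.set)⁻¹ * (volume Q.set * C) := mul_le_mul' le_rfl (h Q hQ hx)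
    _ = C := by
        rw [← mul_assoc, ENNReal.inv_mul_cancel (Cube.volume_set_ne_zero hQ)
          (Cube.volume_set_ne_top hQ), one_mul]

lemma lintegral_halfBall_le (f : Pt n → ε) (x₀ : Bd n) {R : ℝ} (hR : 0 < R) :
    ∫⁻ y in closedBall (0, x₀) R ∩ halfSpace n, ‖f y‖ₑ ≤
      ENNReal.ofReal ((4 * R) ^ n) * carlesonFn f x₀ := by
  set Q : Cube n := ⟨x₀, 4 * R⟩ with hQ
  have hQ0 : 0 < Q.side := by simp only [hQ]; positivity
  have hmem : x₀ ∈ Q.set := fun i => by simp only [hQ]; constructor <;> linarith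
  rw [show ENNReal.ofReal ((4 * R) ^ n) = volume Q.set from (Q.volume_set hQ0.le).symm]
  refine (lintegral_mono_set ?_).trans (lintegral_carleson_le hQ0 hmem)
  rintro y ⟨hy, hyH⟩
  have hyH : 0 < y.1 := hyH
  rw [mem_closedBall, Prod.dist_eq, max_le_iff, Real.dist_eq, sub_zero, abs_of_pos hyH] at hy
  refine ⟨⟨hyH, ?_⟩, fun i => ?_⟩
  · simp only [hQ]; linarith [hy.1]
  · have := abs_le.1 ((abs_apply_le_norm (y.2 - x₀) i).trans
      hy.2)
    rw [PiLp.sub_apply] at this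
    simp only [hQ]
    constructor <;> linarith [this.1, this.2]

/-- The Carleson functional bounds the mass of u in half balls of radius R by a constant times Rⁿ.
Growth of order n against decay of order n+1 leaves the factor 1/ρ from the annuli. -/
lemma exists_lintegral_far_le (n : ℕ) : ∃ C : ℝ≥0, ∀ (u : Pt n → ℝ≥0∞), Measurable u →
    ∀ (x₀ : Bd n) (ρ : ℝ), 0 < ρ → ∫⁻ y in {y | ρ ≤ dist y (0, x₀)} ∩ halfSpace n,
      ENNReal.ofReal (dist y (0, x₀) ^ (-((n : ℝ) + 1))) * u y ≤
        C * (ENNReal.ofReal ρ⁻¹ * carlesonFn u x₀) := by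
  have hn : (0 : ℝ) ≤ n := Nat.cast_nonneg n
  set C0 := ENNReal.ofReal (2 ^ (n : ℝ) * (1 - 2 ^ ((n : ℝ) - (n + 1)))⁻¹)
  refine ⟨(C0 * ENNReal.ofReal (4 ^ n)).toNNReal, fun u hu x₀ ρ hρ => ?_⟩
  rw [ENNReal.coe_toNNReal (by finiteness)]
  have hm : MeasurableSet {y : Pt n | ρ ≤ dist y (0, x₀)} :=
    measurableSet_le measurable_const (continuous_id.dist continuous_const).measurable
  have hg : Measurable fun y : Pt n => ENNReal.ofReal (dist y (0, x₀) ^ (-((n : ℝ) + 1))) := by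
    fun_prop
  have h := lintegral_annuli_le ((hmeas n).withDensity u) (a := n) (b := n + 1) (by linarith)
    (by linarith) (m := ENNReal.ofReal (4 ^ n) * carlesonFn u x₀) (x := ((0, x₀) : Pt n)) hρ
    fun R hR => by
      have hR0 := hρ.trans_le hR
      rw [withDensity_apply _ measurableSet_closedBall, hmeas,
        Measure.restrict_restrict measurableSet_closedBall]
      refine (lintegral_halfBall_le u x₀ hR0).trans (le_of_eq ?_)
      rw [mul_pow, ENNReal.ofReal_mul (by positivity), Real.rpow_natCast]
      ring
  rw [setLIntegral_withDensity_eq_setLIntegral_mul _ hu hg hm, hmeas,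
    Measure.restrict_restrict hm] at h
  calc _ = _ := lintegral_congr fun y => by
        rw [Pi.mul_apply, mul_comm]
    _ ≤ C0 * (ENNReal.ofReal (4 ^ n) * carlesonFn u x₀ *
          ENNReal.ofReal (ρ ^ ((n : ℝ) - (n + 1)))) := h
    _ = _ := by
        rw [show (n : ℝ) - (n + 1) = -1 by ring, Real.rpow_neg_one]
        ring

end Carleson

end CausalCZO

namespace CausalCZO

open Filter Topology Metric

/-! ### The downward estimate -/

section Down

variable {n : ℕ}

/-- The points of the half space above height `X.1 / 2`. -/
def upperRegion (X : Pt n) : Set (Pt n) := {y | 0 < y.1 ∧ X.1 / 2 < y.1}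

/-- The integral of the tail kernel over the upper region. -/
noncomputable def upperTail (u : Pt n → ℝ≥0∞) (X : Pt n) : ℝ≥0∞ :=
  ∫⁻ y in upperRegion X, tailKernel X y * u y

lemma measurableSet_upperRegion_prod :
    MeasurableSet {P : Pt n × Pt n | P.2 ∈ upperRegion P.1} := by
  have : {P : Pt n × Pt n | P.2 ∈ upperRegion P.1} =
    {P | 0 < P.2.1} ∩ {P | P.1.1 / 2 < P.2.1} := rfl
  rw [this]
  exact (measurableSet_lt (by fun_prop) (by fun_prop)).inter
    (measurableSet_lt (by fun_prop) (by fun_prop))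

lemma measurableSet_upperRegion (X : Pt n) : MeasurableSet (upperRegion X) :=
  measurable_prodMk_left measurableSet_upperRegion_prod

/-- Integrals over sections of a measurable set depend measurably on the parameter. -/
lemma measurable_setLIntegral_section {S : Set (Pt n × Pt n)} (hS : MeasurableSet S)
    {g : Pt n → Pt n → ℝ≥0∞} (hg : Measurable (Function.uncurry g)) :
    Measurable fun X => ∫⁻ y in {y | (X, y) ∈ S}, g X y := by
  have h : ∀ X, ∫⁻ y in {y | (X, y) ∈ S}, g X y =
      ∫⁻ y, S.indicator (Function.uncurry g) (X, y) := fun X => by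
    have hm : MeasurableSet {y | (X, y) ∈ S} := measurable_prodMk_left hS
    rw [← lintegral_indicator hm]
    rfl
  simp_rw [h]
  exact (hg.indicator hS).lintegral_prod_right'

lemma measurable_upperTail {u : Pt n → ℝ≥0∞} (hu : Measurable u) : Measurable (upperTail u) :=
  measurable_setLIntegral_section measurableSet_upperRegion_prod
    (g := fun X y => tailKernel X y * u y)
    (measurable_tailKernel.mul (hu.comp measurable_snd))

/-- Splitting an integral against the tail kernel at distance `ρ` from a boundary point. -/
lemma exists_lintegral_tailKernel_le (n : ℕ) : ∃ C : ℝ≥0, ∀ (u : Pt n → ℝ≥0∞), Measurable u →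
    ∀ (x₀ : Bd n) (ρ : ℝ), 0 < ρ → ∀ X : Pt n, 0 < X.1 → 2 * ‖X.2 - x₀‖ ≤ ρ →
    ∀ V : Set (Pt n), MeasurableSet V → V ⊆ halfSpace n →
      ∫⁻ y in V, tailKernel X y * u y ≤
        (∫⁻ y in V ∩ closedBall (0, x₀) ρ, tailKernel X y * u y) +
          C * (ENNReal.ofReal ρ⁻¹ * carlesonFn (V.indicator u) x₀) := by
  obtain ⟨C, hC⟩ := exists_lintegral_far_le n
  refine ⟨(ENNReal.ofReal (2 ^ ((n : ℝ) + 1))).toNNReal * C,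
    fun u hu x₀ ρ hρ X hX hXρ V hV hVH => ?_⟩
  rw [ENNReal.coe_mul, ENNReal.coe_toNNReal ENNReal.ofReal_ne_top, mul_assoc]
  have hcov : V ⊆ (V ∩ closedBall (0, x₀) ρ) ∪ (V ∩ {y | ρ ≤ dist y (0, x₀)}) := by
    intro y hy
    rcases le_total (dist y (0, x₀)) ρ with h | h
    · exact Or.inl ⟨hy, h⟩
    · exact Or.inr ⟨hy, h⟩
  have hm : MeasurableSet {y : Pt n | ρ ≤ dist y (0, x₀)} :=
    measurableSet_le measurable_const (continuous_id.dist continuous_const).measurable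
  refine (lintegral_mono_set hcov).trans ((lintegral_union_le _ _ _).trans
    (add_le_add le_rfl ?_))
  refine le_trans ?_ (mul_le_mul' le_rfl (hC _ (hu.indicator hV) x₀ ρ hρ))
  rw [← lintegral_const_mul' _ _ ENNReal.ofReal_ne_top, ← lintegral_indicator (hV.inter hm),
    ← lintegral_indicator (hm.inter measurableSet_halfSpace)]
  refine lintegral_mono fun y => ?_
  by_cases hy : y ∈ V ∩ {y | ρ ≤ dist y (0, x₀)}
  · have hy2 : ρ ≤ dist y (0, x₀) := hy.2
    rw [indicator_of_mem hy, indicator_of_mem (show y ∈ {y | ρ ≤ dist y (0, x₀)} ∩ halfSpace n from ⟨hy.2, hVH hy.1⟩), indicator_of_mem hy.1, ← mul_assoc]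
    exact mul_le_mul' (tailKernel_le hX (hVH hy.1) (hXρ.trans hy2)) le_rfl
  · rw [indicator_of_notMem hy]; exact bot_le

lemma carlesonFn_mono {f g : Pt n → ℝ≥0∞} (h : ∀ y, f y ≤ g y) (x : Bd n) :
    carlesonFn f x ≤ carlesonFn g x :=
  iSup₂_mono fun _ _ => iSup_mono fun _ => mul_le_mul' le_rfl (lintegral_mono h)

lemma upperRegion_subset (X : Pt n) : upperRegion X ⊆ halfSpace n := fun _ hy => hy.1

/-- Near x₀ the kernel is bounded by X.1^{-(n+1)} and u has finite mass; far away the annular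
estimate applies. Finiteness of the Carleson functional at one boundary point is thus enough for all
X. -/
lemma upperTail_lt_top {u : Pt n → ℝ≥0∞} (hu : Measurable u) {x₀ : Bd n}
    (h : carlesonFn u x₀ < ∞) {X : Pt n} (hX : 0 < X.1) : upperTail u X < ∞ := by
  obtain ⟨C, hC⟩ := exists_lintegral_tailKernel_le n
  set ρ := 2 * ‖X.2 - x₀‖ + 1
  have hρ : 0 < ρ := by positivity
  have hn : (0 : ℝ) ≤ n := Nat.cast_nonneg n
  refine (hC u hu x₀ ρ hρ X hX (by simp [ρ]) _ (measurableSet_upperRegion X)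
    (upperRegion_subset X)).trans_lt (ENNReal.add_lt_top.2 ⟨?_, ?_⟩)
  · calc ∫⁻ y in upperRegion X ∩ closedBall (0, x₀) ρ, tailKernel X y * u y
        ≤ ∫⁻ y in upperRegion X ∩ closedBall (0, x₀) ρ,
            ENNReal.ofReal (X.1 ^ (-((n : ℝ) + 1))) * u y := by
          refine setLIntegral_mono' ((measurableSet_upperRegion X).inter
            measurableSet_closedBall) fun y hy => mul_le_mul' ?_ le_rfl
          have hy0 : 0 < y.1 := hy.1.1
          refine ENNReal.ofReal_le_ofReal (Real.rpow_le_rpow_of_nonpos hX ?_ (by linarith))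
          have := norm_nonneg (y.2 - X.2)
          linarith
      _ = ENNReal.ofReal (X.1 ^ (-((n : ℝ) + 1))) *
            ∫⁻ y in upperRegion X ∩ closedBall (0, x₀) ρ, u y :=
          lintegral_const_mul' _ _ ENNReal.ofReal_ne_top
      _ ≤ ENNReal.ofReal (X.1 ^ (-((n : ℝ) + 1))) *
            (ENNReal.ofReal ((4 * ρ) ^ n) * carlesonFn u x₀) := by
          refine mul_le_mul' le_rfl (le_trans (lintegral_mono_set ?_)
            (lintegral_halfBall_le u x₀ hρ))
          exact fun y hy => ⟨hy.2, hy.1.1⟩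
      _ < ∞ := by finiteness
  · have := (carlesonFn_mono (fun y => indicator_le_self (upperRegion X) u y) x₀).trans_lt h
    finiteness

/-- The Carleson functional of the upper tail. -/
lemma exists_carlesonFn_upperTail_le (n : ℕ) : ∃ C : ℝ≥0, ∀ (u : Pt n → ℝ≥0∞), Measurable u →
    ∀ x₀ : Bd n, carlesonFn (upperTail u) x₀ ≤ C * carlesonFn u x₀ := by
  obtain ⟨C1, hC1⟩ := exists_lintegral_tailKernel_le n
  obtain ⟨C2, hC2⟩ := exists_lintegral_slice_le n
  have hn : (0 : ℝ) ≤ n := Nat.cast_nonneg n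
  set D : ℝ≥0∞ := 2 * C2 * ENNReal.ofReal ((8 * (n + 1)) ^ n) + C1 with hD
  have hDt : D ≠ ∞ := by finiteness
  refine ⟨D.toNNReal, fun u hu x₀ => carlesonFn_le fun Q hQ hx => ?_⟩
  rw [ENNReal.coe_toNNReal hDt]
  simp only [enorm_eq_self]
  -- Chosen so that every point of Q is within ρ/2 of x₀, as the splitting of the tail requires,
  -- while ρ stays comparable to the side of Q.
  set ρ := 2 * ((n + 1) * Q.side) with hρ
  have hρ0 : 0 < ρ := by positivity
  set B : Set (Pt n) := closedBall (0, x₀) ρ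
  have hxQ : ∀ x ∈ Q.set, 2 * ‖x - x₀‖ ≤ ρ := by
    intro x hxx
    have : ‖x - x₀‖ ≤ (n + 1) * Q.side := by
      refine norm_le_of_abs_le hQ.le fun i => ?_
      rw [PiLp.sub_apply, abs_le]
      constructor <;> linarith [(hx i).1, (hx i).2, (hxx i).1, (hxx i).2]
    linarith
  have hpt : ∀ X ∈ Q.carleson, upperTail u X ≤
      (∫⁻ y in upperRegion X ∩ B, tailKernel X y * u y) +
        C1 * (ENNReal.ofReal ρ⁻¹ * carlesonFn u x₀) := by
    intro X hX
    refine (hC1 u hu x₀ ρ hρ0 X hX.1.1 (hxQ _ hX.2) _ (measurableSet_upperRegion X)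
      (upperRegion_subset X)).trans (add_le_add le_rfl ?_)
    exact mul_le_mul' le_rfl (mul_le_mul' le_rfl
      (carlesonFn_mono (fun y => indicator_le_self (upperRegion X) u y) x₀))
  set S : Set (Pt n × Pt n) := {P | P.2 ∈ upperRegion P.1} ∩ {P | P.2 ∈ B}
  have hS : MeasurableSet S :=
    measurableSet_upperRegion_prod.inter (measurable_snd measurableSet_closedBall)
  have hker : Measurable (Function.uncurry fun X y => tailKernel X y * u y) :=
    measurable_tailKernel.mul (hu.comp measurable_snd)
  have hnear : ∫⁻ X in Q.carleson, ∫⁻ y in upperRegion X ∩ B, tailKernel X y * u y ≤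
      2 * C2 * (ENNReal.ofReal ((4 * ρ) ^ n) * carlesonFn u x₀) := by
    set S' : Set (Pt n × Pt n) := S ∩ {P | P.1 ∈ Q.carleson}
    have hS' : MeasurableSet S' := hS.inter (measurable_fst Q.measurableSet_carleson)
    set G : Pt n → Pt n → ℝ≥0∞ := fun X y =>
      S'.indicator (Function.uncurry fun X y => tailKernel X y * u y) (X, y) with hG
    have e1 : ∫⁻ X in Q.carleson, ∫⁻ y in upperRegion X ∩ B, tailKernel X y * u y =
        ∫⁻ X, ∫⁻ y, G X y := by
      rw [← lintegral_indicator Q.measurableSet_carleson]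
      refine lintegral_congr fun X => ?_
      by_cases hX : X ∈ Q.carleson
      · rw [indicator_of_mem hX, ← lintegral_indicator
          ((measurableSet_upperRegion X).inter measurableSet_closedBall)]
        refine lintegral_congr fun y => ?_
        by_cases hy : y ∈ upperRegion X ∩ B
        · rw [indicator_of_mem hy, hG]
          simp only
          rw [indicator_of_mem (show (X, y) ∈ S' from ⟨hy, hX⟩)]
          rfl
        · rw [indicator_of_notMem hy, hG]
          simp only
          rw [indicator_of_notMem (fun h => hy h.1)]
      · rw [indicator_of_notMem hX]
        have : ∀ y, G X y = 0 := fun y => indicator_of_notMem (fun h => hX h.2) _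
        simp [this]
    have hGm : Measurable (Function.uncurry G) := hker.indicator hS'
    rw [e1, lintegral_lintegral_swap hGm.aemeasurable]
    -- Causality enters here: for given y only heights below 2 y.1 contribute. The slice integral is
    -- at most a constant over y.1, so integrating over this range gives a bound independent of y.
    have hinner : ∀ y, ∫⁻ X, G X y ≤ (B ∩ halfSpace n).indicator (fun y => 2 * C2 * u y) y := by
      intro y
      by_cases hy : y ∈ B ∩ halfSpace n
      · have hy0 : 0 < y.1 := hy.2
        rw [indicator_of_mem hy]
        calc ∫⁻ X, G X y ≤ ∫⁻ X : Pt n, (Ioo 0 (2 * y.1) ×ˢ univ).indicator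
              (fun X : Pt n => ENNReal.ofReal ((y.1 + ‖y.2 - X.2‖) ^ (-((n : ℝ) + 1))) * u y) X := by
              refine lintegral_mono fun X => ?_
              simp only [hG]
              by_cases hX : (X, y) ∈ S'
              · have h1 : X.1 / 2 < y.1 := hX.1.1.2
                have h2 : 0 < X.1 := hX.2.1.1
                rw [indicator_of_mem hX, indicator_of_mem (show X ∈ Ioo 0 (2 * y.1) ×ˢ univ from
                  ⟨⟨h2, by linarith⟩, mem_univ _⟩)]
                refine mul_le_mul' (ENNReal.ofReal_le_ofReal ?_) le_rfl
                refine Real.rpow_le_rpow_of_nonpos (by positivity) ?_ (by linarith)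
                linarith
              · rw [indicator_of_notMem hX]; exact bot_le
          _ = ∫⁻ X : ℝ × Bd n in Ioo 0 (2 * y.1) ×ˢ univ,
                ENNReal.ofReal ((y.1 + ‖y.2 - X.2‖) ^ (-((n : ℝ) + 1))) * u y :=
              lintegral_indicator (measurableSet_Ioo.prod MeasurableSet.univ) _
          _ = ∫⁻ _t in Ioo 0 (2 * y.1), ∫⁻ x : Bd n,
                ENNReal.ofReal ((y.1 + ‖y.2 - x‖) ^ (-((n : ℝ) + 1))) * u y := by
              rw [Measure.volume_eq_prod, ← Measure.prod_restrict, Measure.restrict_univ]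
              refine lintegral_prod _ (Measurable.aemeasurable ?_)
              fun_prop
          _ ≤ ∫⁻ _t in Ioo 0 (2 * y.1), C2 * ENNReal.ofReal y.1⁻¹ * u y := by
              refine lintegral_mono fun t => ?_
              rw [lintegral_mul_const _ (by fun_prop)]
              exact mul_le_mul' (hC2 y.2 y.1 hy0) le_rfl
          _ = 2 * C2 * u y := by
              rw [setLIntegral_const, Real.volume_Ioo, sub_zero]
              have : ENNReal.ofReal y.1⁻¹ * ENNReal.ofReal (2 * y.1) = 2 := by
                rw [← ENNReal.ofReal_mul (by positivity)]
                rw [show y.1⁻¹ * (2 * y.1) = 2 by field_simp]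
                simp
              calc _ = C2 * (ENNReal.ofReal y.1⁻¹ * ENNReal.ofReal (2 * y.1)) * u y := by ring
                _ = _ := by rw [this]; ring
      · have : ∀ X, G X y = 0 := fun X => indicator_of_notMem (fun h => hy ⟨h.1.2, h.1.1.1⟩) _
        simp [this]
    refine (lintegral_mono hinner).trans ?_
    rw [lintegral_indicator (measurableSet_closedBall.inter measurableSet_halfSpace),
      lintegral_const_mul _ hu]
    exact mul_le_mul' le_rfl (lintegral_halfBall_le u x₀ hρ0)
  have hmeas1 : Measurable fun X => ∫⁻ y in upperRegion X ∩ B, tailKernel X y * u y :=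
    measurable_setLIntegral_section hS hker
  -- The factor 1/ρ of the far part cancels the height of the Carleson box.
  have hvol : volume Q.carleson * ENNReal.ofReal ρ⁻¹ ≤ volume Q.set := by
    rw [Q.volume_carleson, mul_right_comm, ← ENNReal.ofReal_mul hQ.le]
    refine mul_le_of_le_one_left' ?_
    rw [← ENNReal.ofReal_one]
    refine ENNReal.ofReal_le_ofReal ?_
    rw [mul_inv_le_iff₀ hρ0, one_mul, hρ]
    nlinarith
  have hvol2 : ENNReal.ofReal ((4 * ρ) ^ n) =
      ENNReal.ofReal ((8 * (n + 1)) ^ n) * volume Q.set := by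
    rw [Q.volume_set hQ.le, ← ENNReal.ofReal_mul (by positivity), ← mul_pow]
    congr 2
    rw [hρ]; ring
  calc ∫⁻ X in Q.carleson, upperTail u X
      ≤ ∫⁻ X in Q.carleson, ((∫⁻ y in upperRegion X ∩ B, tailKernel X y * u y) +
        C1 * (ENNReal.ofReal ρ⁻¹ * carlesonFn u x₀)) :=
        setLIntegral_mono' Q.measurableSet_carleson hpt
    _ = (∫⁻ X in Q.carleson, ∫⁻ y in upperRegion X ∩ B, tailKernel X y * u y) +
        C1 * (ENNReal.ofReal ρ⁻¹ * carlesonFn u x₀) * volume Q.carleson := by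
        rw [lintegral_add_left hmeas1, setLIntegral_const]
    _ ≤ 2 * C2 * (ENNReal.ofReal ((4 * ρ) ^ n) * carlesonFn u x₀) +
        C1 * carlesonFn u x₀ * volume Q.set := by
        refine add_le_add hnear ?_
        calc _ = C1 * carlesonFn u x₀ * (volume Q.carleson * ENNReal.ofReal ρ⁻¹) := by ring
          _ ≤ _ := mul_le_mul' le_rfl hvol
    _ = _ := by
        rw [hvol2, hD]; ring

/-- The Carleson functional is controlled by that of the Whitney averages. -/
lemma carlesonFn_le_carlesonFn_whitneyAvg {q : ℝ} (hq : 1 ≤ q) {u : Pt n → ℝ≥0∞}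
    (hu : Measurable u) (x : Bd n) :
    carlesonFn u x ≤ 4 ^ n * carlesonFn (whitneyAvg q u) x := by
  refine carlesonFn_le fun Q hQ hx => ?_
  -- If y lies over Q below height ℓ and in the Whitney region of X, then X.1 < 2ℓ, and X.2 is
  -- within ℓ of y.2 in each coordinate, so X stays over 4Q.
  set Q' : Cube n := ⟨Q.center, 4 * Q.side⟩ with hQ'
  have hQ'0 : 0 < Q'.side := by simp only [hQ']; positivity
  have hx' : x ∈ Q'.set := fun i => by
    simp only [hQ']; constructor <;> linarith [(hx i).1, (hx i).2]
  have h1 : ∫⁻ y in Q.carleson, u y ≤ ∫⁻ X in Q'.carleson, whitneyAvg 1 u X := by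
    refine lintegral_le_lintegral_whitneyAvg hu Q.measurableSet_carleson
      Q'.measurableSet_carleson (fun y hy => hy.1.1) fun y hy X hX => ?_
    obtain ⟨⟨a1, a2⟩, a3⟩ := mem_whitneyAt.1 hX
    have b1 : 0 < y.1 := hy.1.1
    have b2 : y.1 < Q.side := hy.1.2
    refine ⟨⟨b1.trans a2, ?_⟩, fun i => ?_⟩
    · simp only [hQ']; linarith
    · have := hy.2 i
      simp only [hQ']
      constructor <;> linarith [(a3 i).1, (a3 i).2, this.1, this.2]
  have hvol : volume Q'.set = 4 ^ n * volume Q.set := by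
    rw [Q'.volume_set hQ'0.le, Q.volume_set hQ.le, mul_pow, ENNReal.ofReal_mul (by positivity),
      ENNReal.ofReal_pow (by positivity)]
    simp
  calc ∫⁻ y in Q.carleson, ‖u y‖ₑ ≤ ∫⁻ X in Q'.carleson, whitneyAvg q u X := by
        refine h1.trans (setLIntegral_mono' Q'.measurableSet_carleson fun X hX => ?_)
        exact whitneyAvg_one_le hq hu hX.1.1
    _ ≤ volume Q'.set * carlesonFn (whitneyAvg q u) x := lintegral_carleson_le hQ'0 hx'
    _ = _ := by rw [hvol]; ring

/-- Shearing is bounded for the Carleson functional. -/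
lemma exists_lintegral_shear_le {c : Pt n} (hc : 0 < c.1) : ∃ C : ℝ≥0, ∀ w : Pt n → ℝ≥0∞,
    Measurable w → ∀ (Q : Cube n), 0 < Q.side → ∀ x ∈ Q.set,
      ∫⁻ X in Q.carleson, w (shear c X) ≤ volume Q.set * (C * carlesonFn w x) := by
  -- Under the shear, heights below ℓ become at most c.1 ℓ, and horizontal positions move by at most
  -- ‖c.2‖ ℓ, so the image of the Carleson box stays in that of LQ.
  set L := 2 * (1 + c.1 + ‖c.2‖) with hL
  have hL0 : 0 < L := by positivity
  refine ⟨(c.1⁻¹ * L ^ n).toNNReal, fun w hw Q hQ x hx => ?_⟩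
  change _ ≤ _ * (ENNReal.ofReal _ * _)
  set Q' : Cube n := ⟨Q.center, L * Q.side⟩ with hQ'
  have hQ'0 : 0 < Q'.side := by simp only [hQ']; positivity
  have hL1 : 1 ≤ L := by rw [hL]; linarith [norm_nonneg c.2]
  have hx' : x ∈ Q'.set := fun i => by
    simp only [hQ']
    have := le_mul_of_one_le_left hQ.le hL1
    constructor <;> linarith [(hx i).1, (hx i).2]
  calc ∫⁻ X in Q.carleson, w (shear c X)
      ≤ ∫⁻ X, Q'.carleson.indicator w (shear c X) := by
        rw [← lintegral_indicator Q.measurableSet_carleson]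
        refine lintegral_mono fun X => ?_
        by_cases hX : X ∈ Q.carleson
        swap
        · rw [indicator_of_notMem hX]; exact bot_le
        have h1 : 0 < X.1 := hX.1.1
        have h2 : X.1 < Q.side := hX.1.2
        rw [indicator_of_mem hX, indicator_of_mem]
        refine ⟨⟨mul_pos hc h1, ?_⟩, fun i => ?_⟩
        · simp only [hQ', shear, hL]
          nlinarith [norm_nonneg c.2]
        · have h3 := abs_le.1 (abs_apply_le_norm c.2 i)
          have h4 := hX.2 i
          have h5 : X.1 * c.2 i ≤ Q.side * ‖c.2‖ := by
            nlinarith [norm_nonneg c.2]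
          have h6 : -(Q.side * ‖c.2‖) ≤ X.1 * c.2 i := by
            nlinarith [norm_nonneg c.2]
          simp only [hQ', shear, hL, PiLp.add_apply, PiLp.smul_apply, smul_eq_mul]
          constructor <;> nlinarith
    _ = ENNReal.ofReal c.1⁻¹ * ∫⁻ X in Q'.carleson, w X := by
        rw [lintegral_comp_shear hc (hw.indicator Q'.measurableSet_carleson),
          lintegral_indicator Q'.measurableSet_carleson]
    _ ≤ ENNReal.ofReal c.1⁻¹ * (volume Q'.set * carlesonFn w x) :=
        mul_le_mul' le_rfl (lintegral_carleson_le hQ'0 hx')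
    _ = _ := by
        rw [Q'.volume_set hQ'0.le, Q.volume_set hQ.le, mul_pow, ENNReal.ofReal_mul (by positivity),
          ENNReal.ofReal_mul (by positivity)]
        ring

end Down

/-! ### Downward operators and the Carleson functional -/

section DownMain

variable {𝕜 : Type*} [RCLike 𝕜] {n : ℕ}

/-- Otherwise the norm would be that of the constant ∞ on a space of nonzero measure. One good
boundary point suffices, since finiteness of averages and tails spreads from it. -/
lemma exists_carlesonFn_ne_top {p q : ℝ} (hp : 1 < p) {f : Pt n →ₘ[hmeas n] 𝕜}
    (hf : normCW p q f < ∞) : ∃ x, carlesonFn (whitneyAvg q f) x < ∞ := by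
  by_contra! hcon
  have : carlesonFn (whitneyAvg q f) = fun _ => ∞ := by
    ext x
    exact top_le_iff.1 (hcon x)
  rw [normCW, this, eLpNorm_const' _ (by simp; linarith) ENNReal.ofReal_ne_top] at hf
  simp only [enorm_eq_self, ENNReal.toReal_ofReal (by linarith : 0 ≤ p)] at hf
  have hne : (volume : Measure (Bd n)) univ ≠ 0 := Measure.measure_univ_ne_zero.2 (NeZero.ne _)
  have hp' : 0 < 1 / p := by positivity
  rw [ENNReal.top_mul] at hf
  · exact lt_irrefl _ hf
  · rw [Ne, ENNReal.rpow_eq_zero_iff]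
    rintro (⟨h, -⟩ | ⟨-, h⟩)
    · exact hne h
    · linarith

/-- The Carleson boxes over cubes of side m + 1 centred at x exhaust the half space, and on each of
them the average function is integrable. -/
lemma ae_whitneyAvg_lt_top_of_carlesonFn {q : ℝ} (hq : 0 < q) {u : Pt n → ℝ≥0∞}
    (hu : Measurable u) {x : Bd n} (h : carlesonFn (whitneyAvg q u) x < ∞) :
    ∀ᵐ X ∂(hmeas n), whitneyAvg q u X < ∞ := by
  have key : ∀ m : ℕ, ∀ᵐ X ∂(volume : Measure (Pt n)),
      X ∈ (⟨x, m + 1⟩ : Cube n).carleson → whitneyAvg q u X < ∞ := fun m => by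
    have hm : (0 : ℝ) < m + 1 := by positivity
    refine (ae_restrict_iff' (Cube.measurableSet_carleson _)).1
      (ae_lt_top (measurable_whitneyAvg hq hu) ?_)
    refine ((lintegral_carleson_le (f := whitneyAvg q u) (Q := ⟨x, m + 1⟩) hm
      (x := x) fun i => ?_).trans_lt ?_).ne
    · simp only; constructor <;> linarith
    · exact ENNReal.mul_lt_top (Cube.volume_set_ne_top (Q := ⟨x, m + 1⟩) hm).lt_top h
  rw [hmeas, ae_restrict_iff' measurableSet_halfSpace]
  filter_upwards [ae_all_iff.2 key] with X hX hXH
  obtain ⟨m, hm⟩ := exists_nat_gt (X.1 + 2 * ‖X.2 - x‖)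
  refine hX m ⟨⟨hXH, ?_⟩, fun i => ?_⟩
  · simp only; linarith [norm_nonneg (X.2 - x)]
  · have h1 := abs_le.1 (abs_apply_le_norm (X.2 - x) i)
    have h2 : 0 < X.1 := hXH
    rw [PiLp.sub_apply] at h1
    simp only
    constructor <;> linarith [h1.1, h1.2]

lemma eLpNorm_exhaustion_lt_top {q : ℝ} (hq : 0 < q) {f : Pt n →ₘ[hmeas n] 𝕜}
    (h : ∀ᵐ X ∂(hmeas n), whitneyAvg q (fun y => ‖f y‖ₑ) X < ∞) (m : ℕ) :
    eLpNorm f (ENNReal.ofReal q) ((hmeas n).restrict (exhaustion n m)) < ∞ := by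
  have h1 := lintegral_exhaustion_lt_top hq h m
  rw [← eLpNorm_rpow_eq_lintegral hq] at h1
  rwa [ENNReal.rpow_lt_top_iff_of_pos hq] at h1

/-- The extension of a downward causal operator is bounded for the Carleson functional. -/
theorem exists_downward_bound (𝕜 : Type*) [RCLike 𝕜] (n : ℕ) (γ A B : ℝ) (h0 : 0 < γ)
    (h1 : γ ≤ 1) {p q : ℝ} (hp : 1 < p) (hq : 1 < q) :
    ∃ C : ℝ≥0, ∀ S : Lp 𝕜 2 (hmeas n) →L[𝕜] Lp 𝕜 2 (hmeas n), IsDownwardCZO γ A B S →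
      ∃ T, ExtendsBoundedly S q (fun f => normCW p q f) C T := by
  have hq0 : 0 < q := by linarith
  obtain ⟨C0, hC0⟩ := exists_isCausalExtension 𝕜 n γ A B h0 h1 hq
  obtain ⟨s, Λ, hs, hΛ⟩ := exists_localBox_avg_le n hq
  obtain ⟨C1, hC1⟩ := exists_carlesonFn_upperTail_le n
  choose! C2 hC2 using fun (c : Pt n) (hc : 0 < c.1) => exists_lintegral_shear_le hc
  set A' := ENNReal.ofReal (A * (2 * n + 12) ^ ((n : ℝ) + 1)) with hA'
  set D : ℝ≥0∞ := C0 * Λ * (∑ c ∈ s, (C2 c : ℝ≥0∞)) + A' * (C1 * 4 ^ n) with hD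
  have hDt : D ≠ ∞ := by
    have : ∑ c ∈ s, (C2 c : ℝ≥0∞) ≠ ∞ := ENNReal.sum_ne_top.2 fun _ _ => ENNReal.coe_ne_top
    finiteness
  refine ⟨D.toNNReal, fun S hS => ?_⟩
  obtain ⟨k, hk, hker⟩ := hS.exists_kernel
  obtain ⟨T, Y, hT⟩ := hC0 (-1) k S hk hker hS.1
  -- A downward kernel sees only heights above z.1, and z.1 > X.1/2 in the Whitney region.
  have htail : ∀ (f : Pt n →ₘ[hmeas n] 𝕜) (X : Pt n), ∀ z ∈ whitneyAt X,
      ∫⁻ y in (localBox X)ᶜ, ‖causalKernel (-1) k z y‖ₑ * ‖f y‖ₑ ∂(hmeas n) ≤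
        A' * upperTail (fun y => ‖f y‖ₑ) X := fun f X z hz =>
    hk.lintegral_compl_localBox_le (-1) hz (measurableSet_upperRegion X) (fun y hy hc =>
      ⟨hy, by linarith [hz.1.1, show X.1 / 2 < z.1 from hz.1.1]⟩) _
  have hmem : ∀ f : Pt n →ₘ[hmeas n] 𝕜, normCW p q f < ∞ → f ∈ Y ∧
      ∀ m, eLpNorm f (ENNReal.ofReal q) ((hmeas n).restrict (exhaustion n m)) < ∞ := by
    intro f hf
    have hu : Measurable fun y => ‖f y‖ₑ := f.measurable.enorm
    obtain ⟨x, hx⟩ := exists_carlesonFn_ne_top hp hf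
    rw [← whitneyAvg_enorm hq0] at hx
    have hloc := eLpNorm_exhaustion_lt_top hq0 (ae_whitneyAvg_lt_top_of_carlesonFn hq0 hu hx)
    refine ⟨hT.mem_of_tail f hloc (finiteTail_of_forall fun X hX z hz => ?_), hloc⟩
    refine (htail f X z hz).trans_lt (ENNReal.mul_lt_top ENNReal.ofReal_lt_top
      (upperTail_lt_top hu (x₀ := x) ?_ hX))
    exact (carlesonFn_le_carlesonFn_whitneyAvg hq.le hu x).trans_lt (by finiteness)
  refine ⟨T, hT.extends_two, ⟨C0, ?_, ?_, hT.bound⟩, ?_, ?_, ?_⟩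
  · exact fun f g hf hg => hT.map_add f (hT.mem_of_memLp f hf) g (hT.mem_of_memLp g hg)
  · exact fun c f hf => hT.map_smul c f (hT.mem_of_memLp f hf)
  · exact fun f g hf hg => hT.map_add f (hmem f hf).1 g (hmem g hg).1
  · exact fun c f hf => hT.map_smul c f (hmem f hf).1
  intro f hf
  obtain ⟨hfY, hloc⟩ := hmem f hf
  set u : Pt n → ℝ≥0∞ := fun y => ‖f y‖ₑ with hu_def
  have hu : Measurable u := f.measurable.enorm
  have hw := measurable_whitneyAvg hq0 hu
  rw [ENNReal.coe_toNNReal hDt]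
  have hpt : ∀ X : Pt n, 0 < X.1 → whitneyAvg q (T f) X ≤
      C0 * Λ * (∑ c ∈ s, whitneyAvg q u (shear c X)) + A' * upperTail u X := by
    intro X hX
    refine (hT.whitneyAvg_le hq hfY hloc hX (htail f X)).trans (add_le_add ?_ le_rfl)
    rw [mul_assoc]
    exact mul_le_mul' le_rfl (hΛ u X hX)
  -- The estimate is pointwise on the boundary, for the Carleson functional itself. No maximal
  -- function is needed, and p enters only when the norm is taken.
  have hcarl : ∀ x, carlesonFn (whitneyAvg q (T f)) x ≤ D * carlesonFn (whitneyAvg q f) x := by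
    intro x
    rw [← whitneyAvg_enorm hq0 f]
    refine carlesonFn_le fun Q hQ hx => ?_
    have hms : Measurable fun X => ∑ c ∈ s, whitneyAvg q u (shear c X) :=
      Finset.measurable_sum s fun c _ => hw.comp (measurable_shear c)
    calc ∫⁻ X in Q.carleson, ‖whitneyAvg q (T f) X‖ₑ
        ≤ ∫⁻ X in Q.carleson, (C0 * Λ * (∑ c ∈ s, whitneyAvg q u (shear c X)) +
            A' * upperTail u X) :=
          setLIntegral_mono' Q.measurableSet_carleson fun X hX => hpt X hX.1.1
      _ = C0 * Λ * (∑ c ∈ s, ∫⁻ X in Q.carleson, whitneyAvg q u (shear c X)) +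
            A' * ∫⁻ X in Q.carleson, upperTail u X := by
          rw [lintegral_add_left (hms.const_mul _), lintegral_const_mul _ hms,
            lintegral_const_mul _ (measurable_upperTail hu),
            lintegral_finsetSum s (f := fun c X => whitneyAvg q u (shear c X))
              fun c _ => hw.comp (measurable_shear c)]
      _ ≤ C0 * Λ * (∑ c ∈ s, volume Q.set * (C2 c * carlesonFn (whitneyAvg q u) x)) +
            A' * (volume Q.set * (C1 * (4 ^ n * carlesonFn (whitneyAvg q u) x))) := by
          refine add_le_add (mul_le_mul' le_rfl (Finset.sum_le_sum fun c hc =>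
            hC2 c (hs c hc) _ hw Q hQ x hx)) (mul_le_mul' le_rfl ?_)
          refine (lintegral_carleson_le (f := upperTail u) hQ hx).trans (mul_le_mul' le_rfl ?_)
          exact (hC1 u hu x).trans (mul_le_mul' le_rfl
            (carlesonFn_le_carlesonFn_whitneyAvg hq.le hu x))
      _ = _ := by
          rw [← Finset.mul_sum, ← Finset.sum_mul, hD]
          ring
  calc normCW p q (T f) ≤ eLpNorm (fun x => D * carlesonFn (whitneyAvg q f) x)
        (ENNReal.ofReal p) volume := eLpNorm_mono_enorm fun x => hcarl x
    _ = D * normCW p q f := by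
        rw [normCW, eLpNorm_eq_eLpNorm' (by simp; linarith) ENNReal.ofReal_ne_top,
          eLpNorm_eq_eLpNorm' (by simp; linarith) ENNReal.ofReal_ne_top, eLpNorm', eLpNorm',
          ENNReal.toReal_ofReal (by linarith)]
        simp only [enorm_eq_self]
        have hp0 : 0 < p := by linarith
        simp_rw [ENNReal.mul_rpow_of_nonneg _ _ hp0.le]
        rw [lintegral_const_mul' _ _ (by finiteness), ENNReal.mul_rpow_of_nonneg _ _ (by positivity),
          ← ENNReal.rpow_mul, mul_one_div_cancel hp0.ne', ENNReal.rpow_one]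

end DownMain

end CausalCZO

namespace CausalCZO

open Filter Topology Metric

/-! ### The upward estimate -/

section Up

variable {n : ℕ}

/-- The cone of aperture `α` with vertex `x`. -/
def cone (α : ℝ) (x : Bd n) : Set (Pt n) := {y | 0 < y.1 ∧ ‖y.2 - x‖ < α * y.1}

lemma measurableSet_cone_prod (α : ℝ) :
    MeasurableSet {P : Bd n × Pt n | P.2 ∈ cone α P.1} := by
  have : {P : Bd n × Pt n | P.2 ∈ cone α P.1} =
    {P | 0 < P.2.1} ∩ {P | ‖P.2.2 - P.1‖ < α * P.2.1} := rfl
  rw [this]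
  exact (measurableSet_lt (by fun_prop) (by fun_prop)).inter
    (measurableSet_lt (by fun_prop) (by fun_prop))

lemma measurableSet_cone (α : ℝ) (x : Bd n) : MeasurableSet (cone α x) :=
  measurable_prodMk_left (measurableSet_cone_prod α)

lemma nontanFn_le_iff {α : ℝ} {w : Pt n → ℝ≥0∞} {x : Bd n} {c : ℝ≥0∞} :
    nontanFn α w x ≤ c ↔ ∀ᵐ y, y ∈ cone α x → w y ≤ c := by
  rw [← ae_restrict_iff' (measurableSet_cone α x)]
  refine ⟨fun h => ?_, fun h => essSup_le_of_ae_le c h⟩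
  filter_upwards [ENNReal.ae_le_essSup (μ := volume.restrict (cone α x)) w] with y hy
  exact hy.trans h

/-- A sublevel set at height c consists of the x for which the points of the cone with w > c form a
null set. The volume of these sections is measurable in x by Tonelli. -/
lemma measurable_nontanFn (α : ℝ) {w : Pt n → ℝ≥0∞} (hw : Measurable w) :
    Measurable (nontanFn α w) := by
  refine measurable_of_Iic fun c => ?_
  set S : Set (Bd n × Pt n) := {P | P.2 ∈ cone α P.1} ∩ {P | c < w P.2}
  have hS : MeasurableSet S := (measurableSet_cone_prod α).inter
    (measurableSet_lt measurable_const (hw.comp measurable_snd))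
  have : nontanFn α w ⁻¹' Iic c = (fun x => volume (Prod.mk x ⁻¹' S)) ⁻¹' {0} := by
    ext x
    rw [mem_preimage, mem_Iic, nontanFn_le_iff, mem_preimage, mem_singleton_iff, ae_iff]
    congr! 2
    ext y
    simp [S, Set.mem_ofPred_eq]
  rw [this]
  exact measurable_measure_prodMk_left hS (measurableSet_singleton 0)

/-- At almost every point the function is dominated by the non-tangential functional at almost
all boundary points nearby. -/
lemma ae_le_nontanFn (α : ℝ) {w : Pt n → ℝ≥0∞} (hw : Measurable w) :
    ∀ᵐ X : Pt n, ∀ᵐ x : Bd n, X ∈ cone α x → w X ≤ nontanFn α w x := by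
  -- By definition the bound holds for every x at almost every X; Fubini for null sets exchanges the
  -- two quantifiers.
  refine (Measure.ae_ae_comm (μ := (volume : Measure (Bd n)))
    (p := fun x (X : Pt n) => X ∈ cone α x → w X ≤ nontanFn α w x) ?_).1
    (ae_of_all _ fun x => nontanFn_le_iff.1 le_rfl)
  have h1 : MeasurableSet {P : Bd n × Pt n | w P.2 ≤ nontanFn α w P.1} :=
    measurableSet_le (hw.comp measurable_snd) ((measurable_nontanFn α hw).comp measurable_fst)
  have : {P : Bd n × Pt n | P.2 ∈ cone α P.1 → w P.2 ≤ nontanFn α w P.1} =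
      {P : Bd n × Pt n | P.2 ∈ cone α P.1}ᶜ ∪ {P : Bd n × Pt n | w P.2 ≤ nontanFn α w P.1} := by
    ext P
    exact imp_iff_not_or
  rw [this]
  exact (measurableSet_cone_prod α).compl.union h1

/-- Pointwise control by the maximal function of the non-tangential functional, in a cone of any
aperture. -/
lemma ae_le_maxFn_nontanFn {α β : ℝ} (hα : 0 < α) (hβ : 0 ≤ β) {w : Pt n → ℝ≥0∞}
    (hw : Measurable w) : ∀ᵐ X : Pt n, 0 < X.1 → ∀ x : Bd n, ‖X.2 - x‖ ≤ β * X.1 →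
      w X ≤ ENNReal.ofReal ((4 * (α + β) / α) ^ n) * maxFn volume (nontanFn α w) x := by
  filter_upwards [ae_le_nontanFn α hw] with X hX hX0 x hx
  set g := nontanFn α w
  have ht : 0 < α * X.1 / 2 := by positivity
  set a := volume (closedBall X.2 (α * X.1 / 2)) with ha
  have ha0 : a ≠ 0 := (measure_closedBall_pos _ _ ht).ne'
  have hat : a ≠ ∞ := measure_closedBall_lt_top.ne
  -- X lies in the cone of every boundary point within αX.1/2 of X.2, so w X is at most the average
  -- of the non-tangential functional over that ball.
  have h1 : w X * a ≤ ∫⁻ y in closedBall X.2 (α * X.1 / 2), g y := by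
    rw [ha, ← setLIntegral_const]
    refine lintegral_mono_ae ((ae_restrict_iff' measurableSet_closedBall).2 ?_)
    filter_upwards [hX] with y hy hyb
    refine hy ⟨hX0, ?_⟩
    have : ‖X.2 - y‖ ≤ α * X.1 / 2 := by rwa [← dist_eq_norm, dist_comm]
    linarith
  have hβ' : 0 < (α + β) * X.1 := by positivity
  have h2 : ∫⁻ y in closedBall X.2 (α * X.1 / 2), g y ≤
      volume (closedBall (0 : Bd n) (2 * ((α + β) * X.1))) * maxFn volume g x := by
    refine le_trans (lintegral_mono_set ?_) (lintegral_closedBall_le_maxFn volume g x hβ')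
    refine closedBall_subset_closedBall' ?_
    rw [dist_eq_norm]
    nlinarith
  have h3 : volume (closedBall (0 : Bd n) (2 * ((α + β) * X.1))) =
      ENNReal.ofReal ((4 * (α + β) / α) ^ n) * a := by
    rw [ha, volume_closedBall_bd _ ht.le,
      volume_closedBall_bd _ (by positivity : 0 ≤ 2 * ((α + β) * X.1)),
      mul_left_comm (ENNReal.ofReal _), ← ENNReal.ofReal_mul (by positivity)]
    congr 2
    rw [Real.rpow_natCast, Real.rpow_natCast, ← mul_pow]
    congr 1
    field_simp
    ring
  have h4 := h1.trans h2
  rw [h3, mul_right_comm] at h4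
  exact (ENNReal.mul_le_mul_iff_left ha0 hat).1 h4

/-- By the change of variables, preimages of null sets under a shear are null. A measurable hull is
used because P need not be measurable. -/
lemma ae_shear {c : Pt n} (hc : 0 < c.1) {P : Pt n → Prop} (h : ∀ᵐ X, P X) :
    ∀ᵐ X, P (shear c X) := by
  set N := toMeasurable volume {X | ¬ P X} with hN
  have hNm : MeasurableSet N := measurableSet_toMeasurable _ _
  have hN0 : volume N = 0 := (measure_toMeasurable _).trans (ae_iff.1 h)
  have h1 : volume (shear c ⁻¹' N) = 0 := by
    rw [← lintegral_indicator_one (measurable_shear c hNm)]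
    have := lintegral_comp_shear hc (g := N.indicator 1) (measurable_one.indicator hNm)
    rw [lintegral_indicator_one hNm, hN0, mul_zero] at this
    exact this
  refine ae_iff.2 (measure_mono_null (fun X hX => ?_) h1)
  exact subset_toMeasurable _ _ hX

/-- The shears only change the aperture of the cones. -/
lemma exists_ae_shear_le {α : ℝ} (hα : 0 < α) {c : Pt n} (hc : 0 < c.1) : ∃ K : ℝ≥0,
    ∀ w : Pt n → ℝ≥0∞, Measurable w → ∀ᵐ X : Pt n, ∀ x : Bd n, X ∈ cone α x →
      w (shear c X) ≤ K * maxFn volume (nontanFn α w) x := by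
  -- If X is in the cone of aperture α at x, its shear is within (α + ‖c.2‖) X.1 of x, and its
  -- height is c.1 X.1.
  set β := (α + ‖c.2‖) / c.1 with hβ
  have hβ0 : 0 ≤ β := by positivity
  refine ⟨((4 * (α + β) / α) ^ n).toNNReal, fun w hw => ?_⟩
  filter_upwards [ae_shear hc (ae_le_maxFn_nontanFn hα hβ0 hw)] with X hX x hx
  refine hX (mul_pos hc hx.1) x ?_
  simp only [shear]
  have h1 : β * (c.1 * X.1) = (α + ‖c.2‖) * X.1 := by rw [hβ]; field_simp
  rw [h1, show X.2 + X.1 • c.2 - x = (X.2 - x) + X.1 • c.2 by abel]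
  refine (norm_add_le _ _).trans ?_
  rw [norm_smul, Real.norm_of_nonneg hx.1.le]
  linarith [hx.2]

/-- The points of the half space below `X`. -/
def lowerRegion (X : Pt n) : Set (Pt n) := {y | 0 < y.1 ∧ y.1 < X.1}

lemma measurableSet_lowerRegion (X : Pt n) : MeasurableSet (lowerRegion X) :=
  show MeasurableSet ({y : Pt n | 0 < y.1} ∩ {y | y.1 < X.1}) from
    (measurableSet_lt (by fun_prop) (by fun_prop)).inter
      (measurableSet_lt (by fun_prop) (by fun_prop))

/-- The integral of the tail kernel over the lower region. -/
noncomputable def lowerTail (u : Pt n → ℝ≥0∞) (X : Pt n) : ℝ≥0∞ :=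
  ∫⁻ y in lowerRegion X, tailKernel X y * u y

/-- Mass of a function below height `X.1` in a ball. -/
lemma lintegral_lowerRegion_le {α q : ℝ} (hα : 0 < α) (hq : 1 ≤ q) {u : Pt n → ℝ≥0∞}
    (hu : Measurable u) {X : Pt n} {x : Bd n} (hX : X ∈ cone α x) {R : ℝ} (hR : X.1 ≤ R) :
    ∫⁻ y in lowerRegion X ∩ closedBall X R, u y ≤
      ENNReal.ofReal (2 * 4 ^ n) * (volume (closedBall (0 : Bd n) 1) *
        ENNReal.ofReal ((2 * (α + 2 * n + 3)) ^ n)) *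
      maxFn volume (maxFn volume (nontanFn α (whitneyAvg q u))) x *
        ENNReal.ofReal X.1 * ENNReal.ofReal (R ^ (n : ℝ)) := by
  have hX0 : 0 < X.1 := hX.1
  have hR0 : 0 < R := by linarith
  have hw := measurable_whitneyAvg (by linarith : 0 < q) hu
  set w := whitneyAvg q u
  set g := maxFn volume (nontanFn α w) with hg
  have hgm : Measurable g := measurable_maxFn volume (measurable_nontanFn α hw)
  -- Centres whose Whitney regions meet the set lie below height 2X.1 and horizontally within (n+2)R
  -- of X.2; this r is a convenient larger radius.
  set r := (2 * n + 3) * R with hr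
  have hr0 : 0 < r := by positivity
  set U' : Set (Pt n) := Ioo 0 (2 * X.1) ×ˢ closedBall X.2 r with hU'
  have hU'm : MeasurableSet U' := measurableSet_Ioo.prod measurableSet_closedBall
  calc ∫⁻ y in lowerRegion X ∩ closedBall X R, u y
      ≤ ∫⁻ Z in U', whitneyAvg 1 u Z := by
        refine lintegral_le_lintegral_whitneyAvg hu
          ((measurableSet_lowerRegion X).inter measurableSet_closedBall) hU'm
          (fun y hy => hy.1.1) fun y hy Z hyZ => ?_
        rw [mem_whitneyAt] at hyZ
        have h1 : y.1 < X.1 := hy.1.2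
        have h0 : 0 < y.1 := hy.1.1
        have hZ0 : 0 < Z.1 := by linarith
        refine ⟨⟨hZ0, by linarith⟩, ?_⟩
        have h2 : ‖y.2 - Z.2‖ ≤ (n + 1) * (Z.1 / 2) := by
          refine norm_le_of_abs_le (by linarith) fun i => ?_
          rw [PiLp.sub_apply, abs_le]
          constructor <;> linarith [(hyZ.2 i).1, (hyZ.2 i).2]
        have h3 : dist y.2 X.2 ≤ R := (le_max_right _ _).trans (mem_closedBall.1 hy.2)
        rw [mem_closedBall]
        have h4 := dist_triangle_left Z.2 X.2 y.2
        rw [dist_eq_norm y.2 Z.2] at h4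
        have hn : (0 : ℝ) ≤ n := Nat.cast_nonneg n
        have h5 : (n + 1) * (Z.1 / 2) ≤ (n + 1) * R :=
          mul_le_mul_of_nonneg_left (by linarith) (by linarith)
        nlinarith
    -- The first maximal function replaces the average at Z by a function of Z.2 alone, with
    -- aperture zero and so the factor 4ⁿ. The height integral yields X.1, and the remaining
    -- horizontal average yields the second maximal function.
    _ ≤ ∫⁻ Z in U', ENNReal.ofReal (4 ^ n) * g Z.2 := by
        refine lintegral_mono_ae ((ae_restrict_iff' hU'm).2 ?_)
        filter_upwards [ae_le_maxFn_nontanFn hα le_rfl hw] with Z hZ hZU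
        refine (whitneyAvg_one_le hq hu hZU.1.1).trans ((hZ hZU.1.1 Z.2 (by simp)).trans ?_)
        rw [add_zero, mul_div_cancel_right₀ _ hα.ne']
    _ = ENNReal.ofReal (2 * 4 ^ n) * ENNReal.ofReal X.1 * ∫⁻ z in closedBall X.2 r, g z := by
        rw [Measure.volume_eq_prod, ← Measure.prod_restrict, lintegral_prod _ (by fun_prop)]
        simp only
        rw [lintegral_const, lintegral_const_mul _ hgm, Measure.restrict_apply_univ,
          Real.volume_Ioo, sub_zero, ENNReal.ofReal_mul (by norm_num), ENNReal.ofReal_mul (by norm_num)]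
        ring
    _ ≤ ENNReal.ofReal (2 * 4 ^ n) * ENNReal.ofReal X.1 *
          (volume (closedBall (0 : Bd n) (2 * ((α + 2 * n + 3) * R))) * maxFn volume g x) := by
        refine mul_le_mul' le_rfl ((lintegral_mono_set ?_).trans
          (lintegral_closedBall_le_maxFn volume g x (by positivity)))
        refine closedBall_subset_closedBall' ?_
        rw [dist_eq_norm]
        nlinarith [hX.2]
    _ = _ := by
        have h1 : ENNReal.ofReal ((2 * ((α + 2 * n + 3) * R)) ^ (n : ℝ)) =
            ENNReal.ofReal ((2 * (α + 2 * n + 3)) ^ n) * ENNReal.ofReal (R ^ (n : ℝ)) := by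
          rw [← ENNReal.ofReal_mul (by positivity), ← mul_assoc,
            Real.mul_rpow (by positivity) hR0.le, Real.rpow_natCast (2 * (α + 2 * n + 3))]
        rw [volume_closedBall_bd _ (by positivity), h1]
        ring

/-- The lower tail is controlled in a cone by the iterated maximal function. -/
lemma exists_lowerTail_le (n : ℕ) {α q : ℝ} (hα : 0 < α) (hq : 1 ≤ q) : ∃ K : ℝ≥0,
    ∀ u : Pt n → ℝ≥0∞, Measurable u → ∀ (X : Pt n) (x : Bd n), X ∈ cone α x →
      lowerTail u X ≤
        K * maxFn volume (maxFn volume (nontanFn α (whitneyAvg q u))) x := by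
  set L := ENNReal.ofReal (2 * 4 ^ n) * (volume (closedBall (0 : Bd n) 1) *
        ENNReal.ofReal ((2 * (α + 2 * n + 3)) ^ n)) with hL
  have hLt : L ≠ ∞ := by
    have : volume (closedBall (0 : Bd n) 1) ≠ ∞ := measure_closedBall_lt_top.ne
    finiteness
  set J := ENNReal.ofReal (2 ^ (n : ℝ) * (1 - 2 ^ ((n : ℝ) - (n + 1)))⁻¹) with hJ
  have hJt : J ≠ ∞ := ENNReal.ofReal_ne_top
  refine ⟨((1 + J) * L).toNNReal, fun u hu X x hX => ?_⟩
  rw [ENNReal.coe_toNNReal (by finiteness)]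
  have hX0 : 0 < X.1 := hX.1
  set g := maxFn volume (maxFn volume (nontanFn α (whitneyAvg q u))) x
  set m := L * g * ENNReal.ofReal X.1 with hm
  -- As a measure, u below X has growth of order n beyond radius X.1, with a constant proportional
  -- to X.1. Summation over annuli returns the factor 1/X.1, so the tail bound is independent of
  -- scale.
  set ν := (volume.restrict (lowerRegion X)).withDensity u with hν
  have hν1 : ∀ R, X.1 ≤ R → ν (closedBall X R) ≤ m * ENNReal.ofReal (R ^ (n : ℝ)) := fun R hR => by
    rw [hν, withDensity_apply _ measurableSet_closedBall,
      Measure.restrict_restrict measurableSet_closedBall, inter_comm]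
    exact lintegral_lowerRegion_le hα hq hu hX hR
  have hX1 : ENNReal.ofReal X.1 * ENNReal.ofReal (X.1 ^ (-1 : ℝ)) = 1 := by
    rw [← ENNReal.ofReal_mul hX0.le, Real.rpow_neg_one, mul_inv_cancel₀ hX0.ne', ENNReal.ofReal_one]
  have hn1 : (n : ℝ) - (n + 1) = -1 := by ring
  have hfar := lintegral_annuli_le ν (a := n) (b := n + 1) (by linarith) (by positivity) hX0 hν1
  rw [hn1] at hfar
  have hker : Measurable fun y => tailKernel X y :=
    measurable_tailKernel.comp measurable_prodMk_left
  have e1 : lowerTail u X = ∫⁻ y, tailKernel X y ∂ν := by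
    rw [lowerTail, hν, lintegral_withDensity_eq_lintegral_mul _ hu hker]
    refine lintegral_congr fun y => ?_
    rw [Pi.mul_apply, mul_comm]
  have hpos : ∀ᵐ y ∂ν, 0 < y.1 :=
    (withDensity_absolutelyContinuous _ _).ae_le (ae_restrict_of_forall_mem
      (measurableSet_lowerRegion X) fun y hy => hy.1)
  have hneg : -((n : ℝ) + 1) ≤ 0 := by have : (0 : ℝ) ≤ n := Nat.cast_nonneg n; linarith
  have hmf : MeasurableSet {y : Pt n | X.1 ≤ dist y X} :=
    measurableSet_le measurable_const (continuous_id.dist continuous_const).measurable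
  have hcov : (univ : Set (Pt n)) ⊆ closedBall X X.1 ∪ {y | X.1 ≤ dist y X} := fun y _ => by
    rcases le_total (dist y X) X.1 with h | h
    · exact Or.inl h
    · exact Or.inr h
  rw [e1, ← setLIntegral_univ]
  refine (lintegral_mono_set hcov).trans ((lintegral_union_le _ _ _).trans ?_)
  have near : ∫⁻ y in closedBall X X.1, tailKernel X y ∂ν ≤ L * g := by
    calc ∫⁻ y in closedBall X X.1, tailKernel X y ∂ν
        ≤ ∫⁻ _y in closedBall X X.1, ENNReal.ofReal (X.1 ^ (-((n : ℝ) + 1))) ∂ν := by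
          refine lintegral_mono_ae (ae_restrict_of_ae ?_)
          filter_upwards [hpos] with y hy
          refine ENNReal.ofReal_le_ofReal (Real.rpow_le_rpow_of_nonpos hX0 ?_ hneg)
          have := norm_nonneg (y.2 - X.2)
          linarith
      _ ≤ ENNReal.ofReal (X.1 ^ (-((n : ℝ) + 1))) * (m * ENNReal.ofReal (X.1 ^ (n : ℝ))) := by
          rw [setLIntegral_const]
          exact mul_le_mul' le_rfl (hν1 _ le_rfl)
      _ = L * g * (ENNReal.ofReal X.1 * ENNReal.ofReal (X.1 ^ (-1 : ℝ))) := by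
          have : ENNReal.ofReal (X.1 ^ (-1 : ℝ)) =
              ENNReal.ofReal (X.1 ^ (-((n : ℝ) + 1))) * ENNReal.ofReal (X.1 ^ (n : ℝ)) := by
            rw [← ENNReal.ofReal_mul (by positivity), ← Real.rpow_add hX0]
            congr 2; ring
          rw [this, hm]; ring
      _ = L * g := by rw [hX1, mul_one]
  have far : ∫⁻ y in {y | X.1 ≤ dist y X}, tailKernel X y ∂ν ≤ J * (L * g) := by
    calc ∫⁻ y in {y | X.1 ≤ dist y X}, tailKernel X y ∂ν
        ≤ ∫⁻ y in {y | X.1 ≤ dist y X}, ENNReal.ofReal (dist y X ^ (-((n : ℝ) + 1))) ∂ν := by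
          refine lintegral_mono_ae ((ae_restrict_iff' hmf).2 ?_)
          filter_upwards [hpos] with y hy hyd
          have hyd' : X.1 ≤ dist y X := hyd
          refine ENNReal.ofReal_le_ofReal (Real.rpow_le_rpow_of_nonpos (by linarith) ?_ hneg)
          have h3 := norm_nonneg (y.2 - X.2)
          rw [Prod.dist_eq, dist_eq_norm y.2 X.2, Real.dist_eq]
          refine max_le (abs_le.2 ⟨?_, ?_⟩) ?_ <;> linarith
      _ ≤ _ := hfar
      _ = J * (L * g * (ENNReal.ofReal X.1 * ENNReal.ofReal (X.1 ^ (-1 : ℝ)))) := by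
          rw [hm, hJ, hn1]; ring
      _ = _ := by rw [hX1, mul_one]
  refine (add_le_add near far).trans (le_of_eq ?_)
  ring

end Up

end CausalCZO

namespace CausalCZO

open Filter Topology Metric

/-! ### Norms of extended nonnegative functions -/

section LpEnorm

lemma eLpNorm_enn {α : Type*} [MeasurableSpace α] {μ : Measure α} {p : ℝ} (hp : 0 < p)
    (f : α → ℝ≥0∞) : eLpNorm f (ENNReal.ofReal p) μ = (∫⁻ x, f x ^ p ∂μ) ^ (1 / p) := by
  rw [eLpNorm_eq_eLpNorm' (by simpa using hp) ENNReal.ofReal_ne_top, eLpNorm',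
    ENNReal.toReal_ofReal hp.le]
  simp only [enorm_eq_self]

lemma eLpNorm_const_mul_add_le_enn {α : Type*} [MeasurableSpace α] {μ : Measure α} {p : ℝ}
    (hp : 1 ≤ p) {D : ℝ≥0∞} (hD : D ≠ ∞) {f g : α → ℝ≥0∞} (hf : Measurable f) (hg : Measurable g) :
    eLpNorm (fun x => D * (f x + g x)) (ENNReal.ofReal p) μ ≤
      D * (eLpNorm f (ENNReal.ofReal p) μ + eLpNorm g (ENNReal.ofReal p) μ) := by
  have hp0 : 0 < p := by linarith
  rw [eLpNorm_enn hp0, eLpNorm_enn hp0, eLpNorm_enn hp0]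
  simp_rw [ENNReal.mul_rpow_of_nonneg _ _ hp0.le]
  rw [lintegral_const_mul' _ _ (by finiteness), ENNReal.mul_rpow_of_nonneg _ _ (by positivity),
    ← ENNReal.rpow_mul, mul_one_div_cancel hp0.ne', ENNReal.rpow_one]
  exact mul_le_mul' le_rfl (ENNReal.lintegral_Lp_add_le hf.aemeasurable hg.aemeasurable hp)

lemma exists_eLpNorm_maxFn_le (n : ℕ) {p : ℝ} (hp : 1 < p) : ∃ C : ℝ≥0, ∀ g : Bd n → ℝ≥0∞,
    Measurable g → eLpNorm (maxFn volume g) (ENNReal.ofReal p) volume ≤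
      C * eLpNorm g (ENNReal.ofReal p) volume := by
  have hp0 : 0 < p := by linarith
  obtain ⟨C, hC⟩ := lintegral_maxFn_rpow_le (volume : Measure (Bd n)) hp
  refine ⟨((C : ℝ≥0∞) ^ (1 / p)).toNNReal, fun g hg => ?_⟩
  rw [ENNReal.coe_toNNReal (by finiteness), eLpNorm_enn hp0, eLpNorm_enn hp0,
    ← ENNReal.mul_rpow_of_nonneg _ _ (by positivity)]
  exact ENNReal.rpow_le_rpow (hC g hg) (by positivity)

lemma ae_lt_top_of_eLpNorm_enn {α : Type*} [MeasurableSpace α] {μ : Measure α} {p : ℝ} (hp : 0 < p)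
    {f : α → ℝ≥0∞} (hf : Measurable f) (h : eLpNorm f (ENNReal.ofReal p) μ < ∞) :
    ∀ᵐ x ∂μ, f x < ∞ := by
  rw [eLpNorm_enn hp, ENNReal.rpow_lt_top_iff_of_pos (by positivity)] at h
  filter_upwards [ae_lt_top (hf.pow_const p) h.ne] with x hx
  exact (ENNReal.rpow_lt_top_iff_of_pos hp).1 hx

end LpEnorm

/-! ### Upward operators and the non-tangential functional -/

section UpMain

variable {𝕜 : Type*} [RCLike 𝕜] {n : ℕ}

/-- The boundary points whose cone contains X form a ball of positive measure, so an almost sure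
property holds at one of them. -/
lemma exists_mem_cone_of_ae {α : ℝ} (hα : 0 < α) {X : Pt n} (hX : 0 < X.1) {P : Bd n → Prop}
    (h : ∀ᵐ x, P x) : ∃ x, X ∈ cone α x ∧ P x := by
  by_contra! hcon
  have h1 : ball X.2 (α * X.1) ⊆ {x | ¬ P x} := fun x hx =>
    hcon x ⟨hX, by rwa [← dist_eq_norm, dist_comm]⟩
  exact (measure_ball_pos volume X.2 (by positivity : 0 < α * X.1)).ne'
    (measure_mono_null h1 (ae_iff.1 h))

/-- The extension of an upward causal operator is bounded for the non-tangential functional. -/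
theorem exists_upward_bound (𝕜 : Type*) [RCLike 𝕜] (n : ℕ) (α γ A B : ℝ) (hα : 0 < α)
    (h0 : 0 < γ) (h1 : γ ≤ 1) {p q : ℝ} (hp : 1 < p) (hq : 1 < q) :
    ∃ C : ℝ≥0, ∀ S : Lp 𝕜 2 (hmeas n) →L[𝕜] Lp 𝕜 2 (hmeas n), IsUpwardCZO γ A B S →
      ∃ T, ExtendsBoundedly S q (fun f => normNW α p q f) C T := by
  have hq0 : 0 < q := by linarith
  have hp0 : 0 < p := by linarith
  obtain ⟨C0, hC0⟩ := exists_isCausalExtension 𝕜 n γ A B h0 h1 hq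
  obtain ⟨s, Λ, hs, hΛ⟩ := exists_localBox_avg_le n hq
  obtain ⟨C1, hC1⟩ := exists_lowerTail_le n hα hq.le
  choose! C2 hC2 using fun (c : Pt n) (hc : 0 < c.1) => exists_ae_shear_le hα hc
  obtain ⟨M, hM⟩ := exists_eLpNorm_maxFn_le n hp
  set A' := ENNReal.ofReal (A * (2 * n + 12) ^ ((n : ℝ) + 1)) with hA'
  set D : ℝ≥0∞ := C0 * (Λ * (∑ c ∈ s, (C2 c : ℝ≥0∞))) + A' * C1 with hD
  have hDt : D ≠ ∞ := by
    have : ∑ c ∈ s, (C2 c : ℝ≥0∞) ≠ ∞ := ENNReal.sum_ne_top.2 fun _ _ => ENNReal.coe_ne_top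
    finiteness
  -- The local part costs one application of the maximal theorem and the tail costs two.
  refine ⟨(D * (M + M * M)).toNNReal, fun S hS => ?_⟩
  obtain ⟨k, hk, hker⟩ := hS.exists_kernel
  obtain ⟨T, Y, hT⟩ := hC0 1 k S hk hker hS.1
  -- An upward kernel sees only heights below z.1, and z.1 < X.1 in the Whitney region.
  have htail : ∀ (f : Pt n →ₘ[hmeas n] 𝕜) (X : Pt n), ∀ z ∈ whitneyAt X,
      ∫⁻ y in (localBox X)ᶜ, ‖causalKernel 1 k z y‖ₑ * ‖f y‖ₑ ∂(hmeas n) ≤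
        A' * lowerTail (fun y => ‖f y‖ₑ) X := fun f X z hz =>
    hk.lintegral_compl_localBox_le 1 hz (measurableSet_lowerRegion X) (fun y hy hc =>
      ⟨hy, by linarith [hz.1.1, show z.1 < X.1 from hz.1.2]⟩) _
  have hmax : ∀ f : Pt n →ₘ[hmeas n] 𝕜, normNW α p q f < ∞ →
      Measurable (maxFn volume (nontanFn α (whitneyAvg q f))) ∧
      eLpNorm (maxFn volume (nontanFn α (whitneyAvg q f))) (ENNReal.ofReal p) volume ≤
        M * normNW α p q f ∧
      Measurable (maxFn volume (maxFn volume (nontanFn α (whitneyAvg q f)))) ∧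
      eLpNorm (maxFn volume (maxFn volume (nontanFn α (whitneyAvg q f)))) (ENNReal.ofReal p)
        volume ≤ M * (M * normNW α p q f) := by
    intro f hf
    have hm : Measurable (nontanFn α (whitneyAvg q f)) := by
      rw [← whitneyAvg_enorm hq0]
      exact measurable_nontanFn α (measurable_whitneyAvg hq0 f.measurable.enorm)
    have hm1 := measurable_maxFn volume hm
    exact ⟨hm1, hM _ hm, measurable_maxFn volume hm1,
      (hM _ hm1).trans (mul_le_mul' le_rfl (hM _ hm))⟩
  have hmem : ∀ f : Pt n →ₘ[hmeas n] 𝕜, normNW α p q f < ∞ → f ∈ Y ∧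
      ∀ m, eLpNorm f (ENNReal.ofReal q) ((hmeas n).restrict (exhaustion n m)) < ∞ := by
    intro f hf
    have hu : Measurable fun y => ‖f y‖ₑ := f.measurable.enorm
    obtain ⟨hm1, hb1, hm2, hb2⟩ := hmax f hf
    have hfin1 := ae_lt_top_of_eLpNorm_enn hp0 hm1 (hb1.trans_lt (by finiteness))
    have hfin2 := ae_lt_top_of_eLpNorm_enn hp0 hm2 (hb2.trans_lt (by finiteness))
    rw [← whitneyAvg_enorm hq0] at hfin1 hfin2
    have hae : ∀ᵐ X ∂(hmeas n), whitneyAvg q (fun y => ‖f y‖ₑ) X < ∞ := by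
      refine (ae_restrict_iff' measurableSet_halfSpace).2 ?_
      filter_upwards [ae_le_maxFn_nontanFn hα hα.le (measurable_whitneyAvg hq0 hu)] with X hX hXH
      obtain ⟨x, hx, hxt⟩ := exists_mem_cone_of_ae hα (show 0 < X.1 from hXH) hfin1
      exact (hX hXH x hx.2.le).trans_lt (ENNReal.mul_lt_top ENNReal.ofReal_lt_top hxt)
    have hloc := eLpNorm_exhaustion_lt_top hq0 hae
    refine ⟨hT.mem_of_tail f hloc (finiteTail_of_forall fun X hX z hz => ?_), hloc⟩
    obtain ⟨x, hx, hxt⟩ := exists_mem_cone_of_ae hα hX hfin2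
    exact (htail f X z hz).trans_lt (ENNReal.mul_lt_top ENNReal.ofReal_lt_top
      ((hC1 _ hu X x hx).trans_lt (ENNReal.mul_lt_top ENNReal.coe_lt_top hxt)))
  refine ⟨T, hT.extends_two, ⟨C0, ?_, ?_, hT.bound⟩, ?_, ?_, ?_⟩
  · exact fun f g hf hg => hT.map_add f (hT.mem_of_memLp f hf) g (hT.mem_of_memLp g hg)
  · exact fun c f hf => hT.map_smul c f (hT.mem_of_memLp f hf)
  · exact fun f g hf hg => hT.map_add f (hmem f hf).1 g (hmem g hg).1
  · exact fun c f hf => hT.map_smul c f (hmem f hf).1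
  intro f hf
  obtain ⟨hfY, hloc⟩ := hmem f hf
  obtain ⟨hm1, hb1, hm2, hb2⟩ := hmax f hf
  have hu : Measurable fun y => ‖f y‖ₑ := f.measurable.enorm
  have hw := measurable_whitneyAvg hq0 hu
  rw [ENNReal.coe_toNNReal (by finiteness)]
  set g1 := maxFn volume (nontanFn α (whitneyAvg q f)) with hg1
  set g2 := maxFn volume g1 with hg2
  have hpt : ∀ x, nontanFn α (whitneyAvg q (T f)) x ≤ D * (g1 x + g2 x) := by
    intro x
    rw [nontanFn_le_iff]
    have hsh := (Finset.eventually_all s).2 fun c hc => hC2 c (hs c hc) _ hw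
    filter_upwards [hsh] with X hX hXc
    refine (hT.whitneyAvg_le hq hfY hloc hXc.1 (htail f X)).trans ?_
    calc _ ≤ C0 * (Λ * ∑ c ∈ s, (C2 c * g1 x)) + A' * (C1 * g2 x) := by
          refine add_le_add (mul_le_mul' le_rfl ((hΛ _ X hXc.1).trans (mul_le_mul' le_rfl
            (Finset.sum_le_sum fun c hc => ?_)))) (mul_le_mul' le_rfl ?_)
          · rw [hg1, ← whitneyAvg_enorm hq0 f]
            exact hX c hc x hXc
          · rw [hg2, hg1, ← whitneyAvg_enorm hq0 f]
            exact hC1 _ hu X x hXc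
      _ ≤ C0 * (Λ * ∑ c ∈ s, (C2 c * (g1 x + g2 x))) + A' * (C1 * (g1 x + g2 x)) := by
          refine add_le_add (mul_le_mul' le_rfl (mul_le_mul' le_rfl
            (Finset.sum_le_sum fun c _ => mul_le_mul' le_rfl le_self_add)))
            (mul_le_mul' le_rfl (mul_le_mul' le_rfl le_add_self))
      _ = _ := by
          rw [← Finset.sum_mul, hD]
          ring
  calc normNW α p q (T f) ≤ eLpNorm (fun x => D * (g1 x + g2 x)) (ENNReal.ofReal p) volume :=
        eLpNorm_mono_enorm fun x => hpt x
    _ ≤ D * (eLpNorm g1 (ENNReal.ofReal p) volume + eLpNorm g2 (ENNReal.ofReal p) volume) :=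
        eLpNorm_const_mul_add_le_enn hp.le hDt hm1 hm2
    _ ≤ D * (M * normNW α p q f + M * (M * normNW α p q f)) :=
        mul_le_mul' le_rfl (add_le_add hb1 hb2)
    _ = _ := by ring

end UpMain

end CausalCZO

namespace CausalCZO

open Filter Topology Metric

/-! ### Causal sparse sums: the large boxes -/

section Dyadic

variable {n : ℕ} {D : DyadicSystem n}

lemma DyadicSystem.mem_all {Q : Cube n} : Q ∈ D.all ↔ ∃ j, Q ∈ D.cubes j := mem_iUnion

lemma DyadicSystem.side_pos {Q : Cube n} (hQ : Q ∈ D.all) : 0 < Q.side := by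
  obtain ⟨j, hj⟩ := mem_all.1 hQ
  rw [D.side_eq j Q hj]
  positivity

lemma DyadicSystem.level_unique {Q R : Cube n} {i j : ℤ} (hQ : Q ∈ D.cubes i) (hR : R ∈ D.cubes j)
    (h : Q.side = R.side) : i = j := by
  rw [D.side_eq i Q hQ, D.side_eq j R hR] at h
  have := zpow_right_injective₀ (by norm_num : (0 : ℝ) < 2) (by norm_num) h
  omega

lemma DyadicSystem.eq_of_mem {Q R : Cube n} (hQ : Q ∈ D.all) (hR : R ∈ D.all)
    (h : Q.side = R.side) {x : Bd n} (hx : x ∈ Q.set) (hx' : x ∈ R.set) : Q = R := by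
  obtain ⟨i, hi⟩ := mem_all.1 hQ
  obtain ⟨j, hj⟩ := mem_all.1 hR
  obtain rfl := level_unique hi hj h
  exact (D.tiling i x).unique ⟨hi, hx⟩ ⟨hj, hx'⟩

lemma DyadicSystem.exists_ancestor (m : ℕ) {i : ℤ} {Q : Cube n} (hQ : Q ∈ D.cubes (i + m)) :
    ∃ R ∈ D.cubes i, Q.set ⊆ R.set := by
  induction m generalizing Q with
  | zero => exact ⟨Q, by simpa using hQ, subset_rfl⟩
  | succ m ih =>
    obtain ⟨R, hR, hQR⟩ := D.nested (i + m) Q (by convert hQ using 2; push_cast; ring)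
    obtain ⟨R', hR', h⟩ := ih hR
    exact ⟨R', hR', hQR.trans h⟩

lemma DyadicSystem.subset_of_mem {Q R : Cube n} {i : ℤ} {m : ℕ} (hQ : Q ∈ D.cubes (i + m))
    (hR : R ∈ D.cubes i) {x : Bd n} (hx : x ∈ Q.set) (hx' : x ∈ R.set) : Q.set ⊆ R.set := by
  obtain ⟨R', hR', h⟩ := exists_ancestor m hQ
  rwa [(D.tiling i x).unique ⟨hR, hx'⟩ ⟨hR', h hx⟩]

/-- The condition bounds j above by the largest i with 2^i ≤ 1/δ. Descending from i, the terms
decrease at least by halves, whence the factor 2. -/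
lemma tsum_zpow_le {δ : ℝ} (hδ : 0 < δ) (n : ℕ) :
    ∑' j : ℤ, (if δ ≤ (2 : ℝ) ^ (-j) then ENNReal.ofReal (((2 : ℝ) ^ j) ^ (n + 1)) else 0) ≤
      2 * ENNReal.ofReal (δ⁻¹ ^ (n + 1)) := by
  obtain ⟨i, hi1, hi2⟩ := exists_mem_Ico_zpow (y := (2 : ℝ)) (inv_pos.2 hδ) (by norm_num)
  have hj : ∀ j : ℤ, δ ≤ (2 : ℝ) ^ (-j) → j ≤ i := by
    intro j h
    rw [zpow_neg, le_inv_comm₀ hδ (by positivity)] at h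
    have := (zpow_lt_zpow_iff_right₀ (by norm_num : (1 : ℝ) < 2)).1 (h.trans_lt hi2)
    omega
  have hinj : Function.Injective fun m : ℕ => i - (m : ℤ) := fun a b h => by
    simp only at h
    omega
  rw [← hinj.tsum_eq]
  · calc _ ≤ ∑' m : ℕ, ENNReal.ofReal (δ⁻¹ ^ (n + 1)) * (2 : ℝ≥0∞)⁻¹ ^ m := by
          refine ENNReal.tsum_le_tsum fun m => ?_
          split_ifs with h
          · have h2 : (2 : ℝ≥0∞)⁻¹ ^ m = ENNReal.ofReal ((2 : ℝ)⁻¹ ^ m) := by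
              rw [ENNReal.ofReal_pow (by positivity), ENNReal.ofReal_inv_of_pos (by norm_num)]
              simp
            rw [h2, ← ENNReal.ofReal_mul (by positivity)]
            refine ENNReal.ofReal_le_ofReal ?_
            have h3 : (2 : ℝ) ^ (i - (m : ℤ)) = 2 ^ i * (2 : ℝ)⁻¹ ^ m := by
              rw [zpow_sub₀ (by norm_num), zpow_natCast, inv_pow, div_eq_mul_inv]
            rw [h3, mul_pow]
            refine mul_le_mul (pow_le_pow_left₀ (by positivity) hi1 _) ?_ (by positivity)
              (by positivity)
            exact pow_le_of_le_one (by positivity)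
              (pow_le_one₀ (by norm_num) (by norm_num)) (by omega)
          · exact bot_le
      _ = _ := by
          rw [ENNReal.tsum_mul_left, ENNReal.tsum_geometric, ENNReal.one_sub_inv_two, inv_inv,
            mul_comm]
  · intro j h
    have h' : δ ≤ (2 : ℝ) ^ (-j) := by
      by_contra hcon
      exact h (if_neg hcon)
    refine ⟨(i - j).toNat, ?_⟩
    simp only
    have := hj j h'
    omega

lemma Cube.side_dilate (c : ℝ) (Q : Cube n) : (Q.dilate c).side = c * Q.side := rfl

/-- The region has base side 3ℓ and height at least 3ℓ/2 whatever z is, so its volume can be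
replaced by that of the box. -/
lemma Box.volume_region_ge (P : Box n) (hP : 0 < P.base.side) (z : Pt n) :
    ENNReal.ofReal (P.base.side ^ (n + 1)) ≤ volume (P.region z) := by
  rw [Box.region, Measure.volume_eq_prod, Measure.prod_prod, Real.volume_Ioo,
    Cube.volume_set _ (by rw [Cube.side_dilate]; positivity), Cube.side_dilate,
    ← ENNReal.ofReal_mul' (by positivity), pow_succ']
  refine ENNReal.ofReal_le_ofReal (mul_le_mul ?_ (pow_le_pow_left₀ hP.le (by linarith) _)
    (by positivity) ?_)
  · linarith [min_le_left (P.bot + P.base.side / 2) z.1]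
  · linarith [min_le_left (P.bot + P.base.side / 2) z.1]

lemma Box.measurableSet_region (P : Box n) (z : Pt n) : MeasurableSet (P.region z) :=
  measurableSet_Ioo.prod (Cube.measurableSet_set _)

lemma Box.measurableSet_set (P : Box n) : MeasurableSet P.set :=
  measurableSet_Ioo.prod (Cube.measurableSet_set _)

/-- A box of side at least `ℓ` which meets heights below `ℓ` sits on the boundary. -/
lemma Box.bot_eq_zero {P : Box n} {ℓ : ℝ} (h : ℓ ≤ P.base.side) {z : Pt n}
    (hz : z ∈ P.set) (hzl : z.1 < ℓ) : P.bot = 0 ∧ P.k = 0 := by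
  have h1 : (P.k : ℝ) * P.base.side < z.1 := hz.1.1
  have h2 : z.1 < P.k * P.base.side + P.base.side := hz.1.2
  have hk : P.k = 0 := by
    by_contra hk
    have hk1 : (1 : ℝ) ≤ P.k := by exact_mod_cast Nat.one_le_iff_ne_zero.2 hk
    nlinarith
  exact ⟨by simp [Box.bot, hk], hk⟩

/-- The large boxes through z' stand on the boundary, one per generation, so the sum runs over side
lengths L. The region of each lies above ℓ(R)/2, hence in the upper region of any other point z of
the Whitney region, and there t + s + |x - y| ≤ (3n+6)L. For fixed y the sum of L^{-(n+1)} over the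
admissible generations is a multiple of the tail kernel. Decoupling z from z' makes the bound
uniform over the region. -/
lemma exists_tsum_large_boxes_le (n : ℕ) : ∃ C : ℝ≥0, ∀ (D : DyadicSystem n) (𝒮 : Set (Box n)),
    𝒮 ⊆ D.boxes → ∀ u : Pt n → ℝ≥0∞, Measurable u → ∀ R ∈ D.all, ∀ z ∈ R.whitney,
      ∀ z' ∈ R.whitney,
      ∑' P : {P : {P : Box n // P ∈ 𝒮 ∧ z' ∈ P.set} | R.side ≤ P.1.base.side},
        (volume (P.1.1.region z'))⁻¹ * ∫⁻ y in P.1.1.region z', u y ≤ C * upperTail u z := by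
  refine ⟨(2 * ENNReal.ofReal ((3 * n + 6) ^ (n + 1))).toNNReal,
    fun D 𝒮 hS u hu R hR z hz z' hz' => ?_⟩
  rw [ENNReal.coe_toNNReal (by finiteness)]
  have hR0 := D.side_pos hR
  have hz0 : 0 < z.1 := by have : R.side / 2 < z.1 := hz.1.1; linarith
  set δ : Pt n → ℝ := fun y => (z.1 + y.1 + ‖y.2 - z.2‖) / (3 * n + 6) with hδ
  have hδm : Measurable δ := by fun_prop
  set Φ : ℤ → Pt n → ℝ≥0∞ := fun j y =>
    (if δ y ≤ (2 : ℝ) ^ (-j) then ENNReal.ofReal (((2 : ℝ) ^ j) ^ (n + 1)) else 0) * u y with hΦ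
  have hΦm : ∀ j, Measurable (Φ j) := fun j =>
    (Measurable.ite (measurableSet_le hδm measurable_const) measurable_const
      measurable_const).mul hu
  choose lev hlev using fun P : {P : {P : Box n // P ∈ 𝒮 ∧ z' ∈ P.set} |
    R.side ≤ P.1.base.side} => D.mem_all.1 (hS P.1.2.1)
  -- Boxes of one generation containing z' share their base by the tiling property and their
  -- position by k = 0.
  have hinj : Function.Injective lev := by
    intro P P' h
    have hk := Box.bot_eq_zero P.2 P.1.2.2 hz'.1.2
    have hk' := Box.bot_eq_zero P'.2 P'.1.2.2 hz'.1.2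
    have hb : P.1.1.base = P'.1.1.base :=
      (D.tiling (lev P) z'.2).unique ⟨hlev P, P.1.2.2.2⟩ ⟨h ▸ hlev P', P'.1.2.2.2⟩
    refine Subtype.ext (Subtype.ext ?_)
    rcases hP : P.1.1 with ⟨k, b⟩
    rcases hP' : P'.1.1 with ⟨k', b'⟩
    rw [hP, hP'] at hb
    rw [hP] at hk
    rw [hP'] at hk'
    simp only at hb hk hk'
    rw [hb, hk.2, hk'.2]
  have hterm : ∀ P : {P : {P : Box n // P ∈ 𝒮 ∧ z' ∈ P.set} | R.side ≤ P.1.base.side},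
      (volume (P.1.1.region z'))⁻¹ * ∫⁻ y in P.1.1.region z', u y ≤
        ∫⁻ y in upperRegion z, Φ (lev P) y := by
    intro P
    have hside := D.side_eq _ _ (hlev P)
    have hbot := (Box.bot_eq_zero P.2 P.1.2.2 hz'.1.2).1
    have hPz := P.1.2.2
    have hRP : R.side ≤ P.1.1.base.side := P.2
    set L := P.1.1.base.side with hL
    have hL0 : 0 < L := by rw [hside]; positivity
    have hinv : (volume (P.1.1.region z'))⁻¹ ≤ ENNReal.ofReal (((2 : ℝ) ^ lev P) ^ (n + 1)) := by
      have h1 := ENNReal.inv_le_inv.2 (P.1.1.volume_region_ge hL0 z')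
      rwa [← ENNReal.ofReal_inv_of_pos (by positivity), ← hL, hside, zpow_neg, inv_pow,
        inv_inv] at h1
    refine (mul_le_mul' hinv le_rfl).trans ?_
    rw [← lintegral_const_mul' _ _ ENNReal.ofReal_ne_top,
      ← lintegral_indicator (P.1.1.measurableSet_region z'),
      ← lintegral_indicator (measurableSet_upperRegion z)]
    refine lintegral_mono fun y => ?_
    by_cases hy : y ∈ P.1.1.region z'
    · have hy1 : min (P.1.1.bot + L / 2) z'.1 < y.1 := hy.1.1
      have hy2 : y.1 < P.1.1.bot + 2 * L := hy.1.2
      rw [hbot] at hy1 hy2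
      have hz1 : R.side / 2 < z'.1 := hz'.1.1
      have hz2 : z.1 < R.side := hz.1.2
      -- The lower end of the region is the minimum of L/2 and z'.1, both at least ℓ(R)/2. With t
      -- itself in place of the minimum with a + ℓ/2 this would hold as well, but nothing below
      -- ℓ(R)/2 may enter.
      have hlow : R.side / 2 < y.1 := lt_of_le_of_lt (le_min (by linarith) hz1.le) hy1
      have hyU : y ∈ upperRegion z := ⟨by linarith, by linarith⟩
      have hnorm : ‖y.2 - z.2‖ ≤ (n + 1) * (3 * L) := by
        refine norm_le_of_abs_le (by linarith) fun i => ?_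
        have a1 : (P.1.1.base.center i - 3 * L / 2 ≤ y.2 i) ∧
            (y.2 i < P.1.1.base.center i + 3 * L / 2) := hy.2 i
        have a2 := hPz.2 i
        have a3 := hz.2 i
        have a4 := hz'.2 i
        rw [PiLp.sub_apply, abs_le]
        constructor <;> linarith [a1.1, a1.2, a2.1, a2.2, a3.1, a3.2, a4.1, a4.2]
      have hcond : δ y ≤ (2 : ℝ) ^ (-lev P) := by
        rw [← hside, hδ]
        simp only
        rw [div_le_iff₀ (by positivity)]
        nlinarith
      rw [indicator_of_mem hy, indicator_of_mem hyU, hΦ]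
      simp only
      rw [if_pos hcond]
    · rw [indicator_of_notMem hy]; exact bot_le
  calc _ ≤ ∑' P : {P : {P : Box n // P ∈ 𝒮 ∧ z' ∈ P.set} | R.side ≤ P.1.base.side},
        ∫⁻ y in upperRegion z, Φ (lev P) y := ENNReal.tsum_le_tsum hterm
    _ ≤ ∑' j : ℤ, ∫⁻ y in upperRegion z, Φ j y :=
        ENNReal.tsum_comp_le_tsum_of_injective hinj fun j => ∫⁻ y in upperRegion z, Φ j y
    _ = ∫⁻ y in upperRegion z, ∑' j : ℤ, Φ j y :=
        (lintegral_tsum fun j => (hΦm j).aemeasurable).symm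
    _ ≤ ∫⁻ y in upperRegion z,
          2 * ENNReal.ofReal ((3 * n + 6) ^ (n + 1)) * (tailKernel z y * u y) := by
        refine setLIntegral_mono' (measurableSet_upperRegion z) fun y hy => ?_
        have hy0 : 0 < y.1 := hy.1
        have hs : 0 < z.1 + y.1 + ‖y.2 - z.2‖ := by positivity
        have hδ0 : 0 < δ y := by rw [hδ]; positivity
        simp only [hΦ]
        rw [ENNReal.tsum_mul_right, ← mul_assoc]
        refine mul_le_mul' ((tsum_zpow_le hδ0 n).trans (le_of_eq ?_)) le_rfl
        rw [mul_assoc]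
        congr 1
        rw [tailKernel, ← ENNReal.ofReal_mul (by positivity)]
        congr 1
        rw [hδ, Real.rpow_neg hs.le]
        simp only
        rw [inv_div, div_pow, div_eq_mul_inv]
        congr 2
        rw [← Real.rpow_natCast]
        push_cast
        rfl
    _ = _ := by rw [lintegral_const_mul' _ _ (by finiteness), upperTail]

end Dyadic

end CausalCZO

namespace CausalCZO

open Filter Topology Metric

/-! ### Causal sparse sums: the small boxes -/

section Sparse

variable {n : ℕ}

/-- The region `(a, a + 2ℓ) × 3Q` of a box. -/
def Box.star (P : Box n) : Set (Pt n) :=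
  Ioo P.bot (P.bot + 2 * P.base.side) ×ˢ (P.base.dilate 3).set

/-- The integral over the enlarged box, divided by the volume of the box. -/
noncomputable def Box.starAvg (u : Pt n → ℝ≥0∞) (P : Box n) : ℝ≥0∞ :=
  (ENNReal.ofReal (P.base.side ^ (n + 1)))⁻¹ * ∫⁻ y in P.star, u y

lemma Box.measurableSet_star (P : Box n) : MeasurableSet P.star :=
  measurableSet_Ioo.prod (Cube.measurableSet_set _)

lemma Box.volume_set {P : Box n} (hP : 0 < P.base.side) :
    volume P.set = ENNReal.ofReal (P.base.side ^ (n + 1)) := by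
  rw [Box.set, Measure.volume_eq_prod, Measure.prod_prod, Real.volume_Ioo,
    Cube.volume_set _ hP.le, ← ENNReal.ofReal_mul' (by positivity), pow_succ']
  congr 2
  ring

lemma Box.set_subset_star {P : Box n} (hP : 0 < P.base.side) : P.set ⊆ P.star := by
  rintro y ⟨⟨h1, h2⟩, h3⟩
  refine ⟨⟨h1, by linarith⟩, fun i => ?_⟩
  have := h3 i
  show P.base.center i - 3 * P.base.side / 2 ≤ y.2 i ∧ y.2 i < P.base.center i + 3 * P.base.side / 2
  constructor <;> linarith [this.1, this.2]

lemma Box.star_subset_closedBall {P : Box n} (hP : 0 < P.base.side) {z : Pt n} (hz : z ∈ P.set) :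
    P.star ⊆ closedBall z (2 * (n + 1) * P.base.side) := by
  intro y hy
  have h1 : P.bot < z.1 := hz.1.1
  have h2 : z.1 < P.bot + P.base.side := hz.1.2
  have h3 : P.bot < y.1 := hy.1.1
  have h4 : y.1 < P.bot + 2 * P.base.side := hy.1.2
  have hn : (0 : ℝ) ≤ n := Nat.cast_nonneg n
  have hnL : 0 ≤ n * P.base.side := by positivity
  rw [mem_closedBall, Prod.dist_eq, Real.dist_eq, dist_eq_norm]
  refine max_le (abs_le.2 ⟨by nlinarith, by nlinarith⟩) ?_
  have : ‖y.2 - z.2‖ ≤ (n + 1) * (2 * P.base.side) := by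
    refine norm_le_of_abs_le (by linarith) fun i => ?_
    have a1 : (P.base.center i - 3 * P.base.side / 2 ≤ y.2 i) ∧
        (y.2 i < P.base.center i + 3 * P.base.side / 2) := hy.2 i
    have a2 := hz.2 i
    rw [PiLp.sub_apply, abs_le]
    constructor <;> linarith [a1.1, a1.2, a2.1, a2.2]
  linarith

lemma exists_starAvg_le (n : ℕ) : ∃ κ : ℝ≥0, ∀ (u : Pt n → ℝ≥0∞) (P : Box n), 0 < P.base.side →
    ∀ z ∈ P.set, P.starAvg u ≤ κ * maxFn volume u z := by
  set κ := volume (closedBall (0 : Pt n) 1) * ENNReal.ofReal ((4 * (n + 1)) ^ (n + 1)) with hκ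
  have hv : volume (closedBall (0 : Pt n) 1) ≠ ∞ := measure_closedBall_lt_top.ne
  refine ⟨κ.toNNReal, fun u P hP z hz => ?_⟩
  rw [ENNReal.coe_toNNReal (by finiteness)]
  have h1 : ENNReal.ofReal (P.base.side ^ (n + 1)) ≠ 0 := by simp; positivity
  rw [Box.starAvg, ENNReal.inv_mul_le_iff h1 ENNReal.ofReal_ne_top]
  refine (lintegral_mono_set (Box.star_subset_closedBall hP hz)).trans
    ((lintegral_closedBall_le_maxFn volume u z (by positivity)).trans (le_of_eq ?_))
  have h2 : ENNReal.ofReal ((2 * (2 * (n + 1) * P.base.side)) ^ ((n : ℝ) + 1)) =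
      ENNReal.ofReal (P.base.side ^ (n + 1)) * ENNReal.ofReal ((4 * (n + 1)) ^ (n + 1)) := by
    rw [← ENNReal.ofReal_mul (by positivity), ← mul_pow, ← Real.rpow_natCast]
    push_cast
    congr 2
    ring
  rw [volume_closedBall_pt _ (by positivity), h2, hκ]
  ring

lemma starAvg_ne_top {q : ℝ} (hq : 1 ≤ q) {u : Pt n → ℝ≥0∞} (hu : ∫⁻ y, u y ^ q ≠ ∞) {P : Box n}
    (hP : 0 < P.base.side) : P.starAvg u ≠ ∞ := by
  have hV : volume P.star ≠ ∞ := by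
    rw [Box.star, Measure.volume_eq_prod, Measure.prod_prod, Real.volume_Ioo]
    exact ENNReal.mul_ne_top ENNReal.ofReal_ne_top
      (Cube.volume_set_ne_top (by rw [Cube.side_dilate]; positivity))
  have h1 : ENNReal.ofReal (P.base.side ^ (n + 1)) ≠ 0 := by simp; positivity
  refine ENNReal.mul_ne_top (ENNReal.inv_ne_top.2 h1) ?_
  have h2 : ∀ y, u y ≤ 1 + u y ^ q := fun y => by
    rcases le_total (u y) 1 with h | h
    · exact h.trans le_self_add
    · exact (ENNReal.le_rpow_self_of_one_le h hq).trans le_add_self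
  refine ne_top_of_le_ne_top ?_ (lintegral_mono h2)
  rw [lintegral_add_left measurable_const, setLIntegral_const, one_mul]
  exact ENNReal.add_ne_top.2 ⟨hV, ne_top_of_le_ne_top hu (setLIntegral_le_lintegral _ _)⟩

/-- The `L_q` bound for finite sparse sums, by duality. -/
lemma exists_lintegral_finset_starAvg_le (n : ℕ) {η q : ℝ} (hη : 0 < η) (hq : 1 < q) :
    ∃ C : ℝ≥0, ∀ (F : Finset (Box n)) (E : Box n → Set (Pt n)),
      (∀ P ∈ F, 0 < P.base.side) → (∀ P ∈ F, MeasurableSet (E P) ∧ E P ⊆ P.set ∧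
        ENNReal.ofReal η * volume P.set ≤ volume (E P)) →
      (F : Set (Box n)).PairwiseDisjoint E → ∀ u : Pt n → ℝ≥0∞, Measurable u →
      ∫⁻ z, (∑ P ∈ F, P.set.indicator (fun _ => P.starAvg u) z) ^ q ≤ C * ∫⁻ z, u z ^ q := by
  have hq0 : 0 < q := by linarith
  obtain ⟨κ, hκ⟩ := exists_starAvg_le n
  set s := Real.conjExponent q with hs
  have hqs : q.HolderConjugate s := Real.HolderConjugate.conjExponent hq
  have hs1 : 1 < s := hqs.symm.lt
  obtain ⟨Cq, hCq⟩ := lintegral_maxFn_rpow_le (volume : Measure (Pt n)) hq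
  obtain ⟨Cs, hCs⟩ := lintegral_maxFn_rpow_le (volume : Measure (Pt n)) hs1
  set K : ℝ≥0∞ := ENNReal.ofReal η⁻¹ * κ ^ 2 * (Cq : ℝ≥0∞) ^ (1 / q) * (Cs : ℝ≥0∞) ^ (1 / s) with hK
  have hs0 : 0 < 1 / s := by positivity
  have hq0' : 0 < 1 / q := by positivity
  have hKt : K ≠ ∞ := by finiteness
  -- The added 1 keeps the constant nonzero, so that an infinite right side disposes of its case.
  refine ⟨(K ^ q).toNNReal + 1, fun F E hpos hE hdisj u hu => ?_⟩
  rw [ENNReal.coe_add, ENNReal.coe_toNNReal (by finiteness), ENNReal.coe_one]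
  by_cases hU : ∫⁻ z, u z ^ q = ∞
  · rw [hU, ENNReal.mul_top (by simp)]
    exact le_top
  refine le_trans ?_ (mul_le_mul' le_self_add le_rfl)
  set h : Pt n → ℝ≥0∞ := fun z => ∑ P ∈ F, P.set.indicator (fun _ => P.starAvg u) z with hh
  have hhm : Measurable h := Finset.measurable_sum F fun P _ =>
    measurable_const.indicator P.measurableSet_set
  set I := ∫⁻ z, h z ^ q with hI
  -- The sum is finite and each average is finite, so the function is bounded with support of finite
  -- volume. Without this the division at the end would be illegitimate.
  have hIt : I ≠ ∞ := by
    set M := ∑ P ∈ F, P.starAvg u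
    have hM : M ≠ ∞ := ENNReal.sum_ne_top.2 fun P hP => starAvg_ne_top hq.le hU (hpos P hP)
    set V := ⋃ P ∈ F, P.set
    have hV : MeasurableSet V := Finset.measurableSet_biUnion F fun P _ => P.measurableSet_set
    have hVt : volume V ≠ ∞ := by
      refine ne_top_of_le_ne_top ?_ (measure_biUnion_finset_le F _)
      refine ENNReal.sum_ne_top.2 fun P hP => ?_
      rw [Box.volume_set (hpos P hP)]
      exact ENNReal.ofReal_ne_top
    have hle : ∀ z, h z ^ q ≤ V.indicator (fun _ => M ^ q) z := fun z => by
      by_cases hz : z ∈ V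
      · rw [indicator_of_mem hz]
        exact ENNReal.rpow_le_rpow (Finset.sum_le_sum fun P _ => indicator_le_self _ _ z) hq0.le
      · rw [indicator_of_notMem hz]
        have : h z = 0 := Finset.sum_eq_zero fun P hP =>
          indicator_of_notMem (fun hzP => hz (mem_biUnion hP hzP)) _
        rw [this, ENNReal.zero_rpow_of_pos hq0]
    refine ne_top_of_le_ne_top ?_ (lintegral_mono hle)
    rw [lintegral_indicator hV, setLIntegral_const]
    finiteness
  by_cases hI0 : I = 0
  · rw [hI0]; exact bot_le
  -- The extremal dual function: h v = h^q and v^s = h^q.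
  set v : Pt n → ℝ≥0∞ := fun z => h z ^ (q - 1) with hv
  have hvm : Measurable v := hhm.pow_const _
  have hvs : ∫⁻ z, v z ^ s = I := by
    refine lintegral_congr fun z => ?_
    rw [hv]
    simp only
    rw [← ENNReal.rpow_mul, hqs.sub_one_mul_conj]
  -- Sparseness trades the volume of the box for that of its set E at the cost 1/η. On E both
  -- averages are dominated pointwise by maximal functions, and the sets E are disjoint, so the sum
  -- becomes one integral.
  have hterm : ∀ P ∈ F, P.starAvg u * ∫⁻ z in P.set, v z ≤
      ENNReal.ofReal η⁻¹ * κ ^ 2 * ∫⁻ z in E P, maxFn volume u z * maxFn volume v z := by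
    intro P hP
    have hP0 := hpos P hP
    obtain ⟨hEm, hEP, hEv⟩ := hE P hP
    have hvP0 : ENNReal.ofReal (P.base.side ^ (n + 1)) ≠ 0 := by simp; positivity
    have hvol : volume P.set ≤ ENNReal.ofReal η⁻¹ * volume (E P) := by
      calc volume P.set = ENNReal.ofReal η⁻¹ * (ENNReal.ofReal η * volume P.set) := by
            rw [← mul_assoc, ← ENNReal.ofReal_mul (by positivity), inv_mul_cancel₀ hη.ne',
              ENNReal.ofReal_one, one_mul]
        _ ≤ _ := mul_le_mul' le_rfl hEv
    calc P.starAvg u * ∫⁻ z in P.set, v z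
        ≤ P.starAvg u * (volume P.set * P.starAvg v) := by
          refine mul_le_mul' le_rfl ?_
          rw [Box.starAvg, Box.volume_set hP0, ← mul_assoc,
            ENNReal.mul_inv_cancel hvP0 ENNReal.ofReal_ne_top, one_mul]
          exact lintegral_mono_set (Box.set_subset_star hP0)
      _ ≤ P.starAvg u * (ENNReal.ofReal η⁻¹ * volume (E P) * P.starAvg v) :=
          mul_le_mul' le_rfl (mul_le_mul' hvol le_rfl)
      _ = ENNReal.ofReal η⁻¹ * ∫⁻ _z in E P, P.starAvg u * P.starAvg v := by
          rw [setLIntegral_const]; ring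
      _ ≤ ENNReal.ofReal η⁻¹ * ∫⁻ z in E P, κ ^ 2 * (maxFn volume u z * maxFn volume v z) := by
          refine mul_le_mul' le_rfl (setLIntegral_mono' hEm fun z hz => ?_)
          refine (mul_le_mul' (hκ u P hP0 z (hEP hz)) (hκ v P hP0 z (hEP hz))).trans (le_of_eq ?_)
          ring
      _ = _ := by
          rw [lintegral_const_mul' _ _ (by finiteness), mul_assoc]
  have hmain : I ≤ K * (∫⁻ z, u z ^ q) ^ (1 / q) * I ^ (1 / s) := by
    calc I = ∫⁻ z, ∑ P ∈ F, P.starAvg u * P.set.indicator v z := by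
          refine lintegral_congr fun z => ?_
          have : h z ^ q = h z * v z := by
            rw [hv]
            simp only
            conv_lhs => rw [show q = 1 + (q - 1) by ring]
            rw [ENNReal.rpow_add_of_nonneg _ _ zero_le_one (by linarith), ENNReal.rpow_one]
          rw [this, hh]
          simp only
          rw [Finset.sum_mul]
          refine Finset.sum_congr rfl fun P _ => ?_
          by_cases hz : z ∈ P.set
          · rw [indicator_of_mem hz, indicator_of_mem hz]
          · rw [indicator_of_notMem hz, indicator_of_notMem hz, zero_mul, mul_zero]
      _ = ∑ P ∈ F, P.starAvg u * ∫⁻ z in P.set, v z := by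
          rw [lintegral_finsetSum F fun P _ =>
            (hvm.indicator P.measurableSet_set).const_mul _]
          refine Finset.sum_congr rfl fun P _ => ?_
          rw [lintegral_const_mul _ (hvm.indicator P.measurableSet_set),
            lintegral_indicator P.measurableSet_set]
      _ ≤ ∑ P ∈ F, ENNReal.ofReal η⁻¹ * κ ^ 2 *
            ∫⁻ z in E P, maxFn volume u z * maxFn volume v z := Finset.sum_le_sum hterm
      _ = ENNReal.ofReal η⁻¹ * κ ^ 2 *
            ∫⁻ z in ⋃ P ∈ F, E P, maxFn volume u z * maxFn volume v z := by
          rw [← Finset.mul_sum, lintegral_biUnion_finset hdisj fun P hP => (hE P hP).1]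
      _ ≤ ENNReal.ofReal η⁻¹ * κ ^ 2 * ∫⁻ z, (maxFn volume u * maxFn volume v) z :=
          mul_le_mul' le_rfl (setLIntegral_le_lintegral _ _)
      _ ≤ ENNReal.ofReal η⁻¹ * κ ^ 2 * ((∫⁻ z, maxFn volume u z ^ q) ^ (1 / q) *
            (∫⁻ z, maxFn volume v z ^ s) ^ (1 / s)) :=
          mul_le_mul' le_rfl (ENNReal.lintegral_mul_le_Lp_mul_Lq volume hqs
            (measurable_maxFn volume hu).aemeasurable (measurable_maxFn volume hvm).aemeasurable)
      _ ≤ ENNReal.ofReal η⁻¹ * κ ^ 2 * ((Cq * ∫⁻ z, u z ^ q) ^ (1 / q) * (Cs * I) ^ (1 / s)) := by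
          refine mul_le_mul' le_rfl (mul_le_mul' (ENNReal.rpow_le_rpow (hCq u hu) hq0'.le)
            (ENNReal.rpow_le_rpow ?_ hs0.le))
          rw [← hvs]
          exact hCs v hvm
      _ = _ := by
          rw [ENNReal.mul_rpow_of_nonneg _ _ hq0'.le, ENNReal.mul_rpow_of_nonneg _ _ hs0.le, hK]
          ring
  have hsplit : I = I ^ (1 / q) * I ^ (1 / s) := by
    rw [← ENNReal.rpow_add _ _ hI0 hIt, one_div, one_div, hqs.inv_add_inv_eq_one, ENNReal.rpow_one]
  have hIs0 : I ^ (1 / s) ≠ 0 := by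
    rw [Ne, ENNReal.rpow_eq_zero_iff_of_pos hs0]; exact hI0
  have hIst : I ^ (1 / s) ≠ ∞ := ENNReal.rpow_ne_top_of_nonneg hs0.le hIt
  have hroot : I ^ (1 / q) ≤ K * (∫⁻ z, u z ^ q) ^ (1 / q) := by
    refine (ENNReal.mul_le_mul_iff_left hIs0 hIst).1 ?_
    rw [← hsplit]
    exact hmain
  calc I = (I ^ (1 / q)) ^ q := by
        rw [← ENNReal.rpow_mul, one_div_mul_cancel hq0.ne', ENNReal.rpow_one]
    _ ≤ (K * (∫⁻ z, u z ^ q) ^ (1 / q)) ^ q := ENNReal.rpow_le_rpow hroot hq0.le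
    _ = _ := by
        rw [ENNReal.mul_rpow_of_nonneg _ _ hq0.le, ← ENNReal.rpow_mul, one_div_mul_cancel hq0.ne',
          ENNReal.rpow_one]

/-- Disjoint sets of positive measure in a σ-finite space are countable in number. Measurability of
the infinite sum and monotone convergence rest on this. -/
lemma IsSparse.countable {η : ℝ} (hη : 0 < η) {𝒮 : Set (Box n)} (hS : IsSparse η 𝒮)
    (hpos : ∀ P ∈ 𝒮, 0 < P.base.side) : 𝒮.Countable := by
  obtain ⟨E, hE, hdisj⟩ := hS
  have h := Measure.countable_meas_pos_of_disjoint_iUnion (μ := (volume : Measure (Pt n)))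
    (As := fun P : 𝒮 => E P.1) (fun P => (hE P.1 P.2).1)
    (fun P P' hPP' => hdisj P.2 P'.2 fun h => hPP' (Subtype.ext h))
  have huniv : {P : 𝒮 | 0 < volume (E P.1)} = univ := by
    refine eq_univ_of_forall fun P => ?_
    refine lt_of_lt_of_le ?_ (hE P.1 P.2).2.2
    rw [Box.volume_set (hpos P.1 P.2)]
    have := hpos P.1 P.2
    exact ENNReal.mul_pos (by simpa using hη) (by simp; positivity)
  rw [huniv] at h
  exact countable_coe_iff.1 (countable_univ_iff.1 h)

/-- The `L_q` bound for sparse sums of averages over the enlarged boxes. -/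
lemma exists_lintegral_tsum_starAvg_le (n : ℕ) {η q : ℝ} (hη : 0 < η) (hq : 1 < q) :
    ∃ C : ℝ≥0, ∀ 𝒮 : Set (Box n), IsSparse η 𝒮 → (∀ P ∈ 𝒮, 0 < P.base.side) →
      ∀ u : Pt n → ℝ≥0∞, Measurable u →
      Measurable (fun z => ∑' P : 𝒮, P.1.set.indicator (fun _ => P.1.starAvg u) z) ∧
      ∫⁻ z, (∑' P : 𝒮, P.1.set.indicator (fun _ => P.1.starAvg u) z) ^ q ≤ C * ∫⁻ z, u z ^ q := by
  have hq0 : 0 < q := by linarith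
  obtain ⟨C, hC⟩ := exists_lintegral_finset_starAvg_le n hη hq
  refine ⟨C, fun 𝒮 hS hpos u hu => ?_⟩
  have hcount : Countable 𝒮 := (hS.countable hη hpos).to_subtype
  obtain ⟨E, hE, hdisj⟩ := hS
  have hm : ∀ P : 𝒮, Measurable (P.1.set.indicator fun _ => P.1.starAvg u) := fun P =>
    measurable_const.indicator P.1.measurableSet_set
  refine ⟨Measurable.tsum hm, ?_⟩
  -- The power is an order isomorphism, so it commutes with the supremum of finite partial sums, and
  -- these form a directed family.
  have e1 : ∀ z, (∑' P : 𝒮, P.1.set.indicator (fun _ => P.1.starAvg u) z) ^ q =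
      ⨆ F : Finset 𝒮, (∑ P ∈ F, P.1.set.indicator (fun _ => P.1.starAvg u) z) ^ q := fun z => by
    rw [ENNReal.tsum_eq_iSup_sum]
    exact (ENNReal.orderIsoRpow q hq0).map_iSup _
  simp_rw [e1]
  rw [lintegral_iSup_directed]
  · refine iSup_le fun F => ?_
    have := hC (F.map (Function.Embedding.subtype _)) E ?_ ?_ ?_ u hu
    · simpa only [Finset.sum_map, Function.Embedding.subtype_apply] using this
    · intro P hP
      obtain ⟨P', -, rfl⟩ := Finset.mem_map.1 hP
      exact hpos _ P'.2
    · intro P hP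
      obtain ⟨P', -, rfl⟩ := Finset.mem_map.1 hP
      exact hE _ P'.2
    · refine hdisj.subset fun P hP => ?_
      obtain ⟨P', -, rfl⟩ := Finset.mem_map.1 (Finset.mem_coe.1 hP)
      exact P'.2
  · exact fun F => ((Finset.measurable_sum F fun P _ => hm P).pow_const q).aemeasurable
  · refine Monotone.directed_le fun F F' h z => ?_
    exact ENNReal.rpow_le_rpow (Finset.sum_le_sum_of_subset h) hq0.le

end Sparse

end CausalCZO

namespace CausalCZO

open Filter Topology Metric

/-! ### The Carleson estimate for causal sparse sums -/

section SparseMain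

variable {n : ℕ} {D : DyadicSystem n}

/-- Test the inclusion on points of the diagonal of Q. The upper face is not attained, so the second
inequality is reached by contradiction, with the point of Q that would lie on the upper face of R.
-/
lemma Cube.bounds_of_subset {Q R : Cube n} (hQ : 0 < Q.side) (h : Q.set ⊆ R.set) (i : Fin n) :
    R.center i - R.side / 2 ≤ Q.center i - Q.side / 2 ∧
      Q.center i + Q.side / 2 ≤ R.center i + R.side / 2 := by
  have key : ∀ θ : ℝ, -(Q.side / 2) ≤ θ → θ < Q.side / 2 →
      R.center i - R.side / 2 ≤ Q.center i + θ ∧ Q.center i + θ < R.center i + R.side / 2 := by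
    intro θ h1 h2
    have hmem : (WithLp.toLp 2 fun j => Q.center j + θ : Bd n) ∈ Q.set := fun j => by
      show Q.center j - Q.side / 2 ≤ Q.center j + θ ∧ Q.center j + θ < Q.center j + Q.side / 2
      constructor <;> linarith
    exact h hmem i
  have h0 := key (-(Q.side / 2)) le_rfl (by linarith)
  refine ⟨by linarith [h0.1], ?_⟩
  by_contra! hcon
  have := key (R.center i + R.side / 2 - Q.center i) (by linarith [h0.2]) (by linarith)
  linarith [this.2]

/-- The enlargement of a small box meeting a Whitney region stays in the enlarged Whitney
region. -/
lemma Box.star_subset_whitneyTilde {R : Cube n} (hR : R ∈ D.all) {P : Box n} (hP : P ∈ D.boxes)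
    {z : Pt n} (hz : z ∈ R.whitney) (hzP : z ∈ P.set) (hlt : P.base.side < R.side) :
    P.star ⊆ R.whitneyTilde := by
  obtain ⟨i, hi⟩ := D.mem_all.1 hR
  obtain ⟨j, hj⟩ := D.mem_all.1 (show P.base ∈ D.all from hP)
  have hL := D.side_eq j _ hj
  have hℓ := D.side_eq i _ hi
  have hP0 := D.side_pos (show P.base ∈ D.all from hP)
  have hij : i < j := by
    rw [hL, hℓ, zpow_lt_zpow_iff_right₀ (by norm_num)] at hlt
    omega
  obtain ⟨m, rfl⟩ : ∃ m : ℕ, j = i + 1 + m := ⟨(j - i - 1).toNat, by omega⟩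
  have hsub : P.base.set ⊆ R.set := by
    refine D.subset_of_mem (m := m + 1) (i := i) ?_ hi hzP.2 hz.2
    convert hj using 2
    push_cast
    ring
  set L := P.base.side with hLdef
  have hrel : R.side = 2 * ((2 ^ m : ℕ) : ℝ) * L := by
    rw [hL, hℓ, show -(i + 1 + (m : ℤ)) = -i - 1 - m by ring, zpow_sub₀ (by norm_num),
      zpow_sub₀ (by norm_num), zpow_natCast]
    push_cast
    field_simp
  have hz1 : R.side / 2 < z.1 := hz.1.1
  have hz2 : z.1 < R.side := hz.1.2
  have hz3 : (P.k : ℝ) * L < z.1 := hzP.1.1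
  have hz4 : z.1 < P.k * L + L := hzP.1.2
  -- With ℓ(R) = 2·2^m L, the Whitney slab is the union of the layers with index from 2^m to 2·2^m -
  -- 1. A box meeting the slab has an integer index, so it lies entirely in the slab.
  have hk1 : 2 ^ m ≤ P.k := by
    have : ((2 ^ m : ℕ) : ℝ) < ((P.k + 1 : ℕ) : ℝ) := by
      refine lt_of_mul_lt_mul_right ?_ hP0.le
      push_cast at hrel ⊢
      nlinarith
    have := Nat.cast_lt.1 this
    omega
  have hk2 : P.k + 1 ≤ 2 * 2 ^ m := by
    have : (P.k : ℝ) < ((2 * 2 ^ m : ℕ) : ℝ) := by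
      refine lt_of_mul_lt_mul_right ?_ hP0.le
      push_cast at hrel ⊢
      nlinarith
    have := Nat.cast_lt.1 this
    omega
  have hb1 : R.side / 2 ≤ P.bot := by
    have : ((2 ^ m : ℕ) : ℝ) ≤ P.k := Nat.cast_le.2 hk1
    have := mul_le_mul_of_nonneg_right this hP0.le
    rw [Box.bot]
    linarith
  have hb2 : P.bot + L ≤ R.side := by
    have : ((P.k + 1 : ℕ) : ℝ) ≤ ((2 * 2 ^ m : ℕ) : ℝ) := Nat.cast_le.2 hk2
    have := mul_le_mul_of_nonneg_right this hP0.le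
    rw [Box.bot]
    push_cast at this hrel
    linarith
  -- Since a smaller dyadic side is at most half, the enlargement by L upwards and sideways stays
  -- below 3ℓ(R)/2 and inside 2R.
  have hL2 : L ≤ R.side / 2 := by
    have : (1 : ℝ) ≤ ((2 ^ m : ℕ) : ℝ) := by exact_mod_cast Nat.one_le_two_pow
    nlinarith
  rintro y ⟨⟨hy1, hy2⟩, hy3⟩
  refine ⟨⟨by linarith, by linarith⟩, fun a => ?_⟩
  have h1 := Cube.bounds_of_subset hP0 hsub a
  have h2 : (P.base.center a - 3 * L / 2 ≤ y.2 a) ∧ (y.2 a < P.base.center a + 3 * L / 2) := hy3 a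
  show R.center a - 2 * R.side / 2 ≤ y.2 a ∧ y.2 a < R.center a + 2 * R.side / 2
  constructor <;> linarith [h1.1, h1.2, h2.1, h2.2]

lemma Cube.measurableSet_whitney (R : Cube n) : MeasurableSet R.whitney :=
  measurableSet_Ioo.prod R.measurableSet_set

lemma Cube.measurableSet_whitneyTilde (R : Cube n) : MeasurableSet R.whitneyTilde :=
  measurableSet_Ioo.prod (Cube.measurableSet_set _)

lemma Cube.volume_whitney {R : Cube n} (hR : 0 < R.side) :
    volume R.whitney = ENNReal.ofReal (R.side / 2 * R.side ^ n) := by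
  rw [Cube.whitney, Measure.volume_eq_prod, Measure.prod_prod, Real.volume_Ioo,
    Cube.volume_set _ hR.le, ← ENNReal.ofReal_mul' (by positivity)]
  congr 2
  ring

lemma Cube.volume_whitneyTilde {R : Cube n} (hR : 0 < R.side) :
    volume R.whitneyTilde = 2 ^ (n + 1) * volume R.whitney := by
  have h2 : (2 : ℝ≥0∞) ^ (n + 1) = ENNReal.ofReal (2 ^ (n + 1)) := by
    rw [ENNReal.ofReal_pow (by norm_num)]; simp
  rw [Cube.volume_whitney hR, h2, ← ENNReal.ofReal_mul (by positivity), Cube.whitneyTilde,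
    Measure.volume_eq_prod, Measure.prod_prod, Real.volume_Ioo,
    Cube.volume_set _ (by rw [Cube.side_dilate]; positivity), Cube.side_dilate,
    ← ENNReal.ofReal_mul' (by positivity)]
  congr 1
  rw [mul_pow, pow_succ]
  ring

/-- Comparison of the sparse sum in a Whitney region with a constant and a local sparse sum. -/
lemma sparseSum_le_iSup_add {𝒮 : Set (Box n)} (hS : 𝒮 ⊆ D.boxes) (u : Pt n → ℝ≥0∞) {R : Cube n}
    (hR : R ∈ D.all) {z : Pt n} (hz : z ∈ R.whitney) :
    sparseSum 𝒮 u z ≤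
      (∑' P : {P : {P : Box n // P ∈ 𝒮 ∧ z ∈ P.set} | R.side ≤ P.1.base.side},
        (volume (P.1.1.region z))⁻¹ * ∫⁻ y in P.1.1.region z, u y) +
      ∑' P : 𝒮, P.1.set.indicator (fun _ => P.1.starAvg (R.whitneyTilde.indicator u)) z := by
  set Big : Set {P : Box n // P ∈ 𝒮 ∧ z ∈ P.set} := {P | R.side ≤ P.1.base.side}
  set term : {P : Box n // P ∈ 𝒮 ∧ z ∈ P.set} → ℝ≥0∞ := fun P =>
    (volume (P.1.region z))⁻¹ * ∫⁻ y in P.1.region z, u y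
  have hterm : ∀ P : {P : Box n // P ∈ 𝒮 ∧ z ∈ P.set}, term P ≤ Big.indicator term P +
      P.1.set.indicator (fun _ => P.1.starAvg (R.whitneyTilde.indicator u)) z := by
    intro P
    by_cases hP : P ∈ Big
    · rw [indicator_of_mem hP]
      exact le_self_add
    · rw [indicator_of_notMem hP, zero_add, indicator_of_mem P.2.2]
      have hP0 := D.side_pos (show P.1.base ∈ D.all from hS P.2.1)
      have hsub : P.1.star ⊆ R.whitneyTilde :=
        Box.star_subset_whitneyTilde hR (hS P.2.1) hz P.2.2 (not_le.1 hP)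
      refine mul_le_mul' (ENNReal.inv_le_inv.2 (P.1.volume_region_ge hP0 z)) ?_
      have hreg : P.1.region z ⊆ P.1.star := by
        rintro y ⟨⟨h1, h2⟩, h3⟩
        refine ⟨⟨lt_of_le_of_lt (le_min (by linarith) P.2.2.1.1.le) h1, h2⟩, h3⟩
      refine (lintegral_mono_set hreg).trans (le_of_eq ?_)
      exact setLIntegral_congr_fun P.1.measurableSet_star fun y hy =>
        (indicator_of_mem (hsub hy) u).symm
  calc sparseSum 𝒮 u z = ∑' P, term P := by simp only [sparseSum, enorm_eq_self, term]
    _ ≤ ∑' P, (Big.indicator term P +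
        P.1.set.indicator (fun _ => P.1.starAvg (R.whitneyTilde.indicator u)) z) :=
        ENNReal.tsum_le_tsum hterm
    _ = (∑' P, Big.indicator term P) + ∑' P : {P : Box n // P ∈ 𝒮 ∧ z ∈ P.set},
        P.1.set.indicator (fun _ => P.1.starAvg (R.whitneyTilde.indicator u)) z :=
        ENNReal.tsum_add
    _ ≤ _ := by
        refine add_le_add (tsum_subtype Big term).symm.le ?_
        have hinj : Function.Injective
            fun P : {P : Box n // P ∈ 𝒮 ∧ z ∈ P.set} => (⟨P.1, P.2.1⟩ : 𝒮) := fun P P' h =>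
          Subtype.ext (Subtype.mk.inj h)
        exact ENNReal.tsum_comp_le_tsum_of_injective hinj fun P : 𝒮 =>
          P.1.set.indicator (fun _ => P.1.starAvg (R.whitneyTilde.indicator u)) z

/-- The `L_q` average of a sparse operator over one Whitney region. -/
lemma exists_volume_mul_lqAvg_le (n : ℕ) {η q : ℝ} (hη : 0 < η) (hq : 1 < q) : ∃ C C' : ℝ≥0,
    ∀ (D : DyadicSystem n) (𝒮 : Set (Box n)), 𝒮 ⊆ D.boxes → IsSparse η 𝒮 →
      ∀ u : Pt n → ℝ≥0∞, Measurable u → ∀ (A : ℝ≥0) (g : Pt n → ℝ≥0∞),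
      (∀ᵐ x ∂(hmeas n), g x ≤ A * sparseSum 𝒮 u x) → ∀ R ∈ D.all,
      volume R.whitney * lqAvg q R.whitney g ≤
        A * (C * (∫⁻ z in R.whitney, upperTail u z) +
          C' * (volume R.whitney * lqAvg q R.whitneyTilde u)) := by
  have hq0 : 0 < q := by linarith
  have hq1 : 0 < 1 / q := by positivity
  obtain ⟨C1, hC1⟩ := exists_tsum_large_boxes_le n
  obtain ⟨C2, hC2⟩ := exists_lintegral_tsum_starAvg_le n hη hq
  refine ⟨C1, (((2 : ℝ≥0∞) ^ (n + 1) * C2) ^ (1 / q)).toNNReal,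
    fun D 𝒮 hS hsp u hu A g hg R hR => ?_⟩
  rw [ENNReal.coe_toNNReal (by finiteness)]
  have hR0 := D.side_pos hR
  set W := R.whitney with hW
  have hWm : MeasurableSet W := R.measurableSet_whitney
  have hW0 : volume W ≠ 0 := by
    rw [hW, Cube.volume_whitney hR0]; simp; positivity
  have hWt : volume W ≠ ∞ := by
    rw [hW, Cube.volume_whitney hR0]; exact ENNReal.ofReal_ne_top
  obtain ⟨hhm, hhq⟩ := hC2 𝒮 hsp (fun P hP => D.side_pos (hS hP)) (R.whitneyTilde.indicator u)
    (hu.indicator R.measurableSet_whitneyTilde)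
  set h : Pt n → ℝ≥0∞ := fun z =>
    ∑' P : 𝒮, P.1.set.indicator (fun _ => P.1.starAvg (R.whitneyTilde.indicator u)) z
  -- Replacing the large-box sum by its supremum over the region makes it a constant. It is still at
  -- most a multiple of the upper tail at every point of the region, so integration recovers the
  -- tail integral.
  set τ : ℝ≥0∞ := ⨆ z ∈ W,
    ∑' P : {P : {P : Box n // P ∈ 𝒮 ∧ z ∈ P.set} | R.side ≤ P.1.base.side},
        (volume (P.1.1.region z))⁻¹ * ∫⁻ y in P.1.1.region z, u y with hτ
  have hτ1 : ∀ z ∈ W, τ ≤ C1 * upperTail u z := fun z hz =>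
    iSup₂_le fun z' hz' => hC1 D 𝒮 hS u hu R hR z hz z' hz'
  have hτ2 : volume W * τ ≤ C1 * ∫⁻ z in W, upperTail u z := by
    rw [mul_comm, ← setLIntegral_const, ← lintegral_const_mul' _ _ ENNReal.coe_ne_top]
    exact setLIntegral_mono' hWm hτ1
  -- Normalised measure on the Whitney region, under which the average of a constant is that
  -- constant and Minkowski's inequality splits large and small boxes.
  set μ : Measure (Pt n) := (volume W)⁻¹ • volume.restrict W with hμ
  have hμ1 : ∀ F : Pt n → ℝ≥0∞, ∫⁻ z, F z ∂μ = (volume W)⁻¹ * ∫⁻ z in W, F z := fun F => by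
    rw [hμ, lintegral_smul_measure, smul_eq_mul]
  have hWH : W ⊆ halfSpace n := fun z hz => by
    have : R.side / 2 < z.1 := hz.1.1
    show 0 < z.1
    linarith
  have hgW : ∀ᵐ z ∂μ, g z ≤ A * (τ + h z) := by
    refine Measure.ae_smul_measure ?_ _
    have h1 : ∀ᵐ z ∂(volume.restrict W), g z ≤ A * sparseSum 𝒮 u z :=
      ae_mono (Measure.restrict_mono hWH le_rfl) hg
    filter_upwards [h1, ae_restrict_mem hWm] with z hz hzW
    refine hz.trans (mul_le_mul' le_rfl ((sparseSum_le_iSup_add hS u hR hzW).trans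
      (add_le_add ?_ le_rfl)))
    exact le_iSup₂ (f := fun z (_ : z ∈ W) =>
      ∑' P : {P : {P : Box n // P ∈ 𝒮 ∧ z ∈ P.set} | R.side ≤ P.1.base.side},
        (volume (P.1.1.region z))⁻¹ * ∫⁻ y in P.1.1.region z, u y) z hzW
  have hhavg : (∫⁻ z, h z ^ q ∂μ) ^ (1 / q) ≤
      ((2 : ℝ≥0∞) ^ (n + 1) * C2) ^ (1 / q) * lqAvg q R.whitneyTilde u := by
    rw [lqAvg_eq hq0, ← ENNReal.mul_rpow_of_nonneg _ _ hq1.le, hμ1]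
    refine ENNReal.rpow_le_rpow ?_ hq1.le
    have h1 : ∫⁻ z in W, h z ^ q ≤ C2 * ∫⁻ z in R.whitneyTilde, u z ^ q := by
      refine (setLIntegral_le_lintegral _ _).trans (hhq.trans (mul_le_mul' le_rfl (le_of_eq ?_)))
      rw [← lintegral_indicator R.measurableSet_whitneyTilde]
      refine lintegral_congr fun z => ?_
      by_cases hz : z ∈ R.whitneyTilde
      · rw [indicator_of_mem hz, indicator_of_mem hz]
      · rw [indicator_of_notMem hz, indicator_of_notMem hz, ENNReal.zero_rpow_of_pos hq0]
    refine (mul_le_mul' le_rfl h1).trans (le_of_eq ?_)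
    simp only [enorm_eq_self]
    have h2 : (2 : ℝ≥0∞) ^ (n + 1) * (volume R.whitneyTilde)⁻¹ = (volume W)⁻¹ := by
      rw [Cube.volume_whitneyTilde hR0, ENNReal.mul_inv (by simp) (by simp), ← mul_assoc,
        ENNReal.mul_inv_cancel (by simp) (by simp), one_mul]
    rw [← h2]
    ring
  have hgavg : lqAvg q W g ≤
      A * (τ + ((2 : ℝ≥0∞) ^ (n + 1) * C2) ^ (1 / q) * lqAvg q R.whitneyTilde u) := by
    calc lqAvg q W g = (∫⁻ z, g z ^ q ∂μ) ^ (1 / q) := by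
          rw [lqAvg_eq hq0, hμ1]
          simp only [enorm_eq_self]
      _ ≤ (∫⁻ z, (A * (τ + h z)) ^ q ∂μ) ^ (1 / q) := by
          refine ENNReal.rpow_le_rpow (lintegral_mono_ae ?_) hq1.le
          filter_upwards [hgW] with z hz
          exact ENNReal.rpow_le_rpow hz hq0.le
      _ = A * (∫⁻ z, (τ + h z) ^ q ∂μ) ^ (1 / q) := by
          simp_rw [ENNReal.mul_rpow_of_nonneg _ _ hq0.le]
          rw [lintegral_const_mul' _ _ (by finiteness), ENNReal.mul_rpow_of_nonneg _ _ hq1.le,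
            ← ENNReal.rpow_mul, mul_one_div_cancel hq0.ne', ENNReal.rpow_one]
      _ ≤ A * ((∫⁻ _z, τ ^ q ∂μ) ^ (1 / q) + (∫⁻ z, h z ^ q ∂μ) ^ (1 / q)) :=
          mul_le_mul' le_rfl (ENNReal.lintegral_Lp_add_le (f := fun _ => τ) aemeasurable_const
            hhm.aemeasurable hq.le)
      _ ≤ _ := by
          refine mul_le_mul' le_rfl (add_le_add (le_of_eq ?_) hhavg)
          rw [hμ1, setLIntegral_const, mul_left_comm, ENNReal.inv_mul_cancel hW0 hWt, mul_one,
            ← ENNReal.rpow_mul, mul_one_div_cancel hq0.ne', ENNReal.rpow_one]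
  calc volume W * lqAvg q W g ≤ volume W *
        (A * (τ + ((2 : ℝ≥0∞) ^ (n + 1) * C2) ^ (1 / q) * lqAvg q R.whitneyTilde u)) :=
        mul_le_mul' le_rfl hgavg
    _ = A * (volume W * τ + ((2 : ℝ≥0∞) ^ (n + 1) * C2) ^ (1 / q) *
        (volume W * lqAvg q R.whitneyTilde u)) := by ring
    _ ≤ _ := mul_le_mul' le_rfl (add_le_add hτ2 le_rfl)

/-- Whitney regions of distinct dyadic cubes are disjoint, and those of subcubes of Q lie in its
Carleson box. The dimension must be positive: inclusion of cubes compares side lengths only through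
a coordinate. -/
lemma DyadicSystem.tsum_lintegral_whitney_le (hn : 1 ≤ n) (Q : Cube n)
    (v : Pt n → ℝ≥0∞) : ∑' R : {R : Cube n // R ∈ D.all ∧ R.set ⊆ Q.set},
      ∫⁻ z in R.1.whitney, v z ≤ ∫⁻ z in Q.carleson, v z := by
  rw [ENNReal.tsum_eq_iSup_sum]
  refine iSup_le fun F => ?_
  have hdisj : (F : Set {R : Cube n // R ∈ D.all ∧ R.set ⊆ Q.set}).PairwiseDisjoint
      fun R => R.1.whitney := by
    intro R _ R' _ hne
    refine Set.disjoint_left.2 fun z hz hz' => hne (Subtype.ext ?_)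
    refine D.eq_of_mem R.2.1 R'.2.1 ?_ hz.2 hz'.2
    obtain ⟨i, hi⟩ := D.mem_all.1 R.2.1
    obtain ⟨j, hj⟩ := D.mem_all.1 R'.2.1
    have h1 := D.side_eq i _ hi
    have h2 := D.side_eq j _ hj
    have h3 : R.1.side / 2 < z.1 := hz.1.1
    have h4 : z.1 < R.1.side := hz.1.2
    have h5 : R'.1.side / 2 < z.1 := hz'.1.1
    have h6 : z.1 < R'.1.side := hz'.1.2
    have h7 : (2 : ℝ) ^ (-i) < 2 ^ (-j + 1) := by
      rw [zpow_add_one₀ (by norm_num), ← h1, ← h2]; linarith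
    have h8 : (2 : ℝ) ^ (-j) < 2 ^ (-i + 1) := by
      rw [zpow_add_one₀ (by norm_num), ← h1, ← h2]; linarith
    rw [zpow_lt_zpow_iff_right₀ (by norm_num)] at h7 h8
    rw [h1, h2, show i = j by omega]
  rw [← lintegral_biUnion_finset hdisj fun R _ => R.1.measurableSet_whitney]
  refine lintegral_mono_set (iUnion₂_subset fun R _ z hz => ?_)
  have hR0 := D.side_pos R.2.1
  have h3 : R.1.side / 2 < z.1 := hz.1.1
  have h4 : z.1 < R.1.side := hz.1.2
  have hle : R.1.side ≤ Q.side := by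
    have := Cube.bounds_of_subset hR0 R.2.2 ⟨0, hn⟩
    linarith [this.1, this.2]
  exact ⟨⟨by linarith, by linarith⟩, R.2.2 hz.2⟩

/-- The dyadic Carleson estimate for causal sparse sums of measurable functions. -/
lemma exists_carlesonFn_sparse_le {n : ℕ} (hn : 1 ≤ n) {η q : ℝ} (hη : 0 < η) (hq : 1 < q) :
    ∃ C : ℝ≥0, ∀ (D : DyadicSystem n) (𝒮 : Set (Box n)), 𝒮 ⊆ D.boxes → IsSparse η 𝒮 →
      ∀ u : Pt n → ℝ≥0∞, Measurable u → ∀ (A : ℝ≥0) (g : Pt n → ℝ≥0∞),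
      (∀ᵐ x ∂(hmeas n), g x ≤ A * sparseSum 𝒮 u x) → ∀ x : Bd n,
        D.carlesonFn (fun Q => lqAvg q Q.whitney g) x ≤
          C * A * (D.carlesonFn (fun Q => lqAvg q Q.whitneyTilde u) x + carlesonFn u x) := by
  obtain ⟨C1, C2, hC⟩ := exists_volume_mul_lqAvg_le n hη hq
  obtain ⟨C3, hC3⟩ := exists_carlesonFn_upperTail_le n
  refine ⟨C1 * C3 + C2, fun D 𝒮 hS hsp u hu A g hg x => ?_⟩
  push_cast
  refine iSup_le fun Q => iSup_le fun hQ => iSup_le fun hx => ?_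
  have hQ0 := D.side_pos hQ
  have hV0 := Cube.volume_set_ne_zero (Q := Q) hQ0
  have hVt := Cube.volume_set_ne_top (Q := Q) hQ0
  set V := volume Q.set
  set F := D.carlesonFn (fun Q => lqAvg q Q.whitneyTilde u) x
  -- The large-box terms add up to an integral of the upper tail over the Carleson box, to which the
  -- pointwise estimate of the downward case applies.
  have hT : V⁻¹ * ∑' R : {R : Cube n // R ∈ D.all ∧ R.set ⊆ Q.set},
      ∫⁻ z in R.1.whitney, upperTail u z ≤ C3 * carlesonFn u x := by
    rw [ENNReal.inv_mul_le_iff hV0 hVt]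
    refine (D.tsum_lintegral_whitney_le hn Q _).trans
      ((lintegral_carleson_le (f := upperTail u) hQ0 hx).trans (mul_le_mul' le_rfl (hC3 u hu x)))
  have hF : V⁻¹ * ∑' R : {R : Cube n // R ∈ D.all ∧ R.set ⊆ Q.set},
      volume R.1.whitney * lqAvg q R.1.whitneyTilde u ≤ F :=
    le_iSup_of_le Q (le_iSup_of_le hQ (le_iSup_of_le hx le_rfl))
  calc V⁻¹ * ∑' R : {R : Cube n // R ∈ D.all ∧ R.set ⊆ Q.set},
        volume R.1.whitney * lqAvg q R.1.whitney g
      ≤ V⁻¹ * ∑' R : {R : Cube n // R ∈ D.all ∧ R.set ⊆ Q.set},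
        A * (C1 * (∫⁻ z in R.1.whitney, upperTail u z) +
          C2 * (volume R.1.whitney * lqAvg q R.1.whitneyTilde u)) :=
        mul_le_mul' le_rfl (ENNReal.tsum_le_tsum fun R =>
          hC D 𝒮 hS hsp u hu A g hg R.1 R.2.1)
    _ = A * (C1 * (V⁻¹ * ∑' R : {R : Cube n // R ∈ D.all ∧ R.set ⊆ Q.set},
          ∫⁻ z in R.1.whitney, upperTail u z) +
        C2 * (V⁻¹ * ∑' R : {R : Cube n // R ∈ D.all ∧ R.set ⊆ Q.set},
          volume R.1.whitney * lqAvg q R.1.whitneyTilde u)) := by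
        rw [ENNReal.tsum_mul_left, ENNReal.tsum_add, ENNReal.tsum_mul_left, ENNReal.tsum_mul_left]
        ring
    _ ≤ A * (C1 * (C3 * carlesonFn u x) + C2 * F) :=
        mul_le_mul' le_rfl (add_le_add (mul_le_mul' le_rfl hT) (mul_le_mul' le_rfl hF))
    _ ≤ A * (C1 * (C3 * (F + carlesonFn u x)) + C2 * (F + carlesonFn u x)) :=
        mul_le_mul' le_rfl (add_le_add (mul_le_mul' le_rfl (mul_le_mul' le_rfl le_add_self))
          (mul_le_mul' le_rfl le_self_add))
    _ = _ := by ring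

/-- Integrals over subsets of the half space only depend on the class of the function. -/
lemma setLIntegral_congr_hmeas {f g : Pt n → ℝ≥0∞} (h : f =ᵐ[hmeas n] g) {U : Set (Pt n)}
    (hU : U ⊆ halfSpace n) : ∫⁻ y in U, f y = ∫⁻ y in U, g y :=
  lintegral_congr_ae (ae_mono (Measure.restrict_mono hU le_rfl) h)

/-- The dyadic Carleson estimate for causal sparse sums. -/
theorem exists_sparse_bound {𝕜 : Type*} [RCLike 𝕜] {n : ℕ} (hn : 1 ≤ n) {η q : ℝ} (hη : 0 < η)
    (hq : 1 < q) :
    ∃ C : ℝ≥0, ∀ (D : DyadicSystem n) (𝒮 : Set (Box n)), 𝒮 ⊆ D.boxes → IsSparse η 𝒮 →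
      ∀ f : Pt n → 𝕜, AEStronglyMeasurable f (hmeas n) → ∀ (A : ℝ≥0) (g : Pt n → ℝ≥0∞),
      (∀ᵐ x ∂(hmeas n), g x ≤ A * sparseSum 𝒮 f x) → ∀ x : Bd n,
        D.carlesonFn (fun Q => lqAvg q Q.whitney g) x ≤
          C * A * (D.carlesonFn (fun Q => lqAvg q Q.whitneyTilde f) x + carlesonFn f x) := by
  have hq0 : 0 < q := by linarith
  obtain ⟨C, hC⟩ := exists_carlesonFn_sparse_le hn hη hq
  refine ⟨C, fun D 𝒮 hS hsp f hf A g hg x => ?_⟩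
  -- The modulus of f is replaced by a measurable representative. All the functionals integrate over
  -- subsets of the open half space, so they do not notice the change.
  obtain ⟨u, hu, hfu⟩ : ∃ u : Pt n → ℝ≥0∞, Measurable u ∧ (fun y => ‖f y‖ₑ) =ᵐ[hmeas n] u :=
    ⟨_, hf.enorm.measurable_mk, hf.enorm.ae_eq_mk⟩
  have e1 : ∀ᵐ z ∂(hmeas n), sparseSum 𝒮 f z = sparseSum 𝒮 u z := by
    filter_upwards [ae_mem_halfSpace] with z hz
    have hz0 : 0 < z.1 := hz
    refine tsum_congr fun P => congrArg _ ?_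
    simp only [enorm_eq_self]
    refine setLIntegral_congr_hmeas hfu fun y hy => ?_
    have hP0 := D.side_pos (show P.1.base ∈ D.all from hS P.2.1)
    have hb : 0 ≤ P.1.bot := mul_nonneg (Nat.cast_nonneg _) hP0.le
    exact lt_of_le_of_lt (le_min (by linarith) hz0.le) hy.1.1
  have e2 : D.carlesonFn (fun Q => lqAvg q Q.whitneyTilde u) x =
      D.carlesonFn (fun Q => lqAvg q Q.whitneyTilde f) x := by
    refine iSup_congr fun Q => iSup_congr fun _ => iSup_congr fun _ => congrArg _ ?_
    refine tsum_congr fun R => congrArg _ ?_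
    simp only [lqAvg_eq hq0]
    congr 2
    refine setLIntegral_congr_hmeas ?_ fun y hy => ?_
    · filter_upwards [hfu] with y hy
      rw [hy, enorm_eq_self]
    · have h1 : R.1.side / 2 < y.1 := hy.1.1
      have := D.side_pos R.2.1
      show 0 < y.1
      linarith
  have e3 : carlesonFn u x = carlesonFn f x := by
    refine iSup_congr fun Q => iSup_congr fun _ => iSup_congr fun _ => congrArg _ ?_
    simp only [enorm_eq_self]
    exact (setLIntegral_congr_hmeas hfu fun y hy => hy.1.1).symm
  rw [← e2, ← e3]
  refine hC D 𝒮 hS hsp u hu A g ?_ x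
  filter_upwards [hg, e1] with z hz he
  rwa [← he]

end SparseMain

end CausalCZO

/-! ### The three statements together -/

theorem theorem5p1 {𝕜 : Type*} [RCLike 𝕜] (n : ℕ) (hn : 1 ≤ n)
    (p p' q q' : ℝ) (hp : 1 < p) (hq : 1 < q)
    (hpp' : p.HolderConjugate p') (hqq' : q.HolderConjugate q') :
    (∀ γ A B : ℝ, 0 < γ → γ ≤ 1 → ∃ C : ℝ≥0,
      ∀ S : Lp 𝕜 2 (CausalCZO.hmeas n) →L[𝕜] Lp 𝕜 2 (CausalCZO.hmeas n),
        CausalCZO.IsDownwardCZO γ A B S →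
        ∃ T, CausalCZO.ExtendsBoundedly S q (fun f => CausalCZO.normCW p q f) C T) ∧
    (∀ α γ A B : ℝ, 0 < α → 0 < γ → γ ≤ 1 → ∃ C : ℝ≥0,
      ∀ S : Lp 𝕜 2 (CausalCZO.hmeas n) →L[𝕜] Lp 𝕜 2 (CausalCZO.hmeas n),
        CausalCZO.IsUpwardCZO γ A B S →
        ∃ T, CausalCZO.ExtendsBoundedly S q' (fun f => CausalCZO.normNW α p' q' f) C T) ∧
    (∀ η : ℝ, 0 < η → η < 1 → ∃ C : ℝ≥0,
      ∀ (D : CausalCZO.DyadicSystem n) (𝒮 : Set (CausalCZO.Box n)),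
        𝒮 ⊆ D.boxes → CausalCZO.IsSparse η 𝒮 →
        ∀ f : CausalCZO.Pt n → 𝕜, AEStronglyMeasurable f (CausalCZO.hmeas n) →
        ∀ (A : ℝ≥0) (g : CausalCZO.Pt n → ℝ≥0∞),
          (∀ᵐ x ∂(CausalCZO.hmeas n), g x ≤ A * CausalCZO.sparseSum 𝒮 f x) →
          ∀ x : CausalCZO.Bd n,
            D.carlesonFn (fun Q => CausalCZO.lqAvg q Q.whitney g) x ≤
              C * A * (D.carlesonFn (fun Q => CausalCZO.lqAvg q Q.whitneyTilde f) x
                + CausalCZO.carlesonFn f x)) := by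
  refine ⟨fun γ A B h0 h1 => CausalCZO.exists_downward_bound 𝕜 n γ A B h0 h1 hp hq,
    fun α γ A B hα h0 h1 => CausalCZO.exists_upward_bound 𝕜 n α γ A B hα h0 h1
      hpp'.symm.lt hqq'.symm.lt,
    fun η hη _ => CausalCZO.exists_sparse_bound hn hη hq⟩
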